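/- **Setting.** Let $V=\mathbb C^{N}$. For $X\in\mathrm{End}(V^{\otimes n})$ let $X^{\uparrow j}$ denote $X$ acting on the factors $j+1,\dots,j+n$ of a larger tensor power, and for $X\in \mathrm{End}(V^{\otimes 2})$ put $X_j:=X^{\uparrow (j-1)}$ (acting on factors $j,j+1$). $P$ is the permutation of $V\otimes V$, $\mathrm{Tr}_{(i)}$ the trace over the $i$-th factor. *R-matrices.* $X\in\mathrm{End}(V^{\otimes2})$ is skew invertible if there is $\Psi_X$ with $\mathrm{Tr}_{(2)}X_{12}(\Psi_X)_{23}=\mathrm{Tr}_{(2)}(\Psi_X)_{12}X_{23}=P_{13}$; put $C_X=\mathrm{Tr}_{(1)}(\Psi_X)_{12}$, $D_X=\mathrm{Tr}_{(2)}(\Psi_X)_{12}$; $X$ is strict skew invertible if moreover $C_X$ or $D_X$ is invertible. An R-matrix is an invertible $R\in \mathrm{End}(V^{\otimes 2})$ with $R_1R_2R_1=R_2R_1R_2$. A pair $\{R,F\}$ of R-matrices is compatible if $R_1F_2F_1=F_2F_1R_2$ and $R_2F_1F_2=F_1F_2R_1$. For skew invertible $R$ and a matrix $M$ over a $\mathbb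 C$-algebra, the R-trace is $\mathrm{Tr}_R M=\mathrm{Tr}(D_RM)$; $\mathrm{Tr}_{R(i)}$ is the R-trace over the $i$-th factor. *Type $O(k)$.* Let $q\in\mathbb C\setminus\{0,\pm1\}$, $\mu\in\mathbb C\setminus\{0,q,-q^{-1}\}$. An R-matrix $R$ is of BMW type if its minimal polynomial is $(x-q)(x+q^{-1})(x-\mu)$ and $K:=\mu^{-1}(q-q^{-1})^{-1}(qI-R)(q^{-1}I+R)$ satisfies $K_2K_1=R_1R_2K_1=R_1^{-1}R_2^{-1}K_1$ and $K_1K_2K_1=K_1$. Put $i_q=(q^i-q^{-i})/(q-q^{-1})$ and, for the operators on tensor powers of $V$, $$\sigma^-_j(x)=1+\frac{x-1}{q-q^{-1}}R_j+\frac{x-1}{q\mu^{-1}x+1}K_j,\qquad a^{(1)}=1,\quad a^{(i+1)}=\frac{q^i}{(i+1)_q}\,a^{(i)}\sigma^-_i(q^{-2i})\,a^{(i)} .$$ A skew invertible BMW-type R-matrix $R$ is of type $O(k)$, $k\ge2$, if $\mu=q^{1-k}$, $i_q\ne0$ and $a^{(i)}\neq0$ for $2\le i\le k$, $a^{(k)\uparrow1}\sigma_1^-(q^{-2k})a^{(k)\uparrow1}=0$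 on $V^{\otimes(k+1)}$, and $\operatorname{rk}a^{(k)}=1$. *The algebra.* Let $\{R,F\}$ be a compatible pair of strict skew invertible R-matrices with $R$ of type $O(k)$. For a matrix $M$ with entries in an algebra put $M_{\overline1}=M_1$, $M_{\overline{i}}=F_{i-1}M_{\overline{i-1}}F_{i-1}^{-1}$. Let $\mathcal B_n$ be the braid group with generators $\sigma_i$, let $\rho_R(\sigma_i)=R_i$, and let $\alpha\mapsto\alpha^{\uparrow j}$ be the shift $\sigma_i\mapsto\sigma_{i+j}$. For $\alpha\in\mathbb C\mathcal B_n$ put $$ch(\alpha)=\mathrm{Tr}_{R(1,\dots,n)}\bigl(M_{\overline1}\cdots M_{\overline n}\,\rho_R(\alpha)\bigr),\qquad M^{\alpha}=\mathrm{Tr}_{R(2,\dots,n)}\bigl(M_{\overline1}\cdots M_{\overline n}\,\rho_R(\alpha)\bigr),$$ and use the same formulas with $\rho_R(\alpha)$ replaced by an element of $\rho_R(\mathbb C\mathcal B_n)$ (e.g. $K$, $a^{(i)}$). Put $\eta=\frac{(q-\mu)(q^{-1}+\mu)}{\mu(q-q^{-1})}$, $g=\eta^{-1}ch(K)$, $a_0=1$,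 $a_i=ch(a^{(i)})$, and $G_1=\mathrm{Tr}_{(2,3)}K_2F_1^{-1}F_2^{-1}$ (an invertible matrix). The extended $O(k)$-type quantum matrix algebra $\mathcal M^\bullet(R,F)$ is the unital associative $\mathbb C$-algebra generated by the entries of an $N\times N$ matrix $M$ and an element $g^{-1}$, with relations $$R_1M_{\overline1}M_{\overline2}=M_{\overline1}M_{\overline2}R_1,\qquad g^{-1}g=gg^{-1}=1,\qquad g^{-1}M=(G^{-1}MG)\,g^{-1}.$$ Let $\mathcal C^\bullet$ be its (commutative) subalgebra generated by all $ch(\alpha)$ and $g^{-1}$. On the right $\mathcal C^\bullet$-submodule of $\mathrm{Mat}_N(\mathcal M^\bullet(R,F))$ spanned by $I$ and all $M^\alpha$ there is a $\mathcal C^\bullet$-bilinear product $\star$, determined by $$M^{\alpha}\star M^{\beta}=M^{\alpha\beta^{\uparrow n}(\sigma_n\cdots\sigma_2\sigma_1\sigma_2^{-1}\cdots\sigma_n^{-1})}\quad(\alpha\in\mathbb C\mathcal B_n,\ \beta\in\mathbb C\mathcal B_i,\ n,i\geq 1),$$ $$(I c)\star M^\alpha=M^\alpha\star(I c)=M^\alpha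 c,\qquad (Ic)\star(Id)=I(cd)\qquad(c,d\in\mathcal C^\bullet).$$ Let $M^{\overline0}=I$ and $M^{\overline n}=M\star M\star\cdots\star M$ ($n$ times). **Theorem.** Let $\ell\ge2$, let $R$ be of type $O(2\ell-1)$ (so $\mu=q^{2-2\ell}$), let $\{R,F\}$ be a compatible pair of strict skew invertible R-matrices, and assume $q^{2\ell+1}\ne-1$. Put $g^{1/2}:=g^{1-\ell}a_{2\ell-1}$ and, for $i=0,1,\dots,\ell-1$, $$\epsilon_i:=\sum_{j=0}^{i}a_{i-j}\,(-g^{1/2})^j,\qquad \epsilon_{\ell-1+i}:=\epsilon_{\ell-1-i}\,g^i .$$ Then in $\mathrm{Mat}_N(\mathcal M^\bullet(R,F))$ $$\bigl(M-g^{1/2}I\bigr)\star\sum_{i=0}^{2\ell-2}(-q)^i\,M^{\overline{2\ell-i-2}}\,\epsilon_i=0 .$$ -/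

import Mathlib

open scoped BigOperators

noncomputable section

namespace QM

/-! ### Operators on tensor powers of `V = ℂ^N`

An operator on `V^{⊗ n}` (possibly with entries in a `ℂ`-algebra `A`) is a matrix whose rows and
columns are indexed by multi-indices `Fin n → Fin N`. Tensor factors are numbered from `0`. -/

abbrev Op (N n : ℕ) (A : Type*) := Matrix (Fin n → Fin N) (Fin n → Fin N) A

variable {N : ℕ}

/-- A scalar operator, regarded as an operator with entries in `A`. -/
def Op.lift {n : ℕ} (A : Type*) [Ring A] [Algebra ℂ A] (X : Op N n ℂ) : Op N n A :=
  X.map (algebraMap ℂ A)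

/-- `place m j X` is `I^{⊗ j} ⊗ X ⊗ I^{⊗ (m - j - n)}` acting on `V^{⊗ m}`, for `X` acting on
`V^{⊗ n}`. It is only used with `j + n ≤ m` (and is `0` otherwise). -/
def place {A : Type*} [Zero A] {n : ℕ} (m j : ℕ) (X : Op N n A) : Op N m A :=
  Matrix.of fun a b =>
    if h : j + n ≤ m then
      if ∀ s : Fin m, ((s : ℕ) < j ∨ j + n ≤ (s : ℕ)) → a s = b s then
        X (fun t => a ⟨j + t, by omega⟩) (fun t => b ⟨j + t, by omega⟩)
      else 0
    else 0

/-- A matrix over `A`, regarded as an operator on one tensor factor. -/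
def oneStrand {A : Type*} (M : Matrix (Fin N) (Fin N) A) : Op N 1 A :=
  M.submatrix (fun a => a 0) (fun a => a 0)

/-! ### R-matrices, skew invertibility, R-traces -/

/-- An R-matrix: an invertible operator on `V ⊗ V` with `R₁ R₂ R₁ = R₂ R₁ R₂`. -/
structure IsRMatrix (R : Op N 2 ℂ) : Prop where
  isUnit : IsUnit R
  yangBaxter : place 3 0 R * place 3 1 R * place 3 0 R = place 3 1 R * place 3 0 R * place 3 1 R

/-- `Ψ` is a skew inverse of `X`:
`Tr_{(2)} X₁₂ Ψ₂₃ = Tr_{(2)} Ψ₁₂ X₂₃ = P₁₃`, with `P` the permutation. -/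
def IsSkewInverse (X Ψ : Op N 2 ℂ) : Prop :=
  ∀ a c a' c' : Fin N,
    (∑ b, (place 3 0 X * place 3 1 Ψ) ![a, b, c] ![a', b, c'] =
      if a = c' ∧ c = a' then 1 else 0) ∧
    (∑ b, (place 3 0 Ψ * place 3 1 X) ![a, b, c] ![a', b, c'] =
      if a = c' ∧ c = a' then 1 else 0)

def SkewInvertible (X : Op N 2 ℂ) : Prop := ∃ Ψ, IsSkewInverse X Ψ

/-- The skew inverse `Ψ_X` (unique when it exists). -/
def skewInv (X : Op N 2 ℂ) : Op N 2 ℂ := Classical.epsilon (IsSkewInverse X)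

/-- `C_X = Tr_{(1)} (Ψ_X)₁₂`. -/
def matC (X : Op N 2 ℂ) : Matrix (Fin N) (Fin N) ℂ :=
  Matrix.of fun b b' => ∑ a, skewInv X ![a, b] ![a, b']

/-- `D_X = Tr_{(2)} (Ψ_X)₁₂`. -/
def matD (X : Op N 2 ℂ) : Matrix (Fin N) (Fin N) ℂ :=
  Matrix.of fun a a' => ∑ b, skewInv X ![a, b] ![a', b]

def StrictSkewInvertible (X : Op N 2 ℂ) : Prop :=
  SkewInvertible X ∧ (IsUnit (matC X) ∨ IsUnit (matD X))

/-- A compatible pair of R-matrices: both twist relations hold. -/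
structure IsCompatiblePair (R F : Op N 2 ℂ) : Prop where
  rMatrix_left : IsRMatrix R
  rMatrix_right : IsRMatrix F
  twist₁ : place 3 0 R * place 3 1 F * place 3 0 F = place 3 1 F * place 3 0 F * place 3 1 R
  twist₂ : place 3 1 R * place 3 0 F * place 3 1 F = place 3 0 F * place 3 1 F * place 3 0 R

section Trace

variable {A : Type*} [Ring A] [Algebra ℂ A]

/-- `Tr_{(1,…,n)} (D₁ ⋯ D_n X)`; for `D = D_R` this is the R-trace over all tensor factors. -/
def fullTrace (D : Matrix (Fin N) (Fin N) ℂ) {n : ℕ} (X : Op N n A) : A :=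
  ∑ t : Fin n → Fin N, ∑ u : Fin n → Fin N, (∏ j, D (t j) (u j)) • X u t

/-- `Tr_{(2,…,n)} (D₂ ⋯ D_n X)`, where `n = s + 1`; for `D = D_R` this is the R-trace over all
tensor factors but the first one. -/
def tailTrace (D : Matrix (Fin N) (Fin N) ℂ) {s : ℕ} (X : Op N (s + 1) A) :
    Matrix (Fin N) (Fin N) A :=
  Matrix.of fun a b => ∑ t : Fin s → Fin N, ∑ u : Fin s → Fin N,
    (∏ j, D (t j) (u j)) • X (Fin.cons a u : Fin (s + 1) → Fin N) (Fin.cons b t)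

end Trace

/-! ### R-matrices of BMW type and of orthogonal type -/

/-- `K = μ⁻¹ (q - q⁻¹)⁻¹ (q I - R) (q⁻¹ I + R)`, the image of the generators `κ`. -/
def opK (q μ : ℂ) (R : Op N 2 ℂ) : Op N 2 ℂ :=
  (μ⁻¹ * (q - q⁻¹)⁻¹) • ((q • (1 : Op N 2 ℂ) - R) * (q⁻¹ • (1 : Op N 2 ℂ) + R))

open Polynomial in
/-- R-matrices of BMW type with parameters `q`, `μ`. -/
structure IsBMWType (q μ : ℂ) (R : Op N 2 ℂ) : Prop where
  rMatrix : IsRMatrix R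
  q_ne_zero : q ≠ 0
  q_ne_one : q ≠ 1
  q_ne_neg_one : q ≠ -1
  mu_ne_zero : μ ≠ 0
  mu_ne_q : μ ≠ q
  mu_ne_neg_inv : μ ≠ -q⁻¹
  minpoly_eq : minpoly ℂ R = (X - C q) * (X + C q⁻¹) * (X - C μ)
  rel_pos : place 3 1 (opK q μ R) * place 3 0 (opK q μ R) =
    place 3 0 R * place 3 1 R * place 3 0 (opK q μ R)
  rel_neg : place 3 1 (opK q μ R) * place 3 0 (opK q μ R) =
    place 3 0 R⁻¹ * place 3 1 R⁻¹ * place 3 0 (opK q μ R)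
  rel_KKK : place 3 0 (opK q μ R) * place 3 1 (opK q μ R) * place 3 0 (opK q μ R) =
    place 3 0 (opK q μ R)

/-- The `q`-number `i_q = (q^i - q^{-i}) / (q - q⁻¹)`. -/
def qNum (q : ℂ) (i : ℕ) : ℂ := (q ^ i - q⁻¹ ^ i) / (q - q⁻¹)

/-- The image on `V^{⊗ m}` of the baxterized element
`σ⁻_{j+1}(x) = 1 + (x - 1)/(q - q⁻¹) σ_{j+1} + (x - 1)/(α x + 1) κ_{j+1}`, `α = q μ⁻¹`. -/
def baxter (q μ : ℂ) (R : Op N 2 ℂ) (m j : ℕ) (x : ℂ) : Op N m ℂ :=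
  1 + ((x - 1) / (q - q⁻¹)) • place m j R +
    ((x - 1) / (q * μ⁻¹ * x + 1)) • place m j (opK q μ R)

/-- The image `ρ_R(a^{(i)})` on `V^{⊗ i}` of the `i`-th order antisymmetrizer:
`a^{(1)} = 1`, `a^{(i+1)} = q^i / (i+1)_q · a^{(i)} σ⁻_i(q^{-2i}) a^{(i)}`. -/
def antisym (q μ : ℂ) (R : Op N 2 ℂ) : (i : ℕ) → Op N i ℂ
  | 0 => 1
  | 1 => 1
  | i + 2 => (q ^ (i + 1) / qNum q (i + 2)) •
      (place (i + 2) 0 (antisym q μ R (i + 1)) *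
        baxter q μ R (i + 2) i (q⁻¹ ^ (2 * (i + 1))) *
        place (i + 2) 0 (antisym q μ R (i + 1)))

/-- The value `μ = q^{1-k}` of the second parameter in the orthogonal case. -/
def orthMu (q : ℂ) (k : ℕ) : ℂ := q ^ (1 - (k : ℤ))

/-- R-matrices of type `O(k)`. -/
structure IsOrthogonalType (q : ℂ) (k : ℕ) (R : Op N 2 ℂ) : Prop where
  bmw : IsBMWType q (orthMu q k) R
  skew : SkewInvertible R
  two_le : 2 ≤ k
  qNum_ne : ∀ i, 2 ≤ i → i ≤ k → qNum q i ≠ 0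
  rank_ne : ∀ i, 2 ≤ i → i ≤ k → (antisym q (orthMu q k) R i).rank ≠ 0
  vanish : place (k + 1) 1 (antisym q (orthMu q k) R k) *
    baxter q (orthMu q k) R (k + 1) 0 (q⁻¹ ^ (2 * k)) *
    place (k + 1) 1 (antisym q (orthMu q k) R k) = 0
  rank_one : (antisym q (orthMu q k) R k).rank = 1

/-! ### Matrix copies, characteristic elements, descendants of `M` -/

section Copies

variable {A : Type*} [Ring A] [Algebra ℂ A] (R F : Op N 2 ℂ) (M : Matrix (Fin N) (Fin N) A)

/-- The `(i+1)`-st copy of `M` acting on `V^{⊗ m}`: the first copy is `M ⊗ I ⊗ ⋯`, and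
the next copy is obtained by conjugation with `F` placed at the corresponding neighbouring factors. -/
def copy (m : ℕ) : ℕ → Op N m A
  | 0 => place m 0 (oneStrand M)
  | i + 1 => (place m i F).lift A * copy m i * (place m i F⁻¹).lift A

/-- The ordered product of the first `n` copies of `M` on `V^{⊗ n}`. -/
def copiesProd (n : ℕ) : Op N n A := ((List.range n).map (copy F M n)).prod

/-- `ρ_R(ℂ B_n)`: the image of the group algebra of the braid group `B_n` on `V^{⊗ n}`. -/
def braidImage (n : ℕ) : Subalgebra ℂ (Op N n ℂ) :=
  Algebra.adjoin ℂ {X | ∃ i, i + 2 ≤ n ∧ (X = place n i R ∨ X = place n i R⁻¹)}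

/-- `ch(α)`, where `X = ρ_R(α)`: the R-trace over all factors of (product of copies) `· X`. -/
def ch {n : ℕ} (X : Op N n ℂ) : A := fullTrace (matD R) (copiesProd F M n * X.lift A)

/-- `M^α`, where `X = ρ_R(α)`: the R-trace over all factors but the first of
(product of copies) `· X`. -/
def desc {s : ℕ} (X : Op N (s + 1) ℂ) : Matrix (Fin N) (Fin N) A :=
  tailTrace (matD R) (copiesProd F M (s + 1) * X.lift A)

/-- The 2-contraction `g = η⁻¹ ch(κ₁)`, `η = (q - μ)(q⁻¹ + μ) / (μ (q - q⁻¹))`. -/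
def contraction (q μ : ℂ) : A :=
  ((q - μ) * (q⁻¹ + μ) / (μ * (q - q⁻¹)))⁻¹ • ch R F M (opK q μ R)

/-- `a_0 = 1`, `a_i = ch(a^{(i)})`. -/
def elemA (q μ : ℂ) : ℕ → A
  | 0 => 1
  | i + 1 => ch R F M (antisym q μ R (i + 1))

/-- With `X = ρ_R(α)`, `Y = ρ_R(β)`, `α ∈ B_n`, `β ∈ B_i`, `n = s + 1`, `i = t + 1`: the image of
`α ⋆ β = α β^{↑ n} (σ_n ⋯ σ_2 σ_1 σ_2⁻¹ ⋯ σ_n⁻¹)`. -/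
def starExponent {s t : ℕ} (X : Op N (s + 1) ℂ) (Y : Op N (t + 1) ℂ) : Op N (s + 1 + t + 1) ℂ :=
  place (s + 1 + t + 1) 0 X * place (s + 1 + t + 1) (s + 1) Y *
    (((List.range (s + 1)).reverse.map fun j => place (s + 1 + t + 1) j R).prod *
      ((List.range s).map fun j => place (s + 1 + t + 1) (j + 1) R⁻¹).prod)

/-- The right multiple `N c` of a matrix by an element of `A`, componentwise. -/
def rmul (B : Matrix (Fin N) (Fin N) A) (c : A) : Matrix (Fin N) (Fin N) A := B.map (· * c)

/-- `IsStarProduct R F M S B B' Z`: the `⋆`-product of `B` and `B'` is `Z`. Here `S` is the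
(commutative) algebra of coefficients, and the `⋆`-product lives on the right `S`-module spanned by
the identity matrix and all `M^α`. It is the biadditive, `S`-bilinear operation for which
`M^α ⋆ M^β = M^{α ⋆ β}`, `(I c) ⋆ M^α = M^α ⋆ (I c) = M^α c` and `(I c) ⋆ (I d) = I (c d)`. -/
inductive IsStarProduct (S : Subalgebra ℂ A) :
    Matrix (Fin N) (Fin N) A → Matrix (Fin N) (Fin N) A → Matrix (Fin N) (Fin N) A → Prop
  | desc_desc (s t : ℕ) (X : Op N (s + 1) ℂ) (hX : X ∈ braidImage R (s + 1))
      (Y : Op N (t + 1) ℂ) (hY : Y ∈ braidImage R (t + 1)) (c d : A) (hc : c ∈ S) (hd : d ∈ S) :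
      IsStarProduct S (rmul (desc R F M X) c) (rmul (desc R F M Y) d)
        (rmul (desc R F M (starExponent R X Y)) (c * d))
  | one_desc (s : ℕ) (X : Op N (s + 1) ℂ) (hX : X ∈ braidImage R (s + 1))
      (c d : A) (hc : c ∈ S) (hd : d ∈ S) :
      IsStarProduct S (rmul 1 c) (rmul (desc R F M X) d) (rmul (desc R F M X) (d * c))
  | desc_one (s : ℕ) (X : Op N (s + 1) ℂ) (hX : X ∈ braidImage R (s + 1))
      (c d : A) (hc : c ∈ S) (hd : d ∈ S) :
      IsStarProduct S (rmul (desc R F M X) c) (rmul 1 d) (rmul (desc R F M X) (c * d))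
  | one_one (c d : A) (hc : c ∈ S) (hd : d ∈ S) :
      IsStarProduct S (rmul 1 c) (rmul 1 d) (rmul 1 (c * d))
  | add_left {B₁ B₂ B' Z₁ Z₂ : Matrix (Fin N) (Fin N) A}
      (h₁ : IsStarProduct S B₁ B' Z₁) (h₂ : IsStarProduct S B₂ B' Z₂) :
      IsStarProduct S (B₁ + B₂) B' (Z₁ + Z₂)
  | add_right {B B₁ B₂ Z₁ Z₂ : Matrix (Fin N) (Fin N) A}
      (h₁ : IsStarProduct S B B₁ Z₁) (h₂ : IsStarProduct S B B₂ Z₂) :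
      IsStarProduct S B (B₁ + B₂) (Z₁ + Z₂)

end Copies

/-! ### The extended quantum matrix algebra -/

/-- The operator `G`, `G₁ = Tr_{(2,3)} K₂ F₁⁻¹ F₂⁻¹` (ordinary traces). -/
def matG (q μ : ℂ) (R F : Op N 2 ℂ) : Matrix (Fin N) (Fin N) ℂ :=
  tailTrace (s := 2) 1 (place 3 1 (opK q μ R) * place 3 0 F⁻¹ * place 3 1 F⁻¹)

/-- The free algebra on the entries `M_a^b` (`some (a, b)`) and on `g⁻¹` (`none`). -/
abbrev FreeExt (N : ℕ) := FreeAlgebra ℂ (Option (Fin N × Fin N))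

def freeM : Matrix (Fin N) (Fin N) (FreeExt N) :=
  Matrix.of fun a b => FreeAlgebra.ι ℂ (some (a, b))

def freeGInv : FreeExt N := FreeAlgebra.ι ℂ none

/-- Defining relations of the extended quantum matrix algebra:
`R₁ M_{1̄} M_{2̄} = M_{1̄} M_{2̄} R₁`, `g⁻¹ g = g g⁻¹ = 1`, `g⁻¹ M = (G⁻¹ M G) g⁻¹`. -/
inductive ExtRel (q μ : ℂ) (R F : Op N 2 ℂ) : FreeExt N → FreeExt N → Prop
  | quantum (a b : Fin 2 → Fin N) :
      ExtRel q μ R F ((R.lift (FreeExt N) * (copy F freeM 2 0 * copy F freeM 2 1)) a b)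
        ((copy F freeM 2 0 * copy F freeM 2 1 * R.lift (FreeExt N)) a b)
  | inv_mul : ExtRel q μ R F (freeGInv * contraction R F freeM q μ) 1
  | mul_inv : ExtRel q μ R F (contraction R F freeM q μ * freeGInv) 1
  | inv_M (a b : Fin N) :
      ExtRel q μ R F (freeGInv * freeM a b)
        (((matG q μ R F)⁻¹.map (algebraMap ℂ (FreeExt N)) * freeM *
          (matG q μ R F).map (algebraMap ℂ (FreeExt N)) :
            Matrix (Fin N) (Fin N) (FreeExt N)) a b * freeGInv)

/-- The extended quantum matrix algebra of BMW type. -/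
abbrev ExtAlg (q μ : ℂ) (R F : Op N 2 ℂ) := RingQuot (ExtRel q μ R F)

section Ext

variable (q μ : ℂ) (R F : Op N 2 ℂ)

/-- The matrix `M` of generators. -/
def genM : Matrix (Fin N) (Fin N) (ExtAlg q μ R F) :=
  (freeM (N := N)).map (RingQuot.mkAlgHom ℂ (ExtRel q μ R F))

/-- The generator `g⁻¹`. -/
def gInv : ExtAlg q μ R F := RingQuot.mkAlgHom ℂ (ExtRel q μ R F) freeGInv

/-- The 2-contraction `g`. -/
def gElem : ExtAlg q μ R F := contraction R F (genM q μ R F) q μ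

/-- The elements `a_i` of the characteristic subalgebra. -/
def aElem (i : ℕ) : ExtAlg q μ R F := elemA R F (genM q μ R F) q μ i

/-- The extended characteristic subalgebra, generated by all `ch(α)` and by `g⁻¹`. -/
def charAlg : Subalgebra ℂ (ExtAlg q μ R F) :=
  Algebra.adjoin ℂ
    ({x | ∃ n : ℕ, 1 ≤ n ∧ ∃ X ∈ braidImage R n, x = ch R F (genM q μ R F) X} ∪ {gInv q μ R F})

/-- The `⋆`-product of two matrices from the right module over the extended characteristic subalgebra
spanned by `I` and all `M^α`: the matrix `Z` such that `IsStarProduct` holds (an unspecified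
matrix, about which nothing can be proved, if there were no such `Z`). -/
def starMul (B B' : Matrix (Fin N) (Fin N) (ExtAlg q μ R F)) :
    Matrix (Fin N) (Fin N) (ExtAlg q μ R F) :=
  Classical.epsilon fun Z => IsStarProduct R F (genM q μ R F) (charAlg q μ R F) B B' Z

/-- The powers of `M` for the `⋆`-product. -/
def starPow : ℕ → Matrix (Fin N) (Fin N) (ExtAlg q μ R F)
  | 0 => 1
  | n + 1 => starMul q μ R F (genM q μ R F) (starPow n)

/-- `g^{1/2} = g^{1-ℓ} a_{2ℓ-1}` (for `ℓ ≥ 1`). -/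
def gHalf (ℓ : ℕ) : ExtAlg q μ R F := gInv q μ R F ^ (ℓ - 1) * aElem q μ R F (2 * ℓ - 1)

/-- `ε_i = ∑_{j=0}^{i} a_{i-j} (-g^{1/2})^j` for `0 ≤ i ≤ ℓ-1`, and
`ε_{ℓ-1+i} = ε_{ℓ-1-i} g^i` for `0 ≤ i ≤ ℓ-1`. -/
def epsElem (ℓ i : ℕ) : ExtAlg q μ R F :=
  if i ≤ ℓ - 1 then
    ∑ j ∈ Finset.range (i + 1), aElem q μ R F (i - j) * (-gHalf q μ R F ℓ) ^ j
  else
    (∑ j ∈ Finset.range (2 * (ℓ - 1) - i + 1),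
      aElem q μ R F (2 * (ℓ - 1) - i - j) * (-gHalf q μ R F ℓ) ^ j) *
        gElem q μ R F ^ (i - (ℓ - 1))

end Ext

end QM

end

open QM

/-! Write `n = ℓ - 1`, `k = 2n + 1`, `h = g^{1/2}`. Star multiplication by `M`, that is `X ↦ M ⋆ X`,
is an operator `x` on matrices commuting with right multiplication by the commutative characteristic
algebra, so polynomials in `x` over that algebra act on matrices, and `x • I = M`. The claim becomes
`(x - h) E • I = 0` with `E = ∑ (-q)^i x^{2n-i} ε_i`, a statement of commutative algebra once enough
relations are known.

The relations come from two families, `A_i = i_q M^{a^{(i)}}` (`altDesc`) and `B_i = i_q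
M^{a^{(i)↑1} K}` (`altContr`). Building `a^{(i+1)}` by a Baxterized generator at its left end, and
moving the antisymmetrizers around the R-trace, gives `A_{i+1} = q^i M a_i - x A_i - c_i B_i` and `x
B_{i+1} = (μ⁻¹ q^{-i} M a_i + d_i x A_i - B_i) g` (`altDesc_recursion`, `altContr_recursion`), with
`A_1 = M` and `B_1 = μ⁻¹ I g`. Since `a^{(k)}` has rank one, `M_1 ⋯ M_k a^{(k)}` is a multiple of
`a^{(k)}`; hence `A_k` is a multiple of `I a_k` and `B_k` a multiple of `M a_k` (`altDesc_top`,
`altContr_top`).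

Rank one also yields the reciprocity `a_i a_k = g^i a_{k-i}` (`elemA_mul_elemA`), by closing a
diagram of nested cups and caps between antisymmetrizers in two ways. It shows that `h² = g`, that
the `ε_i` are symmetric about `n`, and that `a_{i+1} = ε_{i+1} + h ε_i`. With `y = q h`, the
recursions are solved, after multiplication by powers of `x`, by a sequence with linear recurrence
of characteristic roots `-x²` and `-y²` (`descendant_solution`). The symmetry of the `ε_i` makes the
last terms of this sequence multiples of `E` (`sum_oddQuot_mul`). Comparison with the known `A_k`
and `B_k` leaves two relations on `E • I`, and eliminating between them gives `y E • I = q x E • I`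
(`elimination`, `cayleyHamilton_of_recursions`).

The elimination cancels powers of `x`, so `x` must be injective (`eq_zero_of_starM_eq_zero`); this
rests on nondegeneracy of the contractor, on its twisted form for `K F`, and on invertibility of
`g`. The condition `q^{2ℓ+1} ≠ -1` keeps the denominator of `σ⁻(q²)` nonzero, which is used to
characterise antisymmetric elements.

All computations take place among operators on infinitely many tensor legs, where a shift of an
operator is just a change of leg and partial traces are linear maps. The R-trace is invariant under
conjugation by `F` and cyclic for braids (`legTrace_conj`, `iterTrace_cyclic`); both follow from
skew invertibility. Finally the relational star product is shown to be single valued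
(`star_unique`), so the chosen value `starMul` is the expected one. -/

noncomputable section

namespace QM

/-! ### Operators on infinitely many tensor legs -/

section

variable {N : ℕ} {A : Type*} [Ring A] [Algebra ℂ A]

/-- Operators on functions of infinitely many tensor legs with values in `A`. -/
abbrev LegOp (N : ℕ) (A : Type*) [Ring A] [Algebra ℂ A] := Module.End ℂ ((ℕ → Fin N) → A)

/-- Replace the entries `j, …, j + n - 1` of `b` by `c`. -/
def splice (b : ℕ → Fin N) (j : ℕ) {n : ℕ} (c : Fin n → Fin N) : ℕ → Fin N :=
  fun s => if h : j ≤ s ∧ s < j + n then c ⟨s - j, by omega⟩ else b s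

def window (b : ℕ → Fin N) (j n : ℕ) : Fin n → Fin N := fun t => b (j + t)

@[simp] lemma window_splice (b : ℕ → Fin N) (j : ℕ) {n : ℕ} (c : Fin n → Fin N) :
    window (splice b j c) j n = c := by
  funext t
  simp [window, splice]

@[simp] lemma splice_splice (b : ℕ → Fin N) (j : ℕ) {n : ℕ} (c d : Fin n → Fin N) :
    splice (splice b j c) j d = splice b j d := by
  funext t
  simp only [splice]
  split_ifs <;> rfl

@[simp] lemma splice_window (b : ℕ → Fin N) (j n : ℕ) : splice b j (window b j n) = b := by
  funext t
  simp only [splice, window]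
  split_ifs with h
  · congr 1; omega
  · rfl

/-- The operator `X` acting on the legs `j, …, j + n - 1`. -/
def amp (j : ℕ) {n : ℕ} : Op N n A →ₐ[ℂ] LegOp N A where
  toFun X :=
    { toFun := fun v b => ∑ c, X (window b j n) c * v (splice b j c)
      map_add' := fun v w => by
        funext b; simp [mul_add, Finset.sum_add_distrib]
      map_smul' := fun z v => by
        funext b; simp [Finset.smul_sum] }
  map_one' := by
    ext v b
    simp [Matrix.one_apply]
  map_mul' X Y := by
    ext v b
    simp only [LinearMap.coe_mk, AddHom.coe_mk, Module.End.mul_apply, Matrix.mul_apply,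
      Finset.sum_mul, Finset.mul_sum, window_splice, splice_splice, mul_assoc]
    exact Finset.sum_comm
  map_zero' := by ext v b; simp
  map_add' X Y := by ext v b; simp [add_mul, Finset.sum_add_distrib]
  commutes' z := by
    ext v b
    simp [Matrix.algebraMap_matrix_apply, Algebra.smul_def]

lemma amp_apply (j : ℕ) {n : ℕ} (X : Op N n A) (v : (ℕ → Fin N) → A) (b : ℕ → Fin N) :
    amp j X v b = ∑ c, X (window b j n) c * v (splice b j c) := rfl

/-- Multiplication by an element of the coefficient algebra. -/
def coef : A →ₐ[ℂ] LegOp N A where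
  toFun a := { toFun := fun v b => a * v b
               map_add' := fun v w => by funext b; simp [mul_add]
               map_smul' := fun z v => by funext b; simp }
  map_one' := by ext v b; simp
  map_mul' a c := by ext v b; simp [mul_assoc]
  map_zero' := by ext v b; simp
  map_add' a c := by ext v b; simp [add_mul]
  commutes' z := by ext v b; simp [Algebra.smul_def]

lemma coef_apply (a : A) (v : (ℕ → Fin N) → A) (b : ℕ → Fin N) : coef a v b = a * v b := rfl

/-- Matrix units acting on the leg `n`. -/
def eUnit (n : ℕ) (s t : Fin N) : LegOp N A where
  toFun v b := if b n = s then v (Function.update b n t) else 0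
  map_add' v w := by
    funext b; by_cases h : b n = s <;> simp [h]
  map_smul' z v := by
    funext b; by_cases h : b n = s <;> simp [h]

lemma eUnit_apply (n : ℕ) (s t : Fin N) (v : (ℕ → Fin N) → A) (b : ℕ → Fin N) :
    eUnit n s t v b = if b n = s then v (Function.update b n t) else 0 := rfl

lemma eUnit_mul (n : ℕ) (s t u w : Fin N) :
    (eUnit n s t * eUnit n u w : LegOp N A) = if t = u then eUnit n s w else 0 := by
  by_cases h : t = u
  · subst h
    ext v b
    simp [Module.End.mul_apply, eUnit_apply]
  · ext v b
    simp [Module.End.mul_apply, eUnit_apply, h]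

lemma eUnit_sum (n : ℕ) : ∑ s : Fin N, (eUnit n s s : LegOp N A) = 1 := by
  ext v b
  simp only [LinearMap.sum_apply, Finset.sum_apply, eUnit_apply, Module.End.one_apply]
  rw [Finset.sum_eq_single (b n)] <;> simp +contextual [eq_comm]

/-- Operators that do not touch the leg `n`. -/
def Off (n : ℕ) (x : LegOp N A) : Prop := ∀ s t, Commute (eUnit n s t) x

lemma eUnit_off {m n : ℕ} (h : m ≠ n) (s t : Fin N) : Off m (eUnit n s t : LegOp N A) := by
  intro u w
  ext v b
  simp only [Module.End.mul_apply, eUnit_apply]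
  rw [Function.update_of_ne h.symm, Function.update_of_ne h, Function.update_comm h]
  split_ifs <;> rfl

namespace Off
variable {n : ℕ} {x y : LegOp N A}
lemma mul (hx : Off n x) (hy : Off n y) : Off n (x * y) := fun s t => (hx s t).mul_right (hy s t)
lemma add (hx : Off n x) (hy : Off n y) : Off n (x + y) := fun s t => (hx s t).add_right (hy s t)
lemma smul (z : ℂ) (hx : Off n x) : Off n (z • x) := fun s t => (hx s t).smul_right z
lemma one : Off n (1 : LegOp N A) := fun _ _ => Commute.one_right _
lemma sum {ι : Type*} (S : Finset ι) (f : ι → LegOp N A) (h : ∀ i ∈ S, Off n (f i)) :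
    Off n (∑ i ∈ S, f i) := fun s t => Commute.sum_right _ _ _ fun i hi => h i hi s t
end Off

lemma coef_off (n : ℕ) (a : A) : Off n (coef a : LegOp N A) := by
  intro s t
  ext v b
  simp only [Module.End.mul_apply, eUnit_apply, coef_apply]
  split_ifs <;> simp

lemma amp_off (j : ℕ) {n : ℕ} (X : Op N n A) {m : ℕ} (h : m < j ∨ j + n ≤ m) :
    Off m (amp j X) := by
  intro s t
  ext v b
  simp only [Module.End.mul_apply, eUnit_apply, amp_apply]
  have h1 : ∀ c : Fin n → Fin N, splice b j c m = b m := fun c => by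
    simp only [splice]; rw [dif_neg]; omega
  have h2 : ∀ c : Fin n → Fin N, splice (Function.update b m t) j c =
      Function.update (splice b j c) m t := fun c => by
    funext p
    by_cases hp : p = m
    · subst hp
      simp only [splice, Function.update_self]; rw [dif_neg]; omega
    · simp only [splice, Function.update_of_ne hp]
  have h3 : window (Function.update b m t) j n = window b j n := by
    funext p
    simp only [window]; rw [Function.update_of_ne]; have := p.2; omega
  simp only [h1, h2, h3]
  split_ifs <;> simp

lemma lift_apply {n : ℕ} (X : Op N n ℂ) (a b : Fin n → Fin N) :
    X.lift A a b = algebraMap ℂ A (X a b) := rfl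

lemma coef_comm_amp (a : A) (j : ℕ) {n : ℕ} (X : Op N n ℂ) :
    Commute (coef a) (amp j (X.lift A)) := by
  ext v b
  simp only [Module.End.mul_apply, coef_apply, amp_apply, Finset.mul_sum, lift_apply]
  exact Finset.sum_congr rfl fun c _ => by
    rw [← mul_assoc, ← Algebra.commutes, mul_assoc]

lemma coef_comm_eUnit (a : A) (n : ℕ) (s t : Fin N) :
    Commute (coef a : LegOp N A) (eUnit n s t) := (coef_off n a s t).symm

/-- Disjoint legs alone do not suffice: entries from the noncommutative algebra `A` would still have
to be interchanged, so one of the two operators is taken scalar. -/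
lemma amp_comm_amp {j n j' n' : ℕ} (h : j + n ≤ j' ∨ j' + n' ≤ j) (X : Op N n ℂ) (Y : Op N n' A) :
    Commute (amp j (X.lift A)) (amp j' Y) := by
  have h1 : ∀ (b : ℕ → Fin N) (c : Fin n → Fin N), window (splice b j c) j' n' = window b j' n' :=
    fun b c => by
      funext t; have := t.2
      simp only [window, splice]; rw [dif_neg]; omega
  have h2 : ∀ (b : ℕ → Fin N) (c : Fin n' → Fin N), window (splice b j' c) j n = window b j n :=
    fun b c => by
      funext t; have := t.2
      simp only [window, splice]; rw [dif_neg]; omega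
  have h3 : ∀ (b : ℕ → Fin N) (c : Fin n → Fin N) (d : Fin n' → Fin N),
      splice (splice b j c) j' d = splice (splice b j' d) j c := fun b c d => by
    funext t
    simp only [splice]
    split_ifs <;> first | rfl | omega
  ext v b
  simp only [Module.End.mul_apply, amp_apply, lift_apply, Finset.mul_sum, h1, h2]
  rw [Finset.sum_comm]
  refine Finset.sum_congr rfl fun d _ => Finset.sum_congr rfl fun c _ => ?_
  rw [h3, ← mul_assoc, Algebra.commutes, mul_assoc]

lemma amp_place {n : ℕ} (m i j : ℕ) (h : i + n ≤ m) (X : Op N n A) :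
    amp j (place m i X) = amp (j + i) X := by
  ext v b
  simp only [amp_apply, place, Matrix.of_apply, dif_pos h]
  symm
  -- Only multi-indices agreeing with `b` outside the window contribute to the larger sum, and `e`
  -- parametrises exactly these.
  let e : (Fin n → Fin N) → (Fin m → Fin N) := fun c t =>
    if ht : i ≤ (t : ℕ) ∧ (t : ℕ) < i + n then c ⟨t - i, by omega⟩ else b (j + t)
  refine Fintype.sum_of_injective e ?_ _ _ ?_ ?_
  · intro c d hcd
    funext t
    have := congrFun hcd ⟨i + t, by have := t.2; omega⟩
    simpa [e] using this
  · intro c hc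
    rw [if_neg, zero_mul]
    intro hyp
    apply hc
    refine ⟨fun t => c ⟨i + t, by have := t.2; omega⟩, ?_⟩
    funext s
    simp only [e]
    split_ifs with hs
    · congr 1; ext; simp; omega
    · rw [← hyp s (by omega)]; rfl
  · intro c
    rw [if_pos]
    · have e1 : window b (j + i) n = fun t : Fin n => window b j m ⟨i + t, by have := t.2; omega⟩ := by
        funext t; simp [window, add_assoc]
      have e2 : c = fun t : Fin n => e c ⟨i + t, by have := t.2; omega⟩ := by
        funext t; simp [e]
      congr 1
      · rw [e1]; conv_lhs => rw [e2]
      · congr 1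
        funext s
        simp only [splice, e]
        split_ifs with h1 h2 h3 h4 h5
        · congr 1; ext; simp; omega
        · omega
        · omega
        · omega
        · congr 1; omega
        · rfl
    · intro s hs
      simp only [e, window]
      rw [dif_neg]; omega

lemma coef_injective [NeZero N] : Function.Injective (coef : A → LegOp N A) := by
  intro a c h
  have := congrFun (LinearMap.congr_fun h (fun _ => 1)) (fun _ => 0)
  simpa [coef_apply] using this

/-- Lets an identity proved on legs at one position be read as a matrix identity and transported to
any other position. A nonempty index set is needed to fill the remaining legs. -/
lemma amp_injective (j : ℕ) {n : ℕ} [NeZero N] :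
    Function.Injective (amp j : Op N n A → LegOp N A) := by
  intro X Y h
  ext a c
  have := congrFun (LinearMap.congr_fun h
    (fun b => if window b j n = c then 1 else 0)) (splice (fun _ => 0) j a)
  simpa [amp_apply] using this

/-! ### R-traces over a leg -/

/-- The trace over the leg `n` weighted by `D`. -/
def legTrace (D : Matrix (Fin N) (Fin N) ℂ) (n : ℕ) : LegOp N A →ₗ[ℂ] LegOp N A where
  toFun f := ∑ s, ∑ t, ∑ u, D t u • (eUnit n s u * f * eUnit n t s)
  map_add' f g := by simp [mul_add, add_mul, Finset.sum_add_distrib]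
  map_smul' z f := by
    simp only [mul_smul_comm, smul_mul_assoc, Finset.smul_sum, RingHom.id_apply]
    simp only [smul_comm z]

lemma legTrace_def (D : Matrix (Fin N) (Fin N) ℂ) (n : ℕ) (f : LegOp N A) :
    legTrace D n f = ∑ s, ∑ t, ∑ u, D t u • (eUnit n s u * f * eUnit n t s) := rfl

lemma legTrace_mul_left (D : Matrix (Fin N) (Fin N) ℂ) {n : ℕ} {x : LegOp N A} (hx : Off n x)
    (f : LegOp N A) : legTrace D n (x * f) = x * legTrace D n f := by
  simp only [legTrace_def, Finset.mul_sum, mul_smul_comm, ← mul_assoc, (hx _ _).eq]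

lemma legTrace_mul_right (D : Matrix (Fin N) (Fin N) ℂ) {n : ℕ} {x : LegOp N A} (hx : Off n x)
    (f : LegOp N A) : legTrace D n (f * x) = legTrace D n f * x := by
  simp only [legTrace_def, Finset.sum_mul, smul_mul_assoc, mul_assoc, (hx _ _).eq]

/-- Multiplying the defining sum by a matrix unit on either side selects one summation index, and
both sides collapse to the same double sum. So the trace really removes the leg, for arbitrary
operators. -/
lemma legTrace_off_self (D : Matrix (Fin N) (Fin N) ℂ) (n : ℕ) (f : LegOp N A) :
    Off n (legTrace D n f) := by
  intro a b
  rw [commute_iff_eq]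
  simp only [legTrace_def, Finset.mul_sum, Finset.sum_mul, mul_smul_comm, smul_mul_assoc]
  have h1 : ∀ s t u : Fin N, eUnit n a b * (eUnit n s u * f * eUnit n t s) =
      if s = b then eUnit n a u * f * eUnit n t b else 0 := fun s t u => by
    rw [← mul_assoc, ← mul_assoc, eUnit_mul]
    by_cases h : s = b
    · subst h; simp
    · simp [h, Ne.symm h]
  have h2 : ∀ s t u : Fin N, eUnit n s u * f * eUnit n t s * eUnit n a b =
      if s = a then eUnit n a u * f * eUnit n t b else 0 := fun s t u => by
    rw [mul_assoc, eUnit_mul]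
    by_cases h : s = a
    · subst h; simp
    · simp [h]
  simp only [h1, h2, smul_ite, smul_zero]
  rw [Finset.sum_eq_single b (fun s _ h => by simp [h]) (by simp)]
  symm
  rw [Finset.sum_eq_single a (fun s _ h => by simp [h]) (by simp)]
  simp

lemma legTrace_off (D : Matrix (Fin N) (Fin N) ℂ) {m n : ℕ} {f : LegOp N A} (hf : Off m f) :
    Off m (legTrace D n f) := by
  by_cases h : m = n
  · subst h; exact legTrace_off_self D m f
  · rw [legTrace_def]
    exact Off.sum _ _ fun s _ => Off.sum _ _ fun t _ => Off.sum _ _ fun u _ =>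
      Off.smul _ (((eUnit_off h _ _).mul hf).mul (eUnit_off h _ _))

lemma legTrace_comm (D D' : Matrix (Fin N) (Fin N) ℂ) {m n : ℕ} (h : m ≠ n) (f : LegOp N A) :
    legTrace D m (legTrace D' n f) = legTrace D' n (legTrace D m f) := by
  conv_lhs => rw [legTrace_def D m]
  conv_rhs => rw [legTrace_def D m]
  simp only [map_sum, map_smul]
  refine Finset.sum_congr rfl fun s _ => Finset.sum_congr rfl fun t _ =>
    Finset.sum_congr rfl fun u _ => ?_
  rw [legTrace_mul_right _ (eUnit_off h.symm _ _), legTrace_mul_left _ (eUnit_off h.symm _ _)]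

lemma legTrace_apply (D : Matrix (Fin N) (Fin N) ℂ) (n : ℕ) (f : LegOp N A)
    (v : (ℕ → Fin N) → A) (b : ℕ → Fin N) :
    legTrace D n f v b = ∑ t, ∑ u, D t u •
      f (eUnit n t (b n) v) (Function.update b n u) := by
  simp only [legTrace_def, LinearMap.sum_apply, LinearMap.smul_apply, Finset.sum_apply,
    Pi.smul_apply, Module.End.mul_apply]
  rw [Finset.sum_eq_single (b n)]
  · refine Finset.sum_congr rfl fun t _ => Finset.sum_congr rfl fun u _ => ?_
    rw [eUnit_apply, if_pos rfl]
  · intro s _ h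
    refine Finset.sum_eq_zero fun t _ => Finset.sum_eq_zero fun u _ => ?_
    rw [eUnit_apply, if_neg h.symm, smul_zero]
  · simp

/-- The trace over the last tensor factor. -/
def lastTrace (D : Matrix (Fin N) (Fin N) ℂ) {n : ℕ} (X : Op N (n + 1) A) : Op N n A :=
  Matrix.of fun a b => ∑ t, ∑ u, D t u • X (Fin.snoc a u : Fin (n + 1) → Fin N) (Fin.snoc b t)

lemma sum_snoc {n : ℕ} {M : Type*} [AddCommMonoid M] (f : (Fin (n + 1) → Fin N) → M) :
    ∑ c, f c = ∑ t, ∑ c : Fin n → Fin N, f (Fin.snoc c t : Fin (n + 1) → Fin N) := by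
  rw [← Fintype.sum_prod_type', ← (Fin.snocEquiv (fun _ => Fin N)).sum_comp]
  rfl

/-- Bridge between traces of operators and entrywise traces of matrices; iterating it rewrites `ch`
and `desc` as iterated leg traces. -/
lemma legTrace_amp (D : Matrix (Fin N) (Fin N) ℂ) (j : ℕ) {n : ℕ} (X : Op N (n + 1) A) :
    legTrace D (j + n) (amp j X) = amp j (lastTrace D X) := by
  ext v b
  simp only [legTrace_apply, amp_apply, lastTrace, Matrix.of_apply]
  have h1 : ∀ u, window (Function.update b (j + n) u) j (n + 1) =
      (Fin.snoc (window b j n) u : Fin (n + 1) → Fin N) := fun u => by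
    funext t
    refine Fin.lastCases ?_ (fun t => ?_) t
    · simp [window]
    · simp only [window, Fin.snoc_castSucc, Fin.val_castSucc]
      rw [Function.update_of_ne]; have := t.2; omega
  have h2 : ∀ u (c : Fin n → Fin N) t,
      splice (Function.update b (j + n) u) j (Fin.snoc c t : Fin (n + 1) → Fin N) =
      Function.update (splice b j c) (j + n) t := fun u c t => by
    funext s
    by_cases hs : s = j + n
    · subst hs
      simp [splice, Fin.snoc]
    · rw [Function.update_of_ne hs]
      simp only [splice, Fin.snoc]
      split_ifs <;> first | rfl | omega | exact (Function.update_of_ne hs _ _).symm | exact Function.update_of_ne hs _ _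
  have h3 : ∀ (c : Fin n → Fin N), splice b j c (j + n) = b (j + n) := fun c => by
    simp [splice]
  simp only [sum_snoc, h1, h2, eUnit_apply, Function.update_self, Function.update_idem]
  simp only [Finset.smul_sum, Finset.sum_mul]
  have h4 : ∀ c : Fin n → Fin N, Function.update (splice b j c) (j + n) (b (j + n)) =
      splice b j c := fun c => by rw [← h3 c]; simp
  simp only [h4]
  rw [Finset.sum_comm]
  conv_rhs => rw [Finset.sum_comm]
  rw [Finset.sum_comm]
  refine Finset.sum_congr rfl fun t _ => ?_
  conv_rhs => rw [Finset.sum_comm]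
  refine Finset.sum_congr rfl fun u _ => ?_
  rw [Finset.sum_eq_single t (fun s _ h => Finset.sum_eq_zero fun c _ => by simp [h]) (by simp)]
  exact Finset.sum_congr rfl fun c _ => by simp

/-- Iterated traces over the legs `j, …, j + n - 1`. -/
def iterTrace (D : Matrix (Fin N) (Fin N) ℂ) (j : ℕ) : ℕ → LegOp N A →ₗ[ℂ] LegOp N A
  | 0 => LinearMap.id
  | n + 1 => iterTrace D j n ∘ₗ legTrace D (j + n)

@[simp] lemma iterTrace_zero (D : Matrix (Fin N) (Fin N) ℂ) (j : ℕ) (f : LegOp N A) :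
    iterTrace D j 0 f = f := rfl

lemma iterTrace_succ (D : Matrix (Fin N) (Fin N) ℂ) (j n : ℕ) (f : LegOp N A) :
    iterTrace D j (n + 1) f = iterTrace D j n (legTrace D (j + n) f) := rfl

lemma iterTrace_add (D : Matrix (Fin N) (Fin N) ℂ) (j m n : ℕ) (f : LegOp N A) :
    iterTrace D j (m + n) f = iterTrace D j m (iterTrace D (j + m) n f) := by
  induction n generalizing f with
  | zero => rfl
  | succ n ih => rw [← add_assoc, iterTrace_succ, ih, iterTrace_succ, add_assoc]

lemma iterTrace_mul_left (D : Matrix (Fin N) (Fin N) ℂ) {j n : ℕ} {x : LegOp N A}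
    (hx : ∀ m, j ≤ m → m < j + n → Off m x) (f : LegOp N A) :
    iterTrace D j n (x * f) = x * iterTrace D j n f := by
  induction n generalizing f with
  | zero => rfl
  | succ n ih =>
    rw [iterTrace_succ, legTrace_mul_left D (hx _ (by omega) (by omega)),
      ih fun m h1 h2 => hx m h1 (by omega), iterTrace_succ]

lemma iterTrace_mul_right (D : Matrix (Fin N) (Fin N) ℂ) {j n : ℕ} {x : LegOp N A}
    (hx : ∀ m, j ≤ m → m < j + n → Off m x) (f : LegOp N A) :
    iterTrace D j n (f * x) = iterTrace D j n f * x := by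
  induction n generalizing f with
  | zero => rfl
  | succ n ih =>
    rw [iterTrace_succ, legTrace_mul_right D (hx _ (by omega) (by omega)),
      ih fun m h1 h2 => hx m h1 (by omega), iterTrace_succ]

lemma fullTrace_succ (D : Matrix (Fin N) (Fin N) ℂ) {n : ℕ} (X : Op N (n + 1) A) :
    fullTrace D X = fullTrace D (lastTrace D X) := by
  simp only [fullTrace, sum_snoc, lastTrace, Matrix.of_apply, Finset.smul_sum, Fin.prod_univ_castSucc,
    Fin.snoc_castSucc, Fin.snoc_last, mul_smul]
  rw [Finset.sum_comm]
  refine Finset.sum_congr rfl fun c _ => ?_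
  conv_rhs => rw [Finset.sum_comm]
  refine Finset.sum_congr rfl fun t _ => ?_
  rw [Finset.sum_comm]

lemma iterTrace_amp_full (D : Matrix (Fin N) (Fin N) ℂ) (j : ℕ) {n : ℕ} (X : Op N n A) :
    iterTrace D j n (amp j X) = coef (fullTrace D X) := by
  induction n with
  | zero =>
    ext v b
    simp only [iterTrace_zero, amp_apply, coef_apply, fullTrace]
    simp only [Finset.univ_unique, Finset.sum_singleton, Finset.univ_eq_empty, Finset.prod_empty,
      one_smul]
    congr 2
    · exact Subsingleton.elim _ _
    · funext s
      simp only [splice]; rw [dif_neg]; omega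
  | succ n ih => rw [iterTrace_succ, legTrace_amp, ih, ← fullTrace_succ]

lemma tailTrace_succ (D : Matrix (Fin N) (Fin N) ℂ) {n : ℕ} (X : Op N (n + 1 + 1) A) :
    tailTrace D X = tailTrace D (lastTrace D X) := by
  ext a b
  simp only [tailTrace, sum_snoc, lastTrace, Matrix.of_apply, Finset.smul_sum,
    Fin.prod_univ_castSucc, Fin.snoc_castSucc, Fin.snoc_last, mul_smul,
    Fin.cons_snoc_eq_snoc_cons]
  rw [Finset.sum_comm]
  refine Finset.sum_congr rfl fun c _ => ?_
  conv_rhs => rw [Finset.sum_comm]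
  refine Finset.sum_congr rfl fun t _ => ?_
  rw [Finset.sum_comm]

lemma iterTrace_amp_tail (D : Matrix (Fin N) (Fin N) ℂ) (j : ℕ) {n : ℕ} (X : Op N (n + 1) A) :
    iterTrace D (j + 1) n (amp j X) = amp j (oneStrand (tailTrace D X)) := by
  induction n with
  | zero =>
    rw [iterTrace_zero]
    congr 1
    ext a b
    simp only [oneStrand, tailTrace, Matrix.submatrix_apply, Matrix.of_apply]
    simp only [Finset.univ_unique, Finset.sum_singleton, Finset.univ_eq_empty, Finset.prod_empty,
      one_smul]
    congr 1
    · funext t; fin_cases t; rfl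
    · funext t; fin_cases t; rfl
  | succ n ih =>
    rw [iterTrace_succ, show j + 1 + n = j + (n + 1) by ring, legTrace_amp, ih, ← tailTrace_succ]

end

/-! ### Scalar operators and matrices on single legs. -/

section

variable {N : ℕ} {A : Type*} [Ring A] [Algebra ℂ A]

/-- Scalar operators acting on the legs `j, …, j + n - 1`. -/
def scal (A : Type*) [Ring A] [Algebra ℂ A] (j : ℕ) {n : ℕ} : Op N n ℂ →ₐ[ℂ] LegOp N A :=
  (amp j).comp (Algebra.ofId ℂ A).mapMatrix

lemma scal_def (j : ℕ) {n : ℕ} (X : Op N n ℂ) : scal A j X = amp j (X.lift A) := rfl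

lemma lift_place {n : ℕ} (m j : ℕ) (X : Op N n ℂ) : (place m j X).lift A = place m j (X.lift A) := by
  ext a b
  simp only [Op.lift, place, Matrix.map_apply, Matrix.of_apply]
  split_ifs <;> simp

lemma scal_place {n : ℕ} {m i : ℕ} (j : ℕ) (h : i + n ≤ m) (X : Op N n ℂ) :
    scal A j (place m i X) = scal A (j + i) X := by
  rw [scal_def, lift_place, amp_place _ _ _ h, scal_def]

lemma scal_off (j : ℕ) {n : ℕ} (X : Op N n ℂ) {m : ℕ} (h : m < j ∨ j + n ≤ m) :
    Off m (scal A j X) := amp_off j _ h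

lemma coef_comm_scal (a : A) (j : ℕ) {n : ℕ} (X : Op N n ℂ) : Commute (coef a) (scal A j X) :=
  coef_comm_amp a j X

lemma scal_comm_scal {j n j' n' : ℕ} (h : j + n ≤ j' ∨ j' + n' ≤ j) (X : Op N n ℂ)
    (Y : Op N n' ℂ) : Commute (scal A j X) (scal A j' Y) := amp_comm_amp h X _

lemma scal_injective (j : ℕ) {n : ℕ} [NeZero N] :
    Function.Injective (scal ℂ j : Op N n ℂ → LegOp N ℂ) := by
  intro X Y h
  have := amp_injective j h
  simpa [← Matrix.ext_iff] using this

/-- Matrices acting on the leg `n`. -/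
def leg (n : ℕ) (X : Matrix (Fin N) (Fin N) A) : LegOp N A := amp n (oneStrand X)

lemma amp_succ (j : ℕ) {n : ℕ} (X : Op N (n + 1) A) :
    amp j X = ∑ u, ∑ t, amp j (Matrix.of fun a b : Fin n → Fin N =>
      X (Fin.snoc a u : Fin (n + 1) → Fin N) (Fin.snoc b t)) * eUnit (j + n) u t := by
  ext v b
  have h1 : window b j (n + 1) =
      (Fin.snoc (window b j n) (b (j + n)) : Fin (n + 1) → Fin N) := by
    funext t
    refine Fin.lastCases ?_ (fun t => ?_) t
    · simp [window]
    · simp [window]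
  have h2 : ∀ (c : Fin n → Fin N) t,
      splice b j (Fin.snoc c t : Fin (n + 1) → Fin N) =
      Function.update (splice b j c) (j + n) t := fun c t => by
    funext s
    by_cases hs : s = j + n
    · subst hs
      simp [splice, Fin.snoc]
    · rw [Function.update_of_ne hs]
      simp only [splice, Fin.snoc]
      split_ifs <;> first | rfl | omega
  have h3 : ∀ (c : Fin n → Fin N), splice b j c (j + n) = b (j + n) := fun c => by
    simp [splice]
  simp only [LinearMap.sum_apply, Finset.sum_apply, Module.End.mul_apply, amp_apply, eUnit_apply,
    h1, h2, h3, sum_snoc, Matrix.of_apply]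
  rw [Finset.sum_eq_single (b (j + n)) (fun s _ h => Finset.sum_eq_zero fun t _ =>
    Finset.sum_eq_zero fun c _ => by simp [Ne.symm h]) (by simp)]
  simp

lemma amp_zero_legs (j : ℕ) (X : Op N 0 A) : amp j X = coef (X default default) := by
  ext v b
  simp only [amp_apply, coef_apply, Finset.univ_unique, Finset.sum_singleton]
  congr 2
  · exact Subsingleton.elim _ _
  · funext s
    simp only [splice]; rw [dif_neg]; omega

/-- A scalar operator on finitely many legs is a combination of products of matrix units on these
legs, so commuting with the units leg by leg is enough. -/
lemma commute_scal_of_off {x : LegOp N A} {j n : ℕ} (h : ∀ m, j ≤ m → m < j + n → Off m x)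
    (X : Op N n ℂ) : Commute (scal A j X) x := by
  induction n with
  | zero =>
    rw [scal_def, amp_zero_legs, lift_apply, AlgHom.commutes]
    exact Algebra.commutes _ _
  | succ n ih =>
    rw [scal_def, amp_succ]
    refine Commute.sum_left _ _ _ fun u _ => Commute.sum_left _ _ _ fun t _ => ?_
    refine Commute.mul_left ?_ (h _ (by omega) (by omega) u t)
    exact ih (fun m h1 h2 => h m h1 (by omega)) (Matrix.of fun a b : Fin n → Fin N =>
      X (Fin.snoc a u : Fin (n + 1) → Fin N) (Fin.snoc b t))

lemma leg_eq_sum (n : ℕ) (X : Matrix (Fin N) (Fin N) A) :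
    leg n X = ∑ s, ∑ t, coef (X s t) * eUnit n s t := by
  rw [leg, amp_succ]
  refine Finset.sum_congr rfl fun s _ => Finset.sum_congr rfl fun t _ => ?_
  rw [amp_zero_legs]
  rfl

lemma scal_two_eq_sum (n : ℕ) (X : Op N 2 ℂ) :
    scal A n X = ∑ b, ∑ d, ∑ a, ∑ c, X ![a, b] ![c, d] • (eUnit n a c * eUnit (n + 1) b d) := by
  rw [scal_def, amp_succ]
  refine Finset.sum_congr rfl fun b _ => Finset.sum_congr rfl fun d _ => ?_
  rw [amp_succ, Finset.sum_mul]
  refine Finset.sum_congr rfl fun a _ => ?_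
  rw [Finset.sum_mul]
  refine Finset.sum_congr rfl fun c _ => ?_
  rw [amp_zero_legs]
  simp only [Matrix.of_apply, lift_apply, AlgHom.commutes]
  rw [← Algebra.smul_def, smul_mul_assoc]
  congr 2
  all_goals funext t; fin_cases t <;> rfl

lemma leg_single (n : ℕ) (s t : Fin N) :
    leg n (Matrix.single s t (1 : A)) = eUnit n s t := by
  rw [leg_eq_sum, Finset.sum_eq_single s (fun u _ h => ?_) (by simp),
    Finset.sum_eq_single t (fun u _ h => ?_) (by simp)]
  · simp
  · simp [h.symm]
  · refine Finset.sum_eq_zero fun w _ => ?_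
    simp [h.symm]

lemma leg_add (n : ℕ) (X Y : Matrix (Fin N) (Fin N) A) : leg n (X + Y) = leg n X + leg n Y := by
  rw [leg, leg, leg, ← map_add]; rfl

lemma leg_mul (n : ℕ) (X Y : Matrix (Fin N) (Fin N) A) : leg n (X * Y) = leg n X * leg n Y := by
  rw [leg, leg, leg, ← map_mul]
  congr 1
  ext a b
  simp only [oneStrand, Matrix.submatrix_apply, Matrix.mul_apply]
  exact ((Equiv.funUnique (Fin 1) (Fin N)).sum_comp (fun c => X (a 0) c * Y c (b 0))).symm

lemma leg_one (n : ℕ) : leg n (1 : Matrix (Fin N) (Fin N) A) = 1 := by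
  rw [leg_eq_sum, ← eUnit_sum n]
  refine Finset.sum_congr rfl fun s _ => ?_
  rw [Finset.sum_eq_single s (fun t _ h => by simp [h.symm]) (by simp)]
  simp

lemma leg_off {m n : ℕ} (h : m ≠ n) (X : Matrix (Fin N) (Fin N) A) : Off m (leg n X) :=
  amp_off n _ (by omega)

lemma leg_injective [NeZero N] (n : ℕ) :
    Function.Injective (leg n : Matrix (Fin N) (Fin N) A → LegOp N A) := by
  intro X Y h
  have := amp_injective n h
  ext a b
  exact congrFun (congrFun this (fun _ => a)) (fun _ => b)

lemma leg_mul_coef (n : ℕ) (X : Matrix (Fin N) (Fin N) A) (c : A) :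
    leg n (rmul X c) = leg n X * coef c := by
  simp only [leg_eq_sum, Finset.sum_mul, rmul, Matrix.map_apply, map_mul, mul_assoc]
  simp only [(coef_comm_eUnit _ _ _ _).eq]

lemma leg_map (n : ℕ) (X : Matrix (Fin N) (Fin N) ℂ) :
    leg n (X.map (algebraMap ℂ A)) = scal A n (oneStrand X) := rfl

/-! ### Elementary trace computations -/

lemma legTrace_eUnit (D : Matrix (Fin N) (Fin N) ℂ) (n : ℕ) (s t : Fin N) :
    legTrace D n (eUnit n s t : LegOp N A) = D t s • 1 := by
  rw [legTrace_def]
  simp only [eUnit_mul, ite_mul, zero_mul]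
  rw [← eUnit_sum n, Finset.smul_sum]
  refine Finset.sum_congr rfl fun u _ => ?_
  rw [Finset.sum_eq_single t (fun w _ h => ?_) (by simp),
    Finset.sum_eq_single s (fun w _ h => ?_) (by simp)]
  · simp
  · simp [h]
  · exact Finset.sum_eq_zero fun x _ => by simp [Ne.symm h]

lemma legTrace_leg (D : Matrix (Fin N) (Fin N) ℂ) (n : ℕ) (X : Matrix (Fin N) (Fin N) ℂ) :
    legTrace D n (leg n (X.map (algebraMap ℂ A))) = (D * X).trace • 1 := by
  simp only [leg_eq_sum, map_sum, Matrix.map_apply, AlgHom.commutes, ← Algebra.smul_def, map_smul,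
    legTrace_eUnit, Matrix.trace, Matrix.diag, Matrix.mul_apply, Finset.sum_smul]
  rw [Finset.sum_comm]
  refine Finset.sum_congr rfl fun s _ => Finset.sum_congr rfl fun t _ => ?_
  rw [smul_smul, mul_comm]

lemma legTrace_one (D : Matrix (Fin N) (Fin N) ℂ) (n : ℕ) :
    legTrace D n (1 : LegOp N A) = D.trace • 1 := by
  rw [← eUnit_sum n, map_sum]
  simp only [legTrace_eUnit, Matrix.trace, Matrix.diag, Finset.sum_smul]
  rw [eUnit_sum]

/-- Trace over the first of two legs. -/
lemma legTrace_scal_left (Z : Matrix (Fin N) (Fin N) ℂ) (n : ℕ) (X : Op N 2 ℂ) :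
    legTrace Z n (scal A n X) = leg (n + 1) (Matrix.of fun b d =>
      algebraMap ℂ A (∑ t, ∑ u, Z t u * X ![u, b] ![t, d])) := by
  rw [scal_two_eq_sum, leg_eq_sum]
  conv_lhs => simp only [map_sum, map_smul]
  refine Finset.sum_congr rfl fun b _ => Finset.sum_congr rfl fun d _ => ?_
  rw [Finset.sum_comm, Matrix.of_apply, AlgHom.commutes, ← Algebra.smul_def, Finset.sum_smul]
  refine Finset.sum_congr rfl fun t _ => ?_
  rw [Finset.sum_smul]
  refine Finset.sum_congr rfl fun u _ => ?_
  rw [legTrace_mul_right _ (eUnit_off (by omega) _ _), legTrace_eUnit, smul_mul_assoc, one_mul,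
    smul_smul, mul_comm]

lemma legTrace_scal_right (Z : Matrix (Fin N) (Fin N) ℂ) (n : ℕ) (X : Op N 2 ℂ) :
    legTrace Z (n + 1) (scal A n X) = leg n ((tailTrace (s := 1) Z X).map (algebraMap ℂ A)) := by
  have h := iterTrace_amp_tail Z n (X.lift A) (n := 1)
  rw [iterTrace_succ, iterTrace_zero] at h
  rw [scal_def, leg]
  refine h.trans (congrArg _ (congrArg _ ?_))
  ext a b
  simp only [tailTrace, Matrix.of_apply, Matrix.map_apply, map_sum, lift_apply, Algebra.smul_def,
    map_mul]
  rfl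

end

/-! ### Skew inverses and R-traces -/

section

variable {N : ℕ} {A : Type*} [Ring A] [Algebra ℂ A]

lemma place_mul_place_apply (X Y : Op N 2 ℂ) (a b c a' b' c' : Fin N) :
    (place 3 0 X * place 3 1 Y) ![a, b, c] ![a', b', c'] =
      ∑ x, X ![a, b] ![a', x] * Y ![x, c] ![b', c'] := by
  rw [Matrix.mul_apply]
  symm
  refine Fintype.sum_of_injective (fun x => ![a', x, c]) ?_ _ _ ?_ ?_
  · intro x y h
    simpa using congrFun h 1
  · intro w hw
    have : ¬ (w 0 = a' ∧ w 2 = c) := by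
      rintro ⟨h0, h2⟩
      exact hw ⟨w 1, by funext t; fin_cases t <;> simp [h0, h2]⟩
    simp only [place, Matrix.of_apply]
    by_cases h0 : w 0 = a'
    · have h2 : ¬ c = w 2 := fun h => this ⟨h0, h.symm⟩
      rw [dif_pos (by norm_num), if_neg, zero_mul]
      intro h
      exact h2 (by simpa using h 2 (by norm_num))
    · rw [dif_pos (show 1 + 2 ≤ 3 by norm_num), if_neg (c := ∀ s : Fin 3, ((s : ℕ) < 1 ∨ 1 + 2 ≤ (s : ℕ)) → w s = _), mul_zero]
      intro h
      exact h0 (by simpa using h 0 (by norm_num))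
  · intro x
    simp only [place, Matrix.of_apply]
    rw [dif_pos (by norm_num), if_pos, dif_pos (by norm_num), if_pos]
    · congr 2 <;> funext t <;> fin_cases t <;> rfl
    · intro s hs; fin_cases s <;> simp_all
    · intro s hs; fin_cases s <;> simp_all

lemma tailTrace_two (Z : Matrix (Fin N) (Fin N) ℂ) (X : Op N 2 ℂ) (a a' : Fin N) :
    tailTrace (s := 1) Z X a a' = ∑ t, ∑ u, Z t u * X ![a, u] ![a', t] := by
  simp only [tailTrace, Matrix.of_apply, Finset.univ_unique, Finset.prod_singleton, smul_eq_mul]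
  rw [← (Equiv.funUnique (Fin 1) (Fin N)).symm.sum_comp]
  refine Finset.sum_congr rfl fun t _ => ?_
  rw [← (Equiv.funUnique (Fin 1) (Fin N)).symm.sum_comp]
  refine Finset.sum_congr rfl fun u _ => ?_
  congr 2 <;> funext s <;> fin_cases s <;> rfl

section Skew
variable {X Ψ : Op N 2 ℂ} (h : IsSkewInverse X Ψ)
include h

lemma IsSkewInverse.right (a c a' c' : Fin N) :
    ∑ b, ∑ x, X ![a, b] ![a', x] * Ψ ![x, c] ![b, c'] = if a = c' ∧ c = a' then 1 else 0 := by
  simpa only [place_mul_place_apply] using (h a c a' c').1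

lemma IsSkewInverse.left (a c a' c' : Fin N) :
    ∑ b, ∑ x, Ψ ![a, b] ![a', x] * X ![x, c] ![b, c'] = if a = c' ∧ c = a' then 1 else 0 := by
  simpa only [place_mul_place_apply] using (h a c a' c').2

/-- The skew inverse undoes contraction with `X`, so any complex matrix on a leg is a weighted trace
of `X` over the leg to its left, with a weight independent of the position. Relations satisfied by
`X` thereby yield statements about arbitrary matrices. -/
lemma IsSkewInverse.exists_slice_left (Y : Matrix (Fin N) (Fin N) ℂ) :
    ∃ Z : Matrix (Fin N) (Fin N) ℂ, ∀ n : ℕ,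
      leg (n + 1) (Y.map (algebraMap ℂ A)) = legTrace Z n (scal A n X) := by
  refine ⟨Matrix.of fun t u => ∑ a, ∑ a', Y a' a * Ψ ![a, t] ![a', u], fun n => ?_⟩
  rw [legTrace_scal_left]
  congr 1
  ext c c'
  simp only [Matrix.map_apply, Matrix.of_apply, Finset.sum_mul]
  congr 1
  have : ∀ a a' : Fin N, ∑ t, ∑ u, Y a' a * Ψ ![a, t] ![a', u] * X ![u, c] ![t, c'] =
      if a = c' ∧ c = a' then Y a' a else 0 := fun a a' => by
    simp only [mul_assoc, ← Finset.mul_sum, h.left]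
    simp
  calc Y c c' = ∑ a, ∑ a', if a = c' ∧ c = a' then Y a' a else 0 := by
        rw [Finset.sum_eq_single c' (fun a _ ha => by simp [ha]) (by simp),
          Finset.sum_eq_single c (fun a _ ha => by simp [ha.symm]) (by simp)]
        simp
    _ = ∑ a, ∑ a', ∑ t, ∑ u, Y a' a * Ψ ![a, t] ![a', u] * X ![u, c] ![t, c'] := by
        simp only [this]
    _ = ∑ a, ∑ t, ∑ a', ∑ u, Y a' a * Ψ ![a, t] ![a', u] * X ![u, c] ![t, c'] :=
        Finset.sum_congr rfl fun a _ => Finset.sum_comm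
    _ = ∑ t, ∑ a, ∑ u, ∑ a', Y a' a * Ψ ![a, t] ![a', u] * X ![u, c] ![t, c'] := by
        rw [Finset.sum_comm]
        exact Finset.sum_congr rfl fun t _ => Finset.sum_congr rfl fun a _ => Finset.sum_comm
    _ = _ := Finset.sum_congr rfl fun t _ => Finset.sum_comm

end Skew

lemma SkewInvertible.isSkewInverse {X : Op N 2 ℂ} (h : SkewInvertible X) :
    IsSkewInverse X (skewInv X) := Classical.epsilon_spec h

/-- `D_R` is itself a partial trace of `Ψ`, so summing the identity `Tr_{(2)} R₁₂ Ψ₂₃ = P₁₃` over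
the third leg leaves the identity operator. This is the normalisation of the R-trace. -/
lemma legTrace_matD {R : Op N 2 ℂ} (h : SkewInvertible R) (n : ℕ) :
    legTrace (matD R) (n + 1) (scal A n R) = 1 := by
  rw [legTrace_scal_right, ← leg_one n]
  congr 1
  ext a a'
  rw [Matrix.map_apply, tailTrace_two, Matrix.one_apply]
  have : ∑ t, ∑ u, matD R t u * R ![a, u] ![a', t] = if a = a' then 1 else 0 := by
    calc _ = ∑ t, ∑ u, ∑ c, R ![a, u] ![a', t] * skewInv R ![t, c] ![u, c] := by
          simp only [matD, Matrix.of_apply, Finset.sum_mul, mul_comm (R _ _)]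
      _ = ∑ t, ∑ c, ∑ u, R ![a, u] ![a', t] * skewInv R ![t, c] ![u, c] :=
          Finset.sum_congr rfl fun t _ => Finset.sum_comm
      _ = ∑ c, ∑ t, ∑ u, R ![a, u] ![a', t] * skewInv R ![t, c] ![u, c] := Finset.sum_comm
      _ = ∑ c, ∑ u, ∑ t, R ![a, u] ![a', t] * skewInv R ![t, c] ![u, c] :=
          Finset.sum_congr rfl fun c _ => Finset.sum_comm
      _ = ∑ c, if a = c ∧ c = a' then 1 else 0 := by
          simp only [h.isSkewInverse.right]
      _ = if a = a' then 1 else 0 := by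
          rw [Finset.sum_eq_single a (fun c _ hc => by simp [Ne.symm hc]) (by simp)]
          simp
  rw [this]
  split_ifs <;> simp

/-! ### Braid relations on legs -/

lemma IsRMatrix.mul_inv {R : Op N 2 ℂ} (h : IsRMatrix R) (n : ℕ) :
    scal A n R * scal A n R⁻¹ = 1 := by
  rw [← map_mul, Matrix.mul_nonsing_inv _ ((Matrix.isUnit_iff_isUnit_det _).1 h.isUnit), map_one]

lemma IsRMatrix.inv_mul {R : Op N 2 ℂ} (h : IsRMatrix R) (n : ℕ) :
    scal A n R⁻¹ * scal A n R = 1 := by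
  rw [← map_mul, Matrix.nonsing_inv_mul _ ((Matrix.isUnit_iff_isUnit_det _).1 h.isUnit), map_one]

lemma scal_of_place_eq {X₁ X₂ X₃ Y₁ Y₂ Y₃ : Op N 2 ℂ} {i₁ i₂ i₃ j₁ j₂ j₃ : ℕ}
    (h : place 3 i₁ X₁ * place 3 i₂ X₂ * place 3 i₃ X₃ =
      place 3 j₁ Y₁ * place 3 j₂ Y₂ * place 3 j₃ Y₃)
    (hi : i₁ + 2 ≤ 3 ∧ i₂ + 2 ≤ 3 ∧ i₃ + 2 ≤ 3 ∧ j₁ + 2 ≤ 3 ∧ j₂ + 2 ≤ 3 ∧ j₃ + 2 ≤ 3) (n : ℕ) :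
    scal A (n + i₁) X₁ * scal A (n + i₂) X₂ * scal A (n + i₃) X₃ =
      scal A (n + j₁) Y₁ * scal A (n + j₂) Y₂ * scal A (n + j₃) Y₃ := by
  have := congrArg (scal A n) h
  simpa only [map_mul, scal_place n hi.1, scal_place n hi.2.1, scal_place n hi.2.2.1,
    scal_place n hi.2.2.2.1, scal_place n hi.2.2.2.2.1, scal_place n hi.2.2.2.2.2] using this

lemma IsRMatrix.braid {R : Op N 2 ℂ} (h : IsRMatrix R) (n : ℕ) :
    scal A n R * scal A (n + 1) R * scal A n R =
      scal A (n + 1) R * scal A n R * scal A (n + 1) R :=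
  scal_of_place_eq h.yangBaxter (by norm_num) n

lemma IsCompatiblePair.shift₁ {R F : Op N 2 ℂ} (h : IsCompatiblePair R F) (n : ℕ) :
    scal A n R * scal A (n + 1) F * scal A n F =
      scal A (n + 1) F * scal A n F * scal A (n + 1) R :=
  scal_of_place_eq h.twist₁ (by norm_num) n

lemma IsCompatiblePair.shift₂ {R F : Op N 2 ℂ} (h : IsCompatiblePair R F) (n : ℕ) :
    scal A (n + 1) R * scal A n F * scal A (n + 1) F =
      scal A n F * scal A (n + 1) F * scal A n R :=
  scal_of_place_eq h.twist₂ (by norm_num) n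

lemma IsRMatrix.compatible_self {R : Op N 2 ℂ} (h : IsRMatrix R) : IsCompatiblePair R R :=
  ⟨h, h, h.yangBaxter, h.yangBaxter.symm⟩

/-! ### Conjugation invariance of the R-trace -/

lemma conj_eq_conj {W : Type*} [Ring W] {a a' b b' x y : W} (ha : a * a' = 1) (hb' : b' * b = 1)
    (h : b * a * x = y * b * a) : a * x * a' = b' * y * b := by
  calc a * x * a' = b' * (b * a * x) * a' := by simp only [← mul_assoc, hb', one_mul]
    _ = b' * y * b * (a * a') := by rw [h]; simp only [mul_assoc]
    _ = _ := by rw [ha, mul_one]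

lemma eUnit_eq_scal (m : ℕ) (s t : Fin N) : (eUnit m s t : LegOp N A) =
    scal A m (place 2 0 (oneStrand (Matrix.single s t 1))) := by
  rw [scal_place _ (by norm_num), ← leg_single, add_zero, ← leg_map]
  congr 1
  ext a b
  simp [Matrix.single_apply, apply_ite (algebraMap ℂ A)]

lemma leg_map_smul_one (n : ℕ) (c : ℂ) :
    leg n ((c • (1 : Matrix (Fin N) (Fin N) ℂ)).map (algebraMap ℂ A)) = c • 1 := by
  rw [leg_map, show oneStrand (c • (1 : Matrix (Fin N) (Fin N) ℂ)) = c • (1 : Op N 1 ℂ) from ?_,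
    map_smul, map_one]
  ext a b
  simp only [oneStrand, Matrix.submatrix_apply, Matrix.smul_apply, Matrix.one_apply]
  congr 2
  exact propext ⟨fun h => by funext t; rw [Subsingleton.elim t 0, h], fun h => congrFun h 0⟩

section Conj
variable {R F : Op N 2 ℂ} (h : IsCompatiblePair R F) (hR : SkewInvertible R)
include h hR

/-- Write `Y` as a slice of `R_n`. Compatibility turns `F_{n+1} R_n F_{n+1}⁻¹` into `F_n⁻¹ R_{n+1}
F_n`, and the R-trace of `R_{n+1}` is `1`; the right-hand side reduces to the same quantity by the
R-trace of `R_n`. -/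
lemma IsCompatiblePair.legTrace_conj_leg (n : ℕ) (Y : Matrix (Fin N) (Fin N) ℂ) :
    legTrace (matD R) (n + 1 + 1)
        (scal A (n + 1) F * leg (n + 1) (Y.map (algebraMap ℂ A)) * scal A (n + 1) F⁻¹) =
      legTrace (matD R) (n + 1) (leg (n + 1) (Y.map (algebraMap ℂ A))) := by
  obtain ⟨Z, hZ⟩ := hR.isSkewInverse.exists_slice_left (A := A) Y
  have e : scal A (n + 1) F * scal A n R * scal A (n + 1) F⁻¹ =
      scal A n F⁻¹ * scal A (n + 1) R * scal A n F :=
    conj_eq_conj (h.rMatrix_right.mul_inv _) (h.rMatrix_right.inv_mul _) <| by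
      rw [← h.shift₂]
  rw [hZ, ← legTrace_mul_left _ (scal_off _ _ (by omega)),
    ← legTrace_mul_right _ (scal_off _ _ (by omega)), legTrace_comm _ _ (by omega), e,
    legTrace_mul_right _ (scal_off _ _ (by omega)), legTrace_mul_left _ (scal_off _ _ (by omega)),
    legTrace_matD hR, mul_one, h.rMatrix_right.inv_mul, legTrace_comm _ _ (by omega),
    legTrace_matD hR]

lemma IsCompatiblePair.legTrace_conj_leg' (n : ℕ) (Y : Matrix (Fin N) (Fin N) ℂ) :
    legTrace (matD R) (n + 1 + 1)
        (scal A (n + 1) F⁻¹ * leg (n + 1) (Y.map (algebraMap ℂ A)) * scal A (n + 1) F) =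
      legTrace (matD R) (n + 1) (leg (n + 1) (Y.map (algebraMap ℂ A))) := by
  obtain ⟨Z, hZ⟩ := hR.isSkewInverse.exists_slice_left (A := A) Y
  have e : scal A (n + 1) F⁻¹ * scal A n R * scal A (n + 1) F =
      scal A n F * scal A (n + 1) R * scal A n F⁻¹ := by
    refine (conj_eq_conj (h.rMatrix_right.mul_inv _) (h.rMatrix_right.inv_mul _) ?_).symm
    rw [← h.shift₁]
  rw [hZ, ← legTrace_mul_left _ (scal_off _ _ (by omega)),
    ← legTrace_mul_right _ (scal_off _ _ (by omega)), legTrace_comm _ _ (by omega), e,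
    legTrace_mul_right _ (scal_off _ _ (by omega)), legTrace_mul_left _ (scal_off _ _ (by omega)),
    legTrace_matD hR, mul_one, h.rMatrix_right.mul_inv, legTrace_comm _ _ (by omega),
    legTrace_matD hR]

omit h hR in
-- The slicing argument uses a leg to the left and hence starts at leg `1`. Reading its conclusion
-- as an identity of complex matrices removes this restriction and allows coefficients in `A`.
lemma legTrace_conj_eUnit_of [NeZero N] {G G' : Op N 2 ℂ} {D : Matrix (Fin N) (Fin N) ℂ}
    (hG : ∀ Y : Matrix (Fin N) (Fin N) ℂ, legTrace D (1 + 1)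
        (scal ℂ 1 G * leg 1 (Y.map (algebraMap ℂ ℂ)) * scal ℂ 1 G') =
      legTrace D 1 (leg 1 (Y.map (algebraMap ℂ ℂ)))) (n : ℕ) (s t : Fin N) :
    legTrace D (n + 1) (scal A n G * eUnit n s t * scal A n G') = D t s • 1 := by
  have key := hG (Matrix.single s t 1)
  have e1 : leg 1 ((Matrix.single s t (1 : ℂ)).map (algebraMap ℂ ℂ)) =
      (eUnit 1 s t : LegOp N ℂ) := by
    rw [← leg_single]
    congr 1
  rw [e1, legTrace_eUnit, eUnit_eq_scal, ← map_mul, ← map_mul, legTrace_scal_right] at key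
  have key2 : tailTrace (s := 1) D (G * place 2 0 (oneStrand (Matrix.single s t 1)) * G') =
      D t s • 1 := by
    apply leg_injective 1
    refine Eq.trans ?_ (key.trans ?_)
    · congr 1
    · exact (leg_map_smul_one 1 (D t s)).symm
  rw [eUnit_eq_scal, ← map_mul, ← map_mul, legTrace_scal_right, key2, leg_map_smul_one]

omit h hR in
-- Any operator is a combination of matrix units on leg `n` with coefficients off that leg;
-- coefficients off both legs pass through the trace and through `G'`, so matrix units decide the
-- matter.
lemma legTrace_conj_of {G G' : Op N 2 ℂ} {D : Matrix (Fin N) (Fin N) ℂ} {n : ℕ}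
    (hG : ∀ s t, legTrace D (n + 1) (scal A n G * eUnit n s t * scal A n G') = D t s • 1)
    {Z : LegOp N A} (hZ : Off (n + 1) Z) :
    legTrace D (n + 1) (scal A n G * Z * scal A n G') = legTrace D n Z := by
  have exp : Z = ∑ s, ∑ t, eUnit n s t * (fun s t => ∑ p, eUnit n p s * Z * eUnit n t p) s t := by
    have exp : Z = ∑ s, ∑ t, eUnit n s t * ∑ p, eUnit n p s * Z * eUnit n t p := by
      simp only [Finset.mul_sum, ← mul_assoc, eUnit_mul]
      have : ∀ s t : Fin N, ∑ p, (if t = p then (eUnit n s s : LegOp N A) else 0) * Z * eUnit n t p =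
          eUnit n s s * Z * eUnit n t t := fun s t => by
        rw [Finset.sum_eq_single t (fun p _ hp => by simp [Ne.symm hp]) (by simp)]
        simp
      simp only [this, ← Finset.mul_sum, eUnit_sum, mul_one, ← Finset.sum_mul, one_mul]
    exact exp
  have off1 : ∀ s t : Fin N, Off n ((fun s t => ∑ p, eUnit n p s * Z * eUnit n t p) s t) := fun s t => by
    have := legTrace_off_self (Matrix.single t s 1) n Z
    rw [legTrace_def] at this
    convert this using 2 with p
    rw [Finset.sum_eq_single t (fun w _ hw => ?_) (by simp),
      Finset.sum_eq_single s (fun w _ hw => ?_) (by simp)]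
    · simp
    · simp [Ne.symm hw]
    · exact Finset.sum_eq_zero fun x _ => by simp [Ne.symm hw]
  have off2 : ∀ s t : Fin N, Off (n + 1) ((fun s t => ∑ p, eUnit n p s * Z * eUnit n t p) s t) :=
    fun s t =>
    Off.sum _ _ fun p _ => ((eUnit_off (by omega) _ _).mul hZ).mul (eUnit_off (by omega) _ _)
  generalize (fun s t => ∑ p, eUnit n p s * Z * eUnit n t p) = y at exp off1 off2
  rw [exp]
  simp only [Finset.mul_sum, Finset.sum_mul, map_sum]
  refine Finset.sum_congr rfl fun s _ => Finset.sum_congr rfl fun t _ => ?_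
  have hc : scal A n G' * y s t = y s t * scal A n G' :=
    (commute_scal_of_off (fun m h1 h2 => by
      obtain rfl | rfl : m = n ∨ m = n + 1 := by omega
      · exact off1 s t
      · exact off2 s t) G').eq
  rw [mul_assoc, mul_assoc, ← hc, ← mul_assoc, ← mul_assoc, legTrace_mul_right _ (off2 s t), hG,
    legTrace_mul_right _ (off1 s t), legTrace_eUnit]

lemma IsCompatiblePair.legTrace_conj [NeZero N] {n : ℕ} {Z : LegOp N A} (hZ : Off (n + 1) Z) :
    legTrace (matD R) (n + 1) (scal A n F * Z * scal A n F⁻¹) = legTrace (matD R) n Z :=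
  legTrace_conj_of (legTrace_conj_eUnit_of (fun Y => h.legTrace_conj_leg hR 0 Y) n) hZ

lemma IsCompatiblePair.legTrace_conj' [NeZero N] {n : ℕ} {Z : LegOp N A} (hZ : Off (n + 1) Z) :
    legTrace (matD R) (n + 1) (scal A n F⁻¹ * Z * scal A n F) = legTrace (matD R) n Z :=
  legTrace_conj_of (legTrace_conj_eUnit_of (fun Y => h.legTrace_conj_leg' hR 0 Y) n) hZ

end Conj

end

/-! ### Cyclicity of the R-trace -/

section

variable {N : ℕ} {A : Type*} [Ring A] [Algebra ℂ A]

/-- `D ⊗ D`. -/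
def tensorSq (D : Matrix (Fin N) (Fin N) ℂ) : Op N 2 ℂ :=
  Matrix.of fun a b => D (a 0) (b 0) * D (a 1) (b 1)

lemma sum_comm_two {ι κ κ' B : Type*} [Fintype ι] [Fintype κ] [Fintype κ'] [AddCommMonoid B]
    (f : ι → κ → κ' → B) : ∑ x, ∑ a, ∑ t, f x a t = ∑ a, ∑ t, ∑ x, f x a t := by
  rw [Finset.sum_comm]
  exact Finset.sum_congr rfl fun a _ => Finset.sum_comm

lemma sum_comm_three_two {ι B : Type*} [Fintype ι] [AddCommMonoid B]
    (f : ι → ι → ι → ι → ι → B) :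
    ∑ x, ∑ u, ∑ y, ∑ a, ∑ t, f x u y a t = ∑ a, ∑ t, ∑ x, ∑ u, ∑ y, f x u y a t :=
  (Finset.sum_congr rfl fun _ _ => (Finset.sum_congr rfl fun _ _ => sum_comm_two _).trans
    (sum_comm_two _)).trans (sum_comm_two _)

lemma sum_comm_two_two {ι B : Type*} [Fintype ι] [AddCommMonoid B]
    (f : ι → ι → ι → ι → B) :
    ∑ x, ∑ u, ∑ a, ∑ t, f x u a t = ∑ a, ∑ t, ∑ x, ∑ u, f x u a t :=
  (Finset.sum_congr rfl fun _ _ => sum_comm_two _).trans (sum_comm_two _)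

omit [Algebra ℂ A] in
lemma op_two_mul_apply (X Y : Op N 2 A) (a b : Fin 2 → Fin N) :
    (X * Y) a b = ∑ x, ∑ y, X a ![x, y] * Y ![x, y] b := by
  rw [Matrix.mul_apply, ← (finTwoArrowEquiv (Fin N)).symm.sum_comp, Fintype.sum_prod_type]
  rfl

omit [Algebra ℂ A] in
lemma place_two_leg_apply (Y : Matrix (Fin N) (Fin N) A) (a b c d : Fin N) :
    place 2 0 (oneStrand Y) ![a, b] ![c, d] = if b = d then Y a c else 0 := by
  simp only [place, Matrix.of_apply, oneStrand, Matrix.submatrix_apply]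
  rw [dif_pos (by norm_num)]
  refine if_congr ?_ (by simp) rfl
  constructor
  · intro h; simpa using h 1 (by norm_num)
  · intro h s hs
    fin_cases s
    · simp at hs
    · simpa using h

lemma tailTrace_conj_single_apply (D : Matrix (Fin N) (Fin N) ℂ) (G G' : Op N 2 ℂ)
    (s t a a' : Fin N) :
    tailTrace (s := 1) D (G * place 2 0 (oneStrand (Matrix.single s t 1)) * G') a a' =
      ∑ p, ∑ u, ∑ y, D p u * (G ![a, u] ![s, y] * G' ![t, y] ![a', p]) := by
  rw [tailTrace_two]
  refine Finset.sum_congr rfl fun p _ => Finset.sum_congr rfl fun u _ => ?_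
  rw [← Finset.mul_sum]
  congr 1
  rw [op_two_mul_apply]
  simp only [op_two_mul_apply, place_two_leg_apply]
  rw [Finset.sum_eq_single t (fun x _ hx => ?_) (by simp)]
  · refine Finset.sum_congr rfl fun y _ => ?_
    congr 1
    rw [Finset.sum_eq_single s (fun x _ hx => ?_) (by simp),
      Finset.sum_eq_single y (fun x _ hx => ?_) (by simp)]
    · simp
    · simp [hx]
    · exact Finset.sum_eq_zero fun z _ => by simp [hx.symm]
  · refine Finset.sum_eq_zero fun z _ => ?_
    rw [Finset.sum_eq_zero, zero_mul]
    intro w _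
    refine Finset.sum_eq_zero fun v _ => ?_
    simp [hx.symm]

section
variable {R F : Op N 2 ℂ} (h : IsRMatrix R) (hR : SkewInvertible R) [NeZero N]

lemma tailTrace_conj_of {G G' : Op N 2 ℂ} {D : Matrix (Fin N) (Fin N) ℂ} {s t : Fin N}
    (hG : legTrace D (0 + 1) (scal ℂ 0 G * eUnit 0 s t * scal ℂ 0 G') = D t s • 1) (a a' : Fin N) :
    ∑ p, ∑ u, ∑ y, D p u * (G ![a, u] ![s, y] * G' ![t, y] ![a', p]) =
      if a = a' then D t s else 0 := by
  rw [eUnit_eq_scal, ← map_mul, ← map_mul, legTrace_scal_right, ← leg_map_smul_one 0] at hG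
  have := congrFun (congrFun (leg_injective 0 hG) a) a'
  simp only [Matrix.map_apply, tailTrace_conj_single_apply, Matrix.smul_apply,
    Matrix.one_apply] at this
  simpa using this

include h hR

/-- `D₁ R₂₁⁻¹ = Ψ₁₂ D₂`. -/
lemma IsRMatrix.matD_mul_inv (a s p p' : Fin N) :
    ∑ u, matD R p u * R⁻¹ ![a, u] ![s, p'] = ∑ t, skewInv R ![p, a] ![p', t] * matD R t s := by
  have h1 : ∀ t a', ∑ p, ∑ u, ∑ y, matD R p u * (R⁻¹ ![a, u] ![s, y] * R ![t, y] ![a', p]) =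
      if a = a' then matD R t s else 0 := fun t a' =>
    tailTrace_conj_of (by
      have := h.compatible_self.legTrace_conj' (A := ℂ) hR (n := 0)
        (eUnit_off (m := 0 + 1) (n := 0) (by norm_num) s t)
      rw [this, legTrace_eUnit]) a a'
  have h2 : ∀ x y, ∑ a', ∑ t, skewInv R ![p, a'] ![p', t] * R ![t, y] ![a', x] =
      if p = x ∧ y = p' then 1 else 0 := fun x y => hR.isSkewInverse.left p y p' x
  calc ∑ u, matD R p u * R⁻¹ ![a, u] ![s, p']
      = ∑ x, ∑ u, ∑ y, matD R x u * R⁻¹ ![a, u] ![s, y] * (if p = x ∧ y = p' then 1 else 0) := by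
        symm
        rw [Finset.sum_eq_single p (fun x _ hx => by simp [Ne.symm hx]) (by simp)]
        refine Finset.sum_congr rfl fun u _ => ?_
        rw [Finset.sum_eq_single p' (fun x _ hx => by simp [hx]) (by simp)]
        simp
    _ = ∑ x, ∑ u, ∑ y, ∑ a', ∑ t, matD R x u * R⁻¹ ![a, u] ![s, y] *
          (skewInv R ![p, a'] ![p', t] * R ![t, y] ![a', x]) := by
        simp only [← h2, Finset.mul_sum]
    _ = ∑ a', ∑ t, ∑ x, ∑ u, ∑ y, matD R x u * R⁻¹ ![a, u] ![s, y] *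
          (skewInv R ![p, a'] ![p', t] * R ![t, y] ![a', x]) := sum_comm_three_two _
    _ = ∑ a', ∑ t, skewInv R ![p, a'] ![p', t] * (if a = a' then matD R t s else 0) := by
        refine Finset.sum_congr rfl fun a' _ => Finset.sum_congr rfl fun t _ => ?_
        rw [← h1, Finset.mul_sum]
        refine Finset.sum_congr rfl fun x _ => ?_
        rw [Finset.mul_sum]
        refine Finset.sum_congr rfl fun u _ => ?_
        rw [Finset.mul_sum]
        exact Finset.sum_congr rfl fun y _ => by ring
    _ = _ := by
        rw [Finset.sum_eq_single a (fun x _ hx => by simp [Ne.symm hx]) (by simp)]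
        simp

/-- `R₂₁⁻¹ D₁ = D₂ Ψ₁₂`. -/
lemma IsRMatrix.inv_mul_matD (t p a' p' : Fin N) :
    ∑ w, R⁻¹ ![t, p] ![a', w] * matD R w p' = ∑ s, matD R t s * skewInv R ![p, s] ![p', a'] := by
  have h1 : ∀ a s, ∑ x, ∑ u, ∑ y, matD R x u * (R ![a, u] ![s, y] * R⁻¹ ![t, y] ![a', x]) =
      if a = a' then matD R t s else 0 := fun a s =>
    tailTrace_conj_of (by
      have := h.compatible_self.legTrace_conj (A := ℂ) hR (n := 0)
        (eUnit_off (m := 0 + 1) (n := 0) (by norm_num) s t)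
      rw [this, legTrace_eUnit]) a a'
  have h2 : ∀ u y, ∑ s, ∑ a, skewInv R ![p, s] ![p', a] * R ![a, u] ![s, y] =
      if p = y ∧ u = p' then 1 else 0 := fun u y => hR.isSkewInverse.left p u p' y
  calc ∑ w, R⁻¹ ![t, p] ![a', w] * matD R w p'
      = ∑ x, ∑ u, ∑ y, matD R x u * R⁻¹ ![t, y] ![a', x] * (if p = y ∧ u = p' then 1 else 0) := by
        refine Finset.sum_congr rfl fun x _ => ?_
        symm
        rw [Finset.sum_eq_single p' (fun x _ hx => by simp [hx]) (by simp),
          Finset.sum_eq_single p (fun x _ hx => by simp [Ne.symm hx]) (by simp)]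
        simp [mul_comm]
    _ = ∑ x, ∑ u, ∑ y, ∑ s, ∑ a, matD R x u * R⁻¹ ![t, y] ![a', x] *
          (skewInv R ![p, s] ![p', a] * R ![a, u] ![s, y]) := by
        simp only [← h2, Finset.mul_sum]
    _ = ∑ s, ∑ a, ∑ x, ∑ u, ∑ y, matD R x u * R⁻¹ ![t, y] ![a', x] *
          (skewInv R ![p, s] ![p', a] * R ![a, u] ![s, y]) := sum_comm_three_two _
    _ = ∑ s, ∑ a, skewInv R ![p, s] ![p', a] * (if a = a' then matD R t s else 0) := by
        refine Finset.sum_congr rfl fun s _ => Finset.sum_congr rfl fun a _ => ?_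
        rw [← h1, Finset.mul_sum]
        refine Finset.sum_congr rfl fun x _ => ?_
        rw [Finset.mul_sum]
        refine Finset.sum_congr rfl fun u _ => ?_
        rw [Finset.mul_sum]
        exact Finset.sum_congr rfl fun y _ => by ring
    _ = _ := by
        refine Finset.sum_congr rfl fun s _ => ?_
        rw [Finset.sum_eq_single a' (fun x _ hx => by simp [hx]) (by simp)]
        simp [mul_comm]

/-- The two preceding identities evaluate `D₁ R₂₁⁻¹` and `R₂₁⁻¹ D₁` through the same skew inverse.
Multiplying each by the missing factor `D` shows that `D ⊗ D` commutes with `R⁻¹`, and therefore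
with `R`. -/
lemma IsRMatrix.tensorSq_commute : Commute (tensorSq (matD R)) R := by
  have key : tensorSq (matD R) * R⁻¹ = R⁻¹ * tensorSq (matD R) := by
    ext a b
    obtain ⟨x, p, rfl⟩ : ∃ x p, a = ![x, p] := ⟨a 0, a 1, by funext t; fin_cases t <;> rfl⟩
    obtain ⟨s, p', rfl⟩ : ∃ x p, b = ![x, p] := ⟨b 0, b 1, by funext t; fin_cases t <;> rfl⟩
    simp only [op_two_mul_apply, tensorSq, Matrix.of_apply, Matrix.cons_val_zero,
      Matrix.cons_val_one]
    calc ∑ a, ∑ u, matD R x a * matD R p u * R⁻¹ ![a, u] ![s, p']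
        = ∑ a, ∑ t, matD R x a * (skewInv R ![p, a] ![p', t] * matD R t s) := by
          refine Finset.sum_congr rfl fun a _ => ?_
          simp only [mul_assoc, ← Finset.mul_sum]
          rw [h.matD_mul_inv hR]
      _ = ∑ t, ∑ a, matD R x a * (skewInv R ![p, a] ![p', t] * matD R t s) := Finset.sum_comm
      _ = ∑ t, (∑ a, matD R x a * skewInv R ![p, a] ![p', t]) * matD R t s := by
          simp only [Finset.sum_mul, mul_assoc]
      _ = ∑ t, (∑ w, R⁻¹ ![x, p] ![t, w] * matD R w p') * matD R t s := by
          simp only [h.inv_mul_matD hR]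
      _ = _ := by
          refine Finset.sum_congr rfl fun t _ => ?_
          rw [Finset.sum_mul]
          exact Finset.sum_congr rfl fun w _ => by ring
  have hu := (Matrix.isUnit_iff_isUnit_det _).1 h.isUnit
  calc tensorSq (matD R) * R = R * R⁻¹ * tensorSq (matD R) * R := by
        rw [Matrix.mul_nonsing_inv _ hu, one_mul]
    _ = R * (tensorSq (matD R) * R⁻¹) * R := by rw [key]; simp only [mul_assoc]
    _ = R * tensorSq (matD R) := by
        rw [mul_assoc, mul_assoc, Matrix.nonsing_inv_mul _ hu, mul_one]
end

lemma legTrace_eq_one (D : Matrix (Fin N) (Fin N) ℂ) (n : ℕ) (f : LegOp N A) :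
    legTrace D n f = legTrace 1 n (scal A n (oneStrand D) * f) := by
  rw [legTrace_def, legTrace_def]
  refine Finset.sum_congr rfl fun s _ => Finset.sum_congr rfl fun t _ => ?_
  symm
  rw [Finset.sum_eq_single t (fun u _ hu => by simp [Ne.symm hu]) (by simp),
    Matrix.one_apply_eq, one_smul, ← mul_assoc, ← leg_map, leg_eq_sum, Finset.mul_sum]
  rw [Finset.sum_eq_single t (fun u _ hu => ?_) (by simp)]
  · rw [Finset.mul_sum, Finset.sum_mul, Finset.sum_mul]
    refine Finset.sum_congr rfl fun u _ => ?_
    rw [Matrix.map_apply, AlgHom.commutes, ← Algebra.smul_def, mul_smul_comm, eUnit_mul,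
      if_pos rfl, smul_mul_assoc, smul_mul_assoc]
  · rw [Finset.mul_sum]
    refine Finset.sum_eq_zero fun w _ => ?_
    rw [Matrix.map_apply, AlgHom.commutes, ← Algebra.smul_def, mul_smul_comm, eUnit_mul,
      if_neg (Ne.symm hu), smul_zero]

lemma legTrace_one_cyclic (n : ℕ) (a b : Fin N) (f : LegOp N A) :
    legTrace 1 n (eUnit n a b * f) = legTrace 1 n (f * eUnit n a b) := by
  have h : ∀ g : LegOp N A, legTrace 1 n g = ∑ s, ∑ t, eUnit n s t * g * eUnit n t s := fun g => by
    rw [legTrace_def]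
    refine Finset.sum_congr rfl fun s _ => Finset.sum_congr rfl fun t _ => ?_
    rw [Finset.sum_eq_single t (fun u _ hu => by simp [Ne.symm hu]) (by simp),
      Matrix.one_apply_eq, one_smul]
  rw [h, h]
  refine Finset.sum_congr rfl fun s _ => ?_
  rw [Finset.sum_eq_single a (fun u _ hu => by simp [← mul_assoc, eUnit_mul, hu]) (by simp)]
  rw [Finset.sum_eq_single b (fun u _ hu => by simp [mul_assoc, eUnit_mul, hu.symm]) (by simp)]
  rw [← mul_assoc, eUnit_mul, if_pos rfl, ← mul_assoc, mul_assoc (eUnit n s b * f), eUnit_mul,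
    if_pos rfl]

lemma legTrace_one_two_cyclic (n : ℕ) (X : Op N 2 ℂ) (f : LegOp N A) :
    legTrace 1 n (legTrace 1 (n + 1) (scal A n X * f)) =
      legTrace 1 n (legTrace 1 (n + 1) (f * scal A n X)) := by
  rw [scal_two_eq_sum]
  simp only [Finset.sum_mul, Finset.mul_sum, map_sum, smul_mul_assoc, mul_smul_comm, map_smul]
  refine Finset.sum_congr rfl fun b _ => Finset.sum_congr rfl fun d _ =>
    Finset.sum_congr rfl fun a _ => Finset.sum_congr rfl fun c _ => ?_
  congr 1
  rw [mul_assoc, legTrace_mul_left _ (eUnit_off (by omega) _ _), legTrace_one_cyclic,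
    legTrace_one_cyclic, ← legTrace_mul_right _ (eUnit_off (by omega) _ _), mul_assoc,
    (eUnit_off (by omega) a c b d : Commute (eUnit (n + 1) b d) _).eq]

/-- Once the weights are absorbed into a factor `D ⊗ D`, the double trace is the ordinary one, which
is cyclic; only commutation of `X` with `D ⊗ D` is needed. -/
lemma legTrace_two_cyclic {R : Op N 2 ℂ} (n : ℕ) {X : Op N 2 ℂ} (hX : Commute (tensorSq (matD R)) X)
    (f : LegOp N A) :
    legTrace (matD R) n (legTrace (matD R) (n + 1) (scal A n X * f)) =
      legTrace (matD R) n (legTrace (matD R) (n + 1) (f * scal A n X)) := by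
  have e : ∀ g : LegOp N A, legTrace (matD R) n (legTrace (matD R) (n + 1) g) =
      legTrace 1 n (legTrace 1 (n + 1) (scal A n (tensorSq (matD R)) * g)) := fun g => by
    rw [legTrace_eq_one, legTrace_eq_one _ (n + 1),
      ← legTrace_mul_left _ (scal_off _ _ (by omega)), ← mul_assoc]
    congr 3
    rw [scal_two_eq_sum, ← leg_map, ← leg_map, leg_eq_sum, leg_eq_sum]
    simp only [Matrix.map_apply, AlgHom.commutes, ← Algebra.smul_def, Finset.sum_mul,
      Finset.mul_sum, smul_mul_assoc, mul_smul_comm, tensorSq, Matrix.of_apply,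
      Matrix.cons_val_zero, Matrix.cons_val_one]
    refine Finset.sum_congr rfl fun b _ => Finset.sum_congr rfl fun d _ => ?_
    simp only [Finset.smul_sum, smul_smul]
    simp only [mul_comm]
  rw [e, e, ← mul_assoc, ← map_mul (scal A n), hX.eq, map_mul (scal A n), mul_assoc, legTrace_one_two_cyclic, mul_assoc]

section
variable {R F : Op N 2 ℂ} (h : IsRMatrix R) (hR : SkewInvertible R) [NeZero N]
include h hR

/-- R-traces over several legs are cyclic for braid generators. -/
lemma IsRMatrix.iterTrace_cyclic {a len j : ℕ} (h1 : a ≤ j) (h2 : j + 2 ≤ a + len)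
    (f : LegOp N A) :
    iterTrace (matD R) a len (scal A j R * f) = iterTrace (matD R) a len (f * scal A j R) := by
  -- The traced legs split into those before `j`, the pair `j, j + 1`, and those after; `R_j` passes
  -- through the traces over the legs after the pair.
  obtain ⟨m, rfl⟩ := Nat.exists_eq_add_of_le h1
  obtain ⟨l, rfl⟩ : ∃ l, len = m + 1 + 1 + l := ⟨len - (m + 2), by omega⟩
  rw [iterTrace_add, iterTrace_add _ _ _ l,
    iterTrace_mul_left _ fun p hp _ => scal_off _ _ (by omega),
    iterTrace_mul_right _ fun p hp _ => scal_off _ _ (by omega)]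
  rw [iterTrace_succ, iterTrace_succ, iterTrace_succ _ _ (m + 1), iterTrace_succ _ _ m,
    ← add_assoc, legTrace_two_cyclic _ (h.tensorSq_commute hR)]

end

end

/-! ### Birman-Murakami-Wenzl relations -/

section

variable {N : ℕ} {A : Type*} [Ring A] [Algebra ℂ A]

section BMW

variable {W : Type*} [Ring W] [Algebra ℂ W]

/-- One generator `r`, with inverse `r'` and associated contractor `k`. -/
structure BMWGen (q μ : ℂ) (r r' k : W) : Prop where
  mul_inv : r * r' = 1
  inv_mul : r' * r = 1
  skein : r - r' = (q - q⁻¹) • (1 - k)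
  rk : r * k = μ • k

/-- Two neighbouring generators. -/
structure BMWPair (q μ : ℂ) (r r' k s s' l : W) : Prop where
  fst : BMWGen q μ r r' k
  snd : BMWGen q μ s s' l
  braid : r * s * r = s * r * s
  lk : l * k = r * s * k
  lk' : l * k = r' * s' * k
  klk : k * l * k = k

/-- The parameters of the algebra are generic enough. -/
structure BMWParam (q μ : ℂ) : Prop where
  q_ne : q ≠ 0
  lam_ne : q - q⁻¹ ≠ 0
  mu_ne : μ ≠ 0

/-- The value of the loop divided by `μ`-framing: `k² = η k`. -/
def etaVal (q μ : ℂ) : ℂ := (q - μ) * (q⁻¹ + μ) / (μ * (q - q⁻¹))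

variable {q μ : ℂ} {r r' k s s' l : W}

lemma BMWParam.etaVal_eq (p : BMWParam q μ) : (q - q⁻¹) * etaVal q μ = (q - q⁻¹) - (μ - μ⁻¹) := by
  have h1 := p.q_ne; have h2 := p.lam_ne; have h3 := p.mu_ne
  rw [etaVal, mul_div_assoc', mul_comm μ, mul_div_mul_left _ _ h2]
  field_simp
  ring

namespace BMWGen

lemma k_eq (p : BMWParam q μ) (h : BMWGen q μ r r' k) : k = 1 - (q - q⁻¹)⁻¹ • (r - r') := by
  rw [h.skein, smul_smul, inv_mul_cancel₀ p.lam_ne, one_smul, sub_sub_cancel]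

lemma inv_eq (h : BMWGen q μ r r' k) : r' = r - (q - q⁻¹) • (1 - k) := by
  rw [← h.skein, sub_sub_cancel]

lemma r_eq (h : BMWGen q μ r r' k) : r = r' + (q - q⁻¹) • (1 - k) := by
  rw [← h.skein, add_sub_cancel]

lemma r'_comm {x : W} (h : BMWGen q μ r r' k) (hx : Commute r x) : Commute r' x := by
  calc r' * x = r' * (x * r) * r' := by rw [mul_assoc, mul_assoc, h.mul_inv, mul_one]
    _ = x * r' := by rw [← hx.eq, ← mul_assoc, h.inv_mul, one_mul]

lemma k_comm (p : BMWParam q μ) {x : W} (h : BMWGen q μ r r' k) (hx : Commute r x) :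
    Commute k x := by
  rw [h.k_eq p]
  exact (Commute.one_left x).sub_left ((hx.sub_left (h.r'_comm hx)).smul_left _)

lemma kr (p : BMWParam q μ) (h : BMWGen q μ r r' k) : k * r = μ • k := by
  rw [(h.k_comm p (Commute.refl r)).eq, h.rk]

lemma r'k (p : BMWParam q μ) (h : BMWGen q μ r r' k) : r' * k = μ⁻¹ • k := by
  have : μ • (r' * k) = k := by rw [← mul_smul_comm, ← h.rk, ← mul_assoc, h.inv_mul, one_mul]
  rw [← this, smul_smul, inv_mul_cancel₀ p.mu_ne, one_smul, this]

lemma kk (p : BMWParam q μ) (h : BMWGen q μ r r' k) : k * k = etaVal q μ • k := by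
  have h1 : (r - r') * k = (q - q⁻¹) • (k - k * k) := by
    rw [h.skein, smul_mul_assoc, sub_mul, one_mul]
  rw [sub_mul, h.rk, h.r'k p, ← sub_smul] at h1
  have h2 : (q - q⁻¹) • (k * k) = (q - q⁻¹) • (etaVal q μ • k) := by
    rw [smul_smul, p.etaVal_eq, sub_smul _ (μ - μ⁻¹), h1, smul_sub, sub_sub_cancel]
  have := congrArg (fun z => (q - q⁻¹)⁻¹ • z) h2
  simpa only [smul_smul, ← mul_assoc, inv_mul_cancel₀ p.lam_ne, one_smul, one_mul] using this

lemma rr (h : BMWGen q μ r r' k) :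
    r * r = 1 + (q - q⁻¹) • r - ((q - q⁻¹) * μ) • k := by
  nth_rw 2 [h.r_eq]
  rw [mul_add, h.mul_inv, mul_smul_comm, mul_sub, mul_one, h.rk, smul_sub, smul_smul, add_sub]

lemma op (p : BMWParam q μ) (h : BMWGen q μ r r' k) :
    BMWGen q μ (MulOpposite.op r) (MulOpposite.op r') (MulOpposite.op k) where
  mul_inv := by rw [← MulOpposite.op_mul, h.inv_mul, MulOpposite.op_one]
  inv_mul := by rw [← MulOpposite.op_mul, h.mul_inv, MulOpposite.op_one]
  skein := by rw [← MulOpposite.op_sub, h.skein]; rfl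
  rk := by rw [← MulOpposite.op_mul, h.kr p]; rfl

end BMWGen

namespace BMWPair

/-- `r s r' ... `: `r s` intertwines `r` and `s`. -/
lemma rs_k (p : BMWParam q μ) (h : BMWPair q μ r r' k s s' l) : r * s * k = l * (r * s) := by
  have e : r * s * r = s * (r * s) := by rw [h.braid, mul_assoc]
  have e' : r * s * r' = s' * (r * s) := by
    calc r * s * r' = s' * (s * (r * s)) * r' := by
          rw [← mul_assoc s', h.snd.inv_mul, one_mul]
      _ = s' * (r * s) := by
          rw [← e]; simp only [mul_assoc]; rw [h.fst.mul_inv, mul_one]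
  rw [h.fst.k_eq p, h.snd.k_eq p, mul_sub, sub_mul, mul_smul_comm, smul_mul_assoc, mul_sub, sub_mul,
    e, e', mul_one, one_mul]

lemma sr_l (p : BMWParam q μ) (h : BMWPair q μ r r' k s s' l) : s * r * l = k * (s * r) := by
  have e : s * r * s = r * (s * r) := by rw [← h.braid, mul_assoc]
  have e' : s * r * s' = r' * (s * r) := by
    calc s * r * s' = r' * (r * (s * r)) * s' := by
          rw [← mul_assoc r', h.fst.inv_mul, one_mul]
      _ = r' * (s * r) := by
          rw [← e]; simp only [mul_assoc]; rw [h.snd.mul_inv, mul_one]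
  rw [h.fst.k_eq p, h.snd.k_eq p, mul_sub, sub_mul, mul_smul_comm, smul_mul_assoc, mul_sub, sub_mul,
    e, e', mul_one, one_mul]

lemma inv_braid (h : BMWPair q μ r r' k s s' l) : r' * s' * r' = s' * r' * s' := by
  have e1 : (r' * s' * r') * (r * s * r) = 1 := by
    calc _ = r' * (s' * (r' * r) * s) * r := by simp only [mul_assoc]
      _ = 1 := by rw [h.fst.inv_mul, mul_one, h.snd.inv_mul, mul_one, h.fst.inv_mul]
  have e2 : (s * r * s) * (s' * r' * s') = 1 := by
    calc _ = s * (r * (s * s') * r') * s' := by simp only [mul_assoc]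
      _ = 1 := by rw [h.snd.mul_inv, mul_one, h.fst.mul_inv, mul_one, h.snd.mul_inv]
  rw [h.braid] at e1
  exact left_inv_eq_right_inv e1 e2

/-- The same relations with the inverse generators. -/
lemma neg (p : BMWParam q μ) (h : BMWPair q μ r r' k s s' l) :
    BMWPair q⁻¹ μ⁻¹ r' r k s' s l where
  fst := ⟨h.fst.inv_mul, h.fst.mul_inv, by
    rw [inv_inv, ← neg_sub r r', h.fst.skein, ← neg_smul, neg_sub], h.fst.r'k p⟩
  snd := ⟨h.snd.inv_mul, h.snd.mul_inv, by
    rw [inv_inv, ← neg_sub s s', h.snd.skein, ← neg_smul, neg_sub], h.snd.r'k p⟩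
  braid := h.inv_braid
  lk := h.lk'
  lk' := h.lk
  klk := h.klk

end BMWPair

lemma BMWParam.inv (p : BMWParam q μ) : BMWParam q⁻¹ μ⁻¹ :=
  ⟨inv_ne_zero p.q_ne, by rw [inv_inv, ← neg_sub]; exact neg_ne_zero.2 p.lam_ne,
    inv_ne_zero p.mu_ne⟩

namespace BMWPair

/-- The half twist `r s r` exchanges the two strands' contractors. Together with `garside_l` and
cancellation it converts each relation of a pair into its mirror image. -/
lemma garside_k (p : BMWParam q μ) (h : BMWPair q μ r r' k s s' l) :
    (r * s * r) * k = l * (r * s * r) := by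
  have hc : s * l = l * s := (h.snd.k_comm p (Commute.refl s)).eq.symm
  rw [h.braid, mul_assoc s, mul_assoc s, h.rs_k p, ← mul_assoc, hc, mul_assoc]

lemma garside_l (p : BMWParam q μ) (h : BMWPair q μ r r' k s s' l) :
    (r * s * r) * l = k * (r * s * r) := by
  have hc : r * k = k * r := (h.fst.k_comm p (Commute.refl r)).eq.symm
  rw [mul_assoc r, mul_assoc r, h.sr_l p, ← mul_assoc, hc, mul_assoc]

lemma garside_cancel (h : BMWPair q μ r r' k s s' l) {x y : W}
    (e : x * (r * s * r) = y * (r * s * r)) : x = y := by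
  have := congrArg (· * (r' * s' * r')) e
  have e1 : (r * s * r) * (r' * s' * r') = 1 := by
    calc _ = r * (s * (r * r') * s') * r' := by simp only [mul_assoc]
      _ = 1 := by rw [h.fst.mul_inv, mul_one, h.snd.mul_inv, mul_one, h.fst.mul_inv]
  simpa only [mul_assoc x, mul_assoc y, e1, mul_one] using this

/-- Conjugate `l k = r s k` by the half twist, which interchanges `r` with `s` and `k` with `l`. -/
lemma kl (p : BMWParam q μ) (h : BMWPair q μ r r' k s s' l) : k * l = s * r * l := by
  apply h.garside_cancel
  calc k * l * (r * s * r) = (r * s * r) * (l * k) := by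
        rw [mul_assoc k, ← h.garside_k p, ← mul_assoc, ← h.garside_l p, mul_assoc]
    _ = r * s * r * (r * s * k) := by rw [h.lk]
    _ = s * r * (s * r * s) * k := by rw [h.braid]; simp only [mul_assoc]
    _ = s * r * (r * s * r * k) := by rw [← h.braid]; simp only [mul_assoc]
    _ = s * r * l * (r * s * r) := by rw [h.garside_k p]; simp only [mul_assoc]

lemma lkl (p : BMWParam q μ) (h : BMWPair q μ r r' k s s' l) : l * k * l = l := by
  apply h.garside_cancel
  rw [mul_assoc _ l, ← h.garside_k p, mul_assoc l k, ← mul_assoc k, ← h.garside_l p,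
    mul_assoc _ l, ← mul_assoc l, ← h.garside_k p, mul_assoc, ← mul_assoc k, h.klk]

lemma symm (p : BMWParam q μ) (h : BMWPair q μ r r' k s s' l) : BMWPair q μ s s' l r r' k :=
  ⟨h.snd, h.fst, h.braid.symm, h.kl p, (h.neg p).kl p.inv, h.lkl p⟩

lemma op (p : BMWParam q μ) (h : BMWPair q μ r r' k s s' l) :
    BMWPair q μ (MulOpposite.op r) (MulOpposite.op r') (MulOpposite.op k) (MulOpposite.op s)
      (MulOpposite.op s') (MulOpposite.op l) where
  fst := h.fst.op p
  snd := h.snd.op p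
  braid := by simp only [← MulOpposite.op_mul, ← mul_assoc, h.braid]
  lk := by
    simp only [← MulOpposite.op_mul]
    rw [h.kl p, h.sr_l p]
  lk' := by
    simp only [← MulOpposite.op_mul]
    rw [(h.neg p).kl p.inv, (h.neg p).sr_l p.inv]
  klk := by simp only [← MulOpposite.op_mul, ← mul_assoc, h.klk]

lemma lk_eq (p : BMWParam q μ) (h : BMWPair q μ r r' k s s' l) : l * k = l * (r * s) := by
  rw [h.lk, h.rs_k p]

/-- `k = k l k = k (r s k)`, and `k r = μ k`. -/
lemma ksk (p : BMWParam q μ) (h : BMWPair q μ r r' k s s' l) : k * s * k = μ⁻¹ • k := by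
  have : k = μ • (k * s * k) := by
    conv_lhs => rw [← h.klk, mul_assoc, h.lk, mul_assoc r, ← mul_assoc k, h.fst.kr p]
    simp only [smul_mul_assoc, mul_assoc]
  conv_rhs => rw [this]
  rw [smul_smul, inv_mul_cancel₀ p.mu_ne, one_smul]

lemma r'lk (h : BMWPair q μ r r' k s s' l) : r' * (l * k) = s * k := by
  rw [h.lk, mul_assoc r, ← mul_assoc, h.fst.inv_mul, one_mul]

lemma rlk (h : BMWPair q μ r r' k s s' l) : r * (l * k) = s' * k := by
  rw [h.lk', mul_assoc r', ← mul_assoc, h.fst.mul_inv, one_mul]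

lemma lks' (p : BMWParam q μ) (h : BMWPair q μ r r' k s s' l) : l * k * s' = l * r := by
  rw [h.lk_eq p, mul_assoc l, mul_assoc r, h.snd.mul_inv, mul_one]

lemma lks (p : BMWParam q μ) (h : BMWPair q μ r r' k s s' l) : l * k * s = l * r' :=
  (h.neg p).lks' p.inv

end BMWPair
end BMW

/-! ### BMW relations for operators on legs -/

lemma IsBMWType.q_sub_ne {q μ : ℂ} {R : Op N 2 ℂ} (h : IsBMWType q μ R) : q - q⁻¹ ≠ 0 := by
  intro e
  have h0 := h.q_ne_zero
  have : (q - 1) * (q + 1) = 0 := by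
    have := congrArg (· * q) e
    simp only [sub_mul, inv_mul_cancel₀ h0, zero_mul] at this
    linear_combination this
  rcases mul_eq_zero.1 this with h1 | h1
  · exact h.q_ne_one (sub_eq_zero.1 h1)
  · exact h.q_ne_neg_one (eq_neg_of_add_eq_zero_left h1)

lemma IsBMWType.param {q μ : ℂ} {R : Op N 2 ℂ} (h : IsBMWType q μ R) : BMWParam q μ :=
  ⟨h.q_ne_zero, h.q_sub_ne, h.mu_ne_zero⟩

open Polynomial in
-- The third factor of the minimal polynomial annihilates the product of the other two, and that
-- product is a multiple of `K`.
lemma IsBMWType.mul_opK {q μ : ℂ} {R : Op N 2 ℂ} (h : IsBMWType q μ R) :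
    R * opK q μ R = μ • opK q μ R := by
  have e := minpoly.aeval ℂ R
  rw [h.minpoly_eq] at e
  simp only [map_mul, map_sub, map_add, aeval_X, aeval_C, Algebra.algebraMap_eq_smul_one] at e
  rw [opK, mul_smul_comm, smul_comm μ]
  congr 1
  have e2 : (R - q • 1) * (R + q⁻¹ • 1) * (R - μ • 1) =
      -(R * ((q • 1 - R) * (q⁻¹ • 1 + R)) - μ • ((q • 1 - R) * (q⁻¹ • 1 + R))) := by
    simp only [mul_sub, sub_mul, mul_add, add_mul, smul_mul_assoc, mul_smul_comm, one_mul, mul_one,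
      mul_assoc]
    module
  rw [e2, neg_eq_zero, sub_eq_zero] at e
  exact e

lemma IsBMWType.bmwGen_op {q μ : ℂ} {R : Op N 2 ℂ} (h : IsBMWType q μ R) :
    BMWGen q μ R R⁻¹ (opK q μ R) where
  mul_inv := Matrix.mul_nonsing_inv _ ((Matrix.isUnit_iff_isUnit_det _).1 h.rMatrix.isUnit)
  inv_mul := Matrix.nonsing_inv_mul _ ((Matrix.isUnit_iff_isUnit_det _).1 h.rMatrix.isUnit)
  rk := h.mul_opK
  skein := by
    have i1 : R⁻¹ * R = 1 :=
      Matrix.nonsing_inv_mul _ ((Matrix.isUnit_iff_isUnit_det _).1 h.rMatrix.isUnit)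
    -- Since `R K = μ K`, the quadratic expression `K` may be replaced by `μ R⁻¹ K`, which is linear
    -- in `1`, `R` and `R⁻¹`; this is the skein relation.
    have e : opK q μ R = μ • (R⁻¹ * opK q μ R) := by
      rw [← mul_smul_comm, ← h.mul_opK, ← mul_assoc, i1, one_mul]
    have h1 := h.q_ne_zero; have h2 := h.q_sub_ne; have h3 := h.mu_ne_zero
    rw [e]
    rw [opK, mul_smul_comm, smul_smul, ← mul_assoc R⁻¹, mul_sub, mul_smul_comm, mul_one, i1,
      smul_sub, smul_smul]
    have : (q - q⁻¹) * (μ * (μ⁻¹ * (q - q⁻¹)⁻¹)) = 1 := by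
      rw [mul_inv_cancel_left₀ h3, mul_inv_cancel₀ h2]
    rw [this, one_smul]
    simp only [mul_add, sub_mul, smul_mul_assoc, mul_smul_comm, mul_one, one_mul,
      i1]
    match_scalars <;> field_simp
    ring

lemma scal_place_zero (j : ℕ) (X : Op N 2 ℂ) : scal A j (place 3 0 X) = scal A j X :=
  scal_place j (by norm_num) X

lemma scal_place_one (j : ℕ) (X : Op N 2 ℂ) : scal A j (place 3 1 X) = scal A (j + 1) X :=
  scal_place j (by norm_num) X

section
variable {q μ : ℂ} {R : Op N 2 ℂ} (h : IsBMWType q μ R) (A)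
include h

lemma IsBMWType.gen (j : ℕ) : BMWGen q μ (scal A j R) (scal A j R⁻¹) (scal A j (opK q μ R)) where
  mul_inv := by rw [← map_mul, h.bmwGen_op.mul_inv, map_one]
  inv_mul := by rw [← map_mul, h.bmwGen_op.inv_mul, map_one]
  skein := by rw [← map_sub, h.bmwGen_op.skein, map_smul, map_sub, map_one]
  rk := by rw [← map_mul, h.bmwGen_op.rk, map_smul]

lemma IsBMWType.pair (j : ℕ) :
    BMWPair q μ (scal A j R) (scal A j R⁻¹) (scal A j (opK q μ R))
      (scal A (j + 1) R) (scal A (j + 1) R⁻¹) (scal A (j + 1) (opK q μ R)) where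
  fst := h.gen A j
  snd := h.gen A (j + 1)
  braid := by
    have := congrArg (scal A j) h.rMatrix.yangBaxter
    simpa only [map_mul, scal_place_zero, scal_place_one] using this
  lk := by
    have := congrArg (scal A j) h.rel_pos
    simpa only [map_mul, scal_place_zero, scal_place_one] using this
  lk' := by
    have := congrArg (scal A j) h.rel_neg
    simpa only [map_mul, scal_place_zero, scal_place_one] using this
  klk := by
    have := congrArg (scal A j) h.rel_KKK
    simpa only [map_mul, scal_place_zero, scal_place_one] using this

end

end

/-! ### Antisymmetrizers -/

section

variable {N : ℕ} {A : Type*} [Ring A] [Algebra ℂ A]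

section BMW

variable {W : Type*} [Ring W] [Algebra ℂ W]

/-- Baxterized generator. -/
def sigmaVal (q μ x : ℂ) (r k : W) : W :=
  1 + ((x - 1) / (q - q⁻¹)) • r + ((x - 1) / (q * μ⁻¹ * x + 1)) • k

/-- The antisymmetrizers built from a sequence of generators. -/
def asym (q μ : ℂ) (r k : ℕ → W) : ℕ → W
  | 0 => 1
  | 1 => 1
  | i + 2 => (q ^ (i + 1) / qNum q (i + 2)) •
      (asym q μ r k (i + 1) * sigmaVal q μ (q⁻¹ ^ (2 * (i + 1))) (r i) (k i) *
        asym q μ r k (i + 1))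

/-- A sequence of `n` generators satisfying the BMW relations. -/
structure BMWChain (q μ : ℂ) (n : ℕ) (r r' k : ℕ → W) : Prop where
  gen : ∀ j, j < n → BMWGen q μ (r j) (r' j) (k j)
  pair : ∀ j, j + 1 < n →
    BMWPair q μ (r j) (r' j) (k j) (r (j + 1)) (r' (j + 1)) (k (j + 1))
  comm : ∀ i j, i + 2 ≤ j → j < n → Commute (r i) (r j)

/-- Genericity of the parameters for the antisymmetrizers of order at most `n`. -/
structure AsymParam (q μ : ℂ) (n : ℕ) : Prop extends BMWParam q μ where
  qNum_ne : ∀ i, 1 ≤ i → i ≤ n → qNum q i ≠ 0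
  den_ne : ∀ i, 1 ≤ i → i < n → q * μ⁻¹ * q⁻¹ ^ (2 * i) + 1 ≠ 0
  den_ne' : q * μ⁻¹ * q ^ 2 + 1 ≠ 0
  one_add_ne : 1 + q * μ ≠ 0
  sq_add_ne : q ^ 2 + 1 ≠ 0

variable {q μ : ℂ} {r r' k s s' l : W}

lemma BMWParam.sq_sub_ne (p : BMWParam q μ) : q ^ 2 - 1 ≠ 0 := by
  intro h
  apply p.lam_ne
  have := p.q_ne
  field_simp
  simpa using h

lemma BMWParam.lam_eq (p : BMWParam q μ) : q - q⁻¹ = (q ^ 2 - 1) / q := by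
  have := p.q_ne
  field_simp

/-- An element killed by `σ(q²)` is antisymmetric. -/
lemma BMWGen.of_sigma_mul_eq_zero (p : BMWParam q μ) (h : BMWGen q μ r r' k)
    (d : q * μ⁻¹ * q ^ 2 + 1 ≠ 0) (h1 : 1 + q * μ ≠ 0) (h2 : q ^ 2 + 1 ≠ 0) {y : W}
    (hy : sigmaVal q μ (q ^ 2) r k * y = 0) : r * y = (-q⁻¹) • y ∧ k * y = 0 := by
  have q0 := p.q_ne; have m0 := p.mu_ne; have e := p.sq_sub_ne
  have d' : q ^ 3 + μ ≠ 0 := by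
    intro h; apply d; field_simp; linear_combination h
  have hq : (q ^ 2 - 1) / (q - q⁻¹) = q := by rw [p.lam_eq]; field_simp
  rw [sigmaVal, hq] at hy
  have hk : k * y = 0 := by
    have := congrArg (k * ·) hy
    simp only [mul_zero, ← mul_assoc, mul_add, mul_one, mul_smul_comm, h.kr p, h.kk p, smul_smul,
      add_mul, smul_mul_assoc] at this
    have e2 : k * y + (q * μ) • (k * y) +
        ((q ^ 2 - 1) / (q * μ⁻¹ * q ^ 2 + 1) * etaVal q μ) • (k * y) =
        ((1 + q * μ) * (q * (q ^ 2 + 1)) / (q ^ 3 + μ)) • (k * y) := by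
      rw [etaVal, p.lam_eq]; match_scalars; field_simp; ring
    rw [e2] at this
    exact (smul_eq_zero.1 this).resolve_left
      (div_ne_zero (mul_ne_zero h1 (mul_ne_zero q0 h2)) d')
  refine ⟨?_, hk⟩
  rw [add_mul, smul_mul_assoc _ k, hk, smul_zero, add_zero, add_mul, one_mul, smul_mul_assoc] at hy
  nth_rw 2 [eq_neg_of_add_eq_zero_left hy]
  rw [smul_neg, neg_smul, neg_neg, smul_smul, inv_mul_cancel₀ q0,
    one_smul]

/-- Unitarity of the Baxterized generator at inverse parameters, at the special point where the
scalar factor vanishes. It makes `σ(q⁻²)` antisymmetric. -/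
lemma BMWGen.sigma_mul_sigma (p : BMWParam q μ) (h : BMWGen q μ r r' k)
    (d : q * μ⁻¹ * q ^ 2 + 1 ≠ 0) (d1 : q * μ⁻¹ * q⁻¹ ^ 2 + 1 ≠ 0) :
    sigmaVal q μ (q ^ 2) r k * sigmaVal q μ (q⁻¹ ^ 2) r k = 0 := by
  have q0 := p.q_ne; have m0 := p.mu_ne; have e := p.sq_sub_ne
  have d' : q ^ 3 + μ ≠ 0 := by
    intro h; apply d; field_simp; linear_combination h
  have d1' : 1 + q * μ ≠ 0 := by
    intro h; apply d1; field_simp; linear_combination h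
  have e1 : (q ^ 2 - 1) / (q - q⁻¹) = q := by rw [p.lam_eq]; field_simp
  have e2 : (q⁻¹ ^ 2 - 1) / (q - q⁻¹) = - q⁻¹ := by rw [p.lam_eq]; field_simp; ring
  have e3 : (q ^ 2 - 1) / (q * μ⁻¹ * q ^ 2 + 1) = (q ^ 2 - 1) * μ / (q ^ 3 + μ) := by
    field_simp
  have e4 : (q⁻¹ ^ 2 - 1) / (q * μ⁻¹ * q⁻¹ ^ 2 + 1) = (1 - q ^ 2) * μ / (q * (1 + q * μ)) := by
    field_simp
  rw [sigmaVal, sigmaVal, e1, e2, e3, e4]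
  simp only [mul_add, add_mul, mul_one, one_mul, smul_mul_assoc, mul_smul_comm, h.rr, h.rk, h.kr p,
    h.kk p]
  rw [etaVal, p.lam_eq]
  match_scalars <;> field_simp <;> ring

/-- By the Yang–Baxter equation the product would end in `σ(q²)` of the first generator, which kills
`e`. The verification is direct: `f1`–`f11` reduce all words applied to `e` to a few basic ones,
whose coefficients cancel. -/
lemma BMWPair.sigma_sigma_sigma (p : BMWParam q μ) (h : BMWPair q μ r r' k s s' l) {x x' : ℂ}
    (hx : x' = x * q⁻¹ ^ 2)
    (d : q * μ⁻¹ * q ^ 2 + 1 ≠ 0) (d1 : q * μ⁻¹ * x + 1 ≠ 0) (d2 : q * μ⁻¹ * x' + 1 ≠ 0)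
    {e : W} (hr : r * e = (-q⁻¹) • e) (hk : k * e = 0) :
    sigmaVal q μ (q ^ 2) s l * (sigmaVal q μ x r k * (sigmaVal q μ x' s l * e)) = 0 := by
  have q0 := p.q_ne; have m0 := p.mu_ne; have e0 := p.sq_sub_ne
  subst hx
  have d' : q ^ 3 + μ ≠ 0 := by
    intro h; apply d; field_simp; linear_combination h
  have d1' : q * x + μ ≠ 0 := by
    intro h; apply d1; field_simp; linear_combination h
  have d1'' : x * q + μ ≠ 0 := by rwa [mul_comm x q]
  have d2' : x + q * μ ≠ 0 := by
    intro h; apply d2; field_simp; linear_combination h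
  have e1 : (q ^ 2 - 1) / (q - q⁻¹) = q := by rw [p.lam_eq]; field_simp
  have e2 : (x - 1) / (q - q⁻¹) = (x - 1) * q / (q ^ 2 - 1) := by rw [p.lam_eq]; field_simp
  have e3 : (x * q⁻¹ ^ 2 - 1) / (q - q⁻¹) = (x - q ^ 2) / (q * (q ^ 2 - 1)) := by
    rw [p.lam_eq]; field_simp
  have e4 : (q ^ 2 - 1) / (q * μ⁻¹ * q ^ 2 + 1) = (q ^ 2 - 1) * μ / (q ^ 3 + μ) := by
    field_simp
  have e5 : (x - 1) / (q * μ⁻¹ * x + 1) = (x - 1) * μ / (q * x + μ) := by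
    field_simp
  have e6 : (x * q⁻¹ ^ 2 - 1) / (q * μ⁻¹ * (x * q⁻¹ ^ 2) + 1) =
      (x - q ^ 2) * μ / (q * (x + q * μ)) := by
    field_simp
  have hq : q⁻¹ * q = 1 := inv_mul_cancel₀ q0
  have f1 : k * (s * e) = (-q) • (k * (l * e)) := by
    have : k * l = k * (s * r) := (h.symm p).lk_eq p
    rw [← mul_assoc k l, this]
    simp only [mul_assoc, hr, mul_smul_comm, smul_smul, neg_mul_neg, mul_inv_cancel₀ q0, one_smul]
  have f2 : s * (s * e) = e + (q - q⁻¹) • (s * e) - ((q - q⁻¹) * μ) • (l * e) := by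
    rw [← mul_assoc, h.snd.rr, sub_mul, add_mul, one_mul, smul_mul_assoc, smul_mul_assoc]
  have f3 : s * (l * e) = μ • (l * e) := by rw [← mul_assoc, h.snd.rk, smul_mul_assoc]
  have f4 : s * (r * (s * e)) = (-q⁻¹) • (r * (s * e)) := by
    rw [← mul_assoc r, ← mul_assoc s, ← mul_assoc s, ← h.braid, mul_assoc, hr, mul_smul_comm,
      mul_assoc]
  have f5 : s * (r * (l * e)) = k * (l * e) := by
    rw [← mul_assoc r, ← mul_assoc s, ← mul_assoc s, ← h.kl p, mul_assoc]
  have f6 : s * (k * (l * e)) = r * (l * e) - (q - q⁻¹) • (l * e - k * (l * e)) := by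
    rw [← mul_assoc k, ← mul_assoc s, (h.symm p).rlk, mul_assoc, h.fst.inv_eq, sub_mul,
      smul_mul_assoc, sub_mul, one_mul, mul_assoc]
  have f7 : l * (s * e) = μ • (l * e) := by rw [← mul_assoc, h.snd.kr p, smul_mul_assoc]
  have f8 : l * (l * e) = etaVal q μ • (l * e) := by rw [← mul_assoc, h.snd.kk p, smul_mul_assoc]
  have f9 : l * (r * (s * e)) = 0 := by
    rw [← mul_assoc r, ← mul_assoc l, ← h.lk_eq p, mul_assoc, hk, mul_zero]
  have f10 : l * (r * (l * e)) = μ⁻¹ • (l * e) := by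
    rw [← mul_assoc r, ← mul_assoc l, ← mul_assoc l, (h.symm p).ksk p, smul_mul_assoc]
  have f11 : l * (k * (l * e)) = l * e := by
    rw [← mul_assoc k, ← mul_assoc l, ← mul_assoc l, h.lkl p]
  simp only [sigmaVal, e1, e2, e3, e4, e5, e6]
  obtain ⟨X, hX⟩ : ∃ X, X = (x - 1) * q / (q ^ 2 - 1) := ⟨_, rfl⟩
  obtain ⟨X', hX'⟩ : ∃ X, X = (x - q ^ 2) / (q * (q ^ 2 - 1)) := ⟨_, rfl⟩
  obtain ⟨C, hC⟩ : ∃ C, C = (q ^ 2 - 1) * μ / (q ^ 3 + μ) := ⟨_, rfl⟩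
  obtain ⟨B, hB⟩ : ∃ B, B = (x - 1) * μ / (q * x + μ) := ⟨_, rfl⟩
  obtain ⟨B', hB'⟩ : ∃ B, B = (x - q ^ 2) * μ / (q * (x + q * μ)) := ⟨_, rfl⟩
  rw [← hX, ← hX', ← hC, ← hB, ← hB']
  simp only [add_mul, one_mul, mul_add, smul_mul_assoc,
    mul_smul_comm, hr, hk, f1, f2, f3, f4, f5, f6, f7, f8, f9, f10, f11, smul_zero,
    add_zero]
  rw [hX, hX', hC, hB, hB', etaVal, p.lam_eq]
  match_scalars <;> field_simp <;> ring

namespace BMWChain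

variable {n : ℕ} {r r' k : ℕ → W}

lemma mono {m : ℕ} (h : BMWChain q μ n r r' k) (hm : m ≤ n) : BMWChain q μ m r r' k :=
  ⟨fun j hj => h.gen j (by omega), fun j hj => h.pair j (by omega),
    fun i j hij hj => h.comm i j hij (by omega)⟩

lemma shift {d m : ℕ} (h : BMWChain q μ n r r' k) (hm : d + m ≤ n) :
    BMWChain q μ m (fun j => r (d + j)) (fun j => r' (d + j)) (fun j => k (d + j)) :=
  ⟨fun j hj => h.gen (d + j) (by omega), fun j hj => h.pair (d + j) (by omega),
    fun i j hij hj => h.comm (d + i) (d + j) (by omega) (by omega)⟩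

lemma reverse (p : BMWParam q μ) (h : BMWChain q μ n r r' k) :
    BMWChain q μ n (fun j => r (n - 1 - j)) (fun j => r' (n - 1 - j)) (fun j => k (n - 1 - j)) where
  gen j hj := h.gen _ (by omega)
  pair j hj := by
    obtain ⟨m, hm, hm'⟩ : ∃ m, n - 1 - (j + 1) = m ∧ n - 1 - j = m + 1 :=
      ⟨_, rfl, by omega⟩
    rw [hm, hm']
    exact (h.pair m (by omega)).symm p
  comm i j hij hj := (h.comm _ _ (by omega) (by omega)).symm

lemma op (p : BMWParam q μ) (h : BMWChain q μ n r r' k) :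
    BMWChain q μ n (fun j => MulOpposite.op (r j)) (fun j => MulOpposite.op (r' j))
      (fun j => MulOpposite.op (k j)) :=
  ⟨fun j hj => (h.gen j hj).op p, fun j hj => (h.pair j hj).op p,
    fun i j hij hj => (h.comm i j hij hj).op⟩

end BMWChain

section
variable {r r' k r₁ k₁ : ℕ → W}

lemma op_sigmaVal (q μ x : ℂ) (r k : W) :
    MulOpposite.op (sigmaVal q μ x r k) =
      sigmaVal q μ x (MulOpposite.op r) (MulOpposite.op k) := by
  simp only [sigmaVal, MulOpposite.op_add, MulOpposite.op_smul, MulOpposite.op_one]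

lemma op_asym (q μ : ℂ) (r k : ℕ → W) : ∀ i, MulOpposite.op (asym q μ r k i) =
    asym q μ (fun j => MulOpposite.op (r j)) (fun j => MulOpposite.op (k j)) i
  | 0 => rfl
  | 1 => rfl
  | i + 2 => by
    rw [asym, asym, MulOpposite.op_smul, MulOpposite.op_mul, MulOpposite.op_mul, op_sigmaVal,
      op_asym q μ r k (i + 1), mul_assoc]

lemma asym_congr : ∀ {i : ℕ}, (∀ j, j + 1 < i → r j = r₁ j) → (∀ j, j + 1 < i → k j = k₁ j) →
    asym q μ r k i = asym q μ r₁ k₁ i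
  | 0, _, _ => rfl
  | 1, _, _ => rfl
  | i + 2, hr, hk => by
    rw [asym, asym, hr i (by omega), hk i (by omega),
      asym_congr (fun j hj => hr j (by omega)) (fun j hj => hk j (by omega))]

lemma sigmaVal_commute {x : ℂ} {r k y : W} (hr : Commute r y) (hk : Commute k y) :
    Commute (sigmaVal q μ x r k) y :=
  ((Commute.one_left y).add_left (hr.smul_left _)).add_left (hk.smul_left _)

lemma asym_commute {y : W} : ∀ {i : ℕ}, (∀ j, j + 1 < i → Commute (r j) y) →
    (∀ j, j + 1 < i → Commute (k j) y) → Commute (asym q μ r k i) y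
  | 0, _, _ => Commute.one_left y
  | 1, _, _ => Commute.one_left y
  | i + 2, hr, hk => by
    have : Commute (asym q μ r k (i + 1)) y := asym_commute (fun j hj => hr j (by omega))
      (fun j hj => hk j (by omega))
    rw [asym]
    exact ((this.mul_left (sigmaVal_commute (hr i (by omega)) (hk i (by omega)))).mul_left
      this).smul_left _

/-- `y` is antisymmetric with respect to the first `m` generators. -/
def IsAntisym (q : ℂ) (r k : ℕ → W) (m : ℕ) (y : W) : Prop :=
  ∀ j, j < m → r j * y = (-q⁻¹) • y ∧ k j * y = 0

lemma IsAntisym.mul_right {m : ℕ} {y : W} (h : IsAntisym q r k m y) (z : W) :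
    IsAntisym q r k m (y * z) := fun j hj =>
  ⟨by rw [← mul_assoc, (h j hj).1, smul_mul_assoc], by rw [← mul_assoc, (h j hj).2, zero_mul]⟩

lemma IsAntisym.mono {m m' : ℕ} {y : W} (h : IsAntisym q r k m y) (hm : m' ≤ m) :
    IsAntisym q r k m' y := fun j hj => h j (by omega)

lemma IsAntisym.sigma_mul {m j : ℕ} {y : W} (h : IsAntisym q r k m y) (hj : j < m) (x : ℂ) :
    sigmaVal q μ x (r j) (k j) * y = (1 - (x - 1) / (q - q⁻¹) * q⁻¹) • y := by
  rw [sigmaVal, add_mul, add_mul, smul_mul_assoc, smul_mul_assoc, (h j hj).1, (h j hj).2,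
    smul_zero, add_zero, one_mul, smul_smul]
  match_scalars
  ring

/-- The factor `q^i / (i+1)_q` in the definition of the antisymmetrizers is the inverse of the
eigenvalue of `σ(q^{-2i})` on antisymmetric elements; hence antisymmetrizers fix such elements. -/
lemma asym_coeff {n : ℕ} (p : AsymParam q μ n) {i : ℕ} (hi : i + 1 ≤ n) :
    q ^ i / qNum q (i + 1) * (1 - (q⁻¹ ^ (2 * i) - 1) / (q - q⁻¹) * q⁻¹) = 1 := by
  have q0 := p.q_ne; have e0 := p.sq_sub_ne
  have h := p.qNum_ne (i + 1) (by omega) hi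
  have e1 : q⁻¹ ^ (2 * i) = (q ^ i)⁻¹ * (q ^ i)⁻¹ := by rw [inv_pow, two_mul, pow_add, mul_inv]
  have e2 : q⁻¹ ^ (i + 1) = (q ^ i)⁻¹ * q⁻¹ := by rw [inv_pow, pow_succ, mul_inv]
  have e3 : q ^ i ≠ 0 := pow_ne_zero _ q0
  rw [div_mul_eq_mul_div, div_eq_one_iff_eq h, qNum, p.lam_eq, e1, e2, pow_succ q i]
  generalize q ^ i = Q at *
  field_simp
  ring

lemma IsAntisym.asym_mul {n : ℕ} (p : AsymParam q μ n) {y : W} :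
    ∀ {i : ℕ}, i ≤ n → IsAntisym q r k (i - 1) y → asym q μ r k i * y = y
  | 0, _, _ => one_mul y
  | 1, _, _ => one_mul y
  | i + 2, hi, h => by
    have e := IsAntisym.asym_mul p (i := i + 1) (by omega) (h.mono (by omega))
    rw [asym, smul_mul_assoc, mul_assoc, e, mul_assoc, h.sigma_mul (by omega), mul_smul_comm, e,
      smul_smul, asym_coeff p hi, one_smul]

/-- Induction on the order. All generators but the last are absorbed by the left factor. For the
last one it suffices that `σ(q²)` kills the product; unfolding the left antisymmetrizer once more
produces a triple of Baxterized generators to which `sigma_sigma_sigma` applies. -/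
lemma BMWChain.isAntisym_asym {n : ℕ} (p : AsymParam q μ n) (h : BMWChain q μ (n - 1) r r' k) :
    ∀ i, i ≤ n → IsAntisym q r k (i - 1) (asym q μ r k i)
  | 0, _ => fun j hj => by omega
  | 1, _ => fun j hj => by omega
  | 2, hn => by
    intro j hj
    obtain rfl : j = 0 := by omega
    have g := h.gen 0 (by omega)
    apply g.of_sigma_mul_eq_zero p.toBMWParam p.den_ne' p.one_add_ne p.sq_add_ne
    rw [asym, asym, one_mul, mul_one, mul_smul_comm, g.sigma_mul_sigma p.toBMWParam p.den_ne',
      smul_zero]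
    simpa using p.den_ne 1 le_rfl (by omega)
  | i + 3, hn => by
    have h2 := h.isAntisym_asym p (i + 2) (by omega)
    have h1 := h.isAntisym_asym p (i + 1) (by omega)
    intro j hj
    rcases Nat.lt_or_ge j (i + 1) with hj' | hj'
    · rw [asym, mul_smul_comm, mul_smul_comm]
      have := (h2.mul_right (sigmaVal q μ (q⁻¹ ^ (2 * (i + 1 + 1))) (r (i + 1)) (k (i + 1)) *
        asym q μ r k (i + 2))) j (by omega)
      rw [mul_assoc, this.1, this.2, smul_zero, smul_comm]
      exact ⟨rfl, rfl⟩
    · obtain rfl : j = i + 1 := by omega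
      have P := h.pair i (by omega)
      apply P.snd.of_sigma_mul_eq_zero p.toBMWParam p.den_ne' p.one_add_ne p.sq_add_ne
      have c1 : ∀ x, Commute (sigmaVal q μ x (r (i + 1)) (k (i + 1))) (asym q μ r k (i + 1)) := by
        intro x
        have hc : ∀ j, j + 1 < i + 1 → Commute (r j) (r (i + 1)) := fun j hj =>
          h.comm j (i + 1) (by omega) (by omega)
        refine (asym_commute (fun j hj => ?_) (fun j hj => ?_)).symm
        · exact (sigmaVal_commute (hc j hj).symm
            (P.snd.k_comm p.toBMWParam (hc j hj).symm)).symm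
        · have g := h.gen j (by omega)
          refine (sigmaVal_commute (g.k_comm p.toBMWParam (hc j hj)).symm ?_).symm
          exact P.snd.k_comm p.toBMWParam (g.k_comm p.toBMWParam (hc j hj)).symm
      have e1 : asym q μ r k (i + 1) * asym q μ r k (i + 2) = asym q μ r k (i + 2) :=
        (h2.mono (by omega)).asym_mul p (by omega)
      have e2 : asym q μ r k (i + 2) = (q ^ (i + 1) / qNum q (i + 2)) •
        (asym q μ r k (i + 1) * sigmaVal q μ (q⁻¹ ^ (2 * (i + 1))) (r i) (k i) *
        asym q μ r k (i + 1)) := by rw [asym]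
      have e3 := h2 i (by omega)
      rw [asym]
      generalize asym q μ r k (i + 2) = a at *
      generalize asym q μ r k (i + 1) = b at *
      -- Only the leftmost factor is unfolded; the smaller antisymmetrizer `b` then commutes past
      -- `σ_{i+1}` and is absorbed by the right factor.
      conv in a * _ * a => lhs; lhs; rw [e2]
      simp only [smul_mul_assoc, mul_smul_comm, mul_assoc]
      rw [← mul_assoc b (sigmaVal _ _ _ (r (i + 1)) _) a, ← (c1 _).eq, mul_assoc _ b a, e1,
        ← mul_assoc (sigmaVal _ _ _ _ _) b, (c1 _).eq, mul_assoc b, P.sigma_sigma_sigma p.toBMWParam (x := q⁻¹ ^ (2 * (i + 1))) _ p.den_ne' _ _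
          e3.1 e3.2]
      · simp
      · ring
      · exact p.den_ne _ (by omega) (by omega)
      · exact p.den_ne _ (by omega) (by omega)

variable {n : ℕ} (p : AsymParam q μ n)
include p

lemma BMWChain.asym_mul_gen (h : BMWChain q μ (n - 1) r r' k) {i j : ℕ} (hi : i ≤ n)
    (hj : j + 1 < i) :
    asym q μ r k i * r j = (-q⁻¹) • asym q μ r k i ∧ asym q μ r k i * k j = 0 := by
  have := (h.op p.toBMWParam).isAntisym_asym p i hi j (by omega)
  rw [← op_asym] at this
  exact ⟨MulOpposite.op_injective this.1, MulOpposite.op_injective this.2⟩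

lemma BMWChain.asym_mul_asym (h : BMWChain q μ (n - 1) r r' k) {i : ℕ} (hi : i ≤ n) :
    asym q μ r k i * asym q μ r k i = asym q μ r k i :=
  (h.isAntisym_asym p i hi).asym_mul p hi

lemma mul_asym {y : W} {i : ℕ} (hi : i ≤ n)
    (h1 : ∀ j, j + 1 < i → y * r j = (-q⁻¹) • y ∧ y * k j = 0) : y * asym q μ r k i = y := by
  have : IsAntisym q (fun j => MulOpposite.op (r j)) (fun j => MulOpposite.op (k j)) (i - 1)
      (MulOpposite.op y) := fun j hj =>
    ⟨congrArg MulOpposite.op (h1 j (by omega)).1, congrArg MulOpposite.op (h1 j (by omega)).2⟩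
  have := this.asym_mul p hi
  rw [← op_asym] at this
  exact MulOpposite.op_injective this

/-- Antisymmetrizers do not depend on the direction in which they are built. -/
lemma BMWChain.asym_reverse (h : BMWChain q μ (n - 1) r r' k) :
    asym q μ (fun j => r (n - 1 - 1 - j)) (fun j => k (n - 1 - 1 - j)) n = asym q μ r k n := by
  have hr := h.reverse p.toBMWParam
  have e1 : IsAntisym q (fun j => r (n - 1 - 1 - j)) (fun j => k (n - 1 - 1 - j)) (n - 1)
      (asym q μ r k n) := fun j hj => h.isAntisym_asym p n le_rfl _ (by omega)
  -- Both elements are antisymmetric for the same set of generators, on both sides, so their product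
  -- equals each of them.
  rw [← e1.asym_mul p le_rfl]
  symm
  apply mul_asym p le_rfl
  intro j hj
  have := hr.asym_mul_gen p (le_refl n) (j := n - 1 - 1 - j) (by omega)
  rwa [show n - 1 - 1 - (n - 1 - 1 - j) = j by omega] at this

/-- Recursion which adds a generator on the left end. -/
lemma BMWChain.asym_succ' (h : BMWChain q μ (n - 1) r r' k) {i : ℕ} (hi : i + 2 ≤ n) :
    asym q μ r k (i + 2) = (q ^ (i + 1) / qNum q (i + 2)) •
      (asym q μ (fun j => r (1 + j)) (fun j => k (1 + j)) (i + 1) *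
        sigmaVal q μ (q⁻¹ ^ (2 * (i + 1))) (r 0) (k 0) *
        asym q μ (fun j => r (1 + j)) (fun j => k (1 + j)) (i + 1)) := by
  have p2 : AsymParam q μ (i + 2) := ⟨p.toBMWParam, fun j h1 h2 => p.qNum_ne j h1 (by omega),
    fun j h1 h2 => p.den_ne j h1 (by omega), p.den_ne', p.one_add_ne, p.sq_add_ne⟩
  have p1 : AsymParam q μ (i + 1) := ⟨p.toBMWParam, fun j h1 h2 => p.qNum_ne j h1 (by omega),
    fun j h1 h2 => p.den_ne j h1 (by omega), p.den_ne', p.one_add_ne, p.sq_add_ne⟩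
  have h2 : BMWChain q μ (i + 2 - 1) r r' k := h.mono (by omega)
  have h1 : BMWChain q μ (i + 1 - 1) _ _ _ := h.shift (d := 1) (m := i) (by omega)
  rw [← h2.asym_reverse p2, ← h1.asym_reverse p1, asym]
  have e : asym q μ (fun j => r (i + 2 - 1 - 1 - j)) (fun j => k (i + 2 - 1 - 1 - j)) (i + 1) =
      asym q μ (fun j => r (1 + (i + 1 - 1 - 1 - j))) (fun j => k (1 + (i + 1 - 1 - 1 - j)))
        (i + 1) :=
    asym_congr (fun j hj => congrArg r (by omega)) (fun j hj => congrArg k (by omega))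
  rw [e]
  simp

end

end BMW

end

/-! ### Intertwining relations for inverses and contractors. -/

section

variable {N : ℕ} {A : Type*} [Ring A] [Algebra ℂ A]

lemma intertwine_inv {W : Type*} [Ring W] {a r r' s s' : W} (hr : r * r' = 1) (hs : s' * s = 1)
    (h : a * r = s * a) : a * r' = s' * a := by
  calc a * r' = s' * (s * a) * r' := by rw [← mul_assoc, hs, one_mul]
    _ = s' * a := by rw [← h, mul_assoc, mul_assoc, hr, mul_one]

lemma BMWGen.intertwine_inv {W : Type*} [Ring W] [Algebra ℂ W] {q μ : ℂ} {a r r' k s s' l : W}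
    (g : BMWGen q μ r r' k) (g' : BMWGen q μ s s' l) (h : a * r = s * a) : a * r' = s' * a :=
  QM.intertwine_inv g.mul_inv g'.inv_mul h

lemma BMWGen.intertwine_k {W : Type*} [Ring W] [Algebra ℂ W] {q μ : ℂ} {a r r' k s s' l : W}
    (p : BMWParam q μ) (g : BMWGen q μ r r' k) (g' : BMWGen q μ s s' l) (h : a * r = s * a) :
    a * k = l * a := by
  rw [g.k_eq p, g'.k_eq p, mul_sub, sub_mul, mul_smul_comm, smul_mul_assoc, mul_sub, sub_mul, h,
    g.intertwine_inv g' h, mul_one, one_mul]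

/-! ### Partial traces of the contractor -/

lemma LegOp.sub_smul (a b : ℂ) (x : LegOp N A) : (a - b) • x = a • x - b • x := _root_.sub_smul a b x

lemma LegOp.add_smul (a b : ℂ) (x : LegOp N A) : (a + b) • x = a • x + b • x := _root_.add_smul a b x

lemma legTrace_single_scal (Z : Matrix (Fin N) (Fin N) ℂ) (n : ℕ) (X : Op N 2 ℂ) (p u : Fin N) :
    legTrace Z n (legTrace (Matrix.single p u 1) (n + 1) (scal A n X)) =
      (∑ s, ∑ t, Z s t * X ![t, u] ![s, p]) • 1 := by
  rw [legTrace_scal_right, legTrace_leg]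
  congr 1
  simp only [Matrix.trace, Matrix.diag, Matrix.mul_apply, tailTrace_two]
  refine Finset.sum_congr rfl fun s _ => Finset.sum_congr rfl fun t _ => ?_
  rw [Finset.sum_eq_single p (fun x _ hx => by simp [hx.symm]) (by simp),
    Finset.sum_eq_single u (fun x _ hx => by simp [hx.symm]) (by simp)]
  simp

lemma coef_mul_scal_eq_zero [NeZero N] {a : A} {n : ℕ} {X : Op N 2 ℂ} (hX : X ≠ 0)
    (h : coef a * scal A n X = 0) : a = 0 := by
  obtain ⟨x, y, hxy⟩ : ∃ x y, X x y ≠ 0 := by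
    by_contra! hx
    exact hX (Matrix.ext hx)
  have e : X x y = X ![x 0, x 1] ![y 0, y 1] := by
    congr 1 <;> funext t <;> fin_cases t <;> rfl
  have h2 := congrArg (fun f => legTrace (Matrix.single (y 0) (x 0) 1) n
    (legTrace (Matrix.single (y 1) (x 1) 1) (n + 1) f)) h
  simp only [map_zero] at h2
  rw [legTrace_mul_left _ (coef_off _ _), legTrace_mul_left _ (coef_off _ _),
    legTrace_single_scal] at h2
  rw [Finset.sum_eq_single (y 0) (fun z _ hz => by simp [hz.symm]) (by simp),
    Finset.sum_eq_single (x 0) (fun z _ hz => by simp [hz.symm]) (by simp),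
    Matrix.single_apply_same, one_mul, ← e, mul_smul_comm, mul_one, smul_eq_zero] at h2
  exact coef_injective (h2.resolve_left hxy |>.trans (map_zero coef).symm)

/-- An operator on one leg kills an operator elsewhere only if it vanishes. -/
lemma leg_mul_off_eq_zero {n : ℕ} {Y : Matrix (Fin N) (Fin N) A} {x : LegOp N A} (hx : Off n x)
    (h : leg n Y * x = 0) (a b : Fin N) : coef (Y a b) * x = 0 := by
  have : ∑ p, eUnit n p a * (leg n Y * x) * eUnit n b p = coef (Y a b) * x := by
    rw [leg_eq_sum]
    have e : ∀ p, eUnit n p a * ((∑ s, ∑ t, coef (Y s t) * eUnit n s t) * x) * eUnit n b p =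
        coef (Y a b) * x * eUnit n p p := by
      intro p
      rw [Finset.sum_mul, Finset.mul_sum, Finset.sum_mul]
      rw [Finset.sum_eq_single a (fun s _ hs => ?_) (by simp)]
      · rw [Finset.sum_mul, Finset.mul_sum, Finset.sum_mul,
          Finset.sum_eq_single b (fun t _ ht => ?_) (by simp)]
        · rw [mul_assoc, mul_assoc, (hx b p).symm.eq, ← mul_assoc (eUnit n p a),
            ← mul_assoc (eUnit n p a), ← (coef_comm_eUnit _ _ _ _).eq, mul_assoc (coef _), eUnit_mul,
            if_pos rfl, mul_assoc, ← mul_assoc (eUnit n p b), eUnit_mul, if_pos rfl, (hx p p).eq,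
            mul_assoc]
        · rw [mul_assoc, mul_assoc, (hx b p).symm.eq, mul_assoc, ← mul_assoc (eUnit n a t), eUnit_mul,
            if_neg ht]
          simp
      · rw [Finset.sum_mul, Finset.mul_sum, Finset.sum_mul]
        refine Finset.sum_eq_zero fun t _ => ?_
        rw [← mul_assoc, ← mul_assoc, ← (coef_comm_eUnit _ _ _ _).eq, mul_assoc (coef _), eUnit_mul,
          if_neg hs.symm]
        simp
    rw [Finset.sum_congr rfl fun p _ => e p, ← Finset.mul_sum, eUnit_sum, mul_one]
  rw [← this, h]
  simp

lemma IsBMWType.opK_ne_zero {q μ : ℂ} {R : Op N 2 ℂ} (h : IsBMWType q μ R) : opK q μ R ≠ 0 := by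
  open Polynomial in
  intro h0
  have h1 : (q • (1 : Op N 2 ℂ) - R) * (q⁻¹ • (1 : Op N 2 ℂ) + R) = 0 := by
    rw [opK, smul_eq_zero] at h0
    refine h0.resolve_left (mul_ne_zero (inv_ne_zero h.mu_ne_zero) (inv_ne_zero h.q_sub_ne))
  have h2 : aeval R ((X - C q) * (X + C q⁻¹)) = 0 := by
    simp only [map_mul, map_sub, map_add, aeval_X, aeval_C, Algebra.algebraMap_eq_smul_one]
    rw [add_comm R, ← neg_sub, neg_mul, h1, neg_zero]
  have h3 := minpoly.dvd ℂ R h2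
  rw [h.minpoly_eq] at h3
  have hm : ((X - C q) * (X + C q⁻¹)).Monic := (monic_X_sub_C q).mul (monic_X_add_C _)
  have h4 := natDegree_le_of_dvd h3 hm.ne_zero
  rw [natDegree_mul hm.ne_zero (X_sub_C_ne_zero μ), natDegree_X_sub_C] at h4
  omega

section
variable {q μ : ℂ} {R : Op N 2 ℂ} (hB : IsBMWType q μ R) [NeZero N]
include hB

local notation "r[" j "]" => scal ℂ j R
local notation "r'[" j "]" => scal ℂ j R⁻¹
local notation "k[" j "]" => scal ℂ j (opK q μ R)

/-- Nondegeneracy of the contractor. -/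
lemma IsBMWType.eq_zero_of_leg_mul_opK {Y : Matrix (Fin N) (Fin N) ℂ} {n : ℕ}
    (h : scal ℂ (n + 1) (oneStrand Y) * k[n] = 0) : Y = 0 := by
  have hn : ∀ m, scal ℂ (m + 1) (oneStrand Y) * k[m] = 0 := by
    have e : ∀ m, scal ℂ (m + 1) (oneStrand Y) * k[m] =
        scal ℂ m (place 2 1 (oneStrand Y) * opK q μ R) := fun m => by
      rw [map_mul, scal_place _ (by norm_num)]
    intro m
    rw [e] at h ⊢
    rw [scal_injective n (h.trans (map_zero _).symm), map_zero]
  have P := hB.pair ℂ 0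
  have c : ∀ X : Op N 2 ℂ, Commute (scal ℂ 2 (oneStrand Y)) (scal ℂ 0 X) := fun X =>
    scal_comm_scal (by omega) _ _
  -- `R₂ K₁` and `R₂⁻¹ K₁` equal `R₁^{∓1} K₂ K₁`, and `Y₃` commutes with `R₁` and kills `K₂`. The
  -- skein relation then shows that `Y₃` kills `K₁`, although they act on disjoint legs.
  have h1 : scal ℂ 2 (oneStrand Y) * (r[1] * k[0]) = 0 := by
    have e : r[1] * k[0] = r'[0] * (k[1] * k[0]) := P.r'lk.symm
    rw [e, ← mul_assoc, (c _).eq, mul_assoc, ← mul_assoc _ k[1], hn 1, zero_mul, mul_zero]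
  have h2 : scal ℂ 2 (oneStrand Y) * (r'[1] * k[0]) = 0 := by
    have e : r'[1] * k[0] = r[0] * (k[1] * k[0]) := P.rlk.symm
    rw [e, ← mul_assoc, (c _).eq, mul_assoc, ← mul_assoc _ k[1], hn 1, zero_mul, mul_zero]
  have h3 : scal ℂ 2 (oneStrand Y) * k[0] = 0 := by
    have e : (r[1] - r'[1]) * k[0] = (q - q⁻¹) • (k[0] - k[1] * k[0]) := by
      rw [P.snd.skein, smul_mul_assoc, sub_mul, one_mul]
    have e2 := congrArg (scal ℂ 2 (oneStrand Y) * ·) e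
    simp only [sub_mul, mul_sub, h1, h2, mul_smul_comm, sub_zero] at e2
    rw [← mul_assoc, hn 1, zero_mul, sub_zero] at e2
    exact (smul_eq_zero.1 e2.symm).resolve_left hB.q_sub_ne
  ext a b
  have h4 := leg_mul_off_eq_zero (A := ℂ) (n := 2) (scal_off 0 _ (by omega)) h3 a b
  simpa using coef_mul_scal_eq_zero hB.opK_ne_zero h4

lemma IsBMWType.eq_zero_of_opK_mul_leg {Y : Matrix (Fin N) (Fin N) ℂ} {n : ℕ}
    (h : k[n] * scal ℂ (n + 1) (oneStrand Y) = 0) : Y = 0 := by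
  have hn : ∀ m, k[m] * scal ℂ (m + 1) (oneStrand Y) = 0 := by
    have e : ∀ m, k[m] * scal ℂ (m + 1) (oneStrand Y) =
        scal ℂ m (opK q μ R * place 2 1 (oneStrand Y)) := fun m => by
      rw [map_mul, scal_place _ (by norm_num)]
    intro m
    rw [e] at h ⊢
    rw [scal_injective n (h.trans (map_zero _).symm), map_zero]
  have p := hB.param
  have P := (hB.pair ℂ 0).symm p
  have c : ∀ X : Op N 2 ℂ, Commute (scal ℂ 2 (oneStrand Y)) (scal ℂ 0 X) := fun X =>
    scal_comm_scal (by omega) _ _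
  have h1 : k[0] * r'[1] * scal ℂ 2 (oneStrand Y) = 0 := by
    have e : k[0] * k[1] * r[0] = k[0] * r'[1] := P.lks p
    rw [← e, mul_assoc, ← (c _).eq, mul_assoc, ← mul_assoc k[1], hn 1, zero_mul, mul_zero]
  have h2 : k[0] * r[1] * scal ℂ 2 (oneStrand Y) = 0 := by
    have e : k[0] * k[1] * r'[0] = k[0] * r[1] := P.lks' p
    rw [← e, mul_assoc, ← (c _).eq, mul_assoc, ← mul_assoc k[1], hn 1, zero_mul, mul_zero]
  have h3 : k[0] * scal ℂ 2 (oneStrand Y) = 0 := by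
    have e : k[0] * (r[1] - r'[1]) = (q - q⁻¹) • (k[0] - k[0] * k[1]) := by
      rw [P.fst.skein, mul_smul_comm, mul_sub, mul_one]
    have e2 := congrArg (· * scal ℂ 2 (oneStrand Y)) e
    simp only [sub_mul, mul_sub, h1, h2, smul_mul_assoc, sub_zero] at e2
    rw [mul_assoc, hn 1, mul_zero, sub_zero] at e2
    exact (smul_eq_zero.1 e2.symm).resolve_left hB.q_sub_ne
  rw [← (c _).eq] at h3
  ext a b
  have h4 := leg_mul_off_eq_zero (A := ℂ) (n := 2) (scal_off 0 _ (by omega)) h3 a b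
  simpa using coef_mul_scal_eq_zero hB.opK_ne_zero h4

variable (hs : SkewInvertible R)
include hs

/-- Tracing `K₂ K₁ = R₁ R₂ K₁` over the third leg gives `R₁ K₁ = μ K₁` on the right; nondegeneracy
of the contractor strips `K₁`. -/
lemma IsBMWType.tailTrace_opK : tailTrace (s := 1) (matD R) (opK q μ R) =
    μ • (1 : Matrix (Fin N) (Fin N) ℂ) := by
  have P := hB.pair ℂ 0
  rw [← sub_eq_zero]
  refine hB.eq_zero_of_leg_mul_opK (n := 0) ?_
  have e1 : legTrace (matD R) 2 (k[1] * k[0]) = μ • k[0] := by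
    rw [P.lk, mul_assoc, legTrace_mul_left _ (scal_off _ _ (by omega)),
      legTrace_mul_right _ (scal_off _ _ (by omega)), legTrace_matD hs 1, one_mul, P.fst.rk]
  rw [legTrace_mul_right _ (scal_off _ _ (by omega)), legTrace_scal_right, leg_map] at e1
  have e2 : ∀ Y : Matrix (Fin N) (Fin N) ℂ, oneStrand (Y - μ • 1) = oneStrand Y - μ • 1 := by
    intro Y
    ext a b
    simp only [oneStrand, Matrix.submatrix_apply, Matrix.sub_apply, Matrix.smul_apply,
      Matrix.one_apply]
    congr 3
    exact propext ⟨fun h => by funext t; rw [Subsingleton.elim t 0, h], fun h => congrFun h 0⟩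
  rw [e2, map_sub, map_smul, map_one, sub_mul, e1, smul_mul_assoc, one_mul, sub_self]

lemma IsBMWType.legTrace_opK (n : ℕ) :
    legTrace (matD R) (n + 1) (scal A n (opK q μ R)) = μ • 1 := by
  rw [legTrace_scal_right, hB.tailTrace_opK hs, leg_map_smul_one]

omit [NeZero N] in
-- The traced skein relation expresses the R-trace of `R⁻¹` through `Tr D`. Tracing `K₂ K₁ = R₁⁻¹
-- R₂⁻¹ K₁` gives a second expression, and comparison determines `Tr D`.
lemma IsBMWType.trace_matD_aux (A : Type*) [Ring A] [Algebra ℂ A] [Nontrivial A] [NeZero N] : (matD R).trace = μ * etaVal q μ := by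
  have p := hB.param
  have P := hB.pair A 0
  have h0 : (1 : LegOp N A) - legTrace (matD R) 2 (scal A 1 R⁻¹) =
      ((q - q⁻¹) * ((matD R).trace - μ)) • (1 : LegOp N A) := by
    have h0 := congrArg (legTrace (matD R) 2) P.snd.skein
    rw [map_smul, map_sub, map_sub, legTrace_matD hs, hB.legTrace_opK hs, legTrace_one] at h0
    rw [mul_smul, sub_smul (matD R).trace]
    exact h0
  have h1 : legTrace (matD R) 2 (scal A 1 R⁻¹) = (1 - (q - q⁻¹) * ((matD R).trace - μ)) • 1 := by
    rw [LegOp.sub_smul, one_smul, ← h0, sub_sub_cancel]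
  have e1 : legTrace (matD R) 2 (scal A 1 (opK q μ R) * scal A 0 (opK q μ R)) =
      ((1 - (q - q⁻¹) * ((matD R).trace - μ)) * μ⁻¹) • scal A 0 (opK q μ R) := by
    rw [P.lk', mul_assoc, legTrace_mul_left _ (scal_off _ _ (by omega)),
      legTrace_mul_right _ (scal_off _ _ (by omega)), h1, smul_mul_assoc, one_mul, mul_smul_comm,
      P.fst.r'k p, smul_smul]
  rw [legTrace_mul_right _ (scal_off _ _ (by omega)), hB.legTrace_opK hs 1, smul_mul_assoc, one_mul,
    ← sub_eq_zero, ← LegOp.sub_smul, smul_eq_zero] at e1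
  have hk : scal A 0 (opK q μ R) ≠ 0 := fun h =>
    one_ne_zero (coef_mul_scal_eq_zero (a := (1 : A)) hB.opK_ne_zero (by rw [h, mul_zero]))
  have e2 := e1.resolve_right hk
  have m0 := p.mu_ne
  have e3 : μ * μ - (1 - (q - q⁻¹) * ((matD R).trace - μ)) = 0 := by
    have := congrArg (· * μ) e2
    simp only [sub_mul, mul_assoc, inv_mul_cancel₀ m0, zero_mul] at this
    linear_combination this
  have e4 := p.etaVal_eq
  apply mul_left_cancel₀ p.lam_ne
  have e5 : μ * μ⁻¹ = 1 := mul_inv_cancel₀ m0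
  linear_combination e3 - μ * e4 - e5

lemma IsBMWType.trace_matD : (matD R).trace = μ * etaVal q μ := hB.trace_matD_aux hs ℂ

end

end

/-! ### The contractor has rank one -/

section

variable {N : ℕ} {A : Type*} [Ring A] [Algebra ℂ A]

lemma etaVal_ne_zero {q μ : ℂ} {R : Op N 2 ℂ} (h : IsBMWType q μ R) : etaVal q μ ≠ 0 := by
  have h1 : q⁻¹ + μ ≠ 0 := fun e => h.mu_ne_neg_inv (by linear_combination e)
  exact div_ne_zero (mul_ne_zero (sub_ne_zero.2 h.mu_ne_q.symm) h1)
    (mul_ne_zero h.mu_ne_zero h.q_sub_ne)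

lemma amp_two_eq_sum (n : ℕ) (X : Op N 2 A) :
    amp n X = ∑ b, ∑ d, ∑ a, ∑ c, coef (X ![a, b] ![c, d]) * (eUnit n a c * eUnit (n + 1) b d) := by
  rw [amp_succ]
  refine Finset.sum_congr rfl fun b _ => Finset.sum_congr rfl fun d _ => ?_
  rw [amp_succ, Finset.sum_mul]
  refine Finset.sum_congr rfl fun a _ => ?_
  rw [Finset.sum_mul]
  refine Finset.sum_congr rfl fun c _ => ?_
  rw [amp_zero_legs, Matrix.of_apply, Matrix.of_apply, add_zero, mul_assoc]
  congr 2
  congr 1 <;> funext t <;> fin_cases t <;> rfl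

/-- The matrix of an operator on the second of two legs, for fixed indices on the first leg. -/
def blockAt (X : Op N 2 ℂ) (a c : Fin N) : Matrix (Fin N) (Fin N) ℂ :=
  Matrix.of fun b d => X ![a, b] ![c, d]

lemma scal_eq_sum_block (n : ℕ) (X : Op N 2 ℂ) :
    scal A n X = ∑ a, ∑ c, eUnit n a c * scal A (n + 1) (oneStrand (blockAt X a c)) := by
  rw [scal_two_eq_sum, sum_comm_two_two]
  refine Finset.sum_congr rfl fun a _ => Finset.sum_congr rfl fun c _ => ?_
  rw [← leg_map, leg_eq_sum, Finset.mul_sum]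
  refine Finset.sum_congr rfl fun b _ => ?_
  rw [Finset.mul_sum]
  refine Finset.sum_congr rfl fun d _ => ?_
  rw [Matrix.map_apply, AlgHom.commutes, ← Algebra.smul_def, mul_smul_comm]
  rfl

section
variable {q μ : ℂ} {R : Op N 2 ℂ} (hB : IsBMWType q μ R) (hs : SkewInvertible R) [NeZero N]
include hB hs

/-- With `Y` written as a slice of the generator to the left, the claim is a weighted trace of `K₂
R₁ K₂ = μ⁻¹ K₂`. -/
lemma IsBMWType.opK_mul_leg_mul_opK (Y : Matrix (Fin N) (Fin N) ℂ) : ∃ z : ℂ, ∀ n,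
    scal A n (opK q μ R) * scal A n (oneStrand Y) * scal A n (opK q μ R) =
      z • scal A n (opK q μ R) := by
  obtain ⟨Z, hZ⟩ := hs.isSkewInverse.exists_slice_left (A := ℂ) Y
  have P := (hB.pair ℂ 0).symm hB.param
  have e : scal ℂ 1 (opK q μ R) * scal ℂ 1 (oneStrand Y) * scal ℂ 1 (opK q μ R) =
      (μ⁻¹ * Z.trace) • scal ℂ 1 (opK q μ R) := by
    rw [← leg_map, hZ 0, ← legTrace_mul_left _ (scal_off _ _ (by omega)),
      ← legTrace_mul_right _ (scal_off _ _ (by omega)), P.ksk hB.param, map_smul, ← mul_one (scal ℂ (0 + 1) _),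
      legTrace_mul_left _ (scal_off _ _ (by omega)), legTrace_one, mul_smul_comm, mul_one, smul_smul]
  have e2 : opK q μ R * place 2 0 (oneStrand Y) * opK q μ R = (μ⁻¹ * Z.trace) • opK q μ R := by
    apply scal_injective 1
    rw [map_mul, map_mul, map_smul, scal_place _ (by norm_num), ← e]
  refine ⟨μ⁻¹ * Z.trace, fun n => ?_⟩
  rw [← map_smul, ← e2, map_mul, map_mul, scal_place _ (by norm_num)]
  rfl

/-- Insert `K₁ = K₁ K₂ K₁` on both sides of `K X K`. Blockwise, the two copies of `K₂` compress the
middle to a matrix on the first leg; tracing out the third leg leaves the one-leg case, with the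
nonzero factor `Tr D = μ η`. -/
lemma IsBMWType.opK_mul_mul_opK (X : Op N 2 ℂ) :
    ∃ z : ℂ, opK q μ R * X * opK q μ R = z • opK q μ R := by
  have p := hB.param
  have P := hB.pair ℂ 0
  set k := opK q μ R with hk
  choose c hc using fun a b => hB.opK_mul_leg_mul_opK (A := ℂ) hs (blockAt (k * X * k) a b)
  -- For each pair of indices on the first leg the block of `K X K` is a matrix on the first leg of
  -- `K₂`, hence is compressed to the scalar `c a b`.
  have e1 : scal ℂ 1 k * scal ℂ 0 (k * X * k) * scal ℂ 1 k =
      scal ℂ 0 (oneStrand (Matrix.of c)) * scal ℂ 1 k := by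
    rw [scal_eq_sum_block 0, ← leg_map, leg_eq_sum]
    simp only [Finset.mul_sum, Finset.sum_mul, Matrix.map_apply, AlgHom.commutes,
      ← Algebra.smul_def, smul_mul_assoc]
    refine Finset.sum_congr rfl fun a _ => Finset.sum_congr rfl fun b _ => ?_
    rw [← mul_assoc (scal ℂ 1 k), ← (scal_off 1 k (by omega) : Off 0 (scal ℂ 1 k)) a b, mul_assoc, mul_assoc,
      ← mul_assoc (scal ℂ 1 k), hc, mul_smul_comm]
    rfl
  have e2 : scal ℂ 0 (k * X * k) = scal ℂ 0 k * scal ℂ 0 (oneStrand (Matrix.of c)) *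
      scal ℂ 1 k * scal ℂ 0 k := by
    rw [mul_assoc (scal ℂ 0 k), ← e1, map_mul, map_mul]
    have : ∀ x : LegOp N ℂ, scal ℂ 0 k * (scal ℂ 1 k * (scal ℂ 0 k * x * scal ℂ 0 k) * scal ℂ 1 k) *
      scal ℂ 0 k = (scal ℂ 0 k * scal ℂ 1 k * scal ℂ 0 k) * x *
        (scal ℂ 0 k * scal ℂ 1 k * scal ℂ 0 k) := fun x => by simp only [mul_assoc]
    rw [this, P.klk]
  have e3 := congrArg (legTrace (matD R) 2) e2
  rw [legTrace_mul_right _ (scal_off _ _ (by omega)), legTrace_mul_left _ ((scal_off _ _ (by omega)).mul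
    (scal_off _ _ (by omega))), hB.legTrace_opK hs 1, ← mul_one (scal ℂ 0 (k * X * k)),
    legTrace_mul_left _ (scal_off _ _ (by omega)), legTrace_one, hB.trace_matD hs, mul_smul_comm,
    mul_smul_comm, mul_one, mul_one, smul_mul_assoc] at e3
  obtain ⟨z, hz⟩ := hB.opK_mul_leg_mul_opK (A := ℂ) hs (Matrix.of c)
  rw [hz 0, smul_smul, ← map_smul, ← map_smul] at e3
  have e4 := scal_injective 0 e3
  have hne : μ * etaVal q μ ≠ 0 := mul_ne_zero p.mu_ne (etaVal_ne_zero hB)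
  refine ⟨(μ * etaVal q μ)⁻¹ * (μ * z), ?_⟩
  rw [mul_smul, ← e4, smul_smul, inv_mul_cancel₀ hne, one_smul]

/-- The contractor has rank one, also over a noncommutative algebra. -/
lemma IsBMWType.opK_mul_amp_mul_opK (n : ℕ) (X : Op N 2 A) : ∃ z : A,
    scal A n (opK q μ R) * amp n X * scal A n (opK q μ R) = coef z * scal A n (opK q μ R) := by
  choose c hc using fun a b => hB.opK_mul_mul_opK hs (Matrix.single a b (1 : ℂ))
  refine ⟨∑ b, ∑ d, ∑ x, ∑ y, X ![x, b] ![y, d] * algebraMap ℂ A (c ![x, b] ![y, d]), ?_⟩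
  rw [amp_two_eq_sum]
  simp only [map_sum, Finset.mul_sum, Finset.sum_mul]
  refine Finset.sum_congr rfl fun b _ => Finset.sum_congr rfl fun d _ =>
    Finset.sum_congr rfl fun x _ => Finset.sum_congr rfl fun y _ => ?_
  have e : eUnit n x y * eUnit (n + 1) b d =
      scal A n (Matrix.single ![x, b] ![y, d] (1 : ℂ)) := by
    rw [scal_two_eq_sum]
    symm
    rw [Finset.sum_eq_single b (fun z _ hz => ?_) (by simp),
      Finset.sum_eq_single d (fun z _ hz => ?_) (by simp),
      Finset.sum_eq_single x (fun z _ hz => ?_) (by simp),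
      Finset.sum_eq_single y (fun z _ hz => ?_) (by simp)]
    · simp
    · simp [hz.symm]
    · simp [hz.symm]
    · simp [hz.symm]
    · simp [hz.symm]
  rw [e, ← mul_assoc, ← (coef_comm_scal _ _ _).eq, mul_assoc, mul_assoc, ← map_mul, ← map_mul,
    ← mul_assoc, hc, map_smul, map_mul coef, AlgHom.commutes, mul_assoc, ← Algebra.smul_def]

end

/-! ### Nondegeneracy of the twisted contractor -/

/-- A projection onto the kernel of a matrix. -/
lemma exists_proj_ker {ι : Type*} (U : Matrix ι (Fin N) ℂ) :
    ∃ p : Matrix (Fin N) (Fin N) ℂ, p * p = p ∧ U * p = 0 ∧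
      ∀ Y : Matrix (Fin N) (Fin N) ℂ, U * Y = 0 → p * Y = Y := by
  let L := LinearMap.ker U.mulVecLin
  obtain ⟨L', hL⟩ := L.exists_isCompl
  let π : (Fin N → ℂ) →ₗ[ℂ] (Fin N → ℂ) := L.subtype ∘ₗ L.projectionOnto L' hL
  have h1 : ∀ y, U.mulVec y = 0 → π y = y := fun y hy => by
    have : y ∈ L := by rw [LinearMap.mem_ker]; exact hy
    show ((L.projectionOnto L' hL y : L) : Fin N → ℂ) = y
    rw [Submodule.projectionOnto_apply_left hL ⟨y, this⟩]
  have h2 : ∀ y, U.mulVec (π y) = 0 := fun y => (L.projectionOnto L' hL y).2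
  have hp : ∀ y, (LinearMap.toMatrix' π).mulVec y = π y := fun y => by
    rw [LinearMap.toMatrix'_mulVec]
  have col : ∀ Y : Matrix (Fin N) (Fin N) ℂ, U * Y = 0 → LinearMap.toMatrix' π * Y = Y := by
    intro Y hY
    ext a b
    have := h1 (fun c => Y c b) (by ext i; exact congrFun (congrFun hY i) b)
    rw [← hp] at this
    exact congrFun this a
  have ker : U * LinearMap.toMatrix' π = 0 := by
    ext i b
    have := h2 (Pi.single b 1)
    rw [← hp] at this
    have := congrFun this i
    rw [Matrix.mulVec_mulVec, Matrix.mulVec_single_one] at this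
    exact this
  exact ⟨_, col _ ker, ker, col⟩

/-- Let `L` be the largest subspace with `K F (L ⊗ V) = 0` and `p` a projector onto it. The relation
`hrel` shows that `F` maps `L ⊗ V` into `V ⊗ L`, and by dimension onto it. Hence `K` vanishes on `V
⊗ L`, and nondegeneracy of `K` forces `L = 0`. -/
lemma eq_zero_of_mul_place_eq_zero [NeZero N] {K F G : Op N 2 ℂ} (hGF : G * F = 1)
    (hrel : scal ℂ 1 K * scal ℂ 1 F * scal ℂ 0 F =
      scal ℂ 0 F * scal ℂ 1 F * scal ℂ 0 K * scal ℂ 0 F * scal ℂ 1 G)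
    (hnd : ∀ Y : Matrix (Fin N) (Fin N) ℂ, scal ℂ 0 K * scal ℂ 1 (oneStrand Y) = 0 → Y = 0)
    {Y : Matrix (Fin N) (Fin N) ℂ} (h : K * F * place 2 0 (oneStrand Y) = 0) : Y = 0 := by
  let U : Matrix ((Fin 2 → Fin N) × Fin N) (Fin N) ℂ := Matrix.of fun i a => (K * F) i.1 ![a, i.2]
  have hU : ∀ Y : Matrix (Fin N) (Fin N) ℂ, K * F * place 2 0 (oneStrand Y) = 0 ↔ U * Y = 0 := by
    intro Y
    have e : ∀ i a b, (K * F * place 2 0 (oneStrand Y)) i ![a, b] = (U * Y) (i, b) a := by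
      intro i a b
      rw [op_two_mul_apply, Matrix.mul_apply]
      refine Finset.sum_congr rfl fun x _ => ?_
      rw [Finset.sum_eq_single b (fun y _ hy => by rw [place_two_leg_apply, if_neg hy, mul_zero])
        (by simp), place_two_leg_apply, if_pos rfl]
      rfl
    constructor
    · intro h0
      ext i a
      rw [← e, h0]; rfl
    · intro h0
      ext i j
      have : j = ![j 0, j 1] := by funext t; fin_cases t <;> rfl
      rw [this, e, h0]; rfl
  obtain ⟨p, hpp, hUp, hpY⟩ := exists_proj_ker U
  have hp0 : K * F * place 2 0 (oneStrand p) = 0 := (hU p).2 hUp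
  set P0 : Op N 2 ℂ := place 2 0 (oneStrand p) with hP0
  set P1 : Op N 2 ℂ := place 2 1 (oneStrand p) with hP1
  have s0 : scal ℂ 0 P0 = scal ℂ 0 (oneStrand p) := scal_place 0 (by norm_num) _
  have s1 : scal ℂ 0 P1 = scal ℂ 1 (oneStrand p) := scal_place 0 (by norm_num) _
  have hop : oneStrand p * oneStrand p = (oneStrand p : Op N 1 ℂ) := by
    apply scal_injective 0
    rw [map_mul, ← leg_map, ← leg_mul, ← Matrix.map_mul, hpp]
  have hP0P0 : P0 * P0 = P0 := scal_injective 0 (by rw [map_mul, s0, ← map_mul, hop])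
  have hP1P1 : P1 * P1 = P1 := scal_injective 0 (by rw [map_mul, s1, ← map_mul, hop])
  -- `F` maps `L ⊗ V` to `V ⊗ L`
  have key : P1 * (F * P0) = F * P0 := by
    have e1 : scal ℂ 1 (K * F) * scal ℂ 0 (F * P0) = 0 := by
      rw [map_mul, map_mul, ← mul_assoc, hrel, s0]
      have c : scal ℂ 1 G * scal ℂ 0 (oneStrand p) = scal ℂ 0 (oneStrand p) * scal ℂ 1 G :=
        (scal_comm_scal (by omega) _ _).eq
      have e2 : scal ℂ 0 K * scal ℂ 0 F * scal ℂ 0 (oneStrand p) = 0 := by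
        rw [← s0, ← map_mul, ← map_mul, hp0, map_zero]
      rw [mul_assoc _ (scal ℂ 1 G), c, ← mul_assoc, mul_assoc _ (scal ℂ 0 K), mul_assoc _ _ (scal ℂ 0 (oneStrand p)),
        e2, mul_zero, zero_mul]
    have e2 : ∀ a c, p * blockAt (F * P0) a c = blockAt (F * P0) a c := by
      intro a c
      apply hpY
      rw [← hU]
      apply scal_injective 1
      rw [map_zero, map_mul, scal_place 1 (by norm_num)]
      have e3 : ∑ x, eUnit 0 x a * (scal ℂ 1 (K * F) * scal ℂ 0 (F * P0)) * eUnit 0 c x =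
          scal ℂ 1 (K * F) * scal ℂ 1 (oneStrand (blockAt (F * P0) a c)) := by
        have o : ∀ Z : Matrix (Fin N) (Fin N) ℂ, Off 0 (scal ℂ 1 (oneStrand Z)) := fun Z =>
          scal_off _ _ (by omega)
        have o2 : Off 0 (scal ℂ 1 (K * F)) := scal_off _ _ (by omega)
        have e4 : ∀ x, eUnit 0 x a * (scal ℂ 1 (K * F) * scal ℂ 0 (F * P0)) * eUnit 0 c x =
            scal ℂ 1 (K * F) * scal ℂ 1 (oneStrand (blockAt (F * P0) a c)) * eUnit 0 x x := by
          intro x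
          rw [← mul_assoc, (o2 x a).eq, mul_assoc, mul_assoc, mul_assoc]
          congr 1
          rw [← mul_assoc, scal_eq_sum_block, Finset.mul_sum, Finset.sum_mul]
          rw [Finset.sum_eq_single a (fun s _ hs => ?_) (by simp)]
          · rw [Finset.mul_sum, Finset.sum_mul, Finset.sum_eq_single c (fun t _ ht => ?_) (by simp)]
            · rw [← mul_assoc, eUnit_mul, if_pos rfl, mul_assoc, ← (o _ c x).eq, ← mul_assoc,
                eUnit_mul, if_pos rfl, (o _ x x).eq]
            · rw [← mul_assoc, eUnit_mul, if_pos rfl, mul_assoc, ← (o _ c x).eq, ← mul_assoc,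
                eUnit_mul, if_neg ht, zero_mul]
          · rw [Finset.mul_sum, Finset.sum_mul]
            refine Finset.sum_eq_zero fun t _ => ?_
            rw [← mul_assoc, eUnit_mul, if_neg hs.symm, zero_mul, zero_mul]
        rw [Finset.sum_congr rfl fun x _ => e4 x, ← Finset.mul_sum, eUnit_sum, mul_one]
      rw [add_zero, ← e3, e1]
      simp
    apply scal_injective 0
    rw [map_mul, s1, scal_eq_sum_block, Finset.mul_sum]
    refine Finset.sum_congr rfl fun a _ => ?_
    rw [Finset.mul_sum]
    refine Finset.sum_congr rfl fun c _ => ?_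
    rw [← mul_assoc, ← (scal_off 1 _ (by omega) : Off 0 (scal ℂ 1 (oneStrand p))) a c, mul_assoc,
      ← leg_map, ← leg_map, ← leg_mul, ← Matrix.map_mul, e2]
  have hE : F * P0 * G * (F * P0 * G) = F * P0 * G := by
    calc _ = F * (P0 * (G * F) * P0) * G := by simp only [mul_assoc]
      _ = _ := by rw [hGF, mul_one, hP0P0]
  set E := F * P0 * G with hEdef
  have hPE : P1 * E = E := by rw [hEdef, ← mul_assoc P1, key]
  have tr1 : E.trace = P0.trace := by
    rw [hEdef, Matrix.trace_mul_comm, ← mul_assoc, hGF, one_mul]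
  have tr0 : P0.trace = P1.trace := by
    have b0 : ∀ x y : Fin N, P0 ![x, y] ![x, y] = p x x := fun x y => by
      rw [hP0, place_two_leg_apply, if_pos rfl]
    have b1 : ∀ x y : Fin N, P1 ![x, y] ![x, y] = p y y := fun x y => by
      rw [hP1]
      simp only [place, Matrix.of_apply, oneStrand, Matrix.submatrix_apply]
      rw [dif_pos (by norm_num), if_pos (fun _ _ => trivial)]
      rfl
    have t : ∀ X : Op N 2 ℂ, X.trace = ∑ x, ∑ y, X ![x, y] ![x, y] := fun X => by
      rw [Matrix.trace, ← (finTwoArrowEquiv (Fin N)).symm.sum_comp, Fintype.sum_prod_type]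
      rfl
    rw [t, t, Finset.sum_comm]
    simp only [b0, b1]
  -- `E` projects onto `F (L ⊗ V)`, which lies in `V ⊗ L`. Equality of the two spaces follows
  -- because this difference is an idempotent of trace zero, hence zero in characteristic zero.
  have hD : IsIdempotentElem (P1 - E * P1) := by
    show (P1 - E * P1) * (P1 - E * P1) = P1 - E * P1
    have : E * P1 * (E * P1) = E * P1 := by rw [mul_assoc, ← mul_assoc P1, hPE, ← mul_assoc, hE]
    rw [mul_sub, sub_mul, sub_mul, hP1P1, mul_assoc E P1 P1, hP1P1, this, ← mul_assoc P1, hPE]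
    abel
  have hDt : (P1 - E * P1).trace = 0 := by
    rw [Matrix.trace_sub, Matrix.trace_mul_comm, hPE, tr1, tr0, sub_self]
  have hD0 : P1 - E * P1 = 0 := by
    have hl : IsIdempotentElem (Matrix.toLin' (P1 - E * P1)) := by
      show Matrix.toLin' _ * Matrix.toLin' _ = _
      rw [Module.End.mul_eq_comp, ← Matrix.toLin'_mul, hD]
    have := LinearMap.IsIdempotentElem.eq_zero_of_trace_eq_zero hl (by
      rw [Matrix.trace_toLin'_eq, hDt])
    exact (LinearEquiv.map_eq_zero_iff _).1 this
  have hp : p = 0 := by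
    apply hnd
    rw [← s1, ← map_mul, sub_eq_zero.1 hD0, hEdef]
    rw [show K * (F * P0 * G * P1) = K * F * P0 * (G * P1) by simp only [mul_assoc], hp0, zero_mul,
      map_zero]
  rw [← hpY Y ((hU Y).1 h), hp, zero_mul]

lemma exists_left_inverse_of_mulVec {ι : Type*} [Fintype ι] [DecidableEq ι] (U : Matrix ι (Fin N) ℂ)
    (h : ∀ y, U.mulVec y = 0 → y = 0) : ∃ V : Matrix (Fin N) ι ℂ, V * U = 1 := by
  obtain ⟨g, hg⟩ := LinearMap.exists_leftInverse_of_injective U.mulVecLin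
    (LinearMap.ker_eq_bot'.2 h)
  refine ⟨LinearMap.toMatrix' g, ?_⟩
  have : U = LinearMap.toMatrix' U.mulVecLin := by rw [← Matrix.toLin'_apply', LinearMap.toMatrix'_toLin']
  rw [this, ← LinearMap.toMatrix'_comp, hg, LinearMap.toMatrix'_id]

lemma leg_zero_eq_amp (Y : Matrix (Fin N) (Fin N) A) :
    leg 0 Y = amp 0 (place 2 0 (oneStrand Y)) := by
  rw [amp_place _ _ _ (by norm_num), leg]

/-- A complex matrix with trivial kernel has a left inverse, and this inverse still cancels it after
extension of scalars to `A`. -/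
lemma eq_zero_of_scal_mul_leg_eq_zero [NeZero N] {Z : Op N 2 ℂ}
    (h : ∀ Y : Matrix (Fin N) (Fin N) ℂ, Z * place 2 0 (oneStrand Y) = 0 → Y = 0)
    {Y : Matrix (Fin N) (Fin N) A} (hY : scal A 0 Z * leg 0 Y = 0) : Y = 0 := by
  let U : Matrix ((Fin 2 → Fin N) × Fin N) (Fin N) ℂ := Matrix.of fun i a => Z i.1 ![a, i.2]
  obtain ⟨V, hV⟩ := exists_left_inverse_of_mulVec U fun y hy => by
    have : (Matrix.of fun a _ => y a : Matrix (Fin N) (Fin N) ℂ) = 0 := h _ (by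
      ext i j
      have e : j = ![j 0, j 1] := by funext t; fin_cases t <;> rfl
      rw [e, op_two_mul_apply]
      refine Eq.trans ?_ (congrFun hy (i, j 1))
      refine Finset.sum_congr rfl fun x _ => ?_
      rw [Finset.sum_eq_single (j 1) (fun y _ hy => by rw [place_two_leg_apply, if_neg hy, mul_zero])
        (by simp), place_two_leg_apply, if_pos rfl]
      rfl)
    funext a
    exact congrFun (congrFun this a) a
  have hUY : U.map (algebraMap ℂ A) * Y = 0 := by
    rw [leg_zero_eq_amp, scal_def, ← map_mul] at hY
    have h0 := amp_injective 0 (hY.trans (map_zero _).symm)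
    ext i b
    have := congrFun (congrFun h0 i.1) ![b, i.2]
    rw [op_two_mul_apply] at this
    rw [← show (0 : Op N 2 A) i.1 ![b, i.2] = (0 : Matrix _ _ A) i b from rfl, ← this,
      Matrix.mul_apply]
    refine Finset.sum_congr rfl fun x _ => ?_
    rw [Finset.sum_eq_single i.2 (fun y _ hy => by rw [place_two_leg_apply, if_neg hy, mul_zero])
      (by simp), place_two_leg_apply, if_pos rfl]
    rfl
  have := congrArg (V.map (algebraMap ℂ A) * ·) hUY
  simp only [← Matrix.mul_assoc, ← Matrix.map_mul, hV] at this
  simpa using this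

lemma eq_zero_of_leg_mul_scal_eq_zero [NeZero N] {Z : Op N 2 ℂ}
    (h : ∀ Y : Matrix (Fin N) (Fin N) ℂ, place 2 0 (oneStrand Y) * Z = 0 → Y = 0)
    {Y : Matrix (Fin N) (Fin N) A} (hY : leg 0 Y * scal A 0 Z = 0) : Y = 0 := by
  let U : Matrix ((Fin 2 → Fin N) × Fin N) (Fin N) ℂ := Matrix.of fun i a => Z ![a, i.2] i.1
  obtain ⟨V, hV⟩ := exists_left_inverse_of_mulVec U fun y hy => by
    have : (Matrix.of fun _ a => y a : Matrix (Fin N) (Fin N) ℂ) = 0 := h _ (by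
      ext j i
      have e : j = ![j 0, j 1] := by funext t; fin_cases t <;> rfl
      rw [e, op_two_mul_apply]
      refine Eq.trans ?_ (congrFun hy (i, j 1))
      refine Finset.sum_congr rfl fun x _ => ?_
      rw [Finset.sum_eq_single (j 1) (fun y _ hy => by
        rw [place_two_leg_apply, if_neg hy.symm, zero_mul]) (by simp), place_two_leg_apply, if_pos rfl,
        mul_comm]
      rfl)
    funext a
    exact congrFun (congrFun this a) a
  have hUY : Y * U.transpose.map (algebraMap ℂ A) = 0 := by
    rw [leg_zero_eq_amp, scal_def, ← map_mul] at hY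
    have h0 := amp_injective 0 (hY.trans (map_zero _).symm)
    ext b i
    have := congrFun (congrFun h0 ![b, i.2]) i.1
    rw [op_two_mul_apply] at this
    rw [← show (0 : Op N 2 A) ![b, i.2] i.1 = (0 : Matrix _ _ A) b i from rfl, ← this,
      Matrix.mul_apply]
    refine Finset.sum_congr rfl fun x _ => ?_
    rw [Finset.sum_eq_single i.2 (fun y _ hy => by
      rw [place_two_leg_apply, if_neg hy.symm, zero_mul]) (by simp), place_two_leg_apply, if_pos rfl]
    rfl
  have := congrArg (· * V.transpose.map (algebraMap ℂ A)) hUY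
  simp only [Matrix.mul_assoc, ← Matrix.map_mul, ← Matrix.transpose_mul, hV] at this
  simpa using this

lemma place_transpose {n : ℕ} (m j : ℕ) (X : Op N n ℂ) :
    place m j X.transpose = (place m j X).transpose := by
  ext a b
  simp only [place, Matrix.of_apply, Matrix.transpose_apply, eq_comm]

lemma scal_transpose_of [NeZero N] {X₁ X₂ X₃ Y₁ Y₂ Y₃ Y₄ Y₅ : Op N 2 ℂ}
    (h : scal ℂ 0 X₁ * scal ℂ 1 X₂ * scal ℂ 1 X₃ =
      scal ℂ 1 Y₁ * scal ℂ 0 Y₂ * scal ℂ 0 Y₃ * scal ℂ 1 Y₄ * scal ℂ 0 Y₅) :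
    scal ℂ 1 X₃.transpose * scal ℂ 1 X₂.transpose * scal ℂ 0 X₁.transpose =
      scal ℂ 0 Y₅.transpose * scal ℂ 1 Y₄.transpose * scal ℂ 0 Y₃.transpose *
        scal ℂ 0 Y₂.transpose * scal ℂ 1 Y₁.transpose := by
  have s0 : ∀ X : Op N 2 ℂ, scal ℂ 0 X = scal ℂ 0 (place 3 0 X) := fun X => (scal_place_zero 0 X).symm
  have s1 : ∀ X : Op N 2 ℂ, scal ℂ 1 X = scal ℂ 0 (place 3 1 X) := fun X => (scal_place_one 0 X).symm
  simp only [s0, s1, ← map_mul] at h ⊢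
  have e1 := congrArg Matrix.transpose (scal_injective 0 h)
  simp only [Matrix.transpose_mul, ← place_transpose, ← mul_assoc] at e1
  rw [e1]

section
variable {q μ : ℂ} {R F : Op N 2 ℂ} (hc : IsCompatiblePair R F) (hB : IsBMWType q μ R)
include hc hB

lemma IsCompatiblePair.shift_opK₂ (n : ℕ) :
    scal A n F * scal A (n + 1) F * scal A n (opK q μ R) =
      scal A (n + 1) (opK q μ R) * (scal A n F * scal A (n + 1) F) :=
  (hB.gen A n).intertwine_k hB.param (hB.gen A (n + 1)) (by rw [← hc.shift₂, mul_assoc])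

/-- The transpose of this relation is the hypothesis `hrel` of the kernel argument for the pair
`Kᵀ`, `(F⁻¹)ᵀ`, which handles cancellation on the other side. -/
lemma IsCompatiblePair.inv_shift_opK : scal ℂ 0 F⁻¹ * scal ℂ 1 F⁻¹ * scal ℂ 1 (opK q μ R) =
    scal ℂ 1 F * scal ℂ 0 F⁻¹ * scal ℂ 0 (opK q μ R) * scal ℂ 1 F⁻¹ * scal ℂ 0 F⁻¹ := by
  have hF := hc.rMatrix_right
  have e1 := hc.shift_opK₂ (A := ℂ) hB 0
  have b := hF.braid (A := ℂ) 0
  rw [zero_add] at *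
  have i1 := hF.mul_inv (A := ℂ) 0
  have i2 := hF.inv_mul (A := ℂ) 0
  have i3 := hF.mul_inv (A := ℂ) 1
  have i4 := hF.inv_mul (A := ℂ) 1
  generalize scal ℂ 0 F = f at *
  generalize scal ℂ 1 F = g at *
  generalize scal ℂ 0 F⁻¹ = f' at *
  generalize scal ℂ 1 F⁻¹ = g' at *
  generalize scal ℂ 0 (opK q μ R) = k at *
  generalize scal ℂ 1 (opK q μ R) = l at *
  have c1 : g' * f' * (f * g) = 1 := by
    rw [mul_assoc, ← mul_assoc f', i2, one_mul, i4]
  have c2 : f * g * (g' * f') = 1 := by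
    rw [mul_assoc, ← mul_assoc g, i3, one_mul, i1]
  have e2 : k * (g' * f') = g' * f' * l := by
    calc k * (g' * f') = g' * f' * (f * g * k) * (g' * f') := by
          rw [← mul_assoc (g' * f'), c1, one_mul]
      _ = g' * f' * l * (f * g * (g' * f')) := by rw [e1]; simp only [mul_assoc]
      _ = _ := by rw [c2, mul_one]
  have e3 : f' * (g' * f') = g' * f' * g' := by
    have c3 : (f * g * f) * (f' * (g' * f')) = 1 := by
      simp only [mul_assoc]
      rw [← mul_assoc f f', i1, one_mul, ← mul_assoc g g', i3, one_mul, i1]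
    have c4 : (g' * f' * g') * (g * f * g) = 1 := by
      simp only [mul_assoc]
      rw [← mul_assoc g' g, i4, one_mul, ← mul_assoc f' f, i2, one_mul, i4]
    exact (left_inv_eq_right_inv (by rw [b]; exact c4) c3).symm
  have e4 : g * f' * k * g' * f' = g * (f' * (k * (g' * f'))) := by simp only [mul_assoc]
  rw [e4, e2, ← mul_assoc f', e3]
  simp only [← mul_assoc]
  rw [i3, one_mul]

variable [NeZero N]

/-- `K F (Y ⊗ 1) = 0` only for `Y = 0`. -/
lemma IsCompatiblePair.eq_zero_of_opK_mul_F_mul {Y : Matrix (Fin N) (Fin N) A}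
    (h : scal A 0 (opK q μ R) * scal A 0 F * leg 0 Y = 0) : Y = 0 := by
  have hF := hc.rMatrix_right
  rw [← map_mul] at h
  refine eq_zero_of_scal_mul_leg_eq_zero (fun Y hY => ?_) h
  refine eq_zero_of_mul_place_eq_zero (G := F⁻¹)
    (scal_injective 0 (by rw [map_mul, hF.inv_mul, map_one])) ?_
    (fun Y hY => hB.eq_zero_of_opK_mul_leg hY) hY
  rw [hc.shift_opK₂ hB 0]
  have b := hF.braid (A := ℂ) 0
  rw [zero_add] at *
  rw [mul_assoc (scal ℂ 1 (opK q μ R)), mul_assoc (scal ℂ 1 (opK q μ R)), mul_assoc (scal ℂ 1 (opK q μ R)), b]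
  simp only [mul_assoc]
  rw [hF.mul_inv, mul_one]

/-- `(Y ⊗ 1) F⁻¹ K = 0` only for `Y = 0`. -/
lemma IsCompatiblePair.eq_zero_of_mul_F_inv_mul_opK {Y : Matrix (Fin N) (Fin N) A}
    (h : leg 0 Y * (scal A 0 F⁻¹ * scal A 0 (opK q μ R)) = 0) : Y = 0 := by
  have hF := hc.rMatrix_right
  have hFF : F * F⁻¹ = 1 := scal_injective 0 (by rw [map_mul, hF.mul_inv, map_one])
  rw [← map_mul] at h
  refine eq_zero_of_leg_mul_scal_eq_zero (fun Y hY => ?_) h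
  have hY' : (opK q μ R).transpose * F⁻¹.transpose * place 2 0 (oneStrand Y.transpose) = 0 := by
    rw [show oneStrand Y.transpose = (oneStrand Y).transpose from rfl, place_transpose,
      ← Matrix.transpose_mul, ← Matrix.transpose_mul, hY, Matrix.transpose_zero]
  have e := eq_zero_of_mul_place_eq_zero (G := F.transpose)
    (by rw [← Matrix.transpose_mul, Matrix.nonsing_inv_mul _
      ((Matrix.isUnit_iff_isUnit_det _).1 hF.isUnit), Matrix.transpose_one]) ?_
    (fun Z hZ => ?_) hY'
  · rw [← Matrix.transpose_transpose Y, e, Matrix.transpose_zero]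
  · exact scal_transpose_of (hc.inv_shift_opK hB)
  · have e0 : (opK q μ R).transpose * place 2 1 (oneStrand Z) = 0 := by
      apply scal_injective 0
      rw [map_mul, scal_place 0 (by norm_num), map_zero]
      exact hZ
    have e1 := congrArg Matrix.transpose e0
    rw [Matrix.transpose_mul, ← place_transpose, Matrix.transpose_transpose, Matrix.transpose_zero] at e1
    have e2 : leg 1 (Z.transpose.map (algebraMap ℂ ℂ)) * scal ℂ 0 (opK q μ R) = 0 := by
      have := congrArg (scal ℂ 0) e1
      rw [map_mul, scal_place 0 (by norm_num), map_zero] at this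
      rw [leg_map]
      exact this
    have e3 := hB.eq_zero_of_leg_mul_opK (n := 0) e2
    ext a b
    exact congrFun (congrFun e3 b) a

end

end

/-! ### Rows of generators -/

section

variable {N : ℕ} {A : Type*} [Ring A] [Algebra ℂ A]

section Rows
variable {W : Type*} [Ring W]

/-- `x_s x_{s+1} ⋯ x_{s+i-1}`. -/
def rowProd (x : ℕ → W) (s : ℕ) : ℕ → W
  | 0 => 1
  | i + 1 => rowProd x s i * x (s + i)

/-- `x_{s+i-1} ⋯ x_{s+1} x_s`. -/
def colProd (x : ℕ → W) (s : ℕ) : ℕ → W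
  | 0 => 1
  | i + 1 => x (s + i) * colProd x s i

lemma rowProd_succ (x : ℕ → W) (s i : ℕ) : rowProd x s (i + 1) = rowProd x s i * x (s + i) := rfl
lemma colProd_succ (x : ℕ → W) (s i : ℕ) : colProd x s (i + 1) = x (s + i) * colProd x s i := rfl

lemma rowProd_one (x : ℕ → W) (s : ℕ) : rowProd x s 1 = x s := by
  rw [rowProd, rowProd, one_mul, add_zero]

lemma colProd_one (x : ℕ → W) (s : ℕ) : colProd x s 1 = x s := by
  rw [colProd, colProd, mul_one, add_zero]

lemma rowProd_add (x : ℕ → W) (s i j : ℕ) :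
    rowProd x s (i + j) = rowProd x s i * rowProd x (s + i) j := by
  induction j with
  | zero => rw [add_zero, rowProd, mul_one]
  | succ j ih => rw [← add_assoc, rowProd, ih, rowProd, mul_assoc, add_assoc]

lemma colProd_add (x : ℕ → W) (s i j : ℕ) :
    colProd x s (i + j) = colProd x (s + i) j * colProd x s i := by
  induction j with
  | zero => rw [add_zero, colProd, one_mul]
  | succ j ih => rw [← add_assoc, colProd, ih, colProd, mul_assoc, add_assoc]

lemma rowProd_succ' (x : ℕ → W) (s i : ℕ) : rowProd x s (i + 1) = x s * rowProd x (s + 1) i := by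
  rw [add_comm, rowProd_add, rowProd_one]

lemma colProd_succ' (x : ℕ → W) (s i : ℕ) : colProd x s (i + 1) = colProd x (s + 1) i * x s := by
  rw [add_comm, colProd_add, colProd_one]

lemma rowProd_mul_colProd {x y : ℕ → W} (h : ∀ j, x j * y j = 1) (s i : ℕ) :
    rowProd x s i * colProd y s i = 1 := by
  induction i with
  | zero => rw [rowProd, colProd, mul_one]
  | succ i ih => rw [rowProd, colProd, mul_assoc, ← mul_assoc (x _), h, one_mul, ih]

lemma colProd_mul_rowProd {x y : ℕ → W} (h : ∀ j, y j * x j = 1) (s i : ℕ) :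
    colProd y s i * rowProd x s i = 1 := by
  induction i generalizing s with
  | zero => rw [rowProd, colProd, mul_one]
  | succ i ih => rw [rowProd_succ', colProd_succ', mul_assoc, ← mul_assoc (y _), h, one_mul, ih]

lemma Commute.rowProd_right {x : ℕ → W} {a : W} {s i : ℕ}
    (h : ∀ j, s ≤ j → j < s + i → Commute a (x j)) : Commute a (rowProd x s i) := by
  induction i with
  | zero => exact Commute.one_right _
  | succ i ih => exact (ih fun j h1 h2 => h j h1 (by omega)).mul_right (h _ (by omega) (by omega))

lemma Commute.colProd_right {x : ℕ → W} {a : W} {s i : ℕ}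
    (h : ∀ j, s ≤ j → j < s + i → Commute a (x j)) : Commute a (colProd x s i) := by
  induction i with
  | zero => exact Commute.one_right _
  | succ i ih => exact (h _ (by omega) (by omega)).mul_right (ih fun j h1 h2 => h j h1 (by omega))

/-- A row shifts its generators. -/
lemma rowProd_mul_of_shift {x y : ℕ → W} (hs : ∀ j, x j * x (j + 1) * y j = y (j + 1) * (x j * x (j + 1)))
    (hc : ∀ j j', j + 1 < j' → Commute (x j') (y j)) (hc' : ∀ j j', j' + 1 < j → Commute (x j') (y j))
    {s i j : ℕ} (h1 : s ≤ j) (h2 : j + 1 < s + i) :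
    rowProd x s i * y j = y (j + 1) * rowProd x s i := by
  induction i with
  | zero => omega
  | succ i ih =>
    rcases Nat.lt_or_ge (j + 1) (s + i) with h | h
    · rw [rowProd, mul_assoc, (hc j (s + i) h).eq, ← mul_assoc, ih h, mul_assoc]
    · obtain ⟨i, rfl⟩ : ∃ i', i = i' + 1 := ⟨i - 1, by omega⟩
      obtain rfl : j = s + i := by omega
      rw [rowProd, rowProd, mul_assoc _ (x (s + i)), mul_assoc, ← add_assoc, hs, ← mul_assoc,
        ← ((Commute.rowProd_right fun j h3 h4 => (hc' (s + i + 1) j (by omega)).symm).eq), mul_assoc]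

/-- A column shifts its generators. -/
lemma colProd_mul_of_shift {x y : ℕ → W} (hs : ∀ j, x (j + 1) * x j * y (j + 1) = y j * (x (j + 1) * x j))
    (hc : ∀ j j', j + 1 < j' → Commute (x j') (y j)) (hc' : ∀ j j', j' + 1 < j → Commute (x j') (y j))
    {s i j : ℕ} (h1 : s ≤ j) (h2 : j + 1 < s + i) :
    colProd x s i * y (j + 1) = y j * colProd x s i := by
  induction i with
  | zero => omega
  | succ i ih =>
    rcases Nat.lt_or_ge (j + 1) (s + i) with h | h
    · rw [colProd, mul_assoc, ih h, ← mul_assoc, (hc j (s + i) h).eq, mul_assoc]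
    · obtain ⟨i, rfl⟩ : ∃ i', i = i' + 1 := ⟨i - 1, by omega⟩
      obtain rfl : j = s + i := by omega
      rw [colProd, colProd, mul_assoc, mul_assoc,
        ← ((Commute.colProd_right fun j h3 h4 => (hc' (s + i + 1) j (by omega)).symm).eq),
        ← mul_assoc (x (s + i)), ← mul_assoc, ← mul_assoc, ← add_assoc, hs]
      simp only [mul_assoc]

end Rows

/-! ### Copies of a matrix -/

/-- The copy of `X` on the leg `i`, obtained by conjugation with `F`. -/
def cop (F : Op N 2 ℂ) (X : Matrix (Fin N) (Fin N) A) : ℕ → LegOp N A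
  | 0 => leg 0 X
  | i + 1 => scal A i F * cop F X i * scal A i F⁻¹

/-- The product of the copies `s, …, s + i - 1`. -/
abbrev copSeg (F : Op N 2 ℂ) (X : Matrix (Fin N) (Fin N) A) (s i : ℕ) : LegOp N A :=
  rowProd (cop F X) s i

section
variable (F : Op N 2 ℂ) (X Y : Matrix (Fin N) (Fin N) A)

lemma cop_off {i p : ℕ} (h : i < p) : Off p (cop F X i) := by
  induction i with
  | zero => exact leg_off (by omega) _
  | succ i ih =>
    exact ((scal_off _ _ (by omega)).mul (ih (by omega))).mul (scal_off _ _ (by omega))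

lemma copSeg_off {s i p : ℕ} (h : s + i ≤ p) : Off p (copSeg F X s i) := by
  induction i with
  | zero => exact Off.one
  | succ i ih => exact (ih (by omega)).mul (cop_off _ _ (by omega))

lemma cop_add (i : ℕ) : cop F (X + Y) i = cop F X i + cop F Y i := by
  induction i with
  | zero => exact leg_add _ _ _
  | succ i ih => rw [cop, ih, mul_add, add_mul]; rfl

lemma cop_rmul (c : A) (i : ℕ) : cop F (rmul X c) i = cop F X i * coef c := by
  induction i with
  | zero => exact leg_mul_coef _ _ _
  | succ i ih =>
    rw [cop, ih, cop, mul_assoc, mul_assoc (cop F X i), (coef_comm_scal c i F⁻¹).eq]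
    simp only [mul_assoc]

lemma cop_comm_scal_of_lt {n : ℕ} {i j : ℕ} (h : i < j) (Z : Op N n ℂ) :
    Commute (cop F X i) (scal A j Z) :=
  (commute_scal_of_off (fun m h1 _ => cop_off F X (by omega)) Z).symm

lemma amp_copy {m i : ℕ} (h : i < m) : amp 0 (copy F X m i) = cop F X i := by
  induction i with
  | zero =>
    rw [copy, amp_place _ _ _ (by omega)]
    rfl
  | succ i ih =>
    rw [copy, map_mul, map_mul, ih (by omega), ← scal_def, ← scal_def, scal_place _ (by omega),
      scal_place _ (by omega), zero_add, cop]

lemma amp_copiesProd (n : ℕ) : amp 0 (copiesProd F X n) = copSeg F X 0 n := by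
  rw [copiesProd, map_list_prod, List.map_map]
  have : ∀ i ≤ n, ((List.range i).map (amp 0 ∘ copy F X n)).prod = copSeg F X 0 i := by
    intro i hi
    induction i with
    | zero => rfl
    | succ i ih =>
      rw [List.range_succ, List.map_append, List.prod_append, ih (by omega), List.map_singleton,
        List.prod_singleton, Function.comp_apply, amp_copy _ _ (by omega), copSeg, copSeg, rowProd_succ, zero_add]
  exact this n le_rfl

variable (R : Op N 2 ℂ)

lemma coef_ch {n : ℕ} (x : Op N n ℂ) :
    coef (ch R F X x) = iterTrace (matD R) 0 n (copSeg F X 0 n * scal A 0 x) := by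
  rw [ch, ← iterTrace_amp_full _ 0, map_mul, amp_copiesProd]
  rfl

lemma leg_desc {s : ℕ} (x : Op N (s + 1) ℂ) :
    leg 0 (desc R F X x) = iterTrace (matD R) 1 s (copSeg F X 0 (s + 1) * scal A 0 x) := by
  rw [desc, leg, ← iterTrace_amp_tail _ 0, map_mul, amp_copiesProd]
  rfl

end

section
variable {R F : Op N 2 ℂ} {M : Matrix (Fin N) (Fin N) A}

lemma IsRMatrix.intertwine_inv (h : IsRMatrix R) {a : LegOp N A} {i j : ℕ}
    (e : a * scal A i R = scal A j R * a) : a * scal A i R⁻¹ = scal A j R⁻¹ * a :=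
  QM.intertwine_inv (h.mul_inv i) (h.inv_mul j) e

lemma IsRMatrix.intertwine (h : IsRMatrix R) {n : ℕ} {a : LegOp N A} {s t : ℕ}
    (ha : ∀ j, j + 2 ≤ n → a * scal A (s + j) R = scal A (t + j) R * a)
    {X : Op N n ℂ} (hX : X ∈ braidImage R n) : a * scal A s X = scal A t X * a := by
  induction hX using Algebra.adjoin_induction with
  | mem X hX =>
    obtain ⟨j, hj, rfl | rfl⟩ := hX
    · rw [scal_place _ hj, scal_place _ hj, ha j hj]
    · rw [scal_place _ hj, scal_place _ hj, h.intertwine_inv (ha j hj)]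
  | algebraMap z => rw [AlgHom.commutes, AlgHom.commutes, Algebra.commutes]
  | add X Y _ _ hX hY => rw [map_add, map_add, mul_add, add_mul, hX, hY]
  | mul X Y _ _ hX hY => rw [map_mul, map_mul, ← mul_assoc, hX, mul_assoc, hY, mul_assoc]

lemma IsRMatrix.commute_of (h : IsRMatrix R) {n : ℕ} {a : LegOp N A} {s : ℕ}
    (ha : ∀ j, j + 2 ≤ n → Commute a (scal A (s + j) R)) {X : Op N n ℂ} (hX : X ∈ braidImage R n) :
    Commute a (scal A s X) :=
  h.intertwine (fun j hj => (ha j hj).eq) hX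

/-- For the copy at `j + 2`, `R_j` passes through `F_{j+1} F_j` as `R_{j+1}`, which commutes with
the copy at `j`, and returns to `R_j` through the inverse factors. Later copies only add factors `F`
on disjoint legs. -/
lemma scal_comm_cop (hc : IsCompatiblePair R F) {i j : ℕ} (h : j + 1 < i) (X : Matrix (Fin N) (Fin N) A) :
    Commute (scal A j R) (cop F X i) := by
  obtain ⟨p, rfl⟩ := Nat.exists_eq_add_of_le' h
  induction p with
  | zero =>
    rw [zero_add, cop, cop]
    have e1 := hc.shift₁ (A := A) j
    have hF := hc.rMatrix_right
    have e2 : scal A j F⁻¹ * scal A (j + 1) F⁻¹ * scal A j R =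
        scal A (j + 1) R * (scal A j F⁻¹ * scal A (j + 1) F⁻¹) := by
      have a1 : scal A j F⁻¹ * scal A (j + 1) F⁻¹ * (scal A (j + 1) F * scal A j F) = 1 := by
        rw [mul_assoc, ← mul_assoc (scal A (j + 1) F⁻¹), hF.inv_mul, one_mul, hF.inv_mul]
      have a2 : scal A (j + 1) F * scal A j F * (scal A j F⁻¹ * scal A (j + 1) F⁻¹) = 1 := by
        rw [mul_assoc, ← mul_assoc (scal A j F), hF.mul_inv, one_mul, hF.mul_inv]
      generalize scal A j F⁻¹ * scal A (j + 1) F⁻¹ = c' at *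
      rw [mul_assoc] at e1
      generalize scal A (j + 1) F * scal A j F = c at *
      calc c' * scal A j R = c' * (scal A j R * c) * c' := by rw [mul_assoc, mul_assoc, a2, mul_one]
        _ = _ := by rw [e1, ← mul_assoc, a1, one_mul]
    have e3 := (cop_comm_scal_of_lt F X (Nat.lt_succ_self j) R).eq
    show _ * _ = _ * _
    calc _ = scal A j R * scal A (j + 1) F * scal A j F * cop F X j *
            (scal A j F⁻¹ * scal A (j + 1) F⁻¹) := by simp only [mul_assoc]
      _ = scal A (j + 1) F * scal A j F * (scal A (j + 1) R * cop F X j) *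
            (scal A j F⁻¹ * scal A (j + 1) F⁻¹) := by rw [e1]; simp only [mul_assoc]
      _ = scal A (j + 1) F * scal A j F * cop F X j * (scal A (j + 1) R *
            (scal A j F⁻¹ * scal A (j + 1) F⁻¹)) := by rw [← e3]; simp only [mul_assoc]
      _ = _ := by rw [← e2]; simp only [mul_assoc]
  | succ p ih =>
    rw [show p + 1 + (j + 1).succ = p + (j + 1).succ + 1 by omega, cop]
    exact ((scal_comm_scal (by omega) _ _).mul_right (ih (by omega))).mul_right
      (scal_comm_scal (by omega) _ _)

end

/-! ### Moving copies of a matrix and their R-traces along the legs. -/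

section Shift

variable {R F : Op N 2 ℂ} (hc : IsCompatiblePair R F)

/-- `F_n F_{n+1} ⋯ F_{n+i-1}`. -/
abbrev fRow (A : Type*) [Ring A] [Algebra ℂ A] (F : Op N 2 ℂ) (n i : ℕ) : LegOp N A :=
  rowProd (fun j => scal A j F) n i

abbrev fCol (A : Type*) [Ring A] [Algebra ℂ A] (F : Op N 2 ℂ) (n i : ℕ) : LegOp N A :=
  colProd (fun j => scal A j F) n i

lemma IsRMatrix.fRow_mul_fCol (hF : IsRMatrix F) (n i : ℕ) : fRow A F n i * fCol A F⁻¹ n i = 1 :=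
  rowProd_mul_colProd (fun j => hF.mul_inv j) n i

lemma IsRMatrix.fCol_mul_fRow (hF : IsRMatrix F) (n i : ℕ) : fCol A F⁻¹ n i * fRow A F n i = 1 :=
  colProd_mul_rowProd (fun j => hF.inv_mul j) n i

lemma fRow_off {n i p : ℕ} (h : p < n ∨ n + i < p) : Off p (fRow A F n i) := by
  induction i with
  | zero => exact Off.one
  | succ i ih => exact (ih (by omega)).mul (scal_off _ _ (by omega))

lemma fCol_off {n i p : ℕ} (h : p < n ∨ n + i < p) : Off p (fCol A F n i) := by
  induction i with
  | zero => exact Off.one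
  | succ i ih => exact Off.mul (scal_off _ _ (by omega)) (ih (by omega))

include hc

lemma IsCompatiblePair.fRow_mul_scal {n i j : ℕ} (h1 : n ≤ j) (h2 : j + 1 < n + i) :
    fRow A F n i * scal A j R = scal A (j + 1) R * fRow A F n i :=
  rowProd_mul_of_shift (y := fun j => scal A j R)
    (fun j => by rw [← hc.shift₂, mul_assoc])
    (fun j j' h => scal_comm_scal (by omega) _ _) (fun j j' h => scal_comm_scal (by omega) _ _) h1 h2

/-- Each factor of the row carries one copy to the next position; it commutes with the copies
standing before it, and the new copy commutes with the remaining factors of the row. -/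
lemma IsCompatiblePair.fRow_conj_copSeg (X : Matrix (Fin N) (Fin N) A) (n i : ℕ) :
    fRow A F n i * copSeg F X n i = copSeg F X (n + 1) i * fRow A F n i := by
  have hF := hc.rMatrix_right
  induction i with
  | zero => simp [rowProd]
  | succ i ih =>
    have c1 : Commute (scal A (n + i) F) (copSeg F X n i) :=
      Commute.rowProd_right fun j _ h => (cop_comm_scal_of_lt F X h F).symm
    have c2 : scal A (n + i) F * cop F X (n + i) = cop F X (n + i + 1) * scal A (n + i) F := by
      rw [cop, mul_assoc, hF.inv_mul, mul_one]
    have c3 : Commute (cop F X (n + i + 1)) (fRow A F n i) :=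
      Commute.rowProd_right fun j _ h => (scal_comm_cop hF.compatible_self (by omega) X).symm
    calc fRow A F n (i + 1) * copSeg F X n (i + 1) =
        fRow A F n i * (scal A (n + i) F * copSeg F X n i) * cop F X (n + i) := by
          rw [fRow, rowProd_succ, copSeg, rowProd_succ]; simp only [mul_assoc]
      _ = fRow A F n i * copSeg F X n i * (scal A (n + i) F * cop F X (n + i)) := by
          rw [c1.eq]; simp only [mul_assoc]
      _ = copSeg F X (n + 1) i * (fRow A F n i * cop F X (n + i + 1)) * scal A (n + i) F := by
          rw [c2, ih]; simp only [mul_assoc]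
      _ = copSeg F X (n + 1) i * cop F X (n + 1 + i) * (fRow A F n i * scal A (n + i) F) := by
          rw [← c3.eq, show n + 1 + i = n + i + 1 by omega]; simp only [mul_assoc]
      _ = _ := rfl

lemma IsCompatiblePair.scal_comm_copSeg {s i j : ℕ} (h : j + 1 < s) (X : Matrix (Fin N) (Fin N) A) :
    Commute (scal A j R) (copSeg F X s i) :=
  Commute.rowProd_right fun p hp _ => scal_comm_cop hc (by omega) X

lemma IsCompatiblePair.scal_comm_copSeg_of_mem {n s i j : ℕ} (h : j + n ≤ s)
    (X : Matrix (Fin N) (Fin N) A) {x : Op N n ℂ} (hx : x ∈ braidImage R n) :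
    Commute (copSeg F X s i) (scal A j x) :=
  hc.rMatrix_left.commute_of (fun p hp => (hc.scal_comm_copSeg (by omega) X).symm) hx

lemma IsCompatiblePair.fRow_mul_scal_of_mem (n : ℕ) {i : ℕ} {x : Op N i ℂ} (hx : x ∈ braidImage R i) :
    fRow A F n i * scal A n x = scal A (n + 1) x * fRow A F n i :=
  hc.rMatrix_left.intertwine (fun j hj => by
    rw [hc.fRow_mul_scal (by omega) (by omega), show n + 1 + j = n + j + 1 by omega]) hx

lemma IsCompatiblePair.conj_copSeg_mul_scal (X : Matrix (Fin N) (Fin N) A) (n : ℕ) {i : ℕ} {x : Op N i ℂ}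
    (hx : x ∈ braidImage R i) : copSeg F X (n + 1) i * scal A (n + 1) x =
      fRow A F n i * (copSeg F X n i * scal A n x) * fCol A F⁻¹ n i := by
  rw [← mul_assoc, hc.fRow_conj_copSeg, mul_assoc _ (fRow A F n i), hc.fRow_mul_scal_of_mem n hx,
    mul_assoc, mul_assoc (scal A (n + 1) x), hc.rMatrix_right.fRow_mul_fCol, mul_one]

section
variable (hs : SkewInvertible R) [NeZero N]
include hs

lemma IsCompatiblePair.iterTrace_conj {n i : ℕ} {B : LegOp N A} (hB : ∀ p, n + i ≤ p → Off p B) :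
    iterTrace (matD R) (n + 1) i (fRow A F n i * B * fCol A F⁻¹ n i) = iterTrace (matD R) n i B := by
  induction i generalizing B with
  | zero => simp [rowProd, colProd]
  | succ i ih =>
    rw [iterTrace_succ, iterTrace_succ, fRow, fCol, rowProd_succ, colProd_succ]
    have e : rowProd (fun j => scal A j F) n i * scal A (n + i) F * B *
        (scal A (n + i) F⁻¹ * colProd (fun j => scal A j F⁻¹) n i) =
        rowProd (fun j => scal A j F) n i * (scal A (n + i) F * B * scal A (n + i) F⁻¹) *
          colProd (fun j => scal A j F⁻¹) n i := by simp only [mul_assoc]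
    rw [e, legTrace_mul_right _ (fCol_off (by omega)), legTrace_mul_left _ (fRow_off (by omega)),
      show n + 1 + i = n + i + 1 by omega, hc.legTrace_conj hs (hB _ (by omega)), ih]
    intro p hp
    rcases Nat.eq_or_lt_of_le hp with rfl | h
    · exact legTrace_off_self _ _ _
    · exact legTrace_off _ (hB _ (by omega))

/-- A segment of copies one position further is conjugate to the original one by a row of `F`, and
the R-trace does not see this conjugation. So a characteristic element may be split off at any
position. -/
lemma IsCompatiblePair.iterTrace_copSeg (X : Matrix (Fin N) (Fin N) A) (n : ℕ) {i : ℕ} {x : Op N i ℂ}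
    (hx : x ∈ braidImage R i) :
    iterTrace (matD R) n i (copSeg F X n i * scal A n x) = coef (ch R F X x) := by
  induction n with
  | zero => rw [coef_ch]
  | succ n ih =>
    rw [hc.conj_copSeg_mul_scal X n hx, hc.iterTrace_conj hs, ih]
    exact fun p hp => (copSeg_off _ _ hp).mul (scal_off _ _ (by omega))

lemma IsCompatiblePair.tail_copSeg (X : Matrix (Fin N) (Fin N) A) (n : ℕ) {i : ℕ} {x : Op N (i + 1) ℂ}
    (hx : x ∈ braidImage R (i + 1)) :
    iterTrace (matD R) (n + 1) i (copSeg F X n (i + 1) * scal A n x) = cop F (desc R F X x) n := by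
  induction n with
  | zero => rw [cop, leg_desc]
  | succ n ih =>
    rw [hc.conj_copSeg_mul_scal X n hx, fRow, fCol, rowProd_succ', colProd_succ', cop, ← ih,
      ← hc.iterTrace_conj hs (n := n + 1) (i := i)]
    · rw [← iterTrace_mul_left _ fun p hp _ => scal_off _ _ (by omega),
        ← iterTrace_mul_right _ fun p hp _ => scal_off _ _ (by omega)]
      simp only [mul_assoc]
    · exact fun p hp => (copSeg_off _ _ (by omega)).mul (scal_off _ _ (by omega))

end

end Shift

/-! ### Quantum matrices -/

/-- The defining relation of a quantum matrix. -/
def IsQuantumMatrix (R F : Op N 2 ℂ) (M : Matrix (Fin N) (Fin N) A) : Prop :=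
  R.lift A * (copy F M 2 0 * copy F M 2 1) = copy F M 2 0 * copy F M 2 1 * R.lift A

section Quantum

variable {R F : Op N 2 ℂ} (hc : IsCompatiblePair R F) {M : Matrix (Fin N) (Fin N) A}
  (hM : IsQuantumMatrix R F M)
include hc hM

/-- The defining relation at the first two copies is conjugated along the legs by rows of `F`. -/
lemma IsQuantumMatrix.comm (i : ℕ) : Commute (scal A i R) (cop F M i * cop F M (i + 1)) := by
  induction i with
  | zero =>
    have := congrArg (amp 0) hM
    rwa [map_mul, map_mul _ (_ * _), map_mul, amp_copy _ _ (by norm_num), amp_copy _ _ (by norm_num)] at this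
  | succ i ih =>
    have hF := hc.rMatrix_right
    have e := hc.fRow_conj_copSeg M i 2
    have e2 := hc.fRow_mul_scal (A := A) (n := i) (i := 2) (j := i) (by omega) (by omega)
    have p : ∀ j, copSeg F M j 2 = cop F M j * cop F M (j + 1) := fun j => by
      rw [copSeg, rowProd, rowProd_one]
    rw [← p] at *
    have e3 : copSeg F M (i + 1) 2 = fRow A F i 2 * copSeg F M i 2 * fCol A F⁻¹ i 2 := by
      rw [e, mul_assoc, hF.fRow_mul_fCol, mul_one]
    have e4 : scal A (i + 1) R = fRow A F i 2 * scal A i R * fCol A F⁻¹ i 2 := by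
      rw [e2, mul_assoc, hF.fRow_mul_fCol, mul_one]
    have e5 := hF.fCol_mul_fRow (A := A) i 2
    rw [e3, e4]
    generalize fRow A F i 2 = c at *
    generalize fCol A F⁻¹ i 2 = c' at *
    have : ∀ a b : LegOp N A, c * a * c' * (c * b * c') = c * (a * b) * c' := fun a b => by
      calc _ = c * a * (c' * c) * b * c' := by simp only [mul_assoc]
        _ = _ := by rw [e5, mul_one]; simp only [mul_assoc]
    show _ * _ = _ * _
    rw [this, this, ih.eq]

lemma IsQuantumMatrix.comm_copSeg {s i j : ℕ} (h1 : s ≤ j) (h2 : j + 1 < s + i) :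
    Commute (scal A j R) (copSeg F M s i) := by
  obtain ⟨p, rfl⟩ := Nat.exists_eq_add_of_le h1
  obtain ⟨t, rfl⟩ : ∃ t, i = p + (1 + 1) + t := ⟨i - (p + 2), by omega⟩
  rw [copSeg, rowProd_add, rowProd_add]
  refine (Commute.mul_right ?_ ?_).mul_right ?_
  · exact Commute.rowProd_right fun a _ h => (cop_comm_scal_of_lt F M h R).symm
  · rw [rowProd_add, rowProd_one, rowProd_one]
    exact hM.comm hc _
  · exact Commute.rowProd_right fun a h _ => scal_comm_cop hc (by omega) M

lemma IsQuantumMatrix.comm_copSeg_of_mem {n s i j : ℕ} (h1 : s ≤ j) (h2 : j + n ≤ s + i)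
    {x : Op N n ℂ} (hx : x ∈ braidImage R n) : Commute (copSeg F M s i) (scal A j x) :=
  hc.rMatrix_left.commute_of (fun p hp => (hM.comm_copSeg hc (by omega) (by omega)).symm) hx

end Quantum

end

/-! ### Braid operators on the legs between two bounds -/

section

variable {N : ℕ} {A : Type*} [Ring A] [Algebra ℂ A]

/-- The algebra generated by the braid generators on the legs `a, …, b - 1`. -/
def braidLeg (A : Type*) [Ring A] [Algebra ℂ A] (R : Op N 2 ℂ) (a b : ℕ) : Subalgebra ℂ (LegOp N A) :=
  Algebra.adjoin ℂ {x | ∃ j, a ≤ j ∧ j + 2 ≤ b ∧ (x = scal A j R ∨ x = scal A j R⁻¹)}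

section
variable {R : Op N 2 ℂ}

lemma scal_mem_braidLeg {a b j : ℕ} (h1 : a ≤ j) (h2 : j + 2 ≤ b) : scal A j R ∈ braidLeg A R a b :=
  Algebra.subset_adjoin ⟨j, h1, h2, Or.inl rfl⟩

lemma scal_inv_mem_braidLeg {a b j : ℕ} (h1 : a ≤ j) (h2 : j + 2 ≤ b) :
    scal A j R⁻¹ ∈ braidLeg A R a b :=
  Algebra.subset_adjoin ⟨j, h1, h2, Or.inr rfl⟩

lemma braidLeg_mono {a b a' b' : ℕ} (h1 : a' ≤ a) (h2 : b ≤ b') : braidLeg A R a b ≤ braidLeg A R a' b' :=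
  Algebra.adjoin_mono fun _ ⟨j, hj1, hj2, hj⟩ => ⟨j, by omega, by omega, hj⟩

lemma scal_mem_braidLeg_of_mem {n a b s : ℕ} (h1 : a ≤ s) (h2 : s + n ≤ b) {X : Op N n ℂ}
    (hX : X ∈ braidImage R n) : scal A s X ∈ braidLeg A R a b := by
  induction hX using Algebra.adjoin_induction with
  | mem X hX =>
    obtain ⟨j, hj, rfl | rfl⟩ := hX <;> rw [scal_place _ hj]
    · exact scal_mem_braidLeg (by omega) (by omega)
    · exact scal_inv_mem_braidLeg (by omega) (by omega)
  | algebraMap z => rw [AlgHom.commutes]; exact Subalgebra.algebraMap_mem _ _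
  | add X Y _ _ hX hY => rw [map_add]; exact add_mem hX hY
  | mul X Y _ _ hX hY => rw [map_mul]; exact mul_mem hX hY

lemma braidLeg_off {a b p : ℕ} (h : p < a ∨ b ≤ p) {x : LegOp N A} (hx : x ∈ braidLeg A R a b) :
    Off p x := by
  induction hx using Algebra.adjoin_induction with
  | mem X hX => obtain ⟨j, hj, hj', rfl | rfl⟩ := hX <;> exact scal_off _ _ (by omega)
  | algebraMap z => exact fun s t => (Algebra.commutes z _).symm
  | add X Y _ _ hX hY => exact hX.add hY
  | mul X Y _ _ hX hY => exact hX.mul hY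

lemma IsRMatrix.commute_braidLeg (h : IsRMatrix R) {a b : ℕ} {y : LegOp N A}
    (hy : ∀ j, a ≤ j → j + 2 ≤ b → Commute (scal A j R) y) {x : LegOp N A} (hx : x ∈ braidLeg A R a b) :
    Commute x y := by
  induction hx using Algebra.adjoin_induction with
  | mem X hX =>
    obtain ⟨j, hj, hj', rfl | rfl⟩ := hX
    · exact hy j hj hj'
    · exact (h.intertwine_inv (hy j hj hj').symm.eq).symm
  | algebraMap z => exact Algebra.commutes z _
  | add X Y _ _ hX hY => exact hX.add_left hY
  | mul X Y _ _ hX hY => exact hX.mul_left hY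

lemma IsRMatrix.iterTrace_cyclic_braidLeg [NeZero N] (h : IsRMatrix R) (hs : SkewInvertible R)
    {a len : ℕ} {x : LegOp N A} (hx : x ∈ braidLeg A R a (a + len)) (f : LegOp N A) :
    iterTrace (matD R) a len (x * f) = iterTrace (matD R) a len (f * x) := by
  induction hx using Algebra.adjoin_induction generalizing f with
  | mem X hX =>
    obtain ⟨j, hj, hj', rfl | rfl⟩ := hX
    · exact h.iterTrace_cyclic hs hj hj' f
    · have e := h.iterTrace_cyclic hs (a := a) (len := len) (j := j) (by omega) (by omega)
        (scal A j R⁻¹ * f * scal A j R⁻¹)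
      rw [mul_assoc _ _ (scal A j R), h.inv_mul, mul_one, mul_assoc, ← mul_assoc, h.mul_inv,
        one_mul] at e
      exact e.symm
  | algebraMap z => rw [Algebra.commutes]
  | add X Y _ _ hX hY => rw [add_mul, mul_add, map_add, map_add, hX, hY]
  | mul X Y _ _ hX hY => rw [mul_assoc, hX, mul_assoc, hY, mul_assoc]

end

/-! ### Blocks -/

section Block
variable {W : Type*} [Ring W]

/-- The block braid interchanging `n` and `i` adjacent strands, starting at the strand `s`. -/
def blockProd (x : ℕ → W) (i : ℕ) : ℕ → ℕ → W
  | 0, _ => 1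
  | n + 1, s => blockProd x i n (s + 1) * rowProd x s i

lemma blockProd_mem {S : Type*} [SetLike S W] [SubmonoidClass S W] (T : S) {x : ℕ → W} {i n s : ℕ}
    (h : ∀ j, s ≤ j → j + 2 ≤ s + i + n → x j ∈ T) : blockProd x i n s ∈ T := by
  induction n generalizing s with
  | zero => exact one_mem _
  | succ n ih =>
    refine mul_mem (ih fun j h1 h2 => h j (by omega) (by omega)) ?_
    have : ∀ t ≤ i, rowProd x s t ∈ T := by
      intro t ht
      induction t with
      | zero => exact one_mem _
      | succ t iht => exact mul_mem (iht (by omega)) (h _ (by omega) (by omega))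
    exact this i le_rfl

lemma rowProd_mem {S : Type*} [SetLike S W] [SubmonoidClass S W] (T : S) {x : ℕ → W} {i s : ℕ}
    (h : ∀ j, s ≤ j → j < s + i → x j ∈ T) : rowProd x s i ∈ T := by
  induction i with
  | zero => exact one_mem _
  | succ i ih => exact mul_mem (ih fun j h1 h2 => h j h1 (by omega)) (h _ (by omega) (by omega))

lemma colProd_mem {S : Type*} [SetLike S W] [SubmonoidClass S W] (T : S) {x : ℕ → W} {i s : ℕ}
    (h : ∀ j, s ≤ j → j < s + i → x j ∈ T) : colProd x s i ∈ T := by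
  induction i with
  | zero => exact one_mem _
  | succ i ih => exact mul_mem (h _ (by omega) (by omega)) (ih fun j h1 h2 => h j h1 (by omega))

/-- The same block braid cut into columns instead of rows; this description moves the other bundle
of strands. -/
lemma blockProd_succ_right {x : ℕ → W} (hc : ∀ j j', j + 1 < j' → Commute (x j) (x j')) (i n s : ℕ) :
    blockProd x (i + 1) n s = colProd x s n * blockProd x i n (s + 1) := by
  induction n generalizing s with
  | zero => simp [blockProd, colProd]
  | succ n ih =>
    have c : Commute (blockProd x i n (s + 1 + 1)) (x s) := by
      have := blockProd_mem (Submonoid.centralizer {x s}) (x := x) (i := i) (n := n) (s := s + 1 + 1)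
        fun j h1 h2 => Submonoid.mem_centralizer_iff.2 fun g hg => by
          rw [Set.mem_singleton_iff.1 hg, (hc s j (by omega)).eq]
      exact (Submonoid.mem_centralizer_iff.1 this _ rfl).symm
    rw [blockProd, ih, rowProd_succ', colProd_succ', mul_assoc, ← mul_assoc (blockProd _ _ _ _), c.eq,
      blockProd]
    simp only [mul_assoc]

lemma exists_blockProd_inv {S : Type*} [SetLike S W] [SubmonoidClass S W] (T : S) {x y : ℕ → W}
    (h1 : ∀ j, x j * y j = 1) (h2 : ∀ j, y j * x j = 1) {i n s : ℕ}
    (h : ∀ j, s ≤ j → j + 2 ≤ s + i + n → y j ∈ T) :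
    ∃ u' ∈ T, blockProd x i n s * u' = 1 ∧ u' * blockProd x i n s = 1 := by
  induction n generalizing s with
  | zero => exact ⟨1, one_mem _, by simp [blockProd], by simp [blockProd]⟩
  | succ n ih =>
    obtain ⟨u', hu, e1, e2⟩ := ih (s := s + 1) fun j h1 h2 => h j (by omega) (by omega)
    refine ⟨colProd y s i * u', mul_mem (colProd_mem T fun j h3 h4 => h j h3 (by omega)) hu, ?_, ?_⟩
    · rw [blockProd, mul_assoc, ← mul_assoc (rowProd x s i), rowProd_mul_colProd h1, one_mul, e1]
    · rw [blockProd, mul_assoc, ← mul_assoc u', e2, one_mul, colProd_mul_rowProd h2]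

end Block

section
variable {R : Op N 2 ℂ} (h : IsRMatrix R)
include h

lemma IsRMatrix.rowProd_mul_scal_of_mem (n : ℕ) {i : ℕ} {x : Op N i ℂ} (hx : x ∈ braidImage R i) :
    rowProd (fun j => scal A j R) n i * scal A n x = scal A (n + 1) x * rowProd (fun j => scal A j R) n i :=
  h.compatible_self.fRow_mul_scal_of_mem n hx

lemma IsRMatrix.colProd_mul_scal_of_mem (n : ℕ) {i : ℕ} {x : Op N i ℂ} (hx : x ∈ braidImage R i) :
    colProd (fun j => scal A j R) n i * scal A (n + 1) x = scal A n x * colProd (fun j => scal A j R) n i :=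
  h.intertwine (fun j hj => by
    rw [show n + 1 + j = n + j + 1 by omega]
    exact colProd_mul_of_shift (x := fun j => scal A j R) (y := fun j => scal A j R)
      (fun j => by rw [← h.braid, mul_assoc])
      (fun j j' h => scal_comm_scal (by omega) _ _) (fun j j' h => scal_comm_scal (by omega) _ _)
      (by omega) (by omega)) hx

abbrev rBlock (A : Type*) [Ring A] [Algebra ℂ A] (R : Op N 2 ℂ) (i n s : ℕ) : LegOp N A :=
  blockProd (fun j => scal A j R) i n s

lemma IsRMatrix.rBlock_mul_scal (n s : ℕ) {i : ℕ} {x : Op N i ℂ} (hx : x ∈ braidImage R i) :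
    rBlock A R i n s * scal A s x = scal A (s + n) x * rBlock A R i n s := by
  induction n generalizing s with
  | zero => simp [blockProd]
  | succ n ih =>
    rw [rBlock, blockProd, mul_assoc, h.rowProd_mul_scal_of_mem s hx, ← mul_assoc, ih, mul_assoc,
      show s + 1 + n = s + (n + 1) by omega]

lemma IsRMatrix.rBlock_mul_scal' (i s : ℕ) {n : ℕ} {x : Op N n ℂ} (hx : x ∈ braidImage R n) :
    rBlock A R i n s * scal A (s + i) x = scal A s x * rBlock A R i n s := by
  induction i generalizing s with
  | zero =>
    have : ∀ n s, blockProd (fun j => scal A j R) 0 n s = 1 := by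
      intro n
      induction n with
      | zero => intro s; rfl
      | succ n ih => intro s; rw [blockProd, ih, rowProd, one_mul]
    rw [rBlock, this, one_mul, mul_one, add_zero]
  | succ i ih =>
    rw [rBlock, blockProd_succ_right (fun j j' h => scal_comm_scal (by omega) _ _), mul_assoc,
      show s + (i + 1) = s + 1 + i by omega, ih, ← mul_assoc, h.colProd_mul_scal_of_mem s hx, mul_assoc]

end

/-! ### The conjugated crossings entering the star product -/

section
variable (A) (R : Op N 2 ℂ)

/-- `R_{s} ⋯ R_1 R_0 R_1⁻¹ ⋯ R_s⁻¹`. -/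
def tauLeg : ℕ → LegOp N A
  | 0 => scal A 0 R
  | s + 1 => scal A (s + 1) R * tauLeg s * scal A (s + 1) R⁻¹

/-- `R_{s}⁻¹ ⋯ R_1⁻¹ R_0 R_1 ⋯ R_s`. -/
def tauBarLeg : ℕ → LegOp N A
  | 0 => scal A 0 R
  | s + 1 => scal A (s + 1) R⁻¹ * tauBarLeg s * scal A (s + 1) R

variable {R}

lemma tauLeg_mem (s : ℕ) : tauLeg A R s ∈ braidLeg A R 0 (s + 2) := by
  induction s with
  | zero => exact scal_mem_braidLeg (by omega) (by omega)
  | succ s ih =>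
    exact mul_mem (mul_mem (scal_mem_braidLeg (by omega) (by omega))
      (braidLeg_mono (by omega) (by omega) ih)) (scal_inv_mem_braidLeg (by omega) (by omega))

lemma tauBarLeg_mem (s : ℕ) : tauBarLeg A R s ∈ braidLeg A R 0 (s + 2) := by
  induction s with
  | zero => exact scal_mem_braidLeg (by omega) (by omega)
  | succ s ih =>
    exact mul_mem (mul_mem (scal_inv_mem_braidLeg (by omega) (by omega))
      (braidLeg_mono (by omega) (by omega) ih)) (scal_mem_braidLeg (by omega) (by omega))

lemma tauLeg_eq (s : ℕ) : tauLeg A R s =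
    colProd (fun j => scal A j R) 0 (s + 1) * rowProd (fun j => scal A j R⁻¹) 1 s := by
  induction s with
  | zero => rw [tauLeg, colProd_one, rowProd, mul_one]
  | succ s ih =>
    rw [tauLeg, ih, colProd_succ _ 0 (s + 1), rowProd_succ, zero_add, add_comm 1 s]
    simp only [mul_assoc]

lemma tauBarLeg_eq (s : ℕ) : tauBarLeg A R s =
    colProd (fun j => scal A j R⁻¹) 1 s * rowProd (fun j => scal A j R) 0 (s + 1) := by
  induction s with
  | zero => rw [tauBarLeg, rowProd_one, colProd, one_mul]
  | succ s ih =>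
    rw [tauBarLeg, ih, rowProd_succ _ 0 (s + 1), colProd_succ, zero_add, add_comm 1 s]
    simp only [mul_assoc]

variable {A}

/-- Conjugation invariance peels off the outer crossings one at a time until `Tr_R R = 1` remains.
This is why star multiplication by a multiple of `I` is an ordinary multiplication. -/
lemma legTrace_tauLeg [NeZero N] (h : IsRMatrix R) (hs : SkewInvertible R) (s : ℕ) :
    legTrace (matD R) (s + 1) (tauLeg A R s) = 1 := by
  induction s with
  | zero => exact legTrace_matD hs 0
  | succ s ih =>
    rw [tauLeg, h.compatible_self.legTrace_conj hs (braidLeg_off (by omega) (tauLeg_mem A s)), ih]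

lemma legTrace_tauBarLeg [NeZero N] (h : IsRMatrix R) (hs : SkewInvertible R) (s : ℕ) :
    legTrace (matD R) (s + 1) (tauBarLeg A R s) = 1 := by
  induction s with
  | zero => exact legTrace_matD hs 0
  | succ s ih =>
    rw [tauBarLeg, h.compatible_self.legTrace_conj' hs (braidLeg_off (by omega) (tauBarLeg_mem A s)), ih]

/-- The conjugation relating the two forms of the star product. -/
lemma IsRMatrix.exists_conj_tau (h : IsRMatrix R) (s t : ℕ) :
    ∃ w ∈ braidLeg A R 1 (s + 1 + (t + 1)), ∃ w' ∈ braidLeg A R 1 (s + 1 + (t + 1)), w * w' = 1 ∧ w' * w = 1 ∧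
      ∀ x ∈ braidImage R (s + 1), ∀ y ∈ braidImage R (t + 1),
        scal A 0 x * scal A (s + 1) y * tauLeg A R s =
          w * (tauBarLeg A R t * scal A 0 y * scal A (t + 1) x) * w' := by
  have hi : ∀ j, scal A j R * scal A j R⁻¹ = 1 := fun j => h.mul_inv j
  have hi' : ∀ j, scal A j R⁻¹ * scal A j R = 1 := fun j => h.inv_mul j
  have hc : ∀ j j', j + 1 < j' → Commute (scal A j R) (scal A j' R) := fun j j' h =>
    scal_comm_scal (by omega) _ _
  obtain ⟨p', hp', e1, e2⟩ := exists_blockProd_inv (braidLeg A R 1 (s + 1 + (t + 1))) hi hi' (i := t)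
    (n := s + 1) (s := 1) fun j h1 h2 => scal_inv_mem_braidLeg h1 (by omega)
  have hp : blockProd (fun j => scal A j R) t (s + 1) 1 ∈ braidLeg A R 1 (s + 1 + (t + 1)) :=
    blockProd_mem _ fun j h1 h2 => scal_mem_braidLeg h1 (by omega)
  have hcol : colProd (fun j => scal A j R) 1 s ∈ braidLeg A R 1 (s + 1 + (t + 1)) :=
    colProd_mem _ fun j h1 h2 => scal_mem_braidLeg h1 (by omega)
  have hrow : rowProd (fun j => scal A j R⁻¹) 1 s ∈ braidLeg A R 1 (s + 1 + (t + 1)) :=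
    rowProd_mem _ fun j h1 h2 => scal_inv_mem_braidLeg h1 (by omega)
  refine ⟨_, mul_mem hcol hp, _, mul_mem hp' hrow, ?_, ?_, fun x hx y hy => ?_⟩
  · rw [mul_assoc, ← mul_assoc (blockProd _ _ _ _), e1, one_mul, colProd_mul_rowProd hi]
  · rw [mul_assoc, ← mul_assoc (rowProd _ _ _), rowProd_mul_colProd hi', one_mul, e2]
  · have u1 : colProd (fun j => scal A j R) 1 s * blockProd (fun j => scal A j R) t (s + 1) 1 *
        tauBarLeg A R t = rBlock A R (t + 1) (s + 1) 0 := by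
      have e0 : rBlock A R (t + 1) (s + 1) 0 = colProd (fun j => scal A j R) 1 s *
          blockProd (fun j => scal A j R) t s (1 + 1) * rowProd (fun j => scal A j R) 0 (t + 1) := by
        rw [← blockProd_succ_right hc]
        rfl
      rw [e0, tauBarLeg_eq, blockProd]
      have := rowProd_mul_colProd hi 1 t
      simp only [mul_assoc]
      rw [← mul_assoc (rowProd _ 1 t), this, one_mul]
    have u2 : rBlock A R (t + 1) (s + 1) 0 = colProd (fun j => scal A j R) 0 (s + 1) *
        blockProd (fun j => scal A j R) t (s + 1) 1 := by
      rw [rBlock, blockProd_succ_right hc]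
    have c := h.rBlock_mul_scal (A := A) (s + 1) 0 hy
    have c' := h.rBlock_mul_scal' (A := A) (t + 1) 0 hx
    rw [zero_add] at c c'
    -- The block braid factors as `w τ̄` by `u1` and as `τ (w')⁻¹` here, with `w`, `w'` avoiding the
    -- first strand. Sliding `x` and `y` through the block thus exchanges the two forms of the star
    -- product.
    have u3 : rBlock A R (t + 1) (s + 1) 0 * (p' * rowProd (fun j => scal A j R⁻¹) 1 s) = tauLeg A R s := by
      rw [u2, tauLeg_eq, mul_assoc, ← mul_assoc (blockProd _ _ _ _), e1, one_mul]
    have d : Commute (scal A 0 x) (scal A (s + 1) y) := scal_comm_scal (by omega) _ _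
    calc _ = scal A (s + 1) y * (scal A 0 x * rBlock A R (t + 1) (s + 1) 0) *
          (p' * rowProd (fun j => scal A j R⁻¹) 1 s) := by rw [← u3, d.eq]; simp only [mul_assoc]
      _ = rBlock A R (t + 1) (s + 1) 0 * scal A 0 y * scal A (t + 1) x *
          (p' * rowProd (fun j => scal A j R⁻¹) 1 s) := by
        rw [← c', ← mul_assoc (scal A (s + 1) y), ← c]
      _ = _ := by rw [← u1]; simp only [mul_assoc]

end

/-! ### Products of characteristic elements -/

section
variable {R F : Op N 2 ℂ} (hc : IsCompatiblePair R F) (hs : SkewInvertible R) [NeZero N]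
  {M : Matrix (Fin N) (Fin N) A} (hM : IsQuantumMatrix R F M)
include hc hs

lemma IsCompatiblePair.iterTrace_mul_coef_ch {a len n i : ℕ} (hn : a + len = n) (X : Matrix (Fin N) (Fin N) A)
    {x : Op N n ℂ} (hx : x ∈ braidImage R n) {y : Op N i ℂ} (hy : y ∈ braidImage R i) :
    iterTrace (matD R) a (len + i) (copSeg F X 0 (n + i) * (scal A 0 x * scal A n y)) =
      iterTrace (matD R) a len (copSeg F X 0 n * scal A 0 x) * coef (ch R F X y) := by
  have e : copSeg F X 0 (n + i) * (scal A 0 x * scal A n y) =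
      copSeg F X 0 n * scal A 0 x * (copSeg F X n i * scal A n y) := by
    rw [copSeg, rowProd_add, zero_add, mul_assoc, ← mul_assoc (rowProd (cop F X) n i),
      (hc.scal_comm_copSeg_of_mem (by omega) X hx).eq]
    simp only [mul_assoc]
  rw [e, iterTrace_add, hn, iterTrace_mul_left _ fun p hp _ => (copSeg_off _ _ (by omega)).mul
    (scal_off _ _ (by omega)), hc.iterTrace_copSeg hs X n hy,
    iterTrace_mul_right _ fun p _ _ => coef_off _ _]

lemma IsCompatiblePair.coef_ch_mul_ch (X : Matrix (Fin N) (Fin N) A) {n i : ℕ}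
    {x : Op N n ℂ} (hx : x ∈ braidImage R n) {y : Op N i ℂ} (hy : y ∈ braidImage R i) :
    coef (ch R F X x * ch R F X y) =
      iterTrace (matD R) 0 (n + i) (copSeg F X 0 (n + i) * (scal A 0 x * scal A n y)) := by
  rw [hc.iterTrace_mul_coef_ch hs (zero_add n) X hx hy, map_mul, coef_ch]

lemma IsCompatiblePair.leg_desc_mul_ch (X : Matrix (Fin N) (Fin N) A) {s i : ℕ}
    {x : Op N (s + 1) ℂ} (hx : x ∈ braidImage R (s + 1)) {y : Op N i ℂ} (hy : y ∈ braidImage R i) :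
    leg 0 (rmul (desc R F X x) (ch R F X y)) =
      iterTrace (matD R) 1 (s + i) (copSeg F X 0 (s + 1 + i) * (scal A 0 x * scal A (s + 1) y)) := by
  rw [hc.iterTrace_mul_coef_ch hs (add_comm 1 s) X hx hy, leg_mul_coef, leg_desc]

include hM

/-- Conjugation by braids does not change R-traces of products with copies of `M`. -/
lemma IsQuantumMatrix.iterTrace_conj {a len n : ℕ} (hn : a + len ≤ n) {w w' : LegOp N A}
    (hw : w ∈ braidLeg A R a (a + len)) (hww : w' * w = 1) (y : LegOp N A) :
    iterTrace (matD R) a len (copSeg F M 0 n * (w * y * w')) =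
      iterTrace (matD R) a len (copSeg F M 0 n * y) := by
  have c := hc.rMatrix_left.commute_braidLeg
    (fun j h1 h2 => hM.comm_copSeg hc (s := 0) (i := n) (j := j) (by omega) (by omega)) hw
  rw [mul_assoc w, ← mul_assoc, ← c.eq, mul_assoc, hc.rMatrix_left.iterTrace_cyclic_braidLeg hs hw,
    mul_assoc, mul_assoc y, hww, mul_one]

/-- Both products are R-traces over `n + i` legs, and the block braid exchanging the two bundles
conjugates one argument to the other. -/
lemma IsQuantumMatrix.ch_comm {n i : ℕ} {x : Op N n ℂ} (hx : x ∈ braidImage R n) {y : Op N i ℂ}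
    (hy : y ∈ braidImage R i) : ch R F M x * ch R F M y = ch R F M y * ch R F M x := by
  have h := hc.rMatrix_left
  apply coef_injective (N := N)
  rw [hc.coef_ch_mul_ch hs M hx hy, hc.coef_ch_mul_ch hs M hy hx]
  obtain ⟨u', -, e1, e2⟩ := exists_blockProd_inv (braidLeg A R 0 (n + i))
    (fun j => h.mul_inv (A := A) j) (fun j => h.inv_mul (A := A) j) (i := i)
    (n := n) (s := 0) fun j h1 h2 => scal_inv_mem_braidLeg h1 (by omega)
  have hu : rBlock A R i n 0 ∈ braidLeg A R 0 (0 + (n + i)) :=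
    blockProd_mem _ fun j h1 h2 => scal_mem_braidLeg h1 (by omega)
  have c := h.rBlock_mul_scal (A := A) n 0 hy
  have c' := h.rBlock_mul_scal' (A := A) i 0 hx
  rw [zero_add] at c c'
  have d : Commute (scal A 0 x) (scal A n y) := scal_comm_scal (by omega) _ _
  have e : scal A 0 x * scal A n y = rBlock A R i n 0 * (scal A 0 y * scal A i x) * u' := by
    rw [← mul_assoc, c, mul_assoc _ _ (scal A i x), c', mul_assoc, mul_assoc, e1, mul_one, d.eq]
  rw [e, hM.iterTrace_conj hc hs (by omega) hu e2, add_comm i n]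

end

end

/-! ### Right multiples -/

section

variable {N : ℕ} {A : Type*} [Ring A] [Algebra ℂ A]

section
variable (X Y : Matrix (Fin N) (Fin N) A)
omit [Algebra ℂ A]

lemma rmul_one (X : Matrix (Fin N) (Fin N) A) : rmul X 1 = X := by ext; simp [rmul]
lemma rmul_zero (X : Matrix (Fin N) (Fin N) A) : rmul X 0 = 0 := by ext; simp [rmul]
lemma zero_rmul (c : A) : rmul (0 : Matrix (Fin N) (Fin N) A) c = 0 := by ext; simp [rmul]
lemma rmul_rmul (c d : A) : rmul (rmul X c) d = rmul X (c * d) := by ext; simp [rmul, mul_assoc]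
lemma rmul_add (c d : A) : rmul X (c + d) = rmul X c + rmul X d := by ext; simp [rmul, mul_add]
lemma rmul_neg (c : A) : rmul X (-c) = -rmul X c := by ext; simp [rmul]
lemma add_rmul (c : A) : rmul (X + Y) c = rmul X c + rmul Y c := by ext; simp [rmul, add_mul]
lemma sub_rmul (c : A) : rmul (X - Y) c = rmul X c - rmul Y c := by ext; simp [rmul, sub_mul]
variable [Algebra ℂ A]
lemma smul_rmul (z : ℂ) (c : A) : rmul (z • X) c = z • rmul X c := by ext; simp [rmul]
lemma rmul_smul (z : ℂ) (c : A) : rmul X (z • c) = z • rmul X c := by ext; simp [rmul]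

end

/-! ### Uniqueness of star products -/

section
variable {R F : Op N 2 ℂ} {M : Matrix (Fin N) (Fin N) A}

lemma one_mem_braidImage (n : ℕ) : (1 : Op N n ℂ) ∈ braidImage R n := one_mem _

lemma scal_starExponent {s t : ℕ} (X : Op N (s + 1) ℂ) (Y : Op N (t + 1) ℂ) :
    scal A 0 (starExponent R X Y) = scal A 0 X * scal A (s + 1) Y * tauLeg A R s := by
  have e1 : ∀ i ≤ s + 1, scal A 0 (((List.range i).reverse.map fun j => place (s + 1 + t + 1) j R).prod) =
      colProd (fun j => scal A j R) 0 i := by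
    intro i hi
    induction i with
    | zero => simp [colProd]
    | succ i ih =>
      rw [List.range_succ, List.reverse_append, List.map_append, List.prod_append, map_mul,
        ih (by omega), colProd_succ]
      simp [scal_place 0 (show i + 2 ≤ s + 1 + t + 1 by omega) R]
  have e2 : ∀ i ≤ s, scal A 0 (((List.range i).map fun j => place (s + 1 + t + 1) (j + 1) R⁻¹).prod) =
      rowProd (fun j => scal A j R⁻¹) 1 i := by
    intro i hi
    induction i with
    | zero => simp [rowProd]
    | succ i ih =>
      rw [List.range_succ, List.map_append, List.prod_append, map_mul, ih (by omega), rowProd_succ]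
      simp [scal_place 0 (show i + 1 + 2 ≤ s + 1 + t + 1 by omega) R⁻¹, add_comm]
  rw [starExponent, map_mul, map_mul, map_mul, e1 _ le_rfl, e2 _ le_rfl, ← tauLeg_eq,
    scal_place _ (by omega), scal_place _ (by omega), zero_add, zero_add]

lemma coef_comm_of_mem_braidLeg (c : A) {a b : ℕ} {x : LegOp N A} (hx : x ∈ braidLeg A R a b) :
    Commute (coef c) x := by
  induction hx using Algebra.adjoin_induction with
  | mem X hX => obtain ⟨j, -, -, rfl | rfl⟩ := hX <;> exact coef_comm_scal _ _ _
  | algebraMap z => exact (Algebra.commutes z _).symm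
  | add X Y _ _ hX hY => exact hX.add_right hY
  | mul X Y _ _ hX hY => exact hX.mul_right hY

variable (R F M)

/-- Star multiplication by `M^x c` from the left. -/
def starLeft {s : ℕ} (x : Op N (s + 1) ℂ) (c : A) : Matrix (Fin N) (Fin N) A →+ LegOp N A where
  toFun X := iterTrace (matD R) 1 (s + 1)
    (copSeg F M 0 (s + 1) * scal A 0 x * cop F X (s + 1) * tauLeg A R s) * coef c
  map_zero' := by
    have : cop F (0 : Matrix (Fin N) (Fin N) A) (s + 1) = 0 := by
      have := cop_rmul F (0 : Matrix (Fin N) (Fin N) A) 0 (s + 1)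
      rwa [rmul_zero, map_zero, mul_zero] at this
    rw [this, mul_zero, zero_mul, map_zero, zero_mul]
  map_add' X Y := by rw [cop_add, mul_add, add_mul, map_add, add_mul]

/-- Star multiplication by `M^y d` from the right. -/
def starRight {t : ℕ} (y : Op N (t + 1) ℂ) (d : A) : Matrix (Fin N) (Fin N) A →+ LegOp N A where
  toFun X := iterTrace (matD R) 1 (t + 1)
    (tauBarLeg A R t * (copSeg F M 0 (t + 1) * scal A 0 y * cop F X (t + 1))) * coef d
  map_zero' := by
    have : cop F (0 : Matrix (Fin N) (Fin N) A) (t + 1) = 0 := by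
      have := cop_rmul F (0 : Matrix (Fin N) (Fin N) A) 0 (t + 1)
      rwa [rmul_zero, map_zero, mul_zero] at this
    rw [this, mul_zero, mul_zero, map_zero, zero_mul]
  map_add' X Y := by rw [cop_add, mul_add, mul_add, map_add, add_mul]

/-- Multiplication by `I c`. -/
def starScalar (c : A) : Matrix (Fin N) (Fin N) A →+ LegOp N A where
  toFun X := leg 0 (rmul X c)
  map_zero' := by rw [zero_rmul]; exact map_zero (amp 0)
  map_add' X Y := by rw [add_rmul, leg_add]

/-- Matrices together with their left star multiplications. -/
def leftGraph (S : Subalgebra ℂ A) :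
    AddSubmonoid (Matrix (Fin N) (Fin N) A × (Matrix (Fin N) (Fin N) A →+ LegOp N A)) :=
  AddSubmonoid.closure
    ({p | ∃ (s : ℕ) (x : Op N (s + 1) ℂ) (c : A), x ∈ braidImage R (s + 1) ∧ c ∈ S ∧
        p = (rmul (desc R F M x) c, starLeft R F M x c)} ∪
      {p | ∃ c ∈ S, p = (rmul 1 c, starScalar c)})

/-- Matrices together with their right star multiplications. -/
def rightGraph (S : Subalgebra ℂ A) :
    AddSubmonoid (Matrix (Fin N) (Fin N) A × (Matrix (Fin N) (Fin N) A →+ LegOp N A)) :=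
  AddSubmonoid.closure
    ({p | ∃ (s : ℕ) (x : Op N (s + 1) ℂ) (c : A), x ∈ braidImage R (s + 1) ∧ c ∈ S ∧
        p = (rmul (desc R F M x) c, starRight R F M x c)} ∪
      {p | ∃ c ∈ S, p = (rmul 1 c, starScalar c)})

variable {R F M} (hc : IsCompatiblePair R F) (hs : SkewInvertible R) [NeZero N]
include hc hs

lemma IsCompatiblePair.starLeft_one {s : ℕ} (x : Op N (s + 1) ℂ) (c d : A) :
    starLeft R F M x c (rmul 1 d) = leg 0 (rmul (desc R F M x) (d * c)) := by
  have e : cop F (rmul 1 d : Matrix (Fin N) (Fin N) A) (s + 1) = coef d := by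
    rw [cop_rmul]
    have : ∀ i, cop F (1 : Matrix (Fin N) (Fin N) A) i = 1 := by
      intro i
      induction i with
      | zero => exact leg_one 0
      | succ i ih => rw [cop, ih, mul_one, hc.rMatrix_right.mul_inv]
    rw [this, one_mul]
  show iterTrace _ _ _ _ * _ = _
  rw [e, mul_assoc _ (coef d), (coef_comm_of_mem_braidLeg d (tauLeg_mem A s)).eq, ← mul_assoc,
    iterTrace_mul_right _ fun p _ _ => coef_off _ _, iterTrace_succ, add_comm 1 s,
    legTrace_mul_left _ ((copSeg_off _ _ (by omega)).mul (scal_off _ _ (by omega))),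
    legTrace_tauLeg hc.rMatrix_left hs, mul_one, ← leg_desc, leg_mul_coef, map_mul, mul_assoc]

lemma IsCompatiblePair.starRight_one {t : ℕ} (y : Op N (t + 1) ℂ) (c d : A) :
    starRight R F M y d (rmul 1 c) = leg 0 (rmul (desc R F M y) (c * d)) := by
  have e : cop F (rmul 1 c : Matrix (Fin N) (Fin N) A) (t + 1) = coef c := by
    rw [cop_rmul]
    have : ∀ i, cop F (1 : Matrix (Fin N) (Fin N) A) i = 1 := by
      intro i
      induction i with
      | zero => exact leg_one 0
      | succ i ih => rw [cop, ih, mul_one, hc.rMatrix_right.mul_inv]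
    rw [this, one_mul]
  show iterTrace _ _ _ _ * _ = _
  rw [e, ← mul_assoc, iterTrace_mul_right _ fun p _ _ => coef_off _ _, iterTrace_succ, add_comm 1 t,
    legTrace_mul_right _ ((copSeg_off _ _ (by omega)).mul (scal_off _ _ (by omega))),
    legTrace_tauBarLeg hc.rMatrix_left hs, one_mul, ← leg_desc, leg_mul_coef, map_mul, mul_assoc]

lemma IsCompatiblePair.starLeft_desc {s t : ℕ} {x : Op N (s + 1) ℂ} (hx : x ∈ braidImage R (s + 1))
    {y : Op N (t + 1) ℂ} (hy : y ∈ braidImage R (t + 1)) (c d : A) :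
    starLeft R F M x c (rmul (desc R F M y) d) = leg 0 (rmul (desc R F M (starExponent R x y)) (d * c)) := by
  show iterTrace _ _ _ _ * _ = _
  rw [cop_rmul, ← hc.tail_copSeg hs M (s + 1) hy]
  have e : iterTrace (matD R) 1 (s + 1) (copSeg F M 0 (s + 1) * scal A 0 x *
      (iterTrace (matD R) (s + 1 + 1) t (copSeg F M (s + 1) (t + 1) * scal A (s + 1) y) * coef d) *
        tauLeg A R s) = iterTrace (matD R) 1 (s + 1 + t) (copSeg F M 0 (s + 1 + t + 1) *
          scal A 0 (starExponent R x y)) * coef d := by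
    rw [← mul_assoc, mul_assoc _ (coef d), (coef_comm_of_mem_braidLeg d (tauLeg_mem A s)).eq, ← mul_assoc,
      iterTrace_mul_right _ fun p _ _ => coef_off _ _, iterTrace_add _ 1 (s + 1) t, scal_starExponent]
    congr 2
    rw [← iterTrace_mul_left _ fun p hp _ => (copSeg_off _ _ (by omega)).mul (scal_off _ _ (by omega)),
      ← iterTrace_mul_right _ fun p hp _ => braidLeg_off (by omega) (tauLeg_mem A s), add_comm 1 (s + 1)]
    congr 1
    rw [show s + 1 + t + 1 = s + 1 + (t + 1) by omega, copSeg, copSeg, copSeg, rowProd_add _ 0 (s + 1),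
      zero_add]
    have c := (hc.scal_comm_copSeg_of_mem (s := s + 1) (i := t + 1) (j := 0) (by omega) M hx).eq
    calc _ = copSeg F M 0 (s + 1) * (scal A 0 x * copSeg F M (s + 1) (t + 1)) * scal A (s + 1) y *
          tauLeg A R s := by simp only [mul_assoc]
      _ = _ := by rw [← c]; simp only [mul_assoc]
  rw [e, leg_mul_coef, map_mul coef, leg_desc, ← mul_assoc]

variable (hM : IsQuantumMatrix R F M)
include hM

/-- Conjugation by a braid avoiding the first strand is invisible to the trace over the remaining
legs. It brings the second factor to the front and turns `tauLeg` into `tauBarLeg`. -/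
lemma IsQuantumMatrix.starRight_desc {s t : ℕ} {x : Op N (s + 1) ℂ} (hx : x ∈ braidImage R (s + 1))
    {y : Op N (t + 1) ℂ} (hy : y ∈ braidImage R (t + 1)) (c d : A) :
    starRight R F M y d (rmul (desc R F M x) c) = leg 0 (rmul (desc R F M (starExponent R x y)) (c * d)) := by
  show iterTrace _ _ _ _ * _ = _
  rw [cop_rmul, ← hc.tail_copSeg hs M (t + 1) hx]
  have e : iterTrace (matD R) 1 (t + 1) (tauBarLeg A R t * (copSeg F M 0 (t + 1) * scal A 0 y *
      (iterTrace (matD R) (t + 1 + 1) s (copSeg F M (t + 1) (s + 1) * scal A (t + 1) x) * coef c))) =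
      iterTrace (matD R) 1 (s + 1 + t) (copSeg F M 0 (s + 1 + t + 1) *
          scal A 0 (starExponent R x y)) * coef c := by
    obtain ⟨w, hw, w', -, -, e2, e3⟩ := hc.rMatrix_left.exists_conj_tau (A := A) s t
    rw [scal_starExponent, e3 x hx y hy, hM.iterTrace_conj hc hs (by omega)
      (braidLeg_mono le_rfl (by omega) hw) e2, ← mul_assoc _ _ (coef c), ← mul_assoc,
      iterTrace_mul_right _ fun p _ _ => coef_off _ _, show s + 1 + t = t + 1 + s by omega, show t + 1 + s + 1 = t + 1 + (s + 1) by omega, iterTrace_add _ 1 (t + 1) s]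
    congr 2
    rw [← iterTrace_mul_left _ fun p hp _ => (copSeg_off _ _ (by omega)).mul (scal_off _ _ (by omega)),
      ← iterTrace_mul_left _ fun p hp _ => braidLeg_off (by omega) (tauBarLeg_mem A t), add_comm 1 (t + 1)]
    congr 1
    have cc := (hc.scal_comm_copSeg_of_mem (s := t + 1) (i := s + 1) (j := 0) (by omega) M hy).eq
    have ct := (hc.rMatrix_left.commute_braidLeg (fun j h1 h2 => hM.comm_copSeg hc (s := 0)
      (i := t + 1 + s + 1) (j := j) (by omega) (by omega)) (tauBarLeg_mem A t)).eq
    have cs : copSeg F M 0 (t + 1 + s + 1) = copSeg F M 0 (t + 1) * copSeg F M (t + 1) (s + 1) := by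
      rw [add_assoc (t + 1), copSeg, rowProd_add _ 0 (t + 1), zero_add]
    calc _ = tauBarLeg A R t * (copSeg F M 0 (t + 1) * (scal A 0 y * copSeg F M (t + 1) (s + 1)) *
          scal A (t + 1) x) := by simp only [mul_assoc]
      _ = tauBarLeg A R t * copSeg F M 0 (t + 1 + s + 1) * (scal A 0 y * scal A (t + 1) x) := by
          rw [← cc, cs]; simp only [mul_assoc]
      _ = _ := by rw [ct, add_assoc (t + 1) s 1]; simp only [mul_assoc]
  rw [e, leg_mul_coef, map_mul coef, leg_desc, ← mul_assoc]

variable {S : Subalgebra ℂ A} (hS : ∀ c ∈ S, ∀ d ∈ S, c * d = d * c)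
include hS

/-- An expression of `B` through descendants determines a left multiplication, and one of `B'` a
right multiplication. Their agreement makes the common value independent of both expressions, which
is what uniqueness of the star product requires. -/
lemma IsQuantumMatrix.graph_eq {B B' : Matrix (Fin N) (Fin N) A}
    {f h : Matrix (Fin N) (Fin N) A →+ LegOp N A} (hf : (B, f) ∈ leftGraph R F M S)
    (hh : (B', h) ∈ rightGraph R F M S) : f B' = h B := by
  have key : ∀ p ∈ leftGraph R F M S, ∀ p' ∈ rightGraph R F M S, p.2 p'.1 = p'.2 p.1 := by
    intro p hp
    induction hp using AddSubmonoid.closure_induction with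
    | mem p hp =>
      intro p' hp'
      induction hp' using AddSubmonoid.closure_induction with
      | mem p' hp' =>
        rcases hp with ⟨s, x, c, hx, hc', rfl⟩ | ⟨c, hc', rfl⟩ <;>
          rcases hp' with ⟨t, y, d, hy, hd, rfl⟩ | ⟨d, hd, rfl⟩
        · show starLeft R F M x c _ = starRight R F M y d _
          rw [hc.starLeft_desc hs hx hy, hM.starRight_desc hc hs hx hy, hS c hc' d hd]
        · show starLeft R F M x c _ = leg 0 _
          rw [hc.starLeft_one hs, rmul_rmul, hS c hc' d hd]
        · show leg 0 _ = starRight R F M y d _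
          rw [hc.starRight_one hs, rmul_rmul, hS c hc' d hd]
        · show leg 0 _ = leg 0 _
          rw [rmul_rmul, rmul_rmul, hS c hc' d hd]
      | zero => exact map_zero _
      | add p₁ p₂ _ _ h₁ h₂ =>
        show p.2 (p₁.1 + p₂.1) = p₁.2 p.1 + p₂.2 p.1
        rw [map_add, h₁, h₂]
    | zero => exact fun p' _ => (map_zero p'.2).symm
    | add p₁ p₂ _ _ h₁ h₂ =>
      intro p' hp'
      show p₁.2 p'.1 + p₂.2 p'.1 = p'.2 (p₁.1 + p₂.1)
      rw [map_add, h₁ p' hp', h₂ p' hp']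
  exact key _ hf _ hh

/-- Every derivation of a star product records presentations of the two factors. In the case of sums
on the right the left multiplications may differ, and `graph_eq` reconciles them. -/
lemma IsQuantumMatrix.exists_graph {B B' Z : Matrix (Fin N) (Fin N) A}
    (hZ : IsStarProduct R F M S B B' Z) :
    ∃ f h, (B, f) ∈ leftGraph R F M S ∧ (B', h) ∈ rightGraph R F M S ∧ leg 0 Z = f B' := by
  induction hZ with
  | desc_desc s t x hx y hy c d hc' hd =>
    refine ⟨_, _, AddSubmonoid.subset_closure (Or.inl ⟨s, x, c, hx, hc', rfl⟩),
      AddSubmonoid.subset_closure (Or.inl ⟨t, y, d, hy, hd, rfl⟩), ?_⟩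
    rw [hc.starLeft_desc hs hx hy, hS c hc' d hd]
  | one_desc s x hx c d hc' hd =>
    refine ⟨_, _, AddSubmonoid.subset_closure (Or.inr ⟨c, hc', rfl⟩),
      AddSubmonoid.subset_closure (Or.inl ⟨s, x, d, hx, hd, rfl⟩), ?_⟩
    show _ = leg 0 _
    rw [rmul_rmul]
  | desc_one s x hx c d hc' hd =>
    refine ⟨_, _, AddSubmonoid.subset_closure (Or.inl ⟨s, x, c, hx, hc', rfl⟩),
      AddSubmonoid.subset_closure (Or.inr ⟨d, hd, rfl⟩), ?_⟩
    rw [hc.starLeft_one hs, hS c hc' d hd]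
  | one_one c d hc' hd =>
    refine ⟨_, _, AddSubmonoid.subset_closure (Or.inr ⟨c, hc', rfl⟩),
      AddSubmonoid.subset_closure (Or.inr ⟨d, hd, rfl⟩), ?_⟩
    show _ = leg 0 _
    rw [rmul_rmul, hS c hc' d hd]
  | add_left _ _ ih₁ ih₂ =>
    obtain ⟨f₁, h₁, hf₁, hh₁, e₁⟩ := ih₁
    obtain ⟨f₂, h₂, hf₂, hh₂, e₂⟩ := ih₂
    exact ⟨f₁ + f₂, h₁, add_mem hf₁ hf₂, hh₁, by rw [leg_add, e₁, e₂]; rfl⟩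
  | add_right _ _ ih₁ ih₂ =>
    obtain ⟨f₁, h₁, hf₁, hh₁, e₁⟩ := ih₁
    obtain ⟨f₂, h₂, hf₂, hh₂, e₂⟩ := ih₂
    refine ⟨f₁, h₁ + h₂, hf₁, add_mem hh₁ hh₂, ?_⟩
    rw [leg_add, e₁, e₂, map_add, hM.graph_eq hc hs hS hf₂ hh₂, ← hM.graph_eq hc hs hS hf₁ hh₂]

/-- Star products are unique. -/
lemma IsQuantumMatrix.star_unique {B B' Z Z' : Matrix (Fin N) (Fin N) A}
    (hZ : IsStarProduct R F M S B B' Z) (hZ' : IsStarProduct R F M S B B' Z') : Z = Z' := by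
  obtain ⟨f, h, hf, hh, e⟩ := hM.exists_graph hc hs hS hZ
  obtain ⟨f', h', hf', hh', e'⟩ := hM.exists_graph hc hs hS hZ'
  apply leg_injective 0
  rw [e, e', hM.graph_eq hc hs hS hf hh, hM.graph_eq hc hs hS hf' hh]

end

/-! ### Star multiplication by `M` -/

section
variable (R F : Op N 2 ℂ) (M : Matrix (Fin N) (Fin N) A)

/-- `φ(X) = Tr_{R(2)} (X_{\bar 2} R_1)`. -/
def starPhi (X : Matrix (Fin N) (Fin N) A) : Matrix (Fin N) (Fin N) A :=
  tailTrace (s := 1) (matD R) (copy F X 2 1 * R.lift A)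

/-- Star multiplication by `M` from the left. -/
def starM (X : Matrix (Fin N) (Fin N) A) : Matrix (Fin N) (Fin N) A := M * starPhi R F X

lemma leg_starPhi (X : Matrix (Fin N) (Fin N) A) :
    leg 0 (starPhi R F X) = legTrace (matD R) 1 (cop F X 1 * scal A 0 R) := by
  rw [starPhi, leg, ← iterTrace_amp_tail _ 0, map_mul, amp_copy _ _ (by norm_num)]
  rfl

lemma leg_starM (X : Matrix (Fin N) (Fin N) A) : leg 0 (starM R F M X) =
    legTrace (matD R) 1 (leg 0 M * cop F X 1 * scal A 0 R) := by
  rw [starM, leg_mul, leg_starPhi, mul_assoc, legTrace_mul_left _ (leg_off (by omega) _)]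

variable [NeZero N]

lemma starM_add (X Y : Matrix (Fin N) (Fin N) A) :
    starM R F M (X + Y) = starM R F M X + starM R F M Y := by
  apply leg_injective 0
  rw [leg_add, leg_starM, leg_starM, leg_starM, cop_add, mul_add, add_mul, map_add]

lemma starM_rmul (X : Matrix (Fin N) (Fin N) A) (c : A) :
    starM R F M (rmul X c) = rmul (starM R F M X) c := by
  apply leg_injective 0
  rw [leg_mul_coef, leg_starM, leg_starM, cop_rmul, ← legTrace_mul_right _ (coef_off _ _)]
  simp only [mul_assoc]
  rw [(coef_comm_scal c 0 R).eq]

lemma desc_one : desc R F M (1 : Op N 1 ℂ) = M := by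
  apply leg_injective 0
  rw [leg_desc, map_one, mul_one, iterTrace_zero, copSeg, rowProd_one, cop]

/-- The right module spanned by `I` and all `M^x`. -/
def starSpan (S : Subalgebra ℂ A) : AddSubmonoid (Matrix (Fin N) (Fin N) A) :=
  AddSubmonoid.closure
    ({X | ∃ (s : ℕ) (x : Op N (s + 1) ℂ) (c : A), x ∈ braidImage R (s + 1) ∧ c ∈ S ∧
        X = rmul (desc R F M x) c} ∪ {X | ∃ c ∈ S, X = rmul 1 c})

variable {R F M} (hc : IsCompatiblePair R F) (hs : SkewInvertible R)
include hc hs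

lemma IsCompatiblePair.starM_desc {t : ℕ} {y : Op N (t + 1) ℂ} (hy : y ∈ braidImage R (t + 1)) :
    starM R F M (desc R F M y) = desc R F M (starExponent R (1 : Op N 1 ℂ) y) := by
  have := hc.starLeft_desc hs (s := 0) (M := M) (one_mem_braidImage 1) hy 1 1
  rw [rmul_one, mul_one, rmul_one] at this
  apply leg_injective 0
  rw [← this, leg_starM]
  show _ = iterTrace _ _ _ _ * _
  rw [map_one, map_one, mul_one, mul_one, copSeg, zero_add, rowProd_one]
  rfl

lemma IsCompatiblePair.starM_one : starM R F M 1 = M := by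
  have := hc.starLeft_one hs (s := 0) (M := M) (1 : Op N 1 ℂ) 1 1
  rw [rmul_one, mul_one, rmul_one, desc_one] at this
  apply leg_injective 0
  rw [← this, leg_starM]
  show _ = iterTrace _ _ _ _ * _
  rw [map_one, map_one, mul_one, mul_one, copSeg, zero_add, rowProd_one]
  rfl

omit hc hs in
lemma place_mem_braidImage {n m j : ℕ} (h : j + n ≤ m) {X : Op N n ℂ} (hX : X ∈ braidImage R n) :
    place m j X ∈ braidImage R m := by
  induction hX using Algebra.adjoin_induction with
  | mem X hX =>
    obtain ⟨i, hi, hX⟩ := hX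
    refine Algebra.subset_adjoin ⟨j + i, by omega, hX.imp ?_ ?_⟩ <;> rintro rfl <;>
      exact scal_injective 0 (by rw [scal_place _ h, scal_place _ hi, scal_place _ (by omega), add_assoc])
  | algebraMap z =>
    rw [show place m j (algebraMap ℂ (Op N n ℂ) z) = algebraMap ℂ _ z from
      scal_injective 0 (by rw [scal_place _ h, AlgHom.commutes, AlgHom.commutes])]
    exact Subalgebra.algebraMap_mem _ _
  | add X Y _ _ hX hY =>
    rw [show place m j (X + Y) = place m j X + place m j Y from scal_injective 0 (by
      rw [map_add, scal_place _ h, scal_place _ h, scal_place _ h, map_add])]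
    exact add_mem hX hY
  | mul X Y _ _ hX hY =>
    rw [show place m j (X * Y) = place m j X * place m j Y from scal_injective 0 (by
      rw [map_mul, scal_place _ h, scal_place _ h, scal_place _ h, map_mul])]
    exact mul_mem hX hY

omit hc hs in
lemma starExponent_mem {s t : ℕ} {x : Op N (s + 1) ℂ} (hx : x ∈ braidImage R (s + 1))
    {y : Op N (t + 1) ℂ} (hy : y ∈ braidImage R (t + 1)) :
    starExponent R x y ∈ braidImage R (s + 1 + t + 1) := by
  refine mul_mem (mul_mem (place_mem_braidImage (by omega) hx) (place_mem_braidImage (by omega) hy))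
    (mul_mem (list_prod_mem fun z hz => ?_) (list_prod_mem fun z hz => ?_))
  · simp only [List.mem_map, List.mem_reverse, List.mem_range] at hz
    obtain ⟨j, hj, rfl⟩ := hz
    exact Algebra.subset_adjoin ⟨j, by omega, Or.inl rfl⟩
  · simp only [List.mem_map, List.mem_range] at hz
    obtain ⟨j, hj, rfl⟩ := hz
    exact Algebra.subset_adjoin ⟨j + 1, by omega, Or.inr rfl⟩

variable (S : Subalgebra ℂ A)

lemma IsCompatiblePair.starM_mem {X : Matrix (Fin N) (Fin N) A} (hX : X ∈ starSpan R F M S) :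
    starM R F M X ∈ starSpan R F M S := by
  induction hX using AddSubmonoid.closure_induction with
  | mem X hX =>
    rcases hX with ⟨s, x, c, hx, hc', rfl⟩ | ⟨c, hc', rfl⟩
    · rw [starM_rmul, hc.starM_desc hs hx]
      exact AddSubmonoid.subset_closure (Or.inl ⟨_, _, c, starExponent_mem (one_mem_braidImage 1) hx, hc', rfl⟩)
    · rw [starM_rmul, hc.starM_one hs]
      exact AddSubmonoid.subset_closure (Or.inl ⟨0, 1, c, one_mem_braidImage 1, hc', by rw [desc_one]⟩)
  | zero =>
    have := starM_rmul R F M 0 0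
    rw [rmul_zero, rmul_zero] at this
    rw [this]
    exact zero_mem _
  | add X Y _ _ hX hY => rw [starM_add]; exact add_mem hX hY

omit hc hs [NeZero N] in
lemma rmul_mem_starSpan {X : Matrix (Fin N) (Fin N) A} (hX : X ∈ starSpan R F M S) {d : A} (hd : d ∈ S) :
    rmul X d ∈ starSpan R F M S := by
  induction hX using AddSubmonoid.closure_induction with
  | mem X hX =>
    rcases hX with ⟨s, x, c, hx, hc', rfl⟩ | ⟨c, hc', rfl⟩
    · rw [rmul_rmul]
      exact AddSubmonoid.subset_closure (Or.inl ⟨_, _, _, hx, mul_mem hc' hd, rfl⟩)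
    · rw [rmul_rmul]
      exact AddSubmonoid.subset_closure (Or.inr ⟨_, mul_mem hc' hd, rfl⟩)
  | zero => rw [zero_rmul]; exact zero_mem _
  | add X Y _ _ hX hY => rw [add_rmul]; exact add_mem hX hY

lemma IsCompatiblePair.isStarProduct_starM {X : Matrix (Fin N) (Fin N) A} (hX : X ∈ starSpan R F M S) :
    IsStarProduct R F M S M X (starM R F M X) := by
  induction hX using AddSubmonoid.closure_induction with
  | mem X hX =>
    rcases hX with ⟨s, x, c, hx, hc', rfl⟩ | ⟨c, hc', rfl⟩
    · rw [starM_rmul, hc.starM_desc hs hx]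
      have := IsStarProduct.desc_desc (R := R) (F := F) (M := M) 0 s 1 (one_mem_braidImage 1) x hx 1 c (one_mem S) hc'
      rwa [rmul_one, desc_one, one_mul] at this
    · rw [starM_rmul, hc.starM_one hs]
      have := IsStarProduct.desc_one (R := R) (F := F) (M := M) 0 1 (one_mem_braidImage 1) 1 c (one_mem S) hc'
      rwa [rmul_one, desc_one, one_mul] at this
  | zero =>
    have e := starM_rmul R F M 0 0
    rw [rmul_zero, rmul_zero] at e
    have := IsStarProduct.desc_one (R := R) (F := F) (M := M) 0 1 (one_mem_braidImage 1) 1 0 (one_mem S) (zero_mem S)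
    rw [rmul_one, mul_zero, rmul_zero, rmul_zero, desc_one] at this
    rwa [e]
  | add X Y _ _ hX hY => rw [starM_add]; exact IsStarProduct.add_right hX hY

omit hc hs [NeZero N] in
lemma isStarProduct_scalar {c : A} (hc : c ∈ S) (hS : ∀ c ∈ S, ∀ d ∈ S, c * d = d * c)
    {X : Matrix (Fin N) (Fin N) A} (hX : X ∈ starSpan R F M S) :
    IsStarProduct R F M S (rmul 1 c) X (rmul X c) := by
  induction hX using AddSubmonoid.closure_induction with
  | mem X hX =>
    rcases hX with ⟨s, x, d, hx, hd, rfl⟩ | ⟨d, hd, rfl⟩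
    · rw [rmul_rmul]
      exact IsStarProduct.one_desc s x hx c d hc hd
    · rw [rmul_rmul, hS d hd c hc]
      exact IsStarProduct.one_one c d hc hd
  | zero =>
    have := IsStarProduct.one_one (R := R) (F := F) (M := M) c 0 hc (zero_mem S)
    rw [mul_zero, rmul_zero] at this
    rwa [zero_rmul]
  | add X Y _ _ hX hY => rw [add_rmul]; exact IsStarProduct.add_right hX hY

end

end

/-! ### The commutative algebra behind the Cayley–Hamilton identity -/

section Final

variable {B : Type*} [CommRing B]

/-- `(x^{2j+1} + y^{2j+1}) / (x + y)`. -/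
def oddQuot (x y : B) : ℕ → B
  | 0 => 1
  | j + 1 => x ^ 2 * oddQuot x y j + y ^ (2 * j + 1) * (y - x)

lemma add_mul_oddQuot (x y : B) (j : ℕ) :
    (x + y) * oddQuot x y j = x ^ (2 * j + 1) + y ^ (2 * j + 1) := by
  induction j with
  | zero => simp [oddQuot]
  | succ j ih =>
    rw [oddQuot, mul_add, mul_left_comm, ih]
    ring

lemma oddQuot_succ' (x y : B) (j : ℕ) :
    oddQuot x y (j + 1) = y ^ 2 * oddQuot x y j + x ^ (2 * j + 1) * (x - y) := by
  rw [oddQuot]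
  linear_combination (x - y) * add_mul_oddQuot x y j

/-- `∑_{a<m} x^{2(m-1-a)} y^{2a} (y - x)`. -/
def evenQuot (x y : B) : ℕ → B
  | 0 => 0
  | m + 1 => x ^ 2 * evenQuot x y m + y ^ (2 * m) * (y - x)

lemma oddQuot_add (x y : B) (j m : ℕ) :
    oddQuot x y (j + m) = x ^ (2 * m) * oddQuot x y j + y ^ (2 * j + 1) * evenQuot x y m := by
  induction m with
  | zero => simp [evenQuot]
  | succ m ih =>
    rw [← add_assoc, oddQuot, ih, evenQuot]
    ring

/-- Shadow of `u^{n+m} + (uv)^m u^{n-m}`-type identities for two-term recurrences: sequences built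
from powers of `x²` and `y²` satisfy it around every index. It allows terms symmetric about `n` to
be collected in pairs. -/
lemma oddQuot_symm (x y : B) {n m : ℕ} (h : m ≤ n) :
    oddQuot x y (n + m) + (x * y) ^ (2 * m) * oddQuot x y (n - m) =
      (x ^ (2 * m) + y ^ (2 * m)) * oddQuot x y n := by
  obtain ⟨p, rfl⟩ := Nat.exists_eq_add_of_le' h
  rw [Nat.add_sub_cancel]
  linear_combination oddQuot_add x y (p + m) m - y ^ (2 * m) * oddQuot_add x y p m

/-- The convolution of `ε` with the signed quotients. -/
def convQuot (x y t : B) (ε : ℕ → B) (i : ℕ) : B :=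
  ∑ j ∈ Finset.range (i + 1), (-1) ^ (i - j) * oddQuot x y (i - j) * (t ^ j * ε j)

lemma convQuot_zero (x y t : B) (ε : ℕ → B) : convQuot x y t ε 0 = ε 0 := by
  simp [convQuot, oddQuot]

lemma convQuot_succ_aux (x y t : B) (ε : ℕ → B) (i : ℕ) :
    convQuot x y t ε (i + 1) = -x ^ 2 * convQuot x y t ε i -
      y * (y - x) * (∑ j ∈ Finset.range (i + 1), (-y ^ 2) ^ (i - j) * (t ^ j * ε j)) +
      t ^ (i + 1) * ε (i + 1) := by
  rw [convQuot, Finset.sum_range_succ, Nat.sub_self, pow_zero, oddQuot, one_mul, one_mul, convQuot,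
    Finset.mul_sum, Finset.mul_sum, ← Finset.sum_sub_distrib]
  congr 1
  refine Finset.sum_congr rfl fun j hj => ?_
  rw [show i + 1 - j = i - j + 1 by have := Finset.mem_range.1 hj; omega, oddQuot]
  have : (-y ^ 2) ^ (i - j) = (-1) ^ (i - j) * y ^ (2 * (i - j)) := by
    rw [neg_pow, ← pow_mul]
  rw [this]
  ring

lemma convQuot_one (x y t : B) (ε : ℕ → B) :
    convQuot x y t ε 1 + (x ^ 2 + y ^ 2) * convQuot x y t ε 0 = t * ε 1 + x * y * ε 0 := by
  rw [convQuot_succ_aux, convQuot_zero]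
  simp
  ring

/-- The generating series of `(-1)^j oddQuot x y j` is `(1 + x y u) / ((1 + x² u)(1 + y² u))`, so
convolving with it and clearing the denominator leaves multiplication by `1 + x y u`. For `t = q x`,
`y = q h` the right-hand side becomes `(q x)^{i+2} a_{i+2}`. -/
lemma convQuot_rec (x y t : B) (ε : ℕ → B) (i : ℕ) :
    convQuot x y t ε (i + 2) + (x ^ 2 + y ^ 2) * convQuot x y t ε (i + 1) +
      x ^ 2 * y ^ 2 * convQuot x y t ε i = t ^ (i + 2) * ε (i + 2) + x * y * (t ^ (i + 1) * ε (i + 1)) := by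
  have e : ∑ j ∈ Finset.range (i + 1 + 1), (-y ^ 2) ^ (i + 1 - j) * (t ^ j * ε j) =
      -y ^ 2 * (∑ j ∈ Finset.range (i + 1), (-y ^ 2) ^ (i - j) * (t ^ j * ε j)) + t ^ (i + 1) * ε (i + 1) := by
    rw [Finset.sum_range_succ, Nat.sub_self, pow_zero, one_mul, Finset.mul_sum]
    congr 1
    refine Finset.sum_congr rfl fun j hj => ?_
    rw [show i + 1 - j = i - j + 1 by have := Finset.mem_range.1 hj; omega, pow_succ]
    ring
  rw [convQuot_succ_aux x y t ε (i + 1), e]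
  linear_combination y ^ 2 * convQuot_succ_aux x y t ε i

/-- The polynomial of the Cayley–Hamilton identity. -/
def chPoly (q x : B) (ε : ℕ → B) (n : ℕ) : B :=
  ∑ i ∈ Finset.range (2 * n + 1), (-q) ^ i * (x ^ (2 * n - i) * ε i)

variable [Algebra ℂ B]

/-- Pair the index `i` with `2n - i`. Symmetry of `ε` gives both terms the common factor `ε i`, and
`oddQuot_symm` extracts `oddQuot x (q h) (n + d)` from each pair. -/
lemma sum_oddQuot_mul (q x h : B) (ε : ℕ → B) {n : ℕ}
    (hε : ∀ m ≤ n, ε (n + m) = ε (n - m) * h ^ (2 * m)) (d : ℕ) :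
    ∑ i ∈ Finset.range (2 * n + 1), (-1) ^ i * oddQuot x (q * h) (d + (2 * n - i)) * ((q * x) ^ i * ε i) =
      oddQuot x (q * h) (n + d) * chPoly q x ε n := by
  set y := q * h with hy
  have key : ∀ i, i ≤ n → (-1) ^ i * oddQuot x y (d + (2 * n - i)) * ((q * x) ^ i * ε i) +
      (-1) ^ (2 * n - i) * oddQuot x y (d + (2 * n - (2 * n - i))) * ((q * x) ^ (2 * n - i) * ε (2 * n - i)) =
      oddQuot x y (n + d) * ((-q) ^ i * (x ^ (2 * n - i) * ε i) +
        (-q) ^ (2 * n - i) * (x ^ (2 * n - (2 * n - i)) * ε (2 * n - i))) := by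
    intro i hi
    obtain ⟨m, rfl⟩ := Nat.exists_eq_add_of_le' hi
    have e := hε m (by omega)
    have s := oddQuot_symm x y (n := m + i + d) (m := m) (by omega)
    rw [show m + i + d - m = i + d by omega] at s
    rw [show 2 * (m + i) - i = 2 * m + i by omega, show 2 * (m + i) - (2 * m + i) = i by omega,
      show 2 * m + i = m + i + m by omega, e, show m + i - m = i by omega,
      show d + (m + i + m) = m + i + d + m by omega, add_comm d i]
    have e1 : (-1 : B) ^ (m + i + m) = (-1) ^ i := by
      rw [show m + i + m = 2 * m + i by omega, pow_add, pow_mul]; simp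
    have e2 : (-q) ^ (m + i + m) = (-1) ^ i * (q ^ i * q ^ (2 * m)) := by
      rw [neg_pow, e1, show m + i + m = i + 2 * m by omega, pow_add]
    have e3 : (-q) ^ i = (-1) ^ i * q ^ i := by rw [neg_pow]
    have e4 : y ^ (2 * m) = q ^ (2 * m) * h ^ (2 * m) := by rw [hy, mul_pow]
    have e5 : (q * x) ^ (m + i + m) = q ^ i * q ^ (2 * m) * (x ^ i * x ^ (2 * m)) := by
      rw [mul_pow, show m + i + m = i + 2 * m by omega, pow_add, pow_add]
    have e6 : x ^ (m + i + m) = x ^ i * x ^ (2 * m) := by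
      rw [show m + i + m = i + 2 * m by omega, pow_add]
    rw [e1, e2, e3, e5, e6, mul_pow q x i]
    rw [mul_pow, e4] at s
    linear_combination (-1) ^ i * q ^ i * x ^ i * ε i * s
  have key' : ∀ i ∈ Finset.range (2 * n + 1),
      (-1) ^ i * oddQuot x y (d + (2 * n - i)) * ((q * x) ^ i * ε i) +
      (-1) ^ (2 * n - i) * oddQuot x y (d + (2 * n - (2 * n - i))) * ((q * x) ^ (2 * n - i) * ε (2 * n - i)) =
      oddQuot x y (n + d) * ((-q) ^ i * (x ^ (2 * n - i) * ε i) +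
        (-q) ^ (2 * n - i) * (x ^ (2 * n - (2 * n - i)) * ε (2 * n - i))) := by
    intro i hi
    have hi := Finset.mem_range.1 hi
    rcases Nat.le_total i n with h' | h'
    · exact key i h'
    · have := key (2 * n - i) (by omega)
      rw [show 2 * n - (2 * n - i) = i by omega] at this ⊢
      linear_combination this
  have s := Finset.sum_congr rfl key'
  rw [← Finset.mul_sum, Finset.sum_add_distrib, Finset.sum_add_distrib] at s
  have r : ∀ f : ℕ → B, ∑ i ∈ Finset.range (2 * n + 1), f (2 * n - i) = ∑ i ∈ Finset.range (2 * n + 1), f i := by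
    intro f
    rw [← Finset.sum_range_reflect f]
    exact Finset.sum_congr rfl fun i _ => by rw [show 2 * n + 1 - 1 - i = 2 * n - i by omega]
  rw [r fun i => (-1) ^ i * oddQuot x y (d + (2 * n - i)) * ((q * x) ^ i * ε i),
    r fun i => (-q) ^ i * (x ^ (2 * n - i) * ε i), ← two_mul, ← two_mul, mul_left_comm] at s
  -- Pairing over the whole range counts every term twice; the factor two is invertible in a complex
  -- algebra.
  have two : (2 : B) * algebraMap ℂ B 2⁻¹ = 1 := by
    rw [show (2 : B) = algebraMap ℂ B 2 by rw [map_ofNat], ← map_mul]; simp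
  rw [chPoly]
  generalize ∑ i ∈ Finset.range (2 * n + 1),
    (-1) ^ i * oddQuot x y (d + (2 * n - i)) * ((q * x) ^ i * ε i) = S at *
  generalize ∑ i ∈ Finset.range (2 * n + 1), (-q) ^ i * (x ^ (2 * n - i) * ε i) = S' at *
  linear_combination (algebraMap ℂ B 2⁻¹) * s - (S - oddQuot x y (n + d) * S') * two

variable {V : Type*} [AddCommGroup V] [Module B V]

omit [Algebra ℂ B] in
/-- Closed form of the solution of the recursions for the descendants. -/
lemma descendant_solution {v : V} {x G Q : B} {al be : ℕ → V} {a s c d e w p : ℕ → B} {k : ℕ}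
    (hal : al 1 = x • v) (hbe : be 1 = (G * w 1) • v) (s1 : s 1 = 0) (s2 : s 2 = 1)
    (hs : ∀ j, j + 1 < k → s (j + 3) + (x ^ 2 + G) * s (j + 2) + x ^ 2 * G * s (j + 1) =
      a (j + 1) * x ^ (j + 1))
    (h1 : ∀ j, j + 1 < k → al (j + 2) = (a (j + 1) * x) • v - x • al (j + 1) - c (j + 1) • be (j + 1))
    (h2 : ∀ j, j + 1 < k → x • be (j + 2) =
      (Q * G) • ((w (j + 1) * a (j + 1) * x) • v + (d (j + 1) * x) • al (j + 1) - be (j + 1)))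
    (cw : ∀ j, j + 1 < k → c (j + 1) * w (j + 1) = 1 - e (j + 1))
    (cp : ∀ j, j + 1 < k → c (j + 1) * p (j + 1) = 1 - e j)
    (ww : ∀ j, j + 1 < k → w (j + 2) = Q * w (j + 1))
    (pw : ∀ j, j + 1 < k → p (j + 2) = Q * (w (j + 1) + d (j + 1)))
    (pe : ∀ j, j + 1 < k → p (j + 1) = w (j + 1) + d (j + 1) * e j) :
    ∀ j, j < k → x ^ j • al (j + 1) = (x * (s (j + 2) + e j * G * s (j + 1))) • v ∧
      x ^ j • be (j + 1) = (G * (w (j + 1) * s (j + 2) + p (j + 1) * x ^ 2 * s (j + 1))) • v := by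
  intro j
  induction j with
  | zero => intro _; simp [hal, hbe, s1, s2]
  | succ j ih =>
    intro hj
    obtain ⟨i1, i2⟩ := ih (by omega)
    have S := hs j hj
    constructor
    · have t : x ^ (j + 1) • al (j + 2) = (a (j + 1) * x ^ (j + 1) * x) • v - x ^ 2 • (x ^ j • al (j + 1)) -
          (c (j + 1) * x) • (x ^ j • be (j + 1)) := by
        rw [h1 j hj]
        module
      rw [t, i1, i2, ← S, ← sub_eq_zero, smul_smul, smul_smul, ← sub_smul, ← sub_smul, ← sub_smul]
      convert zero_smul B v using 2
      linear_combination -x * G * s (j + 2) * cw j hj - x * G * x ^ 2 * s (j + 1) * cp j hj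
    · have t : x ^ (j + 1) • be (j + 2) = (Q * G) • ((w (j + 1) * (a (j + 1) * x ^ (j + 1))) • v +
          (d (j + 1) * x) • (x ^ j • al (j + 1)) - x ^ j • be (j + 1)) := by
        rw [pow_succ, mul_smul, h2 j hj]
        module
      rw [t, i1, i2, ← S, ← sub_eq_zero, smul_smul, ← add_smul, ← sub_smul, smul_smul, ← sub_smul]
      convert zero_smul B v using 2
      linear_combination -G * s (j + 3) * ww j hj - G * x ^ 2 * s (j + 2) * pw j hj -
        Q * G * G * x ^ 2 * s (j + 1) * pe j hj

lemma eq_zero_of_algebraMap_smul {z : ℂ} (hz : z ≠ 0) {u : V} (h : algebraMap ℂ B z • u = 0) : u = 0 := by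
  have := congrArg (algebraMap ℂ B z⁻¹ • ·) h
  simpa only [smul_smul, ← map_mul, inv_mul_cancel₀ hz, map_one, one_smul, smul_zero] using this

/-! ### Elimination when the operator `x` is injective. -/

section Cancel

variable {v : V} {x h : B} (hx : ∀ u : V, x • u = 0 → u = 0)
include hx

omit [Algebra ℂ B] in
lemma eq_zero_of_pow_smul (m : ℕ) {u : V} (hu : x ^ m • u = 0) : u = 0 := by
  induction m with
  | zero => simpa using hu
  | succ m ih => exact ih (hx _ (by rwa [pow_succ', mul_smul] at hu))

/-- On a vector on which `y` acts as `z x`. -/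
lemma oddQuot_smul {y : B} {u : V} (z : ℂ) (hu : y • u = (algebraMap ℂ B z * x) • u) (j : ℕ) :
    (algebraMap ℂ B (1 + z) * oddQuot x y j) • u = (algebraMap ℂ B (1 + z ^ (2 * j + 1)) * x ^ (2 * j)) • u := by
  have hp : ∀ m : ℕ, y ^ m • u = (algebraMap ℂ B z * x) ^ m • u := by
    intro m
    induction m with
    | zero => simp
    | succ m ih => rw [pow_succ, mul_smul, hu, smul_comm, ih, ← mul_smul, ← pow_succ']
  have e1 : (x * (algebraMap ℂ B (1 + z) * oddQuot x y j)) • u =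
      ((x + y) * oddQuot x y j) • u := by
    rw [add_mul, add_smul, mul_comm y, mul_smul _ y, hu, smul_smul, ← add_smul, map_add, map_one]
    congr 1
    ring
  rw [add_mul_oddQuot, add_smul, hp, ← add_smul] at e1
  rw [← sub_eq_zero]
  apply hx
  rw [smul_sub, smul_smul, e1, smul_smul, ← sub_smul]
  convert zero_smul B u using 2
  rw [map_add, map_one, map_pow]
  ring

/-- Elimination of `E` from two relations. -/
lemma elimination {q : ℂ} {n : ℕ} {y : B} {u : V} (hq0 : q ≠ 0) (hq1 : q ^ 2 - 1 ≠ 0)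
    (hk : 1 + q ^ (2 * n + 1) ≠ 0) (hn : 1 ≤ n)
    (hA : (oddQuot x y n * (y ^ 2 - (algebraMap ℂ B q) ^ 2 * x ^ 2)) • u = 0)
    (hB : (algebraMap ℂ B (q ^ 2 - 1) * oddQuot x y n +
      algebraMap ℂ B (1 + q ^ (2 * n + 1)) * (x ^ (2 * n - 1) * (x - y))) • u = 0) :
    y • u = (algebraMap ℂ B q * x) • u := by
  set Q := algebraMap ℂ B q with hQ
  -- The term containing `oddQuot` cancels between `y² - Q² x²` times `hB` and `q² - 1` times `hA`;
  -- the remaining scalar and power of `x` are cancellable.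
  have h1 : ((x - y) * (y ^ 2 - Q ^ 2 * x ^ 2)) • u = 0 := by
    apply eq_zero_of_pow_smul hx (2 * n - 1)
    apply eq_zero_of_algebraMap_smul (B := B) hk
    have e := congrArg ((y ^ 2 - Q ^ 2 * x ^ 2) • ·) hB
    have e' := congrArg (algebraMap ℂ B (q ^ 2 - 1) • ·) hA
    simp only [smul_zero, smul_smul] at e e' ⊢
    rw [← sub_eq_zero.2 (e.trans e'.symm), ← sub_smul]
    congr 1
    ring
  -- On this vector `y` acts as `x`, so `oddQuot` acts as `x^{2n}` and `hB` reduces to `(q² - 1)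
  -- x^{2n}`.
  have h2 : (y ^ 2 - Q ^ 2 * x ^ 2) • u = 0 := by
    set u' := (y ^ 2 - Q ^ 2 * x ^ 2) • u with hu'
    have hy : y • u' = (algebraMap ℂ B 1 * x) • u' := by
      rw [map_one, one_mul, ← sub_eq_zero, ← neg_eq_zero, neg_sub, ← sub_smul, hu', smul_smul, h1]
    have e := oddQuot_smul hx 1 hy n
    rw [one_pow, mul_smul, mul_smul, ← sub_eq_zero, ← smul_sub] at e
    have e := sub_eq_zero.1 (eq_zero_of_algebraMap_smul (by norm_num) e)
    apply eq_zero_of_pow_smul hx (2 * n)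
    apply eq_zero_of_algebraMap_smul (B := B) hq1
    have hB' := congrArg ((y ^ 2 - Q ^ 2 * x ^ 2) • ·) hB
    have e2 : (x - y) • u' = 0 := by rw [hu', smul_smul, h1]
    simp only [smul_zero] at hB'
    rw [smul_comm, ← hu', add_smul, mul_smul, e, mul_smul, mul_smul, e2, smul_zero, smul_zero, add_zero] at hB'
    exact hB'
  -- On this vector `y` acts as `-q x`; after multiplication by `1 - q`, relation `hB` becomes `2
  -- q^{2n+1} (1 - q²) x^{2n}`, again cancellable.
  set u' := (y - Q * x) • u with hu'
  have hy : y • u' = (algebraMap ℂ B (-q) * x) • u' := by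
    rw [← sub_eq_zero, ← sub_smul, hu', smul_smul, ← h2, map_neg]
    congr 1
    ring
  have e := oddQuot_smul hx (-q) hy n
  have hB' := congrArg ((algebraMap ℂ B (1 - q) * (y - Q * x)) • ·) hB
  simp only [smul_zero, smul_smul] at hB'
  have e3 : x ^ (2 * n) • u' = 0 := by
    apply eq_zero_of_algebraMap_smul (B := B) (z := 2 * q ^ (2 * n + 1) * (1 - q ^ 2))
    · refine mul_ne_zero (mul_ne_zero two_ne_zero (pow_ne_zero _ hq0)) ?_
      rw [← neg_sub]; exact neg_ne_zero.2 hq1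
    have xx : x ^ (2 * n) = x ^ (2 * n - 1) * x := by rw [← pow_succ]; congr 1; omega
    have g1 : (algebraMap ℂ B (1 + -q) * oddQuot x y n) • u' -
        (algebraMap ℂ B (1 + (-q) ^ (2 * n + 1)) * x ^ (2 * n)) • u' = 0 := sub_eq_zero.2 e
    have g2 : (x ^ (2 * n - 1)) • (y • u' - (algebraMap ℂ B (-q) * x) • u') = 0 := by
      rw [sub_eq_zero.2 hy, smul_zero]
    have odd : (-q) ^ (2 * n + 1) = -q ^ (2 * n + 1) := Odd.neg_pow ⟨n, rfl⟩ q
    have g3 : (algebraMap ℂ B (2 * q ^ (2 * n + 1) * (1 - q ^ 2)) * x ^ (2 * n)) • u' =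
      ((algebraMap ℂ B (1 - q) * (y - Q * x)) * (algebraMap ℂ B (q ^ 2 - 1) * oddQuot x y n +
      algebraMap ℂ B (1 + q ^ (2 * n + 1)) * (x ^ (2 * n - 1) * (x - y)))) • u -
      algebraMap ℂ B (q ^ 2 - 1) • ((algebraMap ℂ B (1 + -q) * oddQuot x y n) • u' -
        (algebraMap ℂ B (1 + (-q) ^ (2 * n + 1)) * x ^ (2 * n)) • u') +
      algebraMap ℂ B ((1 - q) * (1 + q ^ (2 * n + 1))) • ((x ^ (2 * n - 1)) •
        (y • u' - (algebraMap ℂ B (-q) * x) • u')) := by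
      rw [hu', odd, xx]
      simp only [smul_smul, ← sub_smul, ← add_smul]
      congr 1
      simp only [map_add, map_sub, map_mul, map_one, map_neg, map_pow, map_ofNat, ← hQ]
      ring
    rw [smul_smul, g3, hB', g1, g2, smul_zero, smul_zero, sub_zero, add_zero]
  have e4 := eq_zero_of_pow_smul hx _ e3
  rwa [hu', sub_smul, sub_eq_zero] at e4

end Cancel

/-! The scalars entering the recursions. -/

/-- `μ q^{2i-1}` for `μ = q^{1-k}`. -/
def nuVal (q : ℂ) (k i : ℕ) : ℂ := q ^ (2 * i) / q ^ k
-- `cVal` is the coefficient of `B_i` in the recursion for `A_{i+1}`, and `dVal` that of `x A_i` in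
-- the recursion for `x B_{i+1}`.
def dVal (q : ℂ) (k i : ℕ) : ℂ := (q - q⁻¹) / (1 + nuVal q k i)
def cVal (q : ℂ) (k i : ℕ) : ℂ := dVal q k i * nuVal q k i
-- `eVal`, `wVal` and `pVal` are the coefficients of the closed form of `A_i` and `B_i`; the
-- identities below, which rest on `ν_{i+1} = q² ν_i`, are those that make the closed form satisfy
-- the recursions.
def eVal (q : ℂ) (k i : ℕ) : ℂ := 1 - (1 - q⁻¹ ^ 2) / (1 + nuVal q k i)
def wVal (q : ℂ) (k i : ℕ) : ℂ := q ^ k / q ^ (2 * i + 1)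
def pVal (q : ℂ) (k i : ℕ) : ℂ := wVal q k i + dVal q k i * eVal q k (i - 1)

section Scalars
variable {q : ℂ} {k : ℕ} (hq : q ≠ 0) (hν : ∀ i ≤ k, 1 + nuVal q k i ≠ 0)
include hq

omit hq in
lemma nuVal_succ (i : ℕ) : nuVal q k (i + 1) = q ^ 2 * nuVal q k i := by
  rw [nuVal, nuVal]; ring

lemma wVal_eq (i : ℕ) : wVal q k i = q⁻¹ / nuVal q k i := by
  rw [wVal, nuVal]; field_simp; ring

lemma nuVal_ne_zero (i : ℕ) : nuVal q k i ≠ 0 := div_ne_zero (pow_ne_zero _ hq) (pow_ne_zero _ hq)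

lemma wVal_succ (i : ℕ) : wVal q k (i + 1) = q⁻¹ ^ 2 * wVal q k i := by
  rw [wVal, wVal]; field_simp; ring

include hν

lemma cVal_mul_wVal {i : ℕ} (hi : i ≤ k) : cVal q k i * wVal q k i = 1 - eVal q k i := by
  have h1 := hν i hi; have h2 := nuVal_ne_zero (k := k) hq i
  rw [cVal, dVal, eVal, wVal_eq hq]
  generalize nuVal q k i = ν at *
  field_simp
  ring

lemma pVal_succ {i : ℕ} (hi : i + 1 ≤ k) : pVal q k (i + 1) = q⁻¹ ^ 2 * (wVal q k i + dVal q k i) := by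
  have h1 := hν i (by omega); have h2 := nuVal_ne_zero (k := k) hq i; have h3 := hν (i + 1) hi
  rw [pVal, eVal, dVal, dVal, wVal_eq hq, wVal_eq hq, Nat.add_sub_cancel]
  rw [nuVal_succ] at *
  generalize nuVal q k i = ν at *
  field_simp
  ring

lemma cVal_mul_pVal {i : ℕ} (hi : i + 1 ≤ k) : cVal q k (i + 1) * pVal q k (i + 1) = 1 - eVal q k i := by
  have h1 := hν i (by omega); have h2 := nuVal_ne_zero (k := k) hq i; have h3 := hν (i + 1) hi
  rw [pVal_succ hq hν hi, cVal, eVal, dVal, dVal, wVal_eq hq]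
  rw [nuVal_succ] at *
  generalize nuVal q k i = ν at *
  field_simp
  ring

end Scalars

/-- The Cayley–Hamilton identity, deduced from the recursions for the descendants. -/
theorem cayleyHamilton_of_recursions {v : V} {x h : B} (hx : ∀ u : V, x • u = 0 → u = 0) {q : ℂ} {n : ℕ}
    (hq0 : q ≠ 0) (hq1 : q ^ 2 - 1 ≠ 0) (hn : 1 ≤ n)
    (hν : ∀ i ≤ 2 * n + 1, 1 + nuVal q (2 * n + 1) i ≠ 0)
    {al be : ℕ → V} {a ε : ℕ → B}
    (hal : al 1 = x • v) (hbe : be 1 = (algebraMap ℂ B (q ^ (2 * n)) * h ^ 2) • v)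
    (h1 : ∀ j, j + 1 < 2 * n + 1 → al (j + 2) = (algebraMap ℂ B (q ^ (j + 1)) * a (j + 1) * x) • v -
      x • al (j + 1) - algebraMap ℂ B (cVal q (2 * n + 1) (j + 1)) • be (j + 1))
    (h2 : ∀ j, j + 1 < 2 * n + 1 → x • be (j + 2) = h ^ 2 •
      ((algebraMap ℂ B (wVal q (2 * n + 1) (j + 1) * q ^ (j + 1)) * a (j + 1) * x) • v +
        (algebraMap ℂ B (dVal q (2 * n + 1) (j + 1)) * x) • al (j + 1) - be (j + 1)))
    (halk : al (2 * n + 1) =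
      (algebraMap ℂ B (eVal q (2 * n + 1) (2 * n) * q ^ (2 * n + 1)) * a (2 * n + 1)) • v)
    (hbek : be (2 * n + 1) = (algebraMap ℂ B (eVal q (2 * n + 1) (2 * n) * q) * a (2 * n + 1) * x) • v)
    (ε0 : ε 0 = 1) (hε : ∀ i, i ≤ 2 * n → a (i + 1) = ε (i + 1) + h * ε i)
    (εk : ε (2 * n + 1) = 0) (hsymm : ∀ m ≤ n, ε (n + m) = ε (n - m) * h ^ (2 * m)) :
    h • chPoly (algebraMap ℂ B q) x ε n • v = x • chPoly (algebraMap ℂ B q) x ε n • v := by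
  set Q := algebraMap ℂ B q with hQ
  set y := Q * h with hy
  have hQQ : algebraMap ℂ B (q⁻¹ ^ 2) * y ^ 2 = h ^ 2 := by
    rw [hy, mul_pow, hQ, ← mul_assoc, ← map_pow, ← map_mul, ← mul_pow, inv_mul_cancel₀ hq0, one_pow,
      map_one, one_mul]
  -- The shift by two with zero initial values absorbs the exceptional first step of the recurrence
  -- for `convQuot` into the general one.
  let s : ℕ → B := fun i => if i < 2 then 0 else convQuot x y (Q * x) ε (i - 2)
  have s2 : ∀ i, s (i + 2) = convQuot x y (Q * x) ε i := fun i => by simp [s]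
  have sol := descendant_solution (v := v) (x := x) (G := y ^ 2) (Q := algebraMap ℂ B (q⁻¹ ^ 2)) (al := al)
    (be := be) (a := fun i => algebraMap ℂ B (q ^ i) * a i) (s := s)
    (c := fun i => algebraMap ℂ B (cVal q (2 * n + 1) i)) (d := fun i => algebraMap ℂ B (dVal q (2 * n + 1) i))
    (e := fun i => algebraMap ℂ B (eVal q (2 * n + 1) i)) (w := fun i => algebraMap ℂ B (wVal q (2 * n + 1) i))
    (p := fun i => algebraMap ℂ B (pVal q (2 * n + 1) i)) (k := 2 * n + 1) hal (by
      rw [hbe, ← hQQ]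
      congr 1
      have : q ^ (2 * n) * q⁻¹ ^ 2 = wVal q (2 * n + 1) 1 := by rw [wVal]; field_simp; ring
      rw [← this, map_mul, mul_left_comm]
      ring) (by simp [s]) (by rw [s2, convQuot_zero, ε0]) (by
      intro j hj
      rw [show j + 3 = j + 1 + 2 by ring, s2, s2]
      rcases j with _ | j
      · rw [show s (0 + 1) = 0 by simp [s], mul_zero, add_zero, convQuot_one, hε 0 (by omega)]
        simp only [zero_add, pow_one]
        rw [hy]
        ring
      · rw [s2, convQuot_rec, hε (j + 1) (by omega), map_pow, ← hQ, hy]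
        ring) h1 (by
      intro j hj
      rw [h2 j hj, hQQ, map_mul, mul_assoc (algebraMap ℂ B (wVal _ _ _))])
    (fun j hj => by rw [← map_mul, cVal_mul_wVal hq0 hν (by omega), map_sub, map_one])
    (fun j hj => by rw [← map_mul, cVal_mul_pVal hq0 hν (by omega), map_sub, map_one])
    (fun j hj => by rw [← map_mul, wVal_succ hq0])
    (fun j hj => by rw [pVal_succ hq0 hν (by omega), map_mul, map_add])
    (fun j hj => by rw [pVal, map_add, map_mul, Nat.add_sub_cancel])
  obtain ⟨E1, E2⟩ := sol (2 * n) (by omega)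
  have s2' : s (2 * n + 1) = convQuot x y (Q * x) ε (2 * n - 1) := by
    rw [show 2 * n + 1 = (2 * n - 1) + 2 by omega, s2]
  rw [halk, s2, s2'] at E1
  rw [hbek, s2, s2'] at E2
  -- The recurrence is run one step past the end, where `ε (2n+1) = 0`; it expresses the unwanted
  -- `convQuot (2n-1)` through multiples of `E` and `a (2n+1)`.
  have T := convQuot_rec x y (Q * x) ε (2 * n - 1)
  rw [show 2 * n - 1 + 1 = 2 * n by omega, show 2 * n - 1 + 2 = 2 * n + 1 by omega, εk, mul_zero, zero_add] at T
  -- The two last convolutions are the complete symmetric sums and hence multiples of the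
  -- Cayley–Hamilton polynomial.
  have c0 : convQuot x y (Q * x) ε (2 * n) = oddQuot x y n * chPoly Q x ε n := by
    have g := sum_oddQuot_mul Q x h ε hsymm 0
    rw [add_zero] at g
    rw [← g]
    refine Finset.sum_congr rfl fun j hj => ?_
    have hj := Finset.mem_range.1 hj
    have : (-1 : B) ^ (2 * n - j) = (-1) ^ j := by
      rcases Nat.even_or_odd j with e | e
      · rw [e.neg_one_pow, Even.neg_one_pow (by rw [Nat.even_sub (by omega)]; simp [e])]
      · rw [e.neg_one_pow, Odd.neg_one_pow (by rw [Nat.odd_sub' (by omega)]; simp [e])]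
    rw [this, zero_add]
  have c1 : convQuot x y (Q * x) ε (2 * n + 1) = -(oddQuot x y (n + 1) * chPoly Q x ε n) := by
    rw [← sum_oddQuot_mul Q x h ε hsymm 1, convQuot, Finset.sum_range_succ, εk, mul_zero, mul_zero,
      add_zero, ← Finset.sum_neg_distrib]
    refine Finset.sum_congr rfl fun j hj => ?_
    have hj := Finset.mem_range.1 hj
    have : (-1 : B) ^ (2 * n + 1 - j) = -(-1) ^ j := by
      rcases Nat.even_or_odd j with e | e
      · rw [e.neg_one_pow, Odd.neg_one_pow]
        rw [Nat.odd_sub (by omega)]; simp [e]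
      · rw [e.neg_one_pow, Even.neg_one_pow, neg_neg]
        rw [Nat.even_sub (by omega)]; simp [e, Nat.not_even_iff_odd]
    rw [this, show 2 * n + 1 - j = 1 + (2 * n - j) by omega]
    ring
  rw [c0, c1, oddQuot_succ'] at T
  rw [c0] at E1 E2
  have hak := hε (2 * n) le_rfl
  rw [εk, zero_add] at hak
  set E := chPoly Q x ε n with hE
  set W := oddQuot x y n with hW
  set C := convQuot x y (Q * x) ε (2 * n - 1) with hC
  set e := algebraMap ℂ B (eVal q (2 * n + 1) (2 * n)) with he
  have T' : x ^ 2 * y ^ 2 * C = Q ^ (2 * n + 1) * x ^ (2 * n + 1) * a (2 * n + 1) - x ^ 2 * (W * E) +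
      x ^ (2 * n + 1) * (x - y) * E := by
    rw [hak]
    linear_combination T
  have xx : x ^ (2 * n + 1) = x ^ 2 * x ^ (2 * n - 1) := by rw [← pow_add]; congr 1; omega
  -- Closed form of `A_k` against its terminal value; after substituting `T'` the terms in `a
  -- (2n+1)` cancel because the terminal coefficient is `e q^{2n+1}`.
  have hB0 : (((1 - e) * W + e * (x ^ (2 * n - 1) * (x - y))) * E) • v = 0 := by
    apply eq_zero_of_pow_smul hx 2
    have E1' := congrArg (x • ·) E1
    simp only [smul_smul] at E1'
    rw [← sub_eq_zero, ← sub_smul] at E1'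
    rw [smul_smul, ← neg_eq_zero, ← E1', ← neg_smul]
    congr 1
    rw [map_mul, map_pow, ← hQ]
    linear_combination e * T' + e * (x - y) * E * xx
  have hνn := hν (2 * n) (by omega)
  have hνv : nuVal q (2 * n + 1) (2 * n) * q = q ^ (2 * n) := by
    rw [nuVal]
    field_simp
    ring
  set ν := nuVal q (2 * n + 1) (2 * n) with hνdef
  have hB : ((algebraMap ℂ B (q ^ 2 - 1) * W +
      algebraMap ℂ B (1 + q ^ (2 * n + 1)) * (x ^ (2 * n - 1) * (x - y)))) • E • v = 0 := by
    have := congrArg (algebraMap ℂ B (q ^ 2 * (1 + ν)) • ·) hB0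
    simp only [smul_zero, smul_smul] at this
    rw [smul_smul, ← this]
    congr 1
    have z1 : q ^ 2 * (1 + ν) * (1 - eVal q (2 * n + 1) (2 * n)) = q ^ 2 - 1 := by
      rw [eVal, ← hνdef]; field_simp; ring
    have z2 : q ^ 2 * (1 + ν) * eVal q (2 * n + 1) (2 * n) = 1 + q ^ (2 * n + 1) := by
      rw [pow_succ q (2 * n), ← hνv]
      linear_combination -z1
    rw [← z1, ← z2]
    simp only [map_mul, map_sub, map_one, ← he]
    ring
  -- The same comparison for `B_k`, from which `hB0` removes the terms not containing `W`.
  have hA : (W * (y ^ 2 - Q ^ 2 * x ^ 2)) • E • v = 0 := by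
    have hp : pVal q (2 * n + 1) (2 * n + 1) * q ^ (2 * n + 1) = eVal q (2 * n + 1) (2 * n) * q := by
      rw [pVal_succ hq0 hν le_rfl, wVal_eq hq0, dVal, eVal, ← hνdef, pow_succ q (2 * n), ← hνv]
      have := nuVal_ne_zero (k := 2 * n + 1) hq0 (2 * n)
      rw [← hνdef] at this
      field_simp
      ring
    have hw : wVal q (2 * n + 1) (2 * n + 1) * q ^ (2 * n) * q ^ 2 = 1 := by
      rw [wVal]
      field_simp
      ring
    have hpe : pVal q (2 * n + 1) (2 * n + 1) * q ^ (2 * n) = eVal q (2 * n + 1) (2 * n) := by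
      apply mul_right_cancel₀ hq0
      rw [← hp]
      ring
    have z1 := congrArg (algebraMap ℂ B) hpe
    have z2 := congrArg (algebraMap ℂ B) hw
    have z3 := congrArg (algebraMap ℂ B) hp
    simp only [map_mul, map_pow, map_one, ← he, ← hQ] at z1 z2 z3
    have E2' := congrArg ((Q ^ (2 * n) * Q ^ 2) • ·) E2
    have hB0' := congrArg ((Q ^ 2 * x ^ 2) • ·) hB0
    simp only [smul_smul, smul_zero, map_mul, ← he, ← hQ] at E2' hB0'
    rw [← sub_eq_zero, ← sub_smul] at E2'
    have z4 : ∀ {c₁ c₂ c₃ : B}, c₁ • v = 0 → c₂ • v = 0 → c₃ = -c₁ - c₂ → c₃ • v = 0 := by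
      rintro c₁ c₂ _ g₁ g₂ rfl
      rw [sub_smul, neg_smul, g₁, g₂, neg_zero, sub_zero]
    rw [smul_smul]
    refine z4 E2' hB0' ?_
    linear_combination -y ^ 2 * W * E * z2 - Q ^ (2 * n) * Q ^ 2 * algebraMap ℂ B (pVal q (2 * n + 1) (2 * n + 1)) * T' -
      Q ^ (2 * n) * Q ^ 2 * x ^ (2 * n + 1) * a (2 * n + 1) * z3 -
      Q ^ 2 * (-x ^ 2 * W * E + x ^ (2 * n + 1) * (x - y) * E) * z1 - Q ^ 2 * e * (x - y) * E * xx
  have fin := elimination hx hq0 hq1 (by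
    have := hν (2 * n + 1) le_rfl
    rwa [nuVal, two_mul (2 * n + 1), pow_add, mul_div_cancel_right₀ _ (pow_ne_zero _ hq0)] at this) hn hA hB
  rw [← sub_eq_zero] at fin ⊢
  apply eq_zero_of_algebraMap_smul (B := B) hq0
  rw [← fin, ← hQ, hy]
  module

end Final

/-! ### Infinite sequences of Birman-Murakami-Wenzl generators -/

section

variable {N : ℕ} {A : Type*} [Ring A] [Algebra ℂ A]

section Sequence

variable {W : Type*} [Ring W] [Algebra ℂ W]

/-- An infinite sequence of generators. -/
structure BMWSeq (q μ : ℂ) (r r' k : ℕ → W) : Prop where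
  pair : ∀ j, BMWPair q μ (r j) (r' j) (k j) (r (j + 1)) (r' (j + 1)) (k (j + 1))
  comm : ∀ i j, i + 2 ≤ j → Commute (r i) (r j)

namespace BMWSeq

variable {q μ : ℂ} {r r' k : ℕ → W} (p : BMWParam q μ) (h : BMWSeq q μ r r' k)
include h

lemma gen (j : ℕ) : BMWGen q μ (r j) (r' j) (k j) := (h.pair j).fst

lemma chain (n : ℕ) : BMWChain q μ n r r' k :=
  ⟨fun j _ => h.gen j, fun j _ => h.pair j, fun i j hij _ => h.comm i j hij⟩

lemma shift (s : ℕ) : BMWSeq q μ (fun j => r (s + j)) (fun j => r' (s + j)) (fun j => k (s + j)) :=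
  ⟨fun j => h.pair (s + j), fun i j hij => h.comm _ _ (by omega)⟩

lemma comm' {i j : ℕ} (hij : i + 2 ≤ j ∨ j + 2 ≤ i) : Commute (r i) (r j) :=
  hij.elim (h.comm i j) fun hij => (h.comm j i hij).symm

include p

lemma k_comm {i j : ℕ} (hij : i + 2 ≤ j ∨ j + 2 ≤ i) : Commute (k i) (r j) :=
  (h.gen i).k_comm p (h.comm' hij)

lemma kk_comm {i j : ℕ} (hij : i + 2 ≤ j ∨ j + 2 ≤ i) : Commute (k i) (k j) :=
  ((h.gen j).k_comm p (h.k_comm p hij).symm).symm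

/-- A descending product of contractors is a strand running diagonally across; generators on its two
sides sit two legs apart and slide through. -/
lemma colProd_mul_gen {s i j : ℕ} (h1 : s ≤ j) (h2 : j + 2 < s + i) :
    colProd k s i * r (j + 2) = r j * colProd k s i := by
  induction i with
  | zero => omega
  | succ i ih =>
    rcases Nat.lt_or_ge (j + 2) (s + i) with h' | h'
    · rw [colProd_succ, mul_assoc, ih h', ← mul_assoc, ← mul_assoc, (h.k_comm p (by omega)).eq]
    · obtain ⟨i, rfl⟩ : ∃ t, i = t + 2 := ⟨i - 2, by omega⟩
      obtain rfl : j = s + i := by omega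
      rw [colProd_succ, colProd_succ, colProd_succ, show s + (i + 2) = s + i + 2 by omega,
        show s + (i + 1) = s + i + 1 by omega]
      have c : Commute (r (s + i + 2)) (colProd k s i) :=
        Commute.colProd_right fun a h1 h2 => (h.k_comm p (by omega)).symm
      have e1 := (h.pair (s + i + 1)).lks p
      have e2 := (h.pair (s + i)).rlk
      have e2' : r' (s + i + 1) * k (s + i) = r (s + i) * (k (s + i + 1) * k (s + i)) := e2.symm
      have c3 := h.k_comm p (i := s + i + 2) (j := s + i) (by omega)
      generalize colProd k s i = z at *
      calc _ = k (s + i + 2) * (k (s + i + 1) * (k (s + i) * (r (s + i + 2) * z))) := by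
            rw [c.eq]; simp only [mul_assoc]
        _ = k (s + i + 2) * (k (s + i + 1) * (r (s + i + 2) * (k (s + i) * z))) := by
            rw [← mul_assoc (k (s + i)), (h.k_comm p (by omega)).eq, mul_assoc]
        _ = k (s + i + 2) * k (s + i + 1) * r (s + i + 2) * (k (s + i) * z) := by
            simp only [mul_assoc]
        _ = k (s + i + 2) * (r' (s + i + 1) * k (s + i)) * z := by
            rw [e1]; simp only [mul_assoc]
        _ = k (s + i + 2) * r (s + i) * (k (s + i + 1) * (k (s + i) * z)) := by
            rw [e2']; simp only [mul_assoc]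
        _ = _ := by rw [c3.eq]; simp only [mul_assoc]

lemma colProd_mul_rowProd_tail (s i : ℕ) :
    colProd k s (i + 1) * rowProd k (s + 1) i = k (s + i) := by
  induction i with
  | zero => rw [colProd_one, rowProd, mul_one, add_zero]
  | succ i ih =>
    rw [colProd_succ, rowProd_succ, mul_assoc, ← mul_assoc (colProd k s (i + 1)), ih,
      show s + 1 + i = s + i + 1 by omega, show s + (i + 1) = s + i + 1 by omega, ← mul_assoc,
      (h.pair (s + i)).lkl p]

lemma kk_rr'_kk (s : ℕ) :
    k (s + 2) * k (s + 1) * (r s * r' (s + 2)) * (k (s + 1) * k (s + 2)) = k s * k (s + 2) := by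
  have c := (h.gen (s + 2)).r'_comm (h.comm' (i := s + 2) (j := s) (by omega))
  have c2 := h.kk_comm p (i := s + 2) (j := s) (by omega)
  calc _ = k (s + 2) * k (s + 1) * r' (s + 2) * (r s * (k (s + 1) * k (s + 2))) := by
        rw [← c.eq]; simp only [mul_assoc]
    _ = k (s + 2) * (r (s + 1) * r s * k (s + 1)) * k (s + 2) := by
        rw [(h.pair (s + 1)).lks' p]; simp only [mul_assoc]
    _ = k s * (k (s + 2) * k (s + 1) * k (s + 2)) := by
        rw [← (h.pair s).kl p, ← mul_assoc, c2.eq]; simp only [mul_assoc]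
    _ = _ := by rw [(h.pair (s + 1)).lkl p]

end BMWSeq

/-- Moving contractors through a cyclic functional. -/
lemma cyclic_contract {W' : Type*} [AddCommGroup W'] [Module ℂ W'] {q μ : ℂ} {r r' k s s' l : W}
    (p : BMWParam q μ) (h : BMWPair q μ r r' k s s' l) (τ : W →ₗ[ℂ] W')
    (hk : ∀ y, τ (k * y) = τ (y * k)) (hl : ∀ y, τ (l * y) = τ (y * l)) (y : W) :
    τ (l * (k * y * k) * l) = τ (k * y * k) := by
  have e1 : τ (l * (k * y * k) * l) = etaVal q μ • τ (k * y * k * l) := by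
    rw [mul_assoc, hl, mul_assoc (k * y * k), (h.snd).kk p, mul_smul_comm, map_smul]
  have e2 : etaVal q μ • τ (k * y * k * l) = τ (k * y * k) := by
    rw [← map_smul]
    have : etaVal q μ • (k * y * k * l) = k * (k * y * k * l) := by
      rw [← mul_assoc, ← mul_assoc, ← mul_assoc, h.fst.kk p]
      simp only [smul_mul_assoc]
    rw [this, hk, mul_assoc (k * y), mul_assoc (k * y), h.klk]
  rw [e1, e2]

/-- Under a functional cyclic for the contractors, a pair `k_s ⋯ k_s` can be extended to a diagonal
and its mirror image: each further contractor contributes `η` by idempotency, and cyclicity and `k l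
k = k` remove it again. -/
lemma BMWSeq.cyclic_contract {W' : Type*} [AddCommGroup W'] [Module ℂ W'] {q μ : ℂ} {r r' k : ℕ → W}
    (p : BMWParam q μ) (h : BMWSeq q μ r r' k) (τ : W →ₗ[ℂ] W') {s i : ℕ}
    (hk : ∀ j, s ≤ j → j ≤ s + i → ∀ y, τ (k j * y) = τ (y * k j)) (y : W) :
    τ (colProd k s (i + 1) * y * rowProd k s (i + 1)) = τ (k s * y * k s) := by
  induction i with
  | zero => rw [colProd_one, rowProd_one]
  | succ i ih =>
    rw [← ih fun j h1 h2 => hk j h1 (by omega), colProd_succ k s (i + 1), rowProd_succ k s (i + 1)]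
    have e : colProd k s (i + 1) * y * rowProd k s (i + 1) =
        k (s + i) * (colProd k s i * y * rowProd k s i) * k (s + i) := by
      rw [colProd_succ, rowProd_succ]; simp only [mul_assoc]
    have := QM.cyclic_contract p (h.pair (s + i)) τ (hk _ (by omega) (by omega))
      (hk (s + i + 1) (by omega) (by omega)) (colProd k s i * y * rowProd k s i)
    rw [← e] at this
    rw [← this, show s + (i + 1) = s + i + 1 by omega]
    simp only [mul_assoc]

end Sequence

lemma IsBMWType.seq {q μ : ℂ} {R : Op N 2 ℂ} (h : IsBMWType q μ R) (A : Type*) [Ring A] [Algebra ℂ A] :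
    BMWSeq q μ (fun j => scal A j R) (fun j => scal A j R⁻¹) (fun j => scal A j (opK q μ R)) :=
  ⟨fun j => h.pair A j, fun i j hij => scal_comm_scal (by omega) _ _⟩

/-! ### Antisymmetrizers as operators -/

lemma place_self {n : ℕ} (X : Op N n ℂ) : place n 0 X = X := by
  ext a b
  rw [place, Matrix.of_apply, dif_pos (by omega), if_pos fun s hs => by omega]
  congr 1 <;> funext t <;> congr 1 <;> ext <;> simp

lemma opK_mem_braidImage (q μ : ℂ) (R : Op N 2 ℂ) : opK q μ R ∈ braidImage R 2 := by
  have h : R ∈ braidImage R 2 := Algebra.subset_adjoin ⟨0, by omega, Or.inl (place_self R).symm⟩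
  exact Subalgebra.smul_mem _ (mul_mem (sub_mem (Subalgebra.smul_mem _ (one_mem _) _) h)
    (add_mem (Subalgebra.smul_mem _ (one_mem _) _) h)) _

lemma R_mem_braidImage (R : Op N 2 ℂ) : R ∈ braidImage R 2 :=
  Algebra.subset_adjoin ⟨0, by omega, Or.inl (place_self R).symm⟩

lemma antisym_mem_braidImage [NeZero N] (q μ : ℂ) (R : Op N 2 ℂ) : ∀ i, antisym q μ R i ∈ braidImage R i
  | 0 => one_mem _
  | 1 => one_mem _
  | i + 2 => by
    have h := place_mem_braidImage (m := i + 2) (j := 0) (by omega) (antisym_mem_braidImage q μ R (i + 1))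
    refine Subalgebra.smul_mem _ (mul_mem (mul_mem h ?_) h) _
    refine add_mem (add_mem (one_mem _) (Subalgebra.smul_mem _ ?_ _)) (Subalgebra.smul_mem _ ?_ _)
    · exact place_mem_braidImage (by omega) (R_mem_braidImage R)
    · exact place_mem_braidImage (by omega) (opK_mem_braidImage q μ R)

lemma scal_antisym (q μ : ℂ) (R : Op N 2 ℂ) (s : ℕ) : ∀ i, scal A s (antisym q μ R i) =
    asym q μ (fun j => scal A (s + j) R) (fun j => scal A (s + j) (opK q μ R)) i
  | 0 => map_one _
  | 1 => map_one _
  | i + 2 => by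
    rw [antisym, asym, map_smul, map_mul, map_mul, scal_place s (by omega), ← scal_antisym q μ R s (i + 1),
      baxter, sigmaVal, map_add, map_add, map_one, map_smul, map_smul, scal_place s (by omega),
      scal_place s (by omega), add_zero]

end

/-! ### Recursions for the antisymmetric descendants -/

section

variable {N : ℕ} {A : Type*} [Ring A] [Algebra ℂ A]

/-- The trace over all legs but the first of the product of the copies of `M` and `y`. -/
def descTr (R F : Op N 2 ℂ) (M : Matrix (Fin N) (Fin N) A) (s : ℕ) : LegOp N A →ₗ[ℂ] LegOp N A :=
  iterTrace (matD R) 1 s ∘ₗ LinearMap.mulLeft ℂ (copSeg F M 0 (s + 1))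

/-- A BMW type R-matrix, a compatible twist and a matrix satisfying the defining relation. -/
structure BMWQuantum (q μ : ℂ) (R F : Op N 2 ℂ) (M : Matrix (Fin N) (Fin N) A) : Prop where
  pair : IsCompatiblePair R F
  skew : SkewInvertible R
  bmw : IsBMWType q μ R
  rel : IsQuantumMatrix R F M

section

variable {q μ : ℂ} {R F : Op N 2 ℂ} {M : Matrix (Fin N) (Fin N) A}

lemma descTr_apply (s : ℕ) (y : LegOp N A) :
    descTr R F M s y = iterTrace (matD R) 1 s (copSeg F M 0 (s + 1) * y) := rfl

lemma leg_smul (n : ℕ) (z : ℂ) (X : Matrix (Fin N) (Fin N) A) : leg n (z • X) = z • leg n X := by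
  show amp n (z • oneStrand X) = _
  rw [map_smul, leg]

lemma leg_desc' {s : ℕ} (x : Op N (s + 1) ℂ) : leg 0 (desc R F M x) = descTr R F M s (scal A 0 x) :=
  leg_desc _ _ _ _

variable [NeZero N] (h : BMWQuantum q μ R F M)
include h

namespace BMWQuantum

/-- The first leg is not traced, so cyclicity is available only for braids avoiding it; these also
commute with the product of copies. -/
lemma descTr_cyclic {s : ℕ} {w : LegOp N A} (hw : w ∈ braidLeg A R 1 (1 + s)) (y : LegOp N A) :
    descTr R F M s (w * y) = descTr R F M s (y * w) := by
  have c := h.pair.rMatrix_left.commute_braidLeg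
    (fun j h1 h2 => h.rel.comm_copSeg h.pair (s := 0) (i := s + 1) (j := j) (by omega) (by omega)) hw
  rw [descTr_apply, descTr_apply, ← mul_assoc, ← c.eq, mul_assoc,
    h.pair.rMatrix_left.iterTrace_cyclic_braidLeg h.skew hw, mul_assoc]

lemma descTr_mul_scal {s i : ℕ} {x : Op N (s + 1) ℂ} (hx : x ∈ braidImage R (s + 1)) {y : Op N i ℂ}
    (hy : y ∈ braidImage R i) : descTr R F M (s + i) (scal A 0 x * scal A (s + 1) y) =
      leg 0 (rmul (desc R F M x) (ch R F M y)) := by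
  rw [h.pair.leg_desc_mul_ch h.skew M hx hy, descTr_apply, show s + 1 + i = s + i + 1 by omega]

lemma descTr_scal_one {i : ℕ} {y : Op N i ℂ} (hy : y ∈ braidImage R i) :
    descTr R F M i (scal A 1 y) = leg 0 (rmul M (ch R F M y)) := by
  have := h.descTr_mul_scal (s := 0) (one_mem_braidImage 1) hy
  rwa [map_one, one_mul, desc_one, zero_add] at this

lemma descTr_scal_mul_R {s : ℕ} {x : Op N (s + 1) ℂ} (hx : x ∈ braidImage R (s + 1)) :
    descTr R F M (s + 1) (scal A 1 x * scal A 0 R) = leg 0 (starM R F M (desc R F M x)) := by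
  rw [h.pair.starM_desc h.skew hx, leg_desc, scal_starExponent, map_one, one_mul, descTr_apply, tauLeg,
    show 0 + 1 + s = s + 1 by omega]

omit [NeZero N] in
lemma ch_opK : ch R F M (opK q μ R) = etaVal q μ • contraction R F M q μ := by
  rw [contraction, ← etaVal, smul_smul, mul_inv_cancel₀ (etaVal_ne_zero h.bmw), one_smul]

/-- The contractor has rank one and commutes with the product of two copies, so it compresses that
product to a coefficient. The full R-trace, with `Tr_R K = μ² η` and `ch(K) = η g`, identifies the
coefficient. -/
lemma copSeg_mul_opK : copSeg F M 0 2 * scal A 0 (opK q μ R) =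
    coef (μ⁻¹ ^ 2 • contraction R F M q μ) * scal A 0 (opK q μ R) := by
  have p := h.bmw.param
  have η0 := etaVal_ne_zero h.bmw
  obtain ⟨z, hz⟩ := h.bmw.opK_mul_amp_mul_opK h.skew 0 (copiesProd F M 2)
  have c := h.rel.comm_copSeg_of_mem h.pair (s := 0) (i := 2) (j := 0) le_rfl (by omega)
    (opK_mem_braidImage q μ R)
  have kk := (h.bmw.gen A 0).kk p
  rw [amp_copiesProd, ← c.eq, mul_assoc, kk, mul_smul_comm] at hz
  have e : copSeg F M 0 2 * scal A 0 (opK q μ R) = coef ((etaVal q μ)⁻¹ • z) * scal A 0 (opK q μ R) := by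
    rw [map_smul, smul_mul_assoc, ← hz, smul_smul, inv_mul_cancel₀ η0, one_smul]
  rw [e]
  have t := coef_ch F M R (opK q μ R)
  rw [e, h.ch_opK, iterTrace_mul_left _ fun m _ _ => coef_off m _] at t
  have t2 : iterTrace (matD R) 0 2 (scal A 0 (opK q μ R)) = (μ ^ 2 * etaVal q μ) • (1 : LegOp N A) := by
    rw [iterTrace_succ, iterTrace_succ, iterTrace_zero, zero_add, zero_add, h.bmw.legTrace_opK h.skew, map_smul,
      legTrace_one, h.bmw.trace_matD h.skew, smul_smul]
    congr 1
    ring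
  rw [t2, mul_smul_comm, mul_one, ← map_smul] at t
  have t3 := coef_injective (N := N) t
  have m0 := p.mu_ne
  have e1 : contraction R F M q μ = μ ^ 2 • (etaVal q μ)⁻¹ • z := by
    have := congrArg ((etaVal q μ)⁻¹ • ·) t3
    simp only [smul_smul] at this
    rw [inv_mul_cancel₀ η0, one_smul] at this
    rw [this, smul_smul]
    congr 1
    field_simp
  rw [e1, smul_smul, inv_pow, inv_mul_cancel₀ (pow_ne_zero _ m0), one_smul]

/-- Doubling the contractor by `K² = η K` and moving one copy around the trace prepares the shape `K
⋯ K` required for extension to a diagonal. -/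
lemma descTr_insert (s : ℕ) {j : ℕ} (h1 : 1 ≤ j) (h2 : j + 1 ≤ s) {x : LegOp N A}
    (hx : x ∈ braidLeg A R 1 (1 + s)) (y : LegOp N A) :
    descTr R F M s (x * scal A j (opK q μ R) * y) =
      (etaVal q μ)⁻¹ • descTr R F M s (scal A j (opK q μ R) * (y * x) * scal A j (opK q μ R)) := by
  have η0 := etaVal_ne_zero h.bmw
  have kk := (h.bmw.gen A j).kk h.bmw.param
  have hk : scal A j (opK q μ R) ∈ braidLeg A R 1 (1 + s) :=
    scal_mem_braidLeg_of_mem h1 (by omega) (opK_mem_braidImage q μ R)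
  rw [eq_inv_smul_iff₀ η0, ← map_smul]
  have e : etaVal q μ • (x * scal A j (opK q μ R) * y) =
      x * scal A j (opK q μ R) * (scal A j (opK q μ R) * y) := by
    rw [← smul_mul_assoc, ← mul_smul_comm, ← kk]; simp only [mul_assoc]
  rw [e, h.descTr_cyclic (mul_mem hx hk)]
  simp only [mul_assoc]

/-- After extending `K_1` to a diagonal, the contractors carry `x` from leg `2` back to leg `0` and
then collapse to a single `K` beyond it, which is traced to `η g`. -/
lemma descTr_two_contract {s : ℕ} {x : Op N (s + 1) ℂ} (hx : x ∈ braidImage R (s + 1)) :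
    descTr R F M (s + 2) (scal A 2 x * scal A 1 (opK q μ R) * scal A 0 (opK q μ R)) =
      leg 0 (rmul (desc R F M x) (contraction R F M q μ)) := by
  have p := h.bmw.param
  have S := h.bmw.seq A
  have η0 := etaVal_ne_zero h.bmw
  rw [h.descTr_insert _ le_rfl (by omega) (scal_mem_braidLeg_of_mem (by omega) (by omega) hx),
    ← S.cyclic_contract p (s := 1) (i := s) (descTr R F M (s + 2)) fun j h1 h2 y => h.descTr_cyclic
      (scal_mem_braidLeg_of_mem h1 (by omega) (opK_mem_braidImage q μ R)) y]
  have e := h.pair.rMatrix_left.intertwine (A := A) (a := colProd (fun j => scal A j (opK q μ R)) 0 (s + 2))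
    (s := 2) (t := 0) (fun j hj => by
      have := S.colProd_mul_gen p (s := 0) (i := s + 2) (j := j) (by omega) (by omega)
      rwa [zero_add, add_comm 2 j]) hx
  have e2 := S.colProd_mul_rowProd_tail p 0 (s + 1)
  rw [colProd_succ' _ 0 (s + 1)] at e e2
  simp only [zero_add] at e e2
  rw [← mul_assoc, e, mul_assoc, e2, h.descTr_mul_scal hx (opK_mem_braidImage q μ R), h.ch_opK]
  rw [rmul_smul, leg_smul, smul_smul, inv_mul_cancel₀ η0, one_smul]

/-- Same diagonal argument one leg further: `x` moves from leg `3` to leg `1`, the crossings `R_0`,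
`R_2⁻¹` are absorbed by `kk_rr'_kk` leaving `K_0`, and the far contractor is traced to `η g`. -/
lemma descTr_three_contract {t : ℕ} {x : Op N (t + 1) ℂ} (hx : x ∈ braidImage R (t + 1)) :
    descTr R F M (t + 3) (scal A 3 x * scal A 2 R⁻¹ * scal A 1 (opK q μ R) * scal A 0 R) =
      leg 0 (rmul (desc R F M (place (t + 2) 1 x * place (t + 2) 0 (opK q μ R))) (contraction R F M q μ)) := by
  have p := h.bmw.param
  have S := h.bmw.seq A
  have η0 := etaVal_ne_zero h.bmw
  have hK := opK_mem_braidImage q μ R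
  rw [h.descTr_insert _ le_rfl (by omega) (mul_mem (scal_mem_braidLeg_of_mem (by omega) (by omega) hx)
      (scal_inv_mem_braidLeg (by omega) (by omega))),
    ← S.cyclic_contract p (s := 1) (i := t + 1) (descTr R F M (t + 3)) fun j h1 h2 y => h.descTr_cyclic
      (scal_mem_braidLeg_of_mem h1 (by omega) hK) y]
  have e := h.pair.rMatrix_left.intertwine (A := A) (a := colProd (fun j => scal A j (opK q μ R)) 1 (t + 2))
    (s := 3) (t := 1) (fun j hj => by
      have := S.colProd_mul_gen p (s := 1) (i := t + 2) (j := 1 + j) (by omega) (by omega)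
      rwa [show 3 + j = 1 + j + 2 by omega]) hx
  have c : Commute (scal A 0 R) (scal A 3 x) := scal_comm_scal (by omega) _ _
  have e1 : colProd (fun j => scal A j (opK q μ R)) 1 (t + 2) = colProd (fun j => scal A j (opK q μ R)) 3 t *
      (scal A 2 (opK q μ R) * scal A 1 (opK q μ R)) := by
    rw [colProd_succ', colProd_succ', mul_assoc]
  have e2 : rowProd (fun j => scal A j (opK q μ R)) 1 (t + 2) =
      scal A 1 (opK q μ R) * scal A 2 (opK q μ R) * rowProd (fun j => scal A j (opK q μ R)) 3 t := by
    rw [rowProd_succ', rowProd_succ', mul_assoc]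
  have e3 := S.kk_rr'_kk p 0
  have e4 := S.colProd_mul_rowProd_tail p 2 t
  have c2 : Commute (scal A 0 (opK q μ R)) (colProd (fun j => scal A j (opK q μ R)) 3 t) :=
    Commute.colProd_right fun a h1 h2 => scal_comm_scal (by omega) _ _
  rw [colProd_succ'] at e4
  simp only [zero_add] at e3 e4
  have key : colProd (fun j => scal A j (opK q μ R)) 1 (t + 2) * (scal A 0 R * (scal A 3 x * scal A 2 R⁻¹)) *
      rowProd (fun j => scal A j (opK q μ R)) 1 (t + 2) =
      scal A 1 x * scal A 0 (opK q μ R) * scal A (t + 2) (opK q μ R) := by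
    rw [← mul_assoc (scal A 0 R), c.eq, mul_assoc (scal A 3 x), ← mul_assoc (colProd _ _ _), e, e1, e2,
      add_comm t 2, ← e4]
    generalize colProd (fun j => scal A j (opK q μ R)) 3 t = X at *
    generalize rowProd (fun j => scal A j (opK q μ R)) 3 t = Y at *
    calc _ = scal A 1 x * (X * (scal A 2 (opK q μ R) * scal A 1 (opK q μ R) * (scal A 0 R * scal A 2 R⁻¹) *
          (scal A 1 (opK q μ R) * scal A 2 (opK q μ R))) * Y) := by simp only [mul_assoc]
      _ = scal A 1 x * (X * scal A 0 (opK q μ R)) * scal A 2 (opK q μ R) * Y := by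
          rw [e3]; simp only [mul_assoc]
      _ = _ := by rw [← c2.eq]; simp only [mul_assoc]
  rw [key]
  have e5 : scal A 1 x * scal A 0 (opK q μ R) =
      scal A 0 (place (t + 2) 1 x * place (t + 2) 0 (opK q μ R)) := by
    rw [map_mul, scal_place 0 (by omega), scal_place 0 (by omega), zero_add, zero_add]
  rw [e5, h.descTr_mul_scal (s := t + 1) (mul_mem (place_mem_braidImage (by omega) hx)
    (place_mem_braidImage (by omega) hK)) hK, h.ch_opK, rmul_smul, leg_smul, smul_smul, inv_mul_cancel₀ η0, one_smul]

end BMWQuantum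
end

end

/-! ### Normalised antisymmetric descendants and their recursions. -/

section

variable {N : ℕ} {A : Type*} [Ring A] [Algebra ℂ A]

section

variable (q μ : ℂ) (R F : Op N 2 ℂ) (M : Matrix (Fin N) (Fin N) A)

/-- The normalized descendants of the antisymmetrizers. -/
def altDesc : ℕ → Matrix (Fin N) (Fin N) A
  | 0 => 0
  | s + 1 => qNum q (s + 1) • desc R F M (antisym q μ R (s + 1))

/-- The normalized descendants of the antisymmetrizers contracted with the first leg. -/
def altContr : ℕ → Matrix (Fin N) (Fin N) A
  | 0 => 0
  | s + 1 => qNum q (s + 1) •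
      desc R F M (place (s + 2) 1 (antisym q μ R (s + 1)) * place (s + 2) 0 (opK q μ R))

variable {q μ R F M}

lemma smul_three {V : Type*} [AddCommGroup V] [Module ℂ V] {u c α β a b d : ℂ} (h1 : u * c = a)
    (h2 : a * α = -b) (h3 : a * β = -d) (X Y Z : V) :
    u • c • (X + α • Y + β • Z) = a • X - b • Y - d • Z := by
  rw [smul_smul, h1, smul_add, smul_add, smul_smul, smul_smul, h2, h3]
  module

lemma smul_three' {V : Type*} [AddCommGroup V] [Module ℂ V] {u c x α β a b d : ℂ} (h1 : u * c * x = a)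
    (h2 : u * c * α = -b) (h3 : u * c * β = d) (X Y Z : V) :
    u • c • (x • X + α • Y + β • Z) = a • X + d • Z - b • Y := by
  rw [smul_smul, smul_add, smul_add, smul_smul, smul_smul, smul_smul, h1, h2, h3]
  module

lemma sigma_expand {V : Type*} [Ring V] [Algebra ℂ V] {l : ℂ} (hl : l ≠ 0) (x b : ℂ) (r' k : V) :
    1 + ((x - 1) / l) • (r' + l • (1 - k)) + b • k = x • 1 + ((x - 1) / l) • r' + (b - (x - 1)) • k := by
  rw [smul_add, smul_smul, div_mul_cancel₀ _ hl]
  module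

/-- Here `ν = μ q^{2(j+1)-1}`; in terms of it the pole factor `q μ⁻¹ x + 1` at `x = q^{-2(j+1)}` is
`(1 + ν) / ν`. -/
lemma recursion_scalars {n : ℕ} (p : AsymParam q μ n) {j : ℕ} (hj : j + 2 ≤ n) {ν : ℂ}
    (hν : ν * q = μ * q ^ (2 * (j + 1))) (hν1 : 1 + ν ≠ 0) :
    qNum q (j + 2) * (q ^ (j + 1) / qNum q (j + 2)) = q ^ (j + 1) ∧
    q ^ (j + 1) * ((q⁻¹ ^ (2 * (j + 1)) - 1) / (q - q⁻¹)) = -qNum q (j + 1) ∧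
    q ^ (j + 1) * ((q⁻¹ ^ (2 * (j + 1)) - 1) / (q * μ⁻¹ * q⁻¹ ^ (2 * (j + 1)) + 1)) =
      -((q - q⁻¹) / (1 + ν) * ν * qNum q (j + 1)) ∧
    q ^ (j + 1) * q⁻¹ ^ (2 * (j + 1)) = q⁻¹ ^ (j + 1) ∧
    q ^ (j + 1) * ((q⁻¹ ^ (2 * (j + 1)) - 1) / (q * μ⁻¹ * q⁻¹ ^ (2 * (j + 1)) + 1) -
      (q⁻¹ ^ (2 * (j + 1)) - 1)) = (q - q⁻¹) / (1 + ν) * qNum q (j + 1) := by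
  have h0 := p.q_ne; have hl := p.lam_ne; have hμ := p.mu_ne
  have hq := p.qNum_ne (j + 2) (by omega) hj
  have z1 : q ^ (j + 1) * q⁻¹ ^ (2 * (j + 1)) = q⁻¹ ^ (j + 1) := by
    rw [two_mul (j + 1), pow_add q⁻¹ (j + 1), ← mul_assoc, ← mul_pow, mul_inv_cancel₀ h0, one_pow, one_mul]
  have ν0 : ν ≠ 0 := by
    rintro rfl
    rw [zero_mul] at hν
    exact mul_ne_zero hμ (pow_ne_zero _ h0) hν.symm
  have e4 : q * μ⁻¹ * q⁻¹ ^ (2 * (j + 1)) + 1 = (1 + ν) / ν := by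
    rw [inv_pow, ← mul_inv_cancel_right₀ h0 ν, hν]
    field_simp
  have z2 : q ^ (j + 1) * (q⁻¹ ^ (2 * (j + 1)) - 1) = -((q - q⁻¹) * qNum q (j + 1)) := by
    rw [qNum, mul_sub, z1, mul_div_cancel₀ _ hl]; ring
  have e3 : q ^ (j + 1) * ((q⁻¹ ^ (2 * (j + 1)) - 1) / (q * μ⁻¹ * q⁻¹ ^ (2 * (j + 1)) + 1)) =
      -((q - q⁻¹) / (1 + ν) * ν * qNum q (j + 1)) := by
    rw [mul_div_assoc', z2, e4]
    field_simp
  refine ⟨mul_div_cancel₀ _ hq, by rw [mul_div_assoc', z2, neg_div, mul_div_cancel_left₀ _ hl], e3, z1, ?_⟩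
  rw [mul_sub, e3, z2]
  field_simp
  ring

lemma starM_smul [NeZero N] (z : ℂ) (X : Matrix (Fin N) (Fin N) A) :
    starM R F M (z • X) = z • starM R F M X := by
  have : ∀ Y : Matrix (Fin N) (Fin N) A, z • Y = rmul Y (algebraMap ℂ A z) := fun Y => by
    ext a b
    rw [rmul, Matrix.map_apply, Matrix.smul_apply, ← Algebra.commutes, Algebra.smul_def]
  rw [this, this, starM_rmul]

lemma leg_sub (n : ℕ) (X Y : Matrix (Fin N) (Fin N) A) : leg n (X - Y) = leg n X - leg n Y := by
  rw [eq_sub_iff_add_eq, ← leg_add, sub_add_cancel]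

lemma antisym_recursion {n : ℕ} (p : AsymParam q μ n) (hB : IsBMWType q μ R) {s s' : ℕ} (hs : s' = s + 1)
    {i : ℕ} (hi : i + 2 ≤ n) : scal A s (antisym q μ R (i + 2)) = (q ^ (i + 1) / qNum q (i + 2)) •
      (scal A s' (antisym q μ R (i + 1)) *
        sigmaVal q μ (q⁻¹ ^ (2 * (i + 1))) (scal A s R) (scal A s (opK q μ R)) *
        scal A s' (antisym q μ R (i + 1))) := by
  subst hs
  rw [scal_antisym, scal_antisym, (((hB.seq A).shift s).chain (n - 1)).asym_succ' p hi]
  simp only [add_zero, add_assoc]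

lemma antisym_mul_self {n : ℕ} (p : AsymParam q μ n) (hB : IsBMWType q μ R) (s : ℕ) {i : ℕ} (hi : i ≤ n) :
    scal A s (antisym q μ R i) * scal A s (antisym q μ R i) = scal A s (antisym q μ R i) := by
  rw [scal_antisym, (((hB.seq A).shift s).chain (n - 1)).asym_mul_asym p hi]

variable [NeZero N] (h : BMWQuantum q μ R F M)
include h

namespace BMWQuantum

lemma altDesc_one : altDesc q μ R F M 1 = M := by
  have : qNum q 1 = 1 := by rw [qNum, pow_one, pow_one, div_self h.bmw.q_sub_ne]
  rw [altDesc, this, one_smul, antisym, desc_one]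

lemma desc_opK : desc R F M (opK q μ R) = rmul 1 (μ⁻¹ • contraction R F M q μ) := by
  apply leg_injective 0
  rw [leg_desc, iterTrace_succ, iterTrace_zero, h.copSeg_mul_opK, legTrace_mul_left _ (coef_off _ _),
    h.bmw.legTrace_opK h.skew 0, leg_mul_coef, leg_one, one_mul, map_smul, map_smul, smul_mul_smul, mul_one]
  congr 1
  have := h.bmw.mu_ne_zero
  field_simp

lemma altContr_one : altContr q μ R F M 1 = rmul 1 (μ⁻¹ • contraction R F M q μ) := by
  have : qNum q 1 = 1 := by rw [qNum, pow_one, pow_one, div_self h.bmw.q_sub_ne]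
  rw [altContr, this, one_smul, ← h.desc_opK]
  apply leg_injective 0
  rw [leg_desc', leg_desc', map_mul (scal A 0), scal_place 0 (by omega), scal_place 0 (by omega), antisym,
    map_one, one_mul]

lemma contraction_comm {i : ℕ} {x : Op N i ℂ} (hx : x ∈ braidImage R i) :
    contraction R F M q μ * ch R F M x = ch R F M x * contraction R F M q μ := by
  rw [contraction, smul_mul_assoc, mul_smul_comm, h.rel.ch_comm h.pair h.skew (opK_mem_braidImage q μ R) hx]

/-- The right copy of the idempotent passes `y`, goes around the trace and merges with the left
copy. -/
lemma descTr_idempotent {s : ℕ} {w : LegOp N A} (hw : w ∈ braidLeg A R 1 (1 + s)) (hi : w * w = w) {y : LegOp N A}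
    (c : Commute w y) (x : LegOp N A) : descTr R F M s (w * x * w * y) = descTr R F M s (w * (x * y)) := by
  rw [mul_assoc _ w, c.eq, mul_assoc, h.descTr_cyclic hw, mul_assoc, mul_assoc _ _ w, hi, ← mul_assoc,
    ← h.descTr_cyclic hw]

variable {n : ℕ} (p : AsymParam q μ n) {j : ℕ} (hj : j + 2 ≤ n) {ν : ℂ} (hν : ν * q = μ * q ^ (2 * (j + 1)))
  (hν1 : 1 + ν ≠ 0)
include p hj hν hν1

/-- The antisymmetrizer of order `j + 2` is unfolded at its left end, so both inner factors avoid
the untraced leg and merge into one. The three terms `1`, `R`, `K` of the Baxterized generator give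
`M a_{j+1}`, the star product with `M`, and the contracted descendant. -/
lemma altDesc_recursion : altDesc q μ R F M (j + 2) =
    q ^ (j + 1) • rmul M (elemA R F M q μ (j + 1)) - starM R F M (altDesc q μ R F M (j + 1)) -
      ((q - q⁻¹) / (1 + ν) * ν) • altContr q μ R F M (j + 1) := by
  have hm := antisym_mem_braidImage q μ R (j + 1)
  have hK := opK_mem_braidImage q μ R
  have hi := antisym_mul_self (A := A) p h.bmw 1 (i := j + 1) (by omega)
  have hw := scal_mem_braidLeg_of_mem (A := A) (a := 1) (b := 1 + (j + 1)) (s := 1) le_rfl le_rfl hm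
  apply leg_injective 0
  have t1 := h.descTr_scal_one hm
  have t2 := h.descTr_scal_mul_R hm
  have t3 : descTr R F M (j + 1) (scal A 1 (antisym q μ R (j + 1)) * scal A 0 (opK q μ R)) = leg 0 (desc R F M
      (place (j + 2) 1 (antisym q μ R (j + 1)) * place (j + 2) 0 (opK q μ R))) := by
    rw [leg_desc', map_mul (scal A 0), scal_place 0 (by omega), scal_place 0 (by omega)]
  rw [leg_sub, leg_sub, altDesc, leg_smul, leg_smul, altDesc, starM_smul, leg_smul, leg_smul, altContr, leg_smul,
    leg_desc', antisym_recursion p h.bmw (zero_add 1).symm hj, map_smul, mul_assoc, h.descTr_cyclic hw, mul_assoc, hi,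
    ← h.descTr_cyclic hw, sigmaVal, mul_add, mul_add, mul_one, mul_smul_comm, mul_smul_comm, map_add, map_add,
    map_smul, map_smul, t1, t2, t3, elemA]
  generalize leg 0 (rmul M (ch R F M (antisym q μ R (j + 1)))) = X1
  generalize leg 0 (starM R F M (desc R F M (antisym q μ R (j + 1)))) = X2
  generalize leg 0 (desc R F M (place (j + 2) 1 (antisym q μ R (j + 1)) * place (j + 2) 0 (opK q μ R))) = X3
  obtain ⟨e1, e2, e3, -⟩ := recursion_scalars p hj hν hν1
  rw [smul_smul (_ / _ * ν)]
  exact smul_three e1 e2 e3 X1 X2 X3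

/-- Star multiplication by `M` shifts the contracted descendant by one leg; unfolding its
antisymmetrizer gives three words in `R`, `K`, evaluated by `desc_opK`, `descTr_three_contract` and
`descTr_two_contract`. Each releases one factor `g`. -/
lemma altContr_recursion : starM R F M (altContr q μ R F M (j + 2)) =
    rmul ((μ⁻¹ * q⁻¹ ^ (j + 1)) • rmul M (elemA R F M q μ (j + 1)) +
      ((q - q⁻¹) / (1 + ν)) • starM R F M (altDesc q μ R F M (j + 1)) - altContr q μ R F M (j + 1))
      (contraction R F M q μ) := by
  have hm := antisym_mem_braidImage q μ R (j + 1)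
  have hK := opK_mem_braidImage q μ R
  have hi := antisym_mul_self (A := A) p h.bmw 3 (i := j + 1) (by omega)
  have hw := scal_mem_braidLeg_of_mem (A := A) (a := 1) (b := 1 + (j + 3)) (s := 3) (by omega) (by omega) hm
  apply leg_injective 0
  have hx : place (j + 3) 2 (antisym q μ R (j + 1)) * place (j + 3) 1 (opK q μ R) * place (j + 3) 0 (opK q μ R) ∈
      braidImage R (j + 3) := mul_mem (mul_mem (place_mem_braidImage (by omega) hm)
        (place_mem_braidImage (by omega) hK)) (place_mem_braidImage (by omega) hK)
  have hy : place (j + 3) 1 (antisym q μ R (j + 2)) * place (j + 3) 0 (opK q μ R) ∈ braidImage R (j + 3) :=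
    mul_mem (place_mem_braidImage (by omega) (antisym_mem_braidImage q μ R _)) (place_mem_braidImage (by omega) hK)
  have hz : place 3 1 (opK q μ R) * place 3 0 R ∈ braidImage R 3 :=
    mul_mem (place_mem_braidImage (by omega) hK) (place_mem_braidImage (by omega) (R_mem_braidImage R))
  have u1 : desc R F M (place 3 1 (opK q μ R) * place 3 0 R) = μ⁻¹ • rmul M (contraction R F M q μ) := by
    have e := h.descTr_scal_mul_R hK
    rw [h.desc_opK, starM_rmul, h.pair.starM_one h.skew, rmul_smul] at e
    apply leg_injective 0
    rw [← e, leg_desc', map_mul (scal A 0), scal_place 0 (by omega), scal_place 0 (by omega)]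
  have t1 : descTr R F M (j + 3) (scal A 3 (antisym q μ R (j + 1)) * (scal A 1 (opK q μ R) * scal A 0 R)) =
      μ⁻¹ • leg 0 (rmul (rmul M (ch R F M (antisym q μ R (j + 1)))) (contraction R F M q μ)) := by
    have e := h.descTr_mul_scal hz hm
    rw [map_mul (scal A 0), scal_place 0 (by omega), scal_place 0 (by omega), u1, smul_rmul, leg_smul, rmul_rmul,
      h.contraction_comm hm, ← rmul_rmul, show 2 + (j + 1) = j + 3 by omega] at e
    rw [← e, ((scal_comm_scal (Or.inl (by omega)) _ _ : Commute _ _).mul_left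
      (scal_comm_scal (Or.inl (by omega)) _ _ : Commute _ _)).eq]
  have t2 := h.descTr_three_contract hm
  have t3 : descTr R F M (j + 3) (scal A 3 (antisym q μ R (j + 1)) * scal A 2 (opK q μ R) *
      (scal A 1 (opK q μ R) * scal A 0 R)) =
      leg 0 (rmul (starM R F M (desc R F M (antisym q μ R (j + 1)))) (contraction R F M q μ)) := by
    have e := h.descTr_two_contract hm
    have e' : desc R F M (place (j + 3) 2 (antisym q μ R (j + 1)) * place (j + 3) 1 (opK q μ R) *
        place (j + 3) 0 (opK q μ R)) = rmul (desc R F M (antisym q μ R (j + 1))) (contraction R F M q μ) := by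
      apply leg_injective 0
      rw [← e, leg_desc', map_mul (scal A 0), map_mul (scal A 0), scal_place 0 (by omega), scal_place 0 (by omega),
        scal_place 0 (by omega)]
    have e2 := h.descTr_scal_mul_R hx
    rw [e', starM_rmul, map_mul (scal A 1), map_mul (scal A 1), scal_place 1 (by omega), scal_place 1 (by omega),
      scal_place 1 (by omega)] at e2
    rw [← e2]
    simp only [mul_assoc]
  have c : Commute (scal A 3 (antisym q μ R (j + 1))) (scal A 1 (opK q μ R) * scal A 0 R) :=
    (scal_comm_scal (Or.inr (by omega)) _ _ : Commute _ _).mul_right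
      (scal_comm_scal (Or.inr (by omega)) _ _ : Commute _ _)
  have hy' := h.descTr_scal_mul_R hy
  rw [map_mul (scal A 1), scal_place 1 (by omega), scal_place 1 (by omega), add_zero, one_add_one_eq_two] at hy'
  -- The generator is traded for its inverse by the skein relation, because the diagonal argument
  -- evaluates the word with `R_2⁻¹`.
  have hσ : sigmaVal q μ (q⁻¹ ^ (2 * (j + 1))) (scal A 2 R) (scal A 2 (opK q μ R)) =
      q⁻¹ ^ (2 * (j + 1)) • 1 + ((q⁻¹ ^ (2 * (j + 1)) - 1) / (q - q⁻¹)) • scal A 2 R⁻¹ +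
        ((q⁻¹ ^ (2 * (j + 1)) - 1) / (q * μ⁻¹ * q⁻¹ ^ (2 * (j + 1)) + 1) - (q⁻¹ ^ (2 * (j + 1)) - 1)) •
          scal A 2 (opK q μ R) := by
    rw [(h.bmw.gen A 2).r_eq]
    exact sigma_expand p.lam_ne _ _ _ _
  have hD : descTr R F M (j + 3) (scal A 2 (antisym q μ R (j + 2)) * scal A 1 (opK q μ R) * scal A 0 R) =
      (q ^ (j + 1) / qNum q (j + 2)) • descTr R F M (j + 3) (scal A 3 (antisym q μ R (j + 1)) *
        (sigmaVal q μ (q⁻¹ ^ (2 * (j + 1))) (scal A 2 R) (scal A 2 (opK q μ R)) *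
          (scal A 1 (opK q μ R) * scal A 0 R))) := by
    refine (congrArg (fun z => descTr R F M (j + 3) (z * scal A 1 (opK q μ R) * scal A 0 R))
      (antisym_recursion (A := A) p h.bmw (s := 2) (s' := 3) rfl hj)).trans ?_
    show descTr R F M (j + 3) (((q ^ (j + 1) / qNum q (j + 2)) • _) * _ * _) = _
    rw [smul_mul_assoc, smul_mul_assoc, map_smul, mul_assoc _ (scal A 1 (opK q μ R))]
    exact congrArg _ (h.descTr_idempotent hw hi c _)
  rw [hD, hσ, add_mul, add_mul, smul_mul_assoc, smul_mul_assoc, smul_mul_assoc,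
    one_mul, mul_add, mul_add, mul_smul_comm, mul_smul_comm, mul_smul_comm, ← mul_assoc _ (scal A 2 (opK q μ R)),
    ← mul_assoc _ (scal A 2 R⁻¹), map_add, map_add, map_smul, map_smul, map_smul, t1, t3,
    ← mul_assoc _ (scal A 1 (opK q μ R)), t2] at hy'
  have lhs : starM R F M (altContr q μ R F M (j + 2)) = qNum q (j + 2) • starM R F M (desc R F M
      (place (j + 3) 1 (antisym q μ R (j + 2)) * place (j + 3) 0 (opK q μ R))) := starM_smul _ _
  have d1 : altDesc q μ R F M (j + 1) = qNum q (j + 1) • desc R F M (antisym q μ R (j + 1)) := rfl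
  have d2 : altContr q μ R F M (j + 1) = qNum q (j + 1) • desc R F M
      (place (j + 2) 1 (antisym q μ R (j + 1)) * place (j + 2) 0 (opK q μ R)) := rfl
  rw [lhs, leg_smul, ← hy', d1, d2, starM_smul, sub_rmul, add_rmul, smul_rmul, smul_rmul, smul_rmul, smul_rmul,
    leg_sub, leg_add, leg_smul, leg_smul, leg_smul, mul_comm μ⁻¹, mul_smul (q⁻¹ ^ (j + 1)),
    smul_smul (_ / _), elemA]
  obtain ⟨e1, e2, -, e4, e5⟩ := recursion_scalars p hj hν hν1
  rw [← e1] at e2 e4 e5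
  rw [leg_smul]
  exact smul_three' (V := LegOp N A) e4 e2 e5 _ _ _

end BMWQuantum
end

end

/-! ### Operators of rank one -/

section

variable {N : ℕ} {A : Type*} [Ring A] [Algebra ℂ A]

lemma exists_vecMulVec_of_rank_le_one {n : Type*} [Fintype n] [DecidableEq n] {X : Matrix n n ℂ} (h : X.rank ≤ 1) :
    ∃ u v : n → ℂ, X = Matrix.vecMulVec u v := by
  rw [Matrix.rank, finrank_le_one_iff] at h
  obtain ⟨u, hu⟩ := h
  choose c hc using fun j => hu ⟨X.mulVecLin (Pi.single j 1), ⟨_, rfl⟩⟩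
  refine ⟨u, c, ?_⟩
  ext i j
  have := congrFun (congrArg Subtype.val (hc j)) i
  simp at this
  rw [Matrix.vecMulVec_apply, mul_comm, this]

lemma rank_one_sandwich (s : ℕ) {n : ℕ} {X : Op N n ℂ} (h : X.rank ≤ 1) (Y : Op N n A) :
    ∃ z : A, scal A s X * amp s Y * scal A s X = coef z * scal A s X := by
  obtain ⟨u, v, hX⟩ := exists_vecMulVec_of_rank_le_one h
  have hX : ∀ a b, X a b = u a * v b := fun a b => by rw [hX, Matrix.vecMulVec_apply]
  refine ⟨∑ b, ∑ c, (v b * u c) • Y b c, ?_⟩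
  have e : X.lift A * Y * X.lift A = (X.lift A).map ((∑ b, ∑ c, (v b * u c) • Y b c) * ·) := by
    ext a d
    simp only [Matrix.mul_apply, Matrix.map_apply, Op.lift, hX, Finset.sum_mul]
    rw [Finset.sum_comm]
    refine Finset.sum_congr rfl fun b _ => Finset.sum_congr rfl fun c _ => ?_
    simp only [← Algebra.smul_def, ← Algebra.commutes, smul_smul]
    congr 1
    ring
  rw [scal_def, ← map_mul, ← map_mul, e]
  ext w b
  simp only [Module.End.mul_apply, amp_apply, coef_apply, Matrix.map_apply, Finset.mul_sum, mul_assoc]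

/-- Matrix units on several legs. -/
def multiUnit (A : Type*) [Ring A] [Algebra ℂ A] (s : ℕ) {n : ℕ} (a b : Fin n → Fin N) : LegOp N A :=
  scal A s (Matrix.single a b (1 : ℂ) : Op N n ℂ)

lemma multiUnit_mul (s : ℕ) {n : ℕ} (a b c d : Fin n → Fin N) :
    multiUnit A s a b * multiUnit A s c d = if b = c then multiUnit A s a d else 0 := by
  rw [multiUnit, multiUnit, ← map_mul]
  split_ifs with h
  · rw [h, Matrix.single_mul_single_same, one_mul, multiUnit]
  · rw [Matrix.single_mul_single_of_ne _ _ _ _ h, map_zero]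

lemma scal_eq_sum_multiUnit (s : ℕ) {n : ℕ} (X : Op N n ℂ) :
    scal A s X = ∑ a, ∑ b, X a b • multiUnit A s a b := by
  conv_lhs => rw [Matrix.matrix_eq_sum_single X]
  simp only [map_sum]
  refine Finset.sum_congr rfl fun a _ => Finset.sum_congr rfl fun b _ => ?_
  rw [multiUnit, ← map_smul, Matrix.smul_single, smul_eq_mul, mul_one]

lemma off_of_commute_scal {s n p : ℕ} {y : LegOp N A} (hy : ∀ Z : Op N n ℂ, Commute (scal A s Z) y)
    (h1 : s ≤ p) (h2 : p < s + n) : Off p y := by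
  intro t u
  have := hy (place n (p - s) (oneStrand (Matrix.single t u 1)))
  rw [scal_place _ (by omega), show s + (p - s) = p by omega] at this
  rw [← leg_single]
  have e : (Matrix.single t u (1 : ℂ)).map (algebraMap ℂ A) = Matrix.single t u 1 := by
    rw [Matrix.map_single, map_one]
  rw [← e]
  exact this

/-- Writing `X = u vᵀ`, the compression contracts `f` with `v` and `u` on the legs of `X`; what is
left acts on the other legs only. Unlike `rank_one_sandwich`, `f` may act there too. -/
lemma rank_one_sandwich' (s : ℕ) {n : ℕ} {X : Op N n ℂ} (h : X.rank ≤ 1) (f : LegOp N A) :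
    ∃ y : LegOp N A, (∀ p, s ≤ p → p < s + n → Off p y) ∧ scal A s X * f * scal A s X = y * scal A s X := by
  obtain ⟨u, v, hX⟩ := exists_vecMulVec_of_rank_le_one h
  have hX : ∀ a b, X a b = u a * v b := fun a b => by rw [hX, Matrix.vecMulVec_apply]
  refine ⟨∑ b, ∑ c, (v b * u c) • ∑ a, multiUnit A s a b * f * multiUnit A s c a, fun p h1 h2 =>
    off_of_commute_scal (fun Z => ?_) h1 h2, ?_⟩
  · rw [scal_eq_sum_multiUnit]
    refine Commute.sum_left _ _ _ fun a _ => Commute.sum_left _ _ _ fun d _ => Commute.smul_left ?_ _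
    refine Commute.sum_right _ _ _ fun b _ => Commute.sum_right _ _ _ fun c _ => Commute.smul_right ?_ _
    show _ * _ = _ * _
    rw [Finset.mul_sum, Finset.sum_mul, Finset.sum_eq_single d, Finset.sum_eq_single a]
    · rw [← mul_assoc, ← mul_assoc, multiUnit_mul, if_pos rfl, mul_assoc, mul_assoc, mul_assoc, multiUnit_mul, if_pos rfl]
    · intro e _ he
      rw [mul_assoc, multiUnit_mul, if_neg he, mul_zero]
    · simp
    · intro e _ he
      rw [← mul_assoc, ← mul_assoc, multiUnit_mul, if_neg he.symm, zero_mul, zero_mul]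
    · simp
  · have e1 : scal A s X = ∑ b, v b • ∑ a, u a • multiUnit A s a b := by
      rw [scal_eq_sum_multiUnit, Finset.sum_comm]
      simp only [Finset.smul_sum, smul_smul, hX, mul_comm]
    have e2 : scal A s X = ∑ c, u c • ∑ d, v d • multiUnit A s c d := by
      rw [scal_eq_sum_multiUnit]
      simp only [Finset.smul_sum, smul_smul, hX]
    have e3 : ∀ c a, multiUnit A s c a * scal A s X = u a • ∑ d, v d • multiUnit A s c d := by
      intro c a
      rw [e2, Finset.mul_sum, Finset.sum_eq_single a]
      · simp only [mul_smul_comm, Finset.mul_sum, multiUnit_mul, if_true]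
      · intro b _ hb
        simp only [mul_smul_comm, Finset.mul_sum, multiUnit_mul, if_neg hb.symm, smul_zero, Finset.sum_const_zero]
      · simp
    simp only [Finset.sum_mul, smul_mul_assoc, mul_assoc, e3]
    have e4 : scal A s X * (f * scal A s X) =
        (∑ b, v b • ∑ a, u a • multiUnit A s a b) * (f * ∑ c, u c • ∑ d, v d • multiUnit A s c d) := by
      rw [← e1, ← e2]
    rw [e4, Finset.sum_mul]
    refine Finset.sum_congr rfl fun b _ => ?_
    rw [Finset.mul_sum, Finset.mul_sum]
    refine Finset.sum_congr rfl fun c _ => ?_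
    simp only [Finset.sum_mul, Finset.mul_sum, smul_mul_assoc, mul_smul_comm, smul_smul, Finset.smul_sum]
    rw [Finset.sum_comm]
    refine Finset.sum_congr rfl fun a _ => Finset.sum_congr rfl fun d _ => ?_
    congr 1
    ring

/-! ### Partial traces of the antisymmetrizers -/

/-- Factor produced by the R-trace over the last leg of the antisymmetrizer of order `i + 1`: the
bracket is the partial trace of `σ⁻(q^{-2i})`, with `Tr_R 1 = μ η`, `Tr_R R = 1`, `Tr_R K = μ`. -/
def traceVal (q μ : ℂ) (i : ℕ) : ℂ :=
  q ^ i / qNum q (i + 1) * (μ * etaVal q μ + (q⁻¹ ^ (2 * i) - 1) / (q - q⁻¹) +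
    μ * ((q⁻¹ ^ (2 * i) - 1) / (q * μ⁻¹ * q⁻¹ ^ (2 * i) + 1)))

section

variable {q μ : ℂ} {R F : Op N 2 ℂ} {M : Matrix (Fin N) (Fin N) A} [NeZero N]

lemma legTrace_antisym (hB : IsBMWType q μ R) (hs : SkewInvertible R) {n : ℕ} (p : AsymParam q μ n) (s : ℕ) :
    ∀ {i : ℕ}, i + 1 ≤ n → legTrace (matD R) (s + i) (scal A s (antisym q μ R (i + 1))) =
      traceVal q μ i • scal A s (antisym q μ R i)
  | 0, _ => by
    have : qNum q 1 = 1 := by rw [qNum, pow_one, pow_one, div_self hB.q_sub_ne]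
    rw [antisym, antisym, map_one, legTrace_one, hB.trace_matD hs, traceVal, zero_add, this]
    simp
  | i + 1, hi => by
    have e := antisym_mul_self (A := A) p hB s (i := i + 1) (by omega)
    rw [antisym, map_smul, map_mul, map_mul, scal_place s (by omega), add_zero, map_smul,
      legTrace_mul_right _ (scal_off _ _ (by omega)), legTrace_mul_left _ (scal_off _ _ (by omega)), baxter,
      map_add (scal A s), map_add (scal A s), map_one, map_smul, map_smul, scal_place s (by omega), scal_place s (by omega), map_add, map_add,
      legTrace_one, map_smul, map_smul, ← add_assoc, legTrace_matD hs, hB.legTrace_opK hs, hB.trace_matD hs, smul_smul,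
      ← LegOp.add_smul, ← LegOp.add_smul, mul_smul_comm, mul_one, smul_mul_assoc, e, smul_smul, traceVal]
    congr 1
    ring

lemma iterTrace_antisym (hB : IsBMWType q μ R) (hs : SkewInvertible R) {n : ℕ} (p : AsymParam q μ n) {s t i m : ℕ}
    (ht : t = s + i) (h : i + m ≤ n) : iterTrace (matD R) t m (scal A s (antisym q μ R (i + m))) =
      (∏ j ∈ Finset.range m, traceVal q μ (i + j)) • scal A s (antisym q μ R i) := by
  subst ht
  induction m with
  | zero => simp
  | succ m ih =>
    rw [iterTrace_succ, ← add_assoc, add_assoc s, legTrace_antisym hB hs p s (by omega), map_smul, ih (by omega), smul_smul,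
      Finset.prod_range_succ, mul_comm]

variable (h : BMWQuantum q μ R F M) {k : ℕ} (p : AsymParam q μ k) (h1 : (antisym q μ R k).rank ≤ 1)
include h p h1

namespace BMWQuantum

/-- The product of copies commutes with the rank one idempotent and is therefore compressed to a
coefficient; conjugation by rows of `F` shows that it is the same at every position. -/
lemma exists_copSeg_mul_antisym : ∃ z : A, ∀ s, copSeg F M s k * scal A s (antisym q μ R k) =
    coef z * scal A s (antisym q μ R k) := by
  obtain ⟨z, hz⟩ := rank_one_sandwich 0 h1 (copiesProd F M k)
  have hm := antisym_mem_braidImage q μ R k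
  refine ⟨z, fun s => ?_⟩
  induction s with
  | zero =>
    rw [amp_copiesProd, ← (h.rel.comm_copSeg_of_mem h.pair le_rfl (by omega) hm).eq, mul_assoc,
      antisym_mul_self p h.bmw 0 le_rfl] at hz
    exact hz
  | succ s ih =>
    have c : Commute (coef z) (fRow A F s k) := Commute.rowProd_right fun j _ _ => coef_comm_scal _ _ _
    rw [h.pair.conj_copSeg_mul_scal M s hm, ih, ← mul_assoc, ← c.eq, mul_assoc, mul_assoc,
      ← mul_assoc (fRow A F s k), h.pair.fRow_mul_scal_of_mem s hm, mul_assoc (scal A (s + 1) _),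
      h.pair.rMatrix_right.fRow_mul_fCol, mul_one]

/-- The copies act on the top antisymmetrizer by a coefficient `z`, and its partial traces are
multiples of the identity. The full trace `a_k` differs from the partial one by `Tr D = μ η`, which
eliminates both `z` and the trace constants. -/
lemma altDesc_top (hk : 1 ≤ k) : altDesc q μ R F M k =
    (qNum q k / (μ * etaVal q μ)) • rmul 1 (elemA R F M q μ k) := by
  obtain ⟨s, rfl⟩ : ∃ s, k = s + 1 := ⟨k - 1, by omega⟩
  have η0 := mul_ne_zero h.bmw.mu_ne_zero (etaVal_ne_zero h.bmw)
  obtain ⟨z, hz⟩ := h.exists_copSeg_mul_antisym p h1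
  have t := iterTrace_antisym (A := A) h.bmw h.skew p (s := 0) (t := 1) (i := 1) (m := s) rfl (by omega)
  rw [antisym, map_one, add_comm 1 s] at t
  have e1 := leg_desc' (R := R) (F := F) (M := M) (antisym q μ R (s + 1))
  rw [descTr_apply, hz, iterTrace_mul_left _ fun m _ _ => coef_off m _, t] at e1
  have e2 := coef_ch F M R (antisym q μ R (s + 1))
  rw [hz, add_comm s 1, iterTrace_add _ 0 1 s, zero_add, iterTrace_mul_left _ fun m _ _ => coef_off m _,
    iterTrace_succ, iterTrace_zero, legTrace_mul_left _ (coef_off _ _), add_comm 1 s, t, map_smul, zero_add, legTrace_one,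
    h.bmw.trace_matD h.skew] at e2
  apply leg_injective 0
  rw [altDesc, leg_smul, e1, leg_smul, leg_mul_coef, leg_one, one_mul, elemA, e2, mul_smul_comm, mul_smul_comm,
    mul_smul_comm, smul_smul, smul_smul, smul_smul]
  congr 1
  generalize ∏ j ∈ Finset.range s, traceVal q μ (1 + j) = w
  rw [div_mul_eq_mul_div, div_mul_cancel₀ _ η0]

/-- The first copy of `M` survives, the other `k` copies act by the coefficient `z`, and the
remaining contractor is traced to `μ`. -/
lemma altContr_top (hk : 1 ≤ k) : altContr q μ R F M k =
    (qNum q k / etaVal q μ) • rmul M (elemA R F M q μ k) := by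
  obtain ⟨s, rfl⟩ : ∃ s, k = s + 1 := ⟨k - 1, by omega⟩
  have η0 := etaVal_ne_zero h.bmw
  have μ0 := h.bmw.mu_ne_zero
  obtain ⟨z, hz⟩ := h.exists_copSeg_mul_antisym p h1
  have t := iterTrace_antisym (A := A) h.bmw h.skew p (s := 0) (t := 1) (i := 1) (m := s) rfl (by omega)
  have t' := iterTrace_antisym (A := A) h.bmw h.skew p (s := 1) (t := 2) (i := 1) (m := s) rfl (by omega)
  rw [antisym, map_one, add_comm 1 s] at t t'
  have e2 := coef_ch F M R (antisym q μ R (s + 1))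
  rw [hz, add_comm s 1, iterTrace_add _ 0 1 s, zero_add, iterTrace_mul_left _ fun m _ _ => coef_off m _,
    iterTrace_succ, iterTrace_zero, legTrace_mul_left _ (coef_off _ _), add_comm 1 s, t, map_smul, zero_add, legTrace_one,
    h.bmw.trace_matD h.skew] at e2
  have hadd : ∀ f : LegOp N A, iterTrace (matD R) 1 (s + 1) f = legTrace (matD R) 1 (iterTrace (matD R) 2 s f) :=
    fun f => by rw [add_comm s 1, iterTrace_add _ 1 1 s]; rfl
  have e1 := leg_desc' (R := R) (F := F) (M := M) (place (s + 2) 1 (antisym q μ R (s + 1)) * place (s + 2) 0 (opK q μ R))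
  rw [descTr_apply, copSeg, rowProd_succ', map_mul (scal A 0), scal_place 0 (by omega), scal_place 0 (by omega), zero_add,
    zero_add, mul_assoc, ← mul_assoc (rowProd _ _ _), hz, mul_assoc, ← mul_assoc (cop F M 0), iterTrace_mul_left _
      fun m hm _ => (cop_off F M (by omega)).mul (coef_off m _), hadd,
    iterTrace_mul_right _ fun m hm _ => scal_off _ _ (by omega), t', smul_mul_assoc, one_mul, map_smul, h.bmw.legTrace_opK h.skew 0] at e1
  apply leg_injective 0
  rw [altContr, leg_smul, e1, leg_smul, leg_mul_coef, elemA, e2, cop]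
  simp only [mul_smul_comm, smul_smul, mul_one]
  congr 1
  generalize ∏ j ∈ Finset.range s, traceVal q μ (1 + j) = w
  field_simp

end BMWQuantum
end

end

/-! ### Nested cups and caps -/

section

variable {N : ℕ} {A : Type*} [Ring A] [Algebra ℂ A]

section Cups

variable {W : Type*} [Ring W]

/-- `i` nested cups. -/
def cupProd (k : ℕ → W) : ℕ → ℕ → W
  | _, 0 => 1
  | s, i + 1 => colProd k s (i + 1) * cupProd k (s + 2) i

/-- `i` nested caps. -/
def capProd (k : ℕ → W) : ℕ → ℕ → W
  | _, 0 => 1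
  | s, i + 1 => capProd k (s + 2) i * rowProd k s (i + 1)

/-- `k_s k_{s+2} ⋯ k_{s+2i-2}`. -/
def contractors (k : ℕ → W) : ℕ → ℕ → W
  | _, 0 => 1
  | s, i + 1 => k s * contractors k (s + 2) i

lemma op_colProd (k : ℕ → W) (s i : ℕ) :
    colProd (fun j => MulOpposite.op (k j)) s i = MulOpposite.op (rowProd k s i) := by
  induction i with
  | zero => rfl
  | succ i ih => rw [colProd_succ, rowProd_succ, ih, MulOpposite.op_mul]

lemma op_capProd (k : ℕ → W) (s i : ℕ) :
    cupProd (fun j => MulOpposite.op (k j)) s i = MulOpposite.op (capProd k s i) := by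
  induction i generalizing s with
  | zero => rfl
  | succ i ih => rw [cupProd, capProd, ih, op_colProd, MulOpposite.op_mul]

lemma cupProd_mem {S : Type*} [SetLike S W] [SubmonoidClass S W] (T : S) {k : ℕ → W} {i s : ℕ}
    (h : ∀ j, s ≤ j → j + 2 ≤ s + 2 * i → k j ∈ T) : cupProd k s i ∈ T := by
  induction i generalizing s with
  | zero => exact one_mem _
  | succ i ih =>
    exact mul_mem (colProd_mem T fun j h1 h2 => h j h1 (by omega)) (ih fun j h1 h2 => h j (by omega) (by omega))

lemma capProd_mem {S : Type*} [SetLike S W] [SubmonoidClass S W] (T : S) {k : ℕ → W} {i s : ℕ}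
    (h : ∀ j, s ≤ j → j + 2 ≤ s + 2 * i → k j ∈ T) : capProd k s i ∈ T := by
  induction i generalizing s with
  | zero => exact one_mem _
  | succ i ih =>
    exact mul_mem (ih fun j h1 h2 => h j (by omega) (by omega)) (rowProd_mem T fun j h1 h2 => h j h1 (by omega))

lemma commute_of_mem_centralizer {y z : W} (h : z ∈ Submonoid.centralizer {y}) : Commute y z :=
  (Submonoid.mem_centralizer_iff.1 h y rfl)

lemma commute_cupProd {k : ℕ → W} {i s : ℕ} {y : W} (h : ∀ j, s ≤ j → j + 2 ≤ s + 2 * i → Commute y (k j)) :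
    Commute y (cupProd k s i) :=
  commute_of_mem_centralizer (cupProd_mem _ fun j h1 h2 => Submonoid.mem_centralizer_iff.2 (by
    rintro _ rfl; exact (h j h1 h2).eq))

lemma commute_capProd {k : ℕ → W} {i s : ℕ} {y : W} (h : ∀ j, s ≤ j → j + 2 ≤ s + 2 * i → Commute y (k j)) :
    Commute y (capProd k s i) :=
  commute_of_mem_centralizer (capProd_mem _ fun j h1 h2 => Submonoid.mem_centralizer_iff.2 (by
    rintro _ rfl; exact (h j h1 h2).eq))

variable [Algebra ℂ W]

/-- The antisymmetrizers of two commuting sequences agreeing on an element. -/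
lemma asym_mul_eq_asym_mul {q μ : ℂ} {r k r₁ k₁ : ℕ → W} {y : W} : ∀ {i : ℕ},
    (∀ j, j + 1 < i → r j * y = r₁ j * y) → (∀ j, j + 1 < i → k j * y = k₁ j * y) →
    (∀ a b, a + 1 < i → b + 1 < i → Commute (r a) (r₁ b) ∧ Commute (k a) (r₁ b) ∧ Commute (r a) (k₁ b) ∧
      Commute (k a) (k₁ b)) → asym q μ r k i * y = asym q μ r₁ k₁ i * y
  | 0, _, _, _ => rfl
  | 1, _, _, _ => rfl
  | i + 2, hr, hk, hc => by
    have ih : asym q μ r k (i + 1) * y = asym q μ r₁ k₁ (i + 1) * y :=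
      asym_mul_eq_asym_mul (fun j hj => hr j (by omega)) (fun j hj => hk j (by omega))
        fun a b ha hb => hc a b (by omega) (by omega)
    have e : sigmaVal q μ (q⁻¹ ^ (2 * (i + 1))) (r i) (k i) * y =
        sigmaVal q μ (q⁻¹ ^ (2 * (i + 1))) (r₁ i) (k₁ i) * y := by
      rw [sigmaVal, sigmaVal]
      simp only [add_mul, smul_mul_assoc, hr i (by omega), hk i (by omega)]
    have c1 : Commute (sigmaVal q μ (q⁻¹ ^ (2 * (i + 1))) (r i) (k i)) (asym q μ r₁ k₁ (i + 1)) :=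
      (asym_commute
        (fun b hb => (sigmaVal_commute (hc i b (by omega) (by omega)).1 (hc i b (by omega) (by omega)).2.1).symm)
        (fun b hb => (sigmaVal_commute (hc i b (by omega) (by omega)).2.2.1
          (hc i b (by omega) (by omega)).2.2.2).symm)).symm
    have c2 : Commute (asym q μ r k (i + 1)) (sigmaVal q μ (q⁻¹ ^ (2 * (i + 1))) (r₁ i) (k₁ i)) :=
      asym_commute
        (fun a ha => (sigmaVal_commute (hc a i (by omega) (by omega)).1.symm
          (hc a i (by omega) (by omega)).2.2.1.symm).symm)
        (fun a ha => (sigmaVal_commute (hc a i (by omega) (by omega)).2.1.symm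
          (hc a i (by omega) (by omega)).2.2.2.symm).symm)
    have c3 : Commute (asym q μ r k (i + 1)) (asym q μ r₁ k₁ (i + 1)) :=
      asym_commute
        (fun a ha => (asym_commute (fun b hb => (hc a b (by omega) (by omega)).1.symm)
          (fun b hb => (hc a b (by omega) (by omega)).2.2.1.symm)).symm)
        (fun a ha => (asym_commute (fun b hb => (hc a b (by omega) (by omega)).2.1.symm)
          (fun b hb => (hc a b (by omega) (by omega)).2.2.2.symm)).symm)
    rw [asym, asym, smul_mul_assoc, smul_mul_assoc]
    congr 1
    generalize asym q μ r k (i + 1) = a at *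
    generalize asym q μ r₁ k₁ (i + 1) = a₁ at *
    generalize sigmaVal q μ (q⁻¹ ^ (2 * (i + 1))) (r i) (k i) = σ at *
    generalize sigmaVal q μ (q⁻¹ ^ (2 * (i + 1))) (r₁ i) (k₁ i) = σ₁ at *
    calc a * σ * a * y = a * (σ * a₁) * y := by rw [mul_assoc, ih]; simp only [mul_assoc]
      _ = a * a₁ * (σ * y) := by rw [c1.eq]; simp only [mul_assoc]
      _ = a₁ * (a * σ₁) * y := by rw [e, c3.eq]; simp only [mul_assoc]
      _ = a₁ * σ₁ * (a * y) := by rw [c2.eq]; simp only [mul_assoc]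
      _ = _ := by rw [ih]; simp only [mul_assoc]

namespace BMWSeq

variable {q μ : ℂ} {r r' k : ℕ → W} (p : BMWParam q μ) (h : BMWSeq q μ r r' k)
include p h

lemma op : BMWSeq q μ (fun j => MulOpposite.op (r j)) (fun j => MulOpposite.op (r' j))
    (fun j => MulOpposite.op (k j)) :=
  ⟨fun j => (h.pair j).op p, fun i j hij => (h.comm i j hij).op⟩

/-- Generators slide around nested cups. -/
lemma gen_mul_cupProd {i s a b : ℕ} (hab : a + b + 2 = 2 * (s + i)) (h1 : s ≤ a) (h2 : a + 2 ≤ s + i) :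
    r b * cupProd k s i = r a * cupProd k s i := by
  induction i generalizing s a b with
  | zero => omega
  | succ i ih =>
    rw [cupProd]
    rcases Nat.lt_or_ge (a + 2) (s + (i + 1)) with h' | h'
    · have e := ih (s := s + 2) (a := a + 2) (b := b) (by omega) (by omega) (by omega)
      have c : Commute (r b) (colProd k s (i + 1)) :=
        Commute.colProd_right fun j _ _ => (h.k_comm p (by omega)).symm
      rw [← mul_assoc, c.eq, mul_assoc, e, ← mul_assoc, h.colProd_mul_gen p h1 (by omega), mul_assoc]
    · obtain ⟨i, rfl⟩ : ∃ t, i = t + 1 := ⟨i - 1, by omega⟩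
      obtain rfl : a = s + i := by omega
      obtain rfl : b = s + i + 1 + 1 := by omega
      have c : Commute (colProd k s (i + 1)) (k (s + i + 1 + 1)) :=
        (Commute.colProd_right fun j _ _ => h.kk_comm p (by omega)).symm
      have e1 := ((h.pair (s + i + 1)).symm p).rlk
      have e2 := (h.pair (s + i)).rlk
      rw [cupProd, colProd_succ k (s + 2) i, colProd_succ k s (i + 1), show s + (i + 1) = s + i + 1 by omega,
        show s + 2 + i = s + i + 1 + 1 by omega]
      have e3 : k (s + i) * colProd k s i = colProd k s (i + 1) := (colProd_succ k s i).symm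
      generalize cupProd k (s + 2 + 2) i = z
      generalize colProd k (s + 2) i = x
      calc _ = r (s + i + 1 + 1) * (k (s + i + 1) * (colProd k s (i + 1) * k (s + i + 1 + 1))) * x * z := by
            simp only [mul_assoc]
        _ = r (s + i + 1 + 1) * (k (s + i + 1) * k (s + i + 1 + 1)) * colProd k s (i + 1) * x * z := by
            rw [c.eq]; simp only [mul_assoc]
        _ = r' (s + i + 1) * (k (s + i + 1 + 1) * colProd k s (i + 1)) * x * z := by
            rw [e1]; simp only [mul_assoc]
        _ = r' (s + i + 1) * k (s + i) * colProd k s i * k (s + i + 1 + 1) * x * z := by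
            rw [← c.eq, ← e3]; simp only [mul_assoc]
        _ = r (s + i) * k (s + i + 1) * colProd k s (i + 1) * k (s + i + 1 + 1) * x * z := by
            rw [← e2, ← e3]; simp only [mul_assoc]
        _ = _ := by simp only [mul_assoc]

omit p in
lemma inv_mul_of_gen_mul {a b : ℕ} (hab : a + 2 ≤ b) {y : W} (e : r b * y = r a * y) : r' b * y = r' a * y := by
  have c : Commute (r' a) (r b) := (h.gen a).r'_comm (h.comm' (Or.inl hab))
  calc r' b * y = r' b * (r' a * (r a * y)) := by rw [← mul_assoc (r' a), (h.gen a).inv_mul, one_mul]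
    _ = r' b * (r b * (r' a * y)) := by rw [← e, ← mul_assoc (r' a), c.eq, mul_assoc]
    _ = _ := by rw [← mul_assoc, (h.gen b).inv_mul, one_mul]

lemma k_mul_of_gen_mul {a b : ℕ} (hab : a + 2 ≤ b) {y : W} (e : r b * y = r a * y) : k b * y = k a * y := by
  rw [(h.gen b).k_eq p, (h.gen a).k_eq p, sub_mul, sub_mul, smul_mul_assoc, smul_mul_assoc, sub_mul, sub_mul, e,
    h.inv_mul_of_gen_mul hab e]

omit p in
-- Generators slide around nested cups with their order reversed, and an antisymmetrizer is
-- insensitive to reversal; so it slides as a whole.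
lemma asym_mul_cupProd {i : ℕ} (p : AsymParam q μ i) (s : ℕ) :
    asym q μ (fun j => r (s + i + j)) (fun j => k (s + i + j)) i * cupProd k s i =
      asym q μ (fun j => r (s + j)) (fun j => k (s + j)) i * cupProd k s i := by
  have pp := p.toBMWParam
  rw [← ((h.shift s).chain (i - 1)).asym_reverse p]
  have e : ∀ j, j + 1 < i → r (s + i + j) * cupProd k s i = r (s + (i - 1 - 1 - j)) * cupProd k s i :=
    fun j hj => h.gen_mul_cupProd pp (by omega) (by omega) (by omega)
  refine asym_mul_eq_asym_mul e (fun j hj => h.k_mul_of_gen_mul pp (by omega) (e j hj)) fun a b ha hb => ?_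
  exact ⟨h.comm' (by omega), h.k_comm pp (by omega), (h.k_comm pp (by omega)).symm, h.kk_comm pp (by omega)⟩

omit p in
lemma capProd_mul_asym {i : ℕ} (p : AsymParam q μ i) (s : ℕ) :
    capProd k s i * asym q μ (fun j => r (s + i + j)) (fun j => k (s + i + j)) i =
      capProd k s i * asym q μ (fun j => r (s + j)) (fun j => k (s + j)) i := by
  have := (h.op p.toBMWParam).asym_mul_cupProd p s
  rw [op_capProd, ← op_asym q μ (fun j => r (s + i + j)), ← op_asym q μ (fun j => r (s + j))] at this
  exact MulOpposite.op_injective this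

lemma cupProd_mul_contractors (s i : ℕ) : cupProd k s i * contractors k s i = etaVal q μ ^ i • cupProd k s i := by
  induction i generalizing s with
  | zero => simp [cupProd, contractors]
  | succ i ih =>
    have c : Commute (k s) (cupProd k (s + 2) i) := commute_cupProd fun j _ _ => h.kk_comm p (by omega)
    rw [cupProd, contractors, mul_assoc, ← mul_assoc (cupProd _ _ _), ← c.eq, mul_assoc (k s), ih, colProd_succ',
      mul_smul_comm, mul_smul_comm, mul_assoc, ← mul_assoc (k s), (h.gen s).kk p, pow_succ, mul_smul, smul_mul_assoc,
      mul_smul_comm, mul_assoc]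

lemma colProd_mul_rowProd_eta (s i : ℕ) : colProd k s (i + 1) * rowProd k s (i + 1) = etaVal q μ • k (s + i) := by
  rw [rowProd_succ', ← mul_assoc, ← h.colProd_mul_rowProd_tail p s i, ← smul_mul_assoc]
  congr 1
  rw [colProd_succ', mul_assoc, (h.gen s).kk p, mul_smul_comm]

omit p in
lemma rowProd_mul_colProd_mid (s i : ℕ) : rowProd k s i * k (s + i) * colProd k s i = k s := by
  induction i with
  | zero => rw [rowProd, colProd, mul_one, one_mul, add_zero]
  | succ i ih =>
    rw [rowProd_succ, colProd_succ, ← mul_assoc, mul_assoc (rowProd k s i), mul_assoc (rowProd k s i),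
      show s + (i + 1) = s + i + 1 by omega, (h.pair (s + i)).klk, ih]

omit p in
-- Unfolding the antisymmetrizer at its left end, the outer contractors see only one Baxterized
-- generator, and `k s k`, `k l k`, `k²` are all multiples of `k`.
lemma exists_k_asym_k {m n : ℕ} (p : AsymParam q μ n) (hm : m + 1 ≤ n) (s : ℕ) : ∃ w : ℂ,
    k s * asym q μ (fun j => r (s + 1 + j)) (fun j => k (s + 1 + j)) (m + 1) * k s =
      w • (k s * asym q μ (fun j => r (s + 2 + j)) (fun j => k (s + 2 + j)) m) := by
  have pp := p.toBMWParam
  rcases m with _ | m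
  · exact ⟨etaVal q μ, by rw [asym, asym, mul_one, (h.gen s).kk pp]⟩
  · have e := ((h.shift (s + 1)).chain (n - 1)).asym_succ' p hm
    have e1 : (fun j => r (s + 1 + (1 + j))) = fun j => r (s + 2 + j) := by
      funext j; congr 1; omega
    have e2 : (fun j => k (s + 1 + (1 + j))) = fun j => k (s + 2 + j) := by
      funext j; congr 1; omega
    rw [e1, e2, add_zero] at e
    have c : Commute (asym q μ (fun j => r (s + 2 + j)) (fun j => k (s + 2 + j)) (m + 1)) (k s) :=
      asym_commute (fun j _ => (h.k_comm pp (by omega)).symm) fun j _ => h.kk_comm pp (by omega)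
    have ii := ((h.shift (s + 2)).chain (n - 1)).asym_mul_asym p (i := m + 1) (by omega)
    set x := q⁻¹ ^ (2 * (m + 1))
    have hσ : k s * sigmaVal q μ x (r (s + 1)) (k (s + 1)) * k s = (etaVal q μ + (x - 1) / (q - q⁻¹) * μ⁻¹ +
        (x - 1) / (q * μ⁻¹ * x + 1)) • k s := by
      rw [sigmaVal, mul_add, mul_add, mul_one, mul_smul_comm, mul_smul_comm, add_mul, add_mul, smul_mul_assoc,
        smul_mul_assoc, (h.gen s).kk pp, (h.pair s).ksk pp, (h.pair s).klk, smul_smul, ← add_smul, ← add_smul]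
    refine ⟨q ^ (m + 1) / qNum q (m + 2) * (etaVal q μ + (x - 1) / (q - q⁻¹) * μ⁻¹ +
      (x - 1) / (q * μ⁻¹ * x + 1)), ?_⟩
    · rw [e, mul_smul_comm, smul_mul_assoc, mul_smul]
      congr 1
      generalize asym q μ (fun j => r (s + 2 + j)) (fun j => k (s + 2 + j)) (m + 1) = a at *
      calc _ = (k s * a) * sigmaVal q μ x (r (s + 1)) (k (s + 1)) * (a * k s) := by simp only [mul_assoc]
        _ = a * (k s * sigmaVal q μ x (r (s + 1)) (k (s + 1)) * k s) * a := by
            rw [← c.eq]; nth_rw 2 [c.eq]; simp only [mul_assoc]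
        _ = _ := by
            rw [hσ, mul_smul_comm, smul_mul_assoc, c.eq, mul_assoc (k s), ii]

omit p in
-- The innermost cap and cup reduce the order by one and leave a contractor, which straightens the
-- rest of the outer diagonals; then induction. The constant is left unspecified since it is found
-- later by comparison.
lemma exists_cap_asym_cup {n : ℕ} (p : AsymParam q μ n) {i m : ℕ} (hm : m + i ≤ n) (s : ℕ) : ∃ w : ℂ,
    capProd k s i * asym q μ (fun j => r (s + i + j)) (fun j => k (s + i + j)) (m + i) * cupProd k s i =
      w • (contractors k s i * asym q μ (fun j => r (s + 2 * i + j)) (fun j => k (s + 2 * i + j)) m) := by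
  have pp := p.toBMWParam
  induction i generalizing s with
  | zero => exact ⟨1, by simp [capProd, cupProd, contractors]⟩
  | succ i ih =>
    obtain ⟨w, hw⟩ := ih (by omega) (s + 2)
    obtain ⟨w', hw'⟩ := h.exists_k_asym_k p (m := m + i) (by omega) (s + i)
    refine ⟨w' * w, ?_⟩
    have e1 : (fun j => s + i + 1 + j) = fun j => s + (i + 1) + j := by funext j; omega
    have e2 : ∀ j, s + i + 2 + j = s + 2 + i + j := by intro j; omega
    have e3 : ∀ j, s + 2 + 2 * i + j = s + 2 * (i + 1) + j := by intro j; omega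
    have e4 : ∀ j, s + i + 1 + j = s + (i + 1) + j := by intro j; omega
    simp only [e2, e3, e4] at hw hw'
    have c1 : Commute (asym q μ (fun j => r (s + 2 + i + j)) (fun j => k (s + 2 + i + j)) (m + i)) (colProd k s i) :=
      Commute.colProd_right fun a _ _ => asym_commute (fun j _ => (h.k_comm pp (by omega)).symm)
        fun j _ => h.kk_comm pp (by omega)
    have c2 : Commute (k s) (capProd k (s + 2) i) := commute_capProd fun j _ _ => h.kk_comm pp (by omega)
    have c3 := h.rowProd_mul_colProd_mid s i
    rw [capProd, cupProd, contractors, rowProd_succ, colProd_succ, ← add_assoc m]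
    generalize asym q μ (fun j => r (s + (i + 1) + j)) (fun j => k (s + (i + 1) + j)) (m + i + 1) = a at *
    generalize asym q μ (fun j => r (s + 2 + i + j)) (fun j => k (s + 2 + i + j)) (m + i) = b at *
    generalize asym q μ (fun j => r (s + 2 * (i + 1) + j)) (fun j => k (s + 2 * (i + 1) + j)) m = d at *
    calc _ = capProd k (s + 2) i * (rowProd k s i * (k (s + i) * a * k (s + i)) * colProd k s i) * cupProd k (s + 2) i := by
          simp only [mul_assoc]
      _ = w' • (capProd k (s + 2) i * (rowProd k s i * k (s + i) * (b * colProd k s i)) * cupProd k (s + 2) i) := by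
          rw [hw']; simp only [mul_smul_comm, smul_mul_assoc, mul_assoc]
      _ = w' • ((capProd k (s + 2) i * (rowProd k s i * k (s + i) * colProd k s i)) * b * cupProd k (s + 2) i) := by
          rw [c1.eq]; simp only [mul_assoc]
      _ = w' • (k s * (capProd k (s + 2) i * b * cupProd k (s + 2) i)) := by
          rw [c3, ← c2.eq]; simp only [mul_assoc]
      _ = _ := by rw [hw, mul_smul_comm, smul_smul]; simp only [mul_assoc]

end BMWSeq

end Cups

end

/-! ### Reciprocity for the elements `a_i` -/

section

variable {N : ℕ} {A : Type*} [Ring A] [Algebra ℂ A]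

section

variable {q μ : ℂ} {R F : Op N 2 ℂ} {M : Matrix (Fin N) (Fin N) A} [NeZero N]

lemma elemA_eq_ch (i : ℕ) : elemA R F M q μ i = ch R F M (antisym q μ R i) := by
  rcases i with _ | i
  · apply coef_injective (N := N)
    rw [coef_ch, antisym, map_one, mul_one, iterTrace_zero, elemA, map_one]
    rfl
  · rfl

omit [NeZero N] in
lemma opK_mem_braidLeg (q μ : ℂ) (R : Op N 2 ℂ) {a b j : ℕ} (h1 : a ≤ j) (h2 : j + 2 ≤ b) :
    scal A j (opK q μ R) ∈ braidLeg A R a b := scal_mem_braidLeg_of_mem h1 h2 (opK_mem_braidImage q μ R)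

/-- Tracing from the inside, the inner cups and caps give a scalar; the outer diagonals then
collapse to `η` times one contractor, whose R-trace is `μ`. -/
lemma iterTrace_cup_cap (hB : IsBMWType q μ R) (hs : SkewInvertible R) (s i : ℕ) :
    iterTrace (matD R) (s + i) i (cupProd (fun j => scal A j (opK q μ R)) s i *
      capProd (fun j => scal A j (opK q μ R)) s i) = (μ * etaVal q μ) ^ i • (1 : LegOp N A) := by
  have p := hB.param
  have S := hB.seq A
  induction i generalizing s with
  | zero => rw [iterTrace_zero, cupProd, capProd, mul_one, pow_zero, one_smul]
  | succ i ih =>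
    have o1 : ∀ m, s + (i + 1) + 1 ≤ m → m < s + (i + 1) + 1 + i →
        Off m (colProd (fun j => scal A j (opK q μ R)) s (i + 1)) := fun m h1 _ =>
      braidLeg_off (R := R) (a := s) (b := s + i + 2) (by omega)
        (colProd_mem _ fun j h2 h3 => opK_mem_braidLeg q μ R h2 (by omega))
    have o2 : ∀ m, s + (i + 1) + 1 ≤ m → m < s + (i + 1) + 1 + i →
        Off m (rowProd (fun j => scal A j (opK q μ R)) s (i + 1)) := fun m h1 _ =>
      braidLeg_off (R := R) (a := s) (b := s + i + 2) (by omega)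
        (rowProd_mem _ fun j h2 h3 => opK_mem_braidLeg q μ R h2 (by omega))
    have hadd : ∀ f : LegOp N A, iterTrace (matD R) (s + (i + 1)) (i + 1) f =
        legTrace (matD R) (s + i + 1) (iterTrace (matD R) (s + (i + 1) + 1) i f) := fun f => by
      rw [add_comm i 1, iterTrace_add _ _ 1 i, iterTrace_succ, iterTrace_zero, add_zero, add_comm 1 i, add_assoc s i 1]
    have ih' := ih (s + 2)
    rw [show s + 2 + i = s + (i + 1) + 1 by omega] at ih'
    rw [cupProd, capProd, hadd, mul_assoc, ← mul_assoc (cupProd _ _ _), iterTrace_mul_left _ o1,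
      iterTrace_mul_right _ o2, ih', smul_mul_assoc, one_mul, mul_smul_comm, map_smul,
      S.colProd_mul_rowProd_eta p, map_smul, hB.legTrace_opK hs, smul_smul, smul_smul, pow_succ, mul_assoc,
      mul_comm (etaVal q μ)]

lemma iterTrace_antisym_full (hB : IsBMWType q μ R) (hs : SkewInvertible R) {n : ℕ} (p : AsymParam q μ n) (s : ℕ)
    {m : ℕ} (h : m ≤ n) : iterTrace (matD R) s m (scal A s (antisym q μ R m)) =
      (∏ j ∈ Finset.range m, traceVal q μ j) • 1 := by
  have e := iterTrace_antisym (A := A) hB hs p (s := s) (t := s) (i := 0) (m := m) rfl (by omega)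
  rw [Finset.prod_congr rfl fun j _ => by rw [zero_add], antisym, map_one] at e
  rwa [zero_add] at e

omit [NeZero N] in
lemma antisym_tail_mul {n : ℕ} (p : AsymParam q μ n) (hB : IsBMWType q μ R) {s t i m : ℕ} (ht : t = s + i)
    (h : i + m = n) : scal A t (antisym q μ R m) * scal A s (antisym q μ R n) = scal A s (antisym q μ R n) := by
  subst ht
  have e := (((hB.seq A).shift s).chain (n - 1)).isAntisym_asym p n le_rfl
  rw [← scal_antisym] at e
  rw [scal_antisym]
  refine IsAntisym.asym_mul p (by omega) fun j hj => ?_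
  rw [add_assoc]
  exact e (i + j) (by omega)

/-- Splitting off `i` characteristic elements `ch(K)`. The number of legs is an existential `n` with
an equation, so that it can later be identified with `i + k`. -/
lemma exists_contractors_ch (hc : IsCompatiblePair R F) (hs : SkewInvertible R) (q μ : ℂ)
    (X : Matrix (Fin N) (Fin N) A) (i : ℕ) {m : ℕ}
    {y : Op N m ℂ} (hy : y ∈ braidImage R m) : ∃ n, n = 2 * i + m ∧ ∃ Z : Op N n ℂ, Z ∈ braidImage R n ∧
      (∀ s, scal A s Z = contractors (fun j => scal A j (opK q μ R)) s i * scal A (s + 2 * i) y) ∧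
      ch R F X Z = ch R F X (opK q μ R) ^ i * ch R F X y := by
  induction i with
  | zero => exact ⟨m, by omega, y, hy, fun s => by simp [contractors], by simp⟩
  | succ i ih =>
    obtain ⟨n, hn, Z, hZ, hZs, hZc⟩ := ih
    have hK := opK_mem_braidImage q μ R
    refine ⟨2 + n, by omega, place _ 0 (opK q μ R) * place _ 2 Z,
      mul_mem (place_mem_braidImage (by omega) hK) (place_mem_braidImage (by omega) hZ), fun s => ?_, ?_⟩
    · rw [map_mul, scal_place s (by omega), scal_place s (by omega), hZs, contractors, add_zero, mul_assoc,
        show s + 2 + 2 * i = s + 2 * (i + 1) by omega]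
    · apply coef_injective (N := N)
      rw [pow_succ', mul_assoc, ← hZc, hc.coef_ch_mul_ch hs X hK hZ, coef_ch, map_mul (scal A 0), scal_place 0 (by omega),
        scal_place 0 (by omega)]

variable {k : ℕ} (p : AsymParam q μ k) (h1 : (antisym q μ R k).rank ≤ 1)
  (hB : IsBMWType q μ R) (hs : SkewInvertible R) (ht : ∀ j < k, traceVal q μ j ≠ 0)
include p h1 hB hs ht

/-- By rank one the product is `y a^{(k)}` with `y` acting off the legs of `a^{(k)}`. The trace over
those legs determines `y`: on one side it gives a nonzero multiple of `y`; on the other `a^{(k)}` is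
traced down to `a^{(i)}`, which slides through the caps, and the closed cups and caps give a scalar.
-/
lemma exists_antisym_cup_cap_antisym {i : ℕ} (hi : i ≤ k) : ∃ c : ℂ, c ≠ 0 ∧
    scal A i (antisym q μ R k) * cupProd (fun j => scal A j (opK q μ R)) 0 i *
      (capProd (fun j => scal A j (opK q μ R)) 0 i * scal A i (antisym q μ R k)) =
    c • (scal A 0 (antisym q μ R i) * scal A i (antisym q μ R k)) := by
  have pp := p.toBMWParam
  set κ : ℕ → LegOp N A := fun j => scal A j (opK q μ R) with hκ
  obtain ⟨y, hy, e⟩ := rank_one_sandwich' (A := A) i h1 (cupProd κ 0 i * capProd κ 0 i)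
  have hT0 := Finset.prod_ne_zero_iff.2 fun j hj => ht j (Finset.mem_range.1 hj)
  have hT1 : ∏ j ∈ Finset.range (k - i), traceVal q μ (i + j) ≠ 0 :=
    Finset.prod_ne_zero_iff.2 fun j hj => ht (i + j) (by have := Finset.mem_range.1 hj; omega)
  set T0 := ∏ j ∈ Finset.range k, traceVal q μ j
  set T1 := ∏ j ∈ Finset.range (k - i), traceVal q μ (i + j)
  have hm : scal A i (antisym q μ R k) ∈ braidLeg A R i (i + k) :=
    scal_mem_braidLeg_of_mem le_rfl le_rfl (antisym_mem_braidImage q μ R k)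
  have e1 : iterTrace (matD R) i k (y * scal A i (antisym q μ R k)) = T0 • y := by
    rw [iterTrace_mul_left _ hy, iterTrace_antisym_full hB hs p i le_rfl, mul_smul_comm, mul_one]
  have o : ∀ m, i + i ≤ m → m < i + i + (k - i) → Off m (cupProd κ 0 i * capProd κ 0 i) := fun m hm1 _ =>
    (braidLeg_off (R := R) (a := 0) (b := 2 * i) (by omega)
      (cupProd_mem _ fun j h2 h3 => opK_mem_braidLeg q μ R h2 (by omega))).mul
    (braidLeg_off (R := R) (a := 0) (b := 2 * i) (by omega)
      (capProd_mem _ fun j h2 h3 => opK_mem_braidLeg q μ R h2 (by omega)))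
  have hadd : ∀ f : LegOp N A, iterTrace (matD R) i k f =
      iterTrace (matD R) i i (iterTrace (matD R) (i + i) (k - i) f) := fun f => by
    rw [← iterTrace_add, Nat.add_sub_cancel' hi]
  have pi : AsymParam q μ i := ⟨pp, fun j h1 h2 => p.qNum_ne j h1 (by omega),
    fun j h1 h2 => p.den_ne j h1 (by omega), p.den_ne', p.one_add_ne, p.sq_add_ne⟩
  have e2 : iterTrace (matD R) i k (y * scal A i (antisym q μ R k)) =
      (T1 * (μ * etaVal q μ) ^ i) • scal A 0 (antisym q μ R i) := by
    have t := iterTrace_antisym (A := A) hB hs p (s := i) (t := i + i) (i := i) (m := k - i) rfl (by omega)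
    rw [Nat.add_sub_cancel' hi] at t
    have c := (hB.seq A).capProd_mul_asym pi 0
    have cc := iterTrace_cup_cap (A := A) hB hs 0 i
    simp only [zero_add] at c cc
    have d := scal_antisym (A := A) q μ R 0 i
    simp only [zero_add] at d
    rw [← e, mul_assoc, hB.rMatrix.iterTrace_cyclic_braidLeg hs hm, mul_assoc _ _ (scal A i _),
      antisym_mul_self p hB i le_rfl, hadd, iterTrace_mul_left _ o, t, mul_smul_comm, map_smul, mul_assoc,
      scal_antisym (A := A) q μ R i i, c, ← d, ← mul_assoc, iterTrace_mul_right _ fun m h2 h3 =>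
        scal_off _ _ (by omega), cc, smul_mul_assoc, one_mul, smul_smul]
  have e3 : y = (T0⁻¹ * (T1 * (μ * etaVal q μ) ^ i)) • scal A 0 (antisym q μ R i) := by
    rw [mul_smul, ← e2, e1, smul_smul, inv_mul_cancel₀ hT0, one_smul]
  refine ⟨T0⁻¹ * (T1 * (μ * etaVal q μ) ^ i), mul_ne_zero (inv_ne_zero hT0) (mul_ne_zero hT1
    (pow_ne_zero _ (mul_ne_zero hB.mu_ne_zero (etaVal_ne_zero hB)))), ?_⟩
  rw [← smul_mul_assoc, ← e3, ← e]
  simp only [mul_assoc]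

omit h1 in
-- Its full R-trace is a product of the factors `traceVal`, all nonzero.
lemma antisym_mul_antisym_ne_zero [Nontrivial A] {i : ℕ} (hi : i ≤ k) :
    scal A 0 (antisym q μ R i) * scal A i (antisym q μ R k) ≠ 0 := by
  intro h0
  have e := congrArg (iterTrace (matD R) 0 (i + k)) h0
  rw [iterTrace_add, zero_add, map_zero, iterTrace_mul_left _ fun m h2 h3 => scal_off _ _ (by omega),
    iterTrace_antisym_full hB hs p i le_rfl, mul_smul_comm, mul_one, map_smul,
    iterTrace_antisym_full hB hs p 0 hi, smul_smul] at e
  have hT : ∀ m ≤ k, ∏ j ∈ Finset.range m, traceVal q μ j ≠ 0 := fun m hm =>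
    Finset.prod_ne_zero_iff.2 fun j hj => ht j (by have := Finset.mem_range.1 hj; omega)
  have e1 := (smul_eq_zero_iff_right (mul_ne_zero (hT k le_rfl) (hT i hi))).1 e
  have : coef (N := N) (1 : A) = coef 0 := by rw [map_one, map_zero, e1]
  exact one_ne_zero (coef_injective this)

/-- Put `X = a^{(k)} ∪` and `Y = ∩ a^{(k)}` with `i` nested cups and caps. Then `X Y` is `c₁ a^{(i)}
⊗ a^{(k)}` and `Y X` is `c₂` times `i` contractors next to `a^{(k-i)}`. Cyclicity of the R-trace
equates the two characteristic elements up to the ratio of the constants. -/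
lemma BMWQuantum.elemA_mul_elemA (h : BMWQuantum q μ R F M) {i : ℕ} (hi : i ≤ k) :
    elemA R F M q μ i * elemA R F M q μ k = contraction R F M q μ ^ i * elemA R F M q μ (k - i) := by
  rcases subsingleton_or_nontrivial A with _ | _
  · exact Subsingleton.elim _ _
  have pp := p.toBMWParam
  have S := hB.seq A
  obtain ⟨c₁, hc₁, exy⟩ := exists_antisym_cup_cap_antisym (A := A) p h1 hB hs ht hi
  have hne := antisym_mul_antisym_ne_zero (A := A) p hB hs ht hi
  obtain ⟨c₂, eyx⟩ := S.exists_cap_asym_cup p (i := i) (m := k - i) (by omega) 0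
  obtain ⟨n, hn, Z, hZ, hZs, hZc⟩ := exists_contractors_ch h.pair hs q μ M i (antisym_mem_braidImage q μ R (k - i))
  have hZ0 := hZs 0
  obtain rfl : n = i + k := by omega
  rw [Nat.sub_add_cancel hi, zero_add, zero_add, ← scal_antisym, ← scal_antisym] at eyx
  rw [zero_add] at hZ0
  have hcc := S.cupProd_mul_contractors pp 0 i
  have hba := antisym_tail_mul (A := A) p hB (s := i) (t := 2 * i) (i := i) (m := k - i) (by omega) (by omega)
  have hb : Commute (scal A (2 * i) (antisym q μ R (k - i))) (capProd (fun j => scal A j (opK q μ R)) 0 i) :=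
    commute_capProd fun j _ _ => scal_comm_scal (by omega) _ _
  have haa := antisym_mul_self (A := A) p hB i le_rfl
  have ha0 := antisym_mul_self (A := A) p hB 0 hi
  have hcom : Commute (scal A 0 (antisym q μ R i)) (scal A i (antisym q μ R k)) := scal_comm_scal (by omega) _ _
  have hx : scal A i (antisym q μ R k) * cupProd (fun j => scal A j (opK q μ R)) 0 i ∈ braidLeg A R 0 (0 + (i + k)) :=
    mul_mem (scal_mem_braidLeg_of_mem (by omega) (by omega) (antisym_mem_braidImage q μ R k))
      (cupProd_mem _ fun j h2 h3 => opK_mem_braidLeg q μ R h2 (by omega))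
  have hP : ∀ x ∈ braidLeg A R 0 (0 + (i + k)), Commute x (copSeg F M 0 (i + k)) := fun x hx =>
    hB.rMatrix.commute_braidLeg (fun j h2 h3 => (h.rel.comm_copSeg h.pair h2 (by omega))) hx
  have ea : coef (elemA R F M q μ i * elemA R F M q μ k) = iterTrace (matD R) 0 (i + k) (copSeg F M 0 (i + k) *
      (scal A 0 (antisym q μ R i) * scal A i (antisym q μ R k))) := by
    rw [elemA_eq_ch, elemA_eq_ch, h.pair.coef_ch_mul_ch hs M (antisym_mem_braidImage q μ R i)
      (antisym_mem_braidImage q μ R k)]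
  have eZ := coef_ch F M R Z
  rw [hZ0, hZc, ← elemA_eq_ch, h.ch_opK] at eZ
  have hcyc := fun f => hB.rMatrix.iterTrace_cyclic_braidLeg (A := A) hs hx f
  have hPx := (hP _ hx).eq
  generalize scal A i (antisym q μ R k) = a at *
  generalize scal A 0 (antisym q μ R i) = a₀ at *
  generalize scal A (2 * i) (antisym q μ R (k - i)) = b at *
  generalize cupProd (fun j => scal A j (opK q μ R)) 0 i = u at *
  generalize capProd (fun j => scal A j (opK q μ R)) 0 i = v at *
  generalize contractors (fun j => scal A j (opK q μ R)) 0 i = w at *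
  generalize copSeg F M 0 (i + k) = P at *
  have hyx : v * a * (a * u) = c₂ • (w * b) := by rw [← eyx]; simp only [mul_assoc]; rw [← mul_assoc a a, haa]
  -- The product `X Y X Y` is computed as `(X Y)²` and as `X (Y X) Y`; in the latter the contractors
  -- meet the cups and give `η^i`.
  have hc : c₁ = c₂ * etaVal q μ ^ i := by
    have s1 : (a * u * (v * a)) * (a * u * (v * a)) = (c₁ * c₁) • (a₀ * a) := by
      rw [exy, smul_mul_assoc, mul_smul_comm, smul_smul, hcom.symm.mul_mul_mul_comm, ha0, haa]
    have s2 : (a * u * (v * a)) * (a * u * (v * a)) = (c₂ * etaVal q μ ^ i * c₁) • (a₀ * a) := by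
      calc _ = a * u * (v * a * (a * u)) * (v * a) := by simp only [mul_assoc]
        _ = c₂ • (a * (u * w) * (b * v) * a) := by
            rw [hyx, mul_smul_comm, smul_mul_assoc]; simp only [mul_assoc]
        _ = (c₂ * etaVal q μ ^ i) • (a * u * (v * (b * a))) := by
            rw [hcc, hb.eq, mul_smul_comm, smul_mul_assoc, smul_mul_assoc, smul_smul]; simp only [mul_assoc]
        _ = _ := by rw [hba, exy, smul_smul]
    have s3 : (c₁ * c₁ - c₂ * etaVal q μ ^ i * c₁) • (a₀ * a) = 0 := by
      rw [LegOp.sub_smul, ← s1, s2, sub_self]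
    have s4 := (smul_eq_zero.1 s3).resolve_right hne
    exact mul_right_cancel₀ hc₁ (sub_eq_zero.1 s4)
  -- The factor `η^i` from `ch(K) = η g` is exactly what the relation between `c₁` and `c₂`
  -- compensates.
  have t1 : c₁ • coef (N := N) (elemA R F M q μ i * elemA R F M q μ k) =
      c₂ • coef ((etaVal q μ • contraction R F M q μ) ^ i * elemA R F M q μ (k - i)) := by
    rw [ea, eZ, ← map_smul, ← mul_smul_comm, ← exy, ← mul_assoc, ← hPx, mul_assoc, hcyc, mul_assoc, hyx, mul_smul_comm, map_smul]
  apply coef_injective (N := N)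
  rw [smul_pow, smul_mul_assoc, map_smul, smul_smul, ← hc] at t1
  exact smul_right_injective _ hc₁ t1

end

end

/-! ### Injectivity of star multiplication by `M` -/

section

variable {N : ℕ} {A : Type*} [Ring A] [Algebra ℂ A]

section

variable {q μ : ℂ} {R F : Op N 2 ℂ} {M : Matrix (Fin N) (Fin N) A}

lemma leg_tailTrace_cop (D : Matrix (Fin N) (Fin N) ℂ) (F : Op N 2 ℂ) (Y : Matrix (Fin N) (Fin N) A) (T : Op N 2 ℂ) :
    leg 0 (tailTrace (s := 1) D (copy F Y 2 1 * T.lift A)) = legTrace D 1 (cop F Y 1 * scal A 0 T) := by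
  rw [leg, ← iterTrace_amp_tail _ 0, map_mul, amp_copy _ _ (by norm_num)]
  rfl

lemma leg_zero (n : ℕ) : leg n (0 : Matrix (Fin N) (Fin N) A) = 0 := by
  simpa using leg_smul n 0 (0 : Matrix (Fin N) (Fin N) A)

variable [NeZero N]

lemma conj_conj_eq {W : Type*} [Ring W] {f f' g g' m m' t t' : W} (hg : g * g' = 1) (hg' : g' * g = 1)
    (hf : f * f' = 1) (hm : g * m * g' = m') (c : Commute f m') (e : f * g * t = t' * (f * g)) :
    f * (g * (m * t) * g') * f' = m' * t' :=
  calc f * (g * (m * t) * g') * f' = f * (g * m * (g' * g) * t) * g' * f' := by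
        rw [hg', mul_one]; simp only [mul_assoc]
    _ = f * m' * g * t * g' * f' := by rw [← hm]; simp only [mul_assoc]
    _ = m' * (f * g * t) * g' * f' := by rw [c.eq]; simp only [mul_assoc]
    _ = m' * t' * (f * (g * g') * f') := by rw [e]; simp only [mul_assoc]
    _ = m' * t' := by rw [hg, mul_one, hf, mul_one]

/-- The second copy of a partially traced matrix is the same expression on the next legs:
conjugation by `F_1 F_2` moves both the copy of `Y` and `T`, and the R-trace ignores the conjugation
by `F_2`. -/
lemma IsCompatiblePair.cop_one_tailTrace (hc : IsCompatiblePair R F) (hs : SkewInvertible R)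
    (Y : Matrix (Fin N) (Fin N) A) {T : Op N 2 ℂ} (hT : T ∈ braidImage R 2) :
    cop F (tailTrace (s := 1) (matD R) (copy F Y 2 1 * T.lift A)) 1 =
      legTrace (matD R) 2 (cop F Y 2 * scal A 1 T) := by
  have hF := hc.rMatrix_right
  have e0 : Commute (scal A 0 F) (cop F Y 2) := scal_comm_cop hF.compatible_self (by norm_num) Y
  have e1 : scal A 0 F * scal A 1 F * scal A 0 T = scal A 1 T * (scal A 0 F * scal A 1 F) :=
    hc.rMatrix_left.intertwine (fun j hj => by
      obtain rfl : j = 0 := by omega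
      exact (hc.shift₂ 0).symm.trans (mul_assoc _ _ _)) hT
  have e2 : legTrace (matD R) 2 (scal A 1 F * (cop F Y 1 * scal A 0 T) * scal A 1 F⁻¹) =
      legTrace (matD R) 1 (cop F Y 1 * scal A 0 T) :=
    hc.legTrace_conj hs (n := 1) ((cop_off F Y (by norm_num)).mul (scal_off _ _ (by norm_num)))
  have o : ∀ X : Op N 2 ℂ, Off 2 (scal A 0 X) := fun X => scal_off _ _ (by norm_num)
  rw [cop, cop, leg_tailTrace_cop, ← e2, ← legTrace_mul_left _ (o _), ← legTrace_mul_right _ (o _)]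
  exact congrArg _ (conj_conj_eq (hF.mul_inv 1) (hF.inv_mul 1) (hF.mul_inv 0) rfl e0 e1)

/-- A partial trace of `Z K` vanishes only if `Z K` does. -/
lemma IsBMWType.mul_opK_eq_zero_of_legTrace (hB : IsBMWType q μ R) (hs : SkewInvertible R) {Z : LegOp N A} (hZ : Off 2 Z)
    (h : legTrace (matD R) 1 (Z * scal A 0 (opK q μ R)) = 0) : Z * scal A 0 (opK q μ R) = 0 := by
  have p := hB.param
  have P := hB.pair A 0
  have e := hB.rMatrix.compatible_self.legTrace_conj hs (n := 1)
    (hZ.mul (scal_off (A := A) 0 (opK q μ R) (m := 2) (by norm_num)))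
  rw [h] at e
  have e1 := (P.symm p).lks p
  have e2 := (P.symm p).lkl p
  rw [zero_add] at P e1 e2
  have e3 := congrArg (fun y => y * scal A 0 R⁻¹ * scal A 0 (opK q μ R)) e
  simp only [zero_mul] at e3
  have o : ∀ X : Op N 2 ℂ, Off 2 (scal A 0 X) := fun X => scal_off _ _ (by norm_num)
  rw [one_add_one_eq_two, ← legTrace_mul_right _ (o _), ← legTrace_mul_right _ (o _)] at e3
  rw [← e3]
  symm
  calc _ = legTrace (matD R) 2 (scal A 1 R * (Z * scal A 0 (opK q μ R))) := by
        congr 1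
        calc scal A 1 R * (Z * scal A 0 (opK q μ R)) * scal A 1 R⁻¹ * scal A 0 R⁻¹ * scal A 0 (opK q μ R)
            = scal A 1 R * Z * (scal A 0 (opK q μ R) * scal A 1 R⁻¹) * scal A 0 R⁻¹ * scal A 0 (opK q μ R) := by
              simp only [mul_assoc]
          _ = scal A 1 R * Z * (scal A 0 (opK q μ R) * scal A 1 (opK q μ R) * (scal A 0 R * scal A 0 R⁻¹) *
                scal A 0 (opK q μ R)) := by rw [← e1]; simp only [mul_assoc]
          _ = _ := by rw [hB.rMatrix.mul_inv, mul_one, e2]; simp only [mul_assoc]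
    _ = _ := by
        rw [legTrace_mul_right _ (hZ.mul (o _)), show legTrace (matD R) 2 (scal A 1 R) = 1 from legTrace_matD hs 1, one_mul]

namespace BMWQuantum

variable (h : BMWQuantum q μ R F M) {c : A} (hc : c * contraction R F M q μ = 1)
include h hc

/-- `M_1 M_{\bar 2} F_1 Y_1 = M_1 F_1 (M Y)_1` vanishes, while `K` turns `M_1 M_{\bar 2}` into a
multiple of the invertible `g`. So `K F Y_1 = 0`, and the twisted contractor is nondegenerate. -/
lemma eq_zero_of_mul_eq_zero {Y : Matrix (Fin N) (Fin N) A} (hY : M * Y = 0) : Y = 0 := by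
  have hF := h.pair.rMatrix_right
  refine h.pair.eq_zero_of_opK_mul_F_mul h.bmw ?_
  have e := h.copSeg_mul_opK
  have cm := h.rel.comm_copSeg_of_mem h.pair (s := 0) (i := 2) (j := 0) le_rfl le_rfl (opK_mem_braidImage q μ R)
  have e1 : copSeg F M 0 2 * (scal A 0 F * leg 0 Y) = 0 := by
    have : copSeg F M 0 2 = leg 0 M * (scal A 0 F * leg 0 M * scal A 0 F⁻¹) := by
      rw [copSeg, rowProd_succ, rowProd_succ, rowProd, one_mul]; rfl
    rw [this]
    calc _ = leg 0 M * scal A 0 F * leg 0 M * (scal A 0 F⁻¹ * scal A 0 F) * leg 0 Y := by simp only [mul_assoc]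
      _ = leg 0 M * scal A 0 F * leg 0 (M * Y) := by rw [hF.inv_mul, mul_one, leg_mul]; simp only [mul_assoc]
      _ = 0 := by rw [hY, leg_zero, mul_zero]
  have e2 : coef (μ⁻¹ ^ 2 • contraction R F M q μ) * (scal A 0 (opK q μ R) * scal A 0 F * leg 0 Y) = 0 := by
    rw [← mul_assoc, ← mul_assoc, ← e, cm.eq, mul_assoc, mul_assoc, e1, mul_zero]
  have e3 := congrArg (fun y => coef (μ ^ 2 • c) * y) e2
  simp only [mul_zero] at e3
  have μ0 := h.bmw.mu_ne_zero
  rwa [← mul_assoc, ← map_mul, smul_mul_smul_comm, hc, ← mul_pow, mul_inv_cancel₀ μ0, one_pow, one_smul, map_one,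
    one_mul] at e3

omit hc in
-- Shift the vanishing trace by one leg and multiply by `R_1` and `K_1`: the relation `R_1 R_2 K_1 =
-- K_2 K_1` replaces the generator by the contractor. Nondegeneracy strips `K_1`, then the trace of
-- `Y_{\bar 2} K_1` is undone, and nondegeneracy is used once more.
lemma eq_zero_of_starPhi_eq_zero {Y : Matrix (Fin N) (Fin N) A} (hY : starPhi R F Y = 0) : Y = 0 := by
  have hB := h.bmw
  have hs := h.skew
  have p := hB.param
  have P := hB.pair A 0
  rw [zero_add] at P
  have c0 : ∀ X : Matrix (Fin N) (Fin N) A, X = 0 → leg 0 X = 0 := fun X hX => by rw [hX, leg_zero]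
  have e1 : legTrace (matD R) 2 (cop F Y 2 * scal A 1 R) = 0 := by
    rw [← h.pair.cop_one_tailTrace hs Y (R_mem_braidImage R), cop, cop]
    have := c0 _ hY
    rw [starPhi] at this
    rw [this, mul_zero, zero_mul]
  have o : ∀ X : Op N 2 ℂ, Off 2 (scal A 0 X) := fun X => scal_off _ _ (by norm_num)
  have e2 : legTrace (matD R) 2 (cop F Y 2 * scal A 1 (opK q μ R)) * scal A 0 (opK q μ R) = 0 := by
    have e := congrArg (fun y => scal A 0 R * y * scal A 0 (opK q μ R)) e1
    simp only [mul_zero, zero_mul] at e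
    rw [← legTrace_mul_left _ (o _), ← legTrace_mul_right _ (o _)] at e
    rw [← e, ← legTrace_mul_right _ (o _)]
    congr 1
    have cm : Commute (scal A 0 R) (cop F Y 2) := scal_comm_cop h.pair (by norm_num) Y
    rw [← mul_assoc, cm.eq, mul_assoc, mul_assoc, mul_assoc, ← mul_assoc (scal A 0 R), P.lk, mul_assoc]
  rw [← h.pair.cop_one_tailTrace hs Y (opK_mem_braidImage q μ R)] at e2
  have hF := h.pair.rMatrix_right
  have canc : ∀ X : Matrix (Fin N) (Fin N) A, cop F X 1 * scal A 0 (opK q μ R) = 0 → X = 0 := fun X hX => by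
    refine h.pair.eq_zero_of_mul_F_inv_mul_opK hB ?_
    have e := congrArg (fun y => scal A 0 F⁻¹ * y) hX
    simp only [mul_zero] at e
    rw [← e, cop, cop, mul_assoc (_ * _), mul_assoc (scal A 0 F), ← mul_assoc (scal A 0 F⁻¹), hF.inv_mul, one_mul]
  have e3 := c0 _ (canc _ e2)
  rw [leg_tailTrace_cop] at e3
  exact canc _ (hB.mul_opK_eq_zero_of_legTrace hs (cop_off F Y (by norm_num)) e3)

lemma eq_zero_of_starM_eq_zero {Y : Matrix (Fin N) (Fin N) A} (hY : starM R F M Y = 0) : Y = 0 :=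
  h.eq_zero_of_starPhi_eq_zero (h.eq_zero_of_mul_eq_zero hc hY)

end BMWQuantum

end

end

/-! ### The scalars in the orthogonal case -/

section

variable {q : ℂ} {n : ℕ}

lemma orthMu_odd (q : ℂ) (n : ℕ) : orthMu q (2 * n + 1) = (q ^ (2 * n))⁻¹ := by
  rw [orthMu, show (1 : ℤ) - ((2 * n + 1 : ℕ) : ℤ) = -((2 * n : ℕ) : ℤ) by push_cast; ring, zpow_neg, zpow_natCast]

lemma pow_sq_ne_one_of_qNum_ne {i : ℕ} (h : qNum q i ≠ 0) : q ^ i * q ^ i ≠ 1 := by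
  intro e
  apply h
  rw [qNum, inv_pow, ← eq_inv_of_mul_eq_one_left e, sub_self, zero_div]

/-- A zero would give `q^{|a-b|} = -1`, hence `q^{2|a-b|} = 1`, which is excluded by nonvanishing of
a `q`-number of order at most `k`. -/
lemma pow_add_pow_ne_zero {k : ℕ} (q0 : q ≠ 0) (hk : ∀ i, 1 ≤ i → i ≤ k → q ^ i * q ^ i ≠ 1) {a b : ℕ}
    (h1 : a ≠ b) (h2 : a ≤ b + k) (h3 : b ≤ a + k) : q ^ a + q ^ b ≠ 0 := by
  have key : ∀ i, 1 ≤ i → i ≤ k → 1 + q ^ i ≠ 0 := fun i h1 h2 e => hk i h1 h2 (by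
    rw [eq_neg_of_add_eq_zero_right e]; ring)
  rcases lt_or_gt_of_ne h1 with h | h
  · obtain ⟨c, rfl⟩ := Nat.exists_eq_add_of_lt h
    intro e
    refine key (c + 1) (by omega) (by omega) ((mul_eq_zero.1 ?_).resolve_left (pow_ne_zero a q0))
    rw [← e]; ring
  · obtain ⟨c, rfl⟩ := Nat.exists_eq_add_of_lt h
    intro e
    refine key (c + 1) (by omega) (by omega) ((mul_eq_zero.1 ?_).resolve_left (pow_ne_zero b q0))
    rw [← e]; ring

lemma pow_sub_pow_ne_zero {k : ℕ} (q0 : q ≠ 0) (hk : ∀ i, 1 ≤ i → i ≤ k → q ^ i * q ^ i ≠ 1) {a b : ℕ}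
    (h1 : a < b) (h2 : b ≤ a + k) : q ^ (2 * b) - q ^ (2 * a) ≠ 0 := by
  obtain ⟨c, rfl⟩ := Nat.exists_eq_add_of_lt h1
  intro e
  have e1 : q ^ (2 * a) * (q ^ (c + 1) * q ^ (c + 1) - 1) = 0 := by rw [← e]; ring
  exact hk (c + 1) (by omega) (by omega)
    (sub_eq_zero.1 ((mul_eq_zero.1 e1).resolve_left (pow_ne_zero _ q0)))

variable (q0 : q ≠ 0) (hk : ∀ i, 1 ≤ i → i ≤ 2 * n + 1 → q ^ i * q ^ i ≠ 1)
include q0 hk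

/-- Up to a unit this is `q^{2n+1} + q^{2i}`; the exponents have different parity and so never
coincide. -/
lemma one_add_nuVal_ne_zero {i : ℕ} (hi : i ≤ 2 * n + 1) : 1 + nuVal q (2 * n + 1) i ≠ 0 := by
  have := pow_add_pow_ne_zero q0 hk (a := 2 * n + 1) (b := 2 * i) (by omega) (by omega) (by omega)
  intro e
  apply this
  rw [nuVal] at e
  field_simp at e
  rwa [mul_zero] at e

omit q0 in
lemma sq_sub_one_ne_zero : q ^ 2 - 1 ≠ 0 := by
  have := hk 1 le_rfl (by omega)
  intro e
  exact this (by linear_combination e)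

lemma sub_inv_ne_zero : q - q⁻¹ ≠ 0 := by
  have := sq_sub_one_ne_zero hk
  intro e
  apply this
  field_simp at e
  linear_combination e

/-- Every condition is, up to a unit, a sum `q^a + q^b` with `a ≠ b` at distance at most `k`, except
the denominator of `σ(q²)`, which is `q^{2n+3} + 1` and needs the separate hypothesis. -/
lemma asymParam_orthMu (hn : 1 ≤ n) (hq : q ^ (2 * n + 3) ≠ -1) : AsymParam q (orthMu q (2 * n + 1)) (2 * n + 1) where
  q_ne := q0
  lam_ne := sub_inv_ne_zero q0 hk
  mu_ne := by rw [orthMu_odd]; exact inv_ne_zero (pow_ne_zero _ q0)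
  qNum_ne i h1 h2 := by
    intro e
    rw [qNum, div_eq_zero_iff] at e
    have e1 := sub_eq_zero.1 (e.resolve_right (sub_inv_ne_zero q0 hk))
    apply hk i h1 h2
    nth_rw 2 [e1]
    rw [← mul_pow, mul_inv_cancel₀ q0, one_pow]
  den_ne i h1 h2 := by
    have := pow_add_pow_ne_zero q0 hk (a := 2 * n + 1) (b := 2 * i) (by omega) (by omega) (by omega)
    intro e
    apply this
    rw [orthMu_odd, inv_inv, inv_pow] at e
    field_simp at e
    linear_combination e
  den_ne' := by
    intro e
    apply hq
    rw [orthMu_odd, inv_inv] at e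
    linear_combination e
  one_add_ne := by
    have := pow_add_pow_ne_zero q0 hk (a := 2 * n) (b := 1) (by omega) (by omega) (by omega)
    intro e
    apply this
    rw [orthMu_odd] at e
    field_simp at e
    linear_combination e
  sq_add_ne := by
    have := pow_add_pow_ne_zero q0 hk (a := 2) (b := 0) (by omega) (by omega) (by omega)
    rwa [pow_zero] at this

/-- For `μ = q^{-2n}` the bracket in `traceVal` factors, up to units and nonzero denominators, as
`(q^{2n} + q^{2j+1}) (q^{2(2n+1)} - q^{2j})`, which does not vanish for `j ≤ 2n`. -/
lemma traceVal_orthMu_ne_zero {j : ℕ} (hj : j < 2 * n + 1) (hqn : qNum q (j + 1) ≠ 0) : traceVal q (orthMu q (2 * n + 1)) j ≠ 0 := by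
  have d := sub_inv_ne_zero q0 hk
  have d' := sq_sub_one_ne_zero hk
  have f1 : q * q ^ (2 * n) + q ^ (2 * j) ≠ 0 := by
    rw [← pow_succ']
    exact pow_add_pow_ne_zero q0 hk (by omega) (by omega) (by omega)
  have f2 := pow_add_pow_ne_zero q0 hk (a := 2 * n) (b := 2 * j + 1) (by omega) (by omega) (by omega)
  have f3 := pow_sub_pow_ne_zero q0 hk (a := j) (b := 2 * n + 1) (by omega) (by omega)
  have e : (q - q⁻¹) * (q * q ^ (2 * n) + q ^ (2 * j)) * (q ^ (2 * j) * (q ^ (2 * n)) ^ 2 * q) *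
      (orthMu q (2 * n + 1) * etaVal q (orthMu q (2 * n + 1)) + (q⁻¹ ^ (2 * j) - 1) / (q - q⁻¹) +
        orthMu q (2 * n + 1) * ((q⁻¹ ^ (2 * j) - 1) / (q * (orthMu q (2 * n + 1))⁻¹ * q⁻¹ ^ (2 * j) + 1))) =
      (q ^ (2 * n) + q ^ (2 * j + 1)) * (q ^ (2 * (2 * n + 1)) - q ^ (2 * j)) := by
    have hx : (q⁻¹ ^ (2 * j)) = (q ^ (2 * j))⁻¹ := inv_pow _ _
    have g1 : q * q ^ (2 * n) * (q ^ (2 * j))⁻¹ + 1 = (q * q ^ (2 * n) + q ^ (2 * j)) / q ^ (2 * j) := by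
      field_simp
    rw [etaVal, orthMu_odd, inv_inv, hx, g1, show q - q⁻¹ = (q ^ 2 - 1) / q by field_simp]
    rw [show q ^ (2 * (2 * n + 1)) = (q ^ (2 * n)) ^ 2 * q ^ 2 by ring, pow_succ q (2 * j)] at *
    have Y0 := pow_ne_zero (2 * n) q0
    have X0 := pow_ne_zero (2 * j) q0
    generalize q ^ (2 * n) = Y at *
    generalize q ^ (2 * j) = X at *
    field_simp
    ring
  intro t
  rw [traceVal, mul_eq_zero] at t
  rw [t.resolve_left (div_ne_zero (pow_ne_zero _ q0) hqn), mul_zero] at e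
  exact mul_ne_zero f2 f3 e.symm

lemma qNum_div_mu_eta (hn : 1 ≤ n) : qNum q (2 * n + 1) / (orthMu q (2 * n + 1) * etaVal q (orthMu q (2 * n + 1))) =
    eVal q (2 * n + 1) (2 * n) * q ^ (2 * n + 1) := by
  obtain ⟨m, rfl⟩ : ∃ m, n = m + 1 := ⟨n - 1, by omega⟩
  have d := sq_sub_one_ne_zero hk
  have f1 := pow_add_pow_ne_zero q0 hk (a := 2 * m + 1) (b := 0) (by omega) (by omega) (by omega)
  have f2 : q ^ (2 * m + 3) - 1 ≠ 0 := fun e => hk (2 * m + 3) (by omega) (by omega) (by rw [sub_eq_zero.1 e, one_mul])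
  have Y0 := pow_ne_zero (2 * m + 1) q0
  rw [eVal, nuVal, etaVal, orthMu_odd, qNum, inv_pow, show q - q⁻¹ = (q ^ 2 - 1) / q by field_simp,
    show q ^ (2 * (2 * (m + 1))) = (q ^ (2 * m + 1)) ^ 2 * q ^ 2 by ring,
    show q ^ (2 * (m + 1) + 1) = q ^ (2 * m + 1) * q ^ 2 by ring, show q ^ (2 * (m + 1)) = q ^ (2 * m + 1) * q by ring]
  rw [show q ^ (2 * m + 3) = q ^ (2 * m + 1) * q ^ 2 by ring] at f2
  rw [pow_zero] at f1
  generalize q ^ (2 * m + 1) = Y at *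
  have g1 : q - (Y * q)⁻¹ = (Y * q ^ 2 - 1) / (Y * q) := by field_simp
  have g2 : q⁻¹ + (Y * q)⁻¹ = (Y + 1) / (Y * q) := by field_simp
  have g3 : 1 + Y ^ 2 * q ^ 2 / (Y * q ^ 2) = Y + 1 := by field_simp; ring
  rw [g1, g2, g3]
  field_simp
  ring

lemma qNum_div_eta (hn : 1 ≤ n) : qNum q (2 * n + 1) / etaVal q (orthMu q (2 * n + 1)) =
    eVal q (2 * n + 1) (2 * n) * q := by
  have Y0 := pow_ne_zero (2 * n) q0
  have e := qNum_div_mu_eta q0 hk hn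
  have h0 : orthMu q (2 * n + 1) ≠ 0 := by rw [orthMu_odd]; exact inv_ne_zero Y0
  rw [← mul_div_mul_left _ _ h0, mul_div_assoc, e, orthMu_odd, pow_succ q (2 * n)]
  field_simp

omit hk in
lemma nuVal_mul (j : ℕ) : nuVal q (2 * n + 1) j * q = orthMu q (2 * n + 1) * q ^ (2 * j) := by
  rw [nuVal, orthMu_odd, pow_succ q (2 * n)]
  field_simp

omit hk in
lemma wVal_mul (j : ℕ) : wVal q (2 * n + 1) j * q ^ j = (orthMu q (2 * n + 1))⁻¹ * q⁻¹ ^ j := by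
  rw [wVal, orthMu_odd, inv_inv, pow_succ q (2 * n), pow_succ q (2 * j), two_mul j, pow_add, inv_pow]
  field_simp

end

/-! ### The coefficients of the characteristic identity -/

section

variable {N : ℕ} {A : Type*} [Ring A] [Algebra ℂ A]

section

variable {C : Type*} [CommRing C]

/-- The alternating sums `ε_i` below the middle index. -/
def epsHalf (a : ℕ → C) (h : C) (i : ℕ) : C := ∑ j ∈ Finset.range (i + 1), a (i - j) * (-h) ^ j

/-- The coefficients `ε_i`: symmetric around the index `n`, zero above `2 n`. -/
def epsSymm (a : ℕ → C) (h g : C) (n i : ℕ) : C :=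
  if i ≤ n then epsHalf a h i else if i ≤ 2 * n then epsHalf a h (2 * n - i) * g ^ (i - n) else 0

variable {a : ℕ → C} {h g : C} {n : ℕ}

lemma epsHalf_succ (i : ℕ) : epsHalf a h (i + 1) = a (i + 1) - h * epsHalf a h i := by
  rw [epsHalf, epsHalf, Finset.sum_range_succ', pow_zero, mul_one, Nat.sub_zero, Finset.mul_sum, sub_eq_add_neg,
    ← Finset.sum_neg_distrib, add_comm]
  congr 1
  refine Finset.sum_congr rfl fun j _ => ?_
  rw [Nat.add_sub_add_right, pow_succ]
  ring

lemma epsHalf_zero (h0 : a 0 = 1) : epsHalf a h 0 = 1 := by simp [epsHalf, h0]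

lemma epsSymm_add {m : ℕ} (hh : h ^ 2 = g) (hm : m ≤ n) : epsSymm a h g n (n + m) = epsSymm a h g n (n - m) * h ^ (2 * m) := by
  rw [pow_mul, hh]
  rcases m with _ | m
  · rw [pow_zero, mul_one]; rfl
  · rw [epsSymm, epsSymm, if_neg (by omega), if_pos (by omega), if_pos (by omega), Nat.add_sub_cancel_left,
      show 2 * n - (n + (m + 1)) = n - (m + 1) by omega]

/-- Below the middle this is the telescoping recursion of the alternating sums. Above it,
reciprocity `ha` and `h² = g` reflect the same recursion; the case `i = 2n` is the boundary where `ε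
(2n+1) = 0`. -/
lemma eq_epsSymm_add (h0 : a 0 = 1) (hh : h ^ 2 = g) (ha : ∀ i ≤ n, a (2 * n + 1 - i) = g ^ (n - i) * h * a i) {i : ℕ}
    (hi : i ≤ 2 * n) : a (i + 1) = epsSymm a h g n (i + 1) + h * epsSymm a h g n i := by
  have mid : ∀ j, n ≤ j → j ≤ 2 * n → epsSymm a h g n j = epsHalf a h (2 * n - j) * g ^ (j - n) := fun j h1 h2 => by
    rcases h1.eq_or_lt with rfl | h1
    · rw [epsSymm, if_pos le_rfl, Nat.sub_self, pow_zero, mul_one, two_mul, Nat.add_sub_cancel]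
    · rw [epsSymm, if_neg (by omega), if_pos h2]
  rcases lt_or_ge i n with h1 | h1
  · rw [epsSymm, epsSymm, if_pos (by omega), if_pos (by omega), epsHalf_succ]
    ring
  · obtain ⟨d, rfl⟩ : ∃ d, i = n + d := Nat.exists_eq_add_of_le h1
    obtain ⟨j, rfl⟩ : ∃ j, n = j + d := ⟨n - d, by omega⟩
    have e := ha j (by omega)
    rw [show 2 * (j + d) + 1 - j = j + d + d + 1 by omega, Nat.add_sub_cancel_left] at e
    rw [e, mid (j + d + d) h1 hi, Nat.add_sub_cancel_left, show 2 * (j + d) - (j + d + d) = j by omega]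
    rcases j with _ | j
    · rw [epsSymm, if_neg (by omega), if_neg (by omega), epsHalf_zero h0, h0]
      ring
    · rw [mid (j + 1 + d + d + 1) (by omega) (by omega), show 2 * (j + 1 + d) - (j + 1 + d + d + 1) = j by omega,
        show j + 1 + d + d + 1 - (j + 1 + d) = d + 1 by omega, epsHalf_succ, pow_succ g, ← hh]
      ring

end

/-! ### The characteristic identity for a matrix over an algebra -/

section

variable {q μ : ℂ} {R F : Op N 2 ℂ} {M : Matrix (Fin N) (Fin N) A}

section

variable {C : Type*} [CommRing C] [Algebra ℂ C]

/-- Right multiplication by scalars as a representation of a commutative algebra. -/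
def rmulHom (N : ℕ) (ι : C →ₐ[ℂ] A) : C →+* Module.End ℂ (Matrix (Fin N) (Fin N) A) where
  toFun c :=
    { toFun := fun X => rmul X (ι c)
      map_add' := fun _ _ => add_rmul _ _ _
      map_smul' := fun _ _ => smul_rmul _ _ _ }
  map_one' := LinearMap.ext fun X => by
    show rmul X (ι 1) = X
    rw [map_one, rmul_one]
  map_mul' c d := LinearMap.ext fun X => by
    show rmul X (ι (c * d)) = rmul (rmul X (ι d)) (ι c)
    rw [rmul_rmul, mul_comm, map_mul]
  map_zero' := LinearMap.ext fun X => by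
    show rmul X (ι 0) = 0
    rw [map_zero, rmul_zero]
  map_add' c d := LinearMap.ext fun X => by
    show rmul X (ι (c + d)) = rmul X (ι c) + rmul X (ι d)
    rw [map_add, rmul_add]

variable [NeZero N]

def starMHom (R F : Op N 2 ℂ) (M : Matrix (Fin N) (Fin N) A) : Module.End ℂ (Matrix (Fin N) (Fin N) A) where
  toFun := starM R F M
  map_add' := starM_add R F M
  map_smul' := starM_smul

/-- Polynomials in star multiplication by `M` with coefficients acting by right multiplication. -/
def starPoly (R F : Op N 2 ℂ) (M : Matrix (Fin N) (Fin N) A) (ι : C →ₐ[ℂ] A) :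
    Polynomial C →+* Module.End ℂ (Matrix (Fin N) (Fin N) A) :=
  Polynomial.eval₂RingHom' (rmulHom N ι) (starMHom R F M) fun c => LinearMap.ext fun X =>
    (starM_rmul R F M X (ι c)).symm

lemma starPoly_C (ι : C →ₐ[ℂ] A) (c : C) (X : Matrix (Fin N) (Fin N) A) :
    starPoly R F M ι (Polynomial.C c) X = rmul X (ι c) :=
  LinearMap.congr_fun (Polynomial.eval₂_C (rmulHom N ι) (starMHom R F M)) X

lemma starPoly_X (ι : C →ₐ[ℂ] A) (X : Matrix (Fin N) (Fin N) A) :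
    starPoly R F M ι Polynomial.X X = starM R F M X :=
  LinearMap.congr_fun (Polynomial.eval₂_X (rmulHom N ι) (starMHom R F M)) X

lemma starPoly_X_pow (ι : C →ₐ[ℂ] A) (i : ℕ) (X : Matrix (Fin N) (Fin N) A) :
    starPoly R F M ι (Polynomial.X ^ i) X = (starM R F M)^[i] X := by
  induction i with
  | zero => rw [pow_zero, map_one]; rfl
  | succ i ih => rw [pow_succ', map_mul, Module.End.mul_apply, ih, starPoly_X, Function.iterate_succ_apply']

lemma starPoly_algebraMap (ι : C →ₐ[ℂ] A) (z : ℂ) (X : Matrix (Fin N) (Fin N) A) :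
    starPoly R F M ι (algebraMap ℂ (Polynomial C) z) X = z • X := by
  rw [Polynomial.algebraMap_apply, starPoly_C, AlgHom.commutes, Algebra.algebraMap_eq_smul_one, rmul_smul, rmul_one]

end

variable {C : Type*} [CommRing C] [Algebra ℂ C] [NeZero N] {n : ℕ}

/-- The Cayley–Hamilton identity multiplied by the factor `M - g^{1/2} I`, for the matrix of generators of any
quantum matrix algebra of type `O(2 n + 1)` with an invertible contraction. -/
theorem BMWQuantum.cayleyHamilton (h : BMWQuantum q (orthMu q (2 * n + 1)) R F M) (hn : 1 ≤ n)
    (h1 : (antisym q (orthMu q (2 * n + 1)) R (2 * n + 1)).rank ≤ 1)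
    (hqn : ∀ i, 1 ≤ i → i ≤ 2 * n + 1 → qNum q i ≠ 0) (hq : q ^ (2 * n + 3) ≠ -1)
    (ι : C →ₐ[ℂ] A) (hι : Function.Injective ι) {a : ℕ → C} (ha : ∀ i, ι (a i) = elemA R F M q (orthMu q (2 * n + 1)) i)
    {g g' : C} (hg : ι g = contraction R F M q (orthMu q (2 * n + 1))) (hg' : g' * g = 1) :
    rmul (∑ i ∈ Finset.range (2 * n + 1), (-q) ^ i •
        rmul ((starM R F M)^[2 * n - i] 1) (ι (epsSymm a (g' ^ n * a (2 * n + 1)) g n i))) (ι (g' ^ n * a (2 * n + 1))) =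
      starM R F M (∑ i ∈ Finset.range (2 * n + 1), (-q) ^ i •
        rmul ((starM R F M)^[2 * n - i] 1) (ι (epsSymm a (g' ^ n * a (2 * n + 1)) g n i))) := by
  have q0 := h.bmw.q_ne_zero
  have hk : ∀ i, 1 ≤ i → i ≤ 2 * n + 1 → q ^ i * q ^ i ≠ 1 := fun i h1 h2 => pow_sq_ne_one_of_qNum_ne (hqn i h1 h2)
  have p := asymParam_orthMu q0 hk hn hq
  have ht : ∀ j < 2 * n + 1, traceVal q (orthMu q (2 * n + 1)) j ≠ 0 := fun j hj =>
    traceVal_orthMu_ne_zero q0 hk hj (hqn _ (by omega) (by omega))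
  have hrec : ∀ i ≤ 2 * n + 1, a i * a (2 * n + 1) = g ^ i * a (2 * n + 1 - i) := fun i hi => hι (by
    rw [map_mul, map_mul, map_pow, ha, ha, ha, hg]
    exact elemA_mul_elemA p h1 h.bmw h.skew ht h hi)
  have a0 : a 0 = 1 := hι (by rw [ha, map_one]; rfl)
  set hf := g' ^ n * a (2 * n + 1) with hhf
  have gg : ∀ m, g' ^ m * g ^ m = 1 := fun m => by rw [← mul_pow, hg', one_pow]
  have ak : a (2 * n + 1) = g ^ n * hf := by rw [hhf, ← mul_assoc, mul_comm (g ^ n), gg, one_mul]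
  -- Reciprocity at `i = k` reads `a_k² = g^k`, so `g^{-n} a_k` is a square root of `g`.
  have hh : hf ^ 2 = g := by
    have e := hrec _ le_rfl
    rw [Nat.sub_self, a0, mul_one] at e
    calc hf ^ 2 = g' ^ n * g' ^ n * (a (2 * n + 1) * a (2 * n + 1)) := by rw [hhf]; ring
      _ = (g' ^ n * g ^ n) * (g' ^ n * g ^ n) * g := by rw [e]; ring
      _ = g := by rw [gg, one_mul, one_mul]
  have hsym : ∀ i ≤ n, a (2 * n + 1 - i) = g ^ (n - i) * hf * a i := fun i hi => by
    obtain ⟨d, rfl⟩ := Nat.exists_eq_add_of_le hi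
    have e := hrec i (by omega)
    rw [Nat.add_sub_cancel_left]
    calc _ = (g' ^ i * g ^ i) * a (2 * (i + d) + 1 - i) := by rw [gg, one_mul]
      _ = g' ^ i * (a i * a (2 * (i + d) + 1)) := by rw [e]; ring
      _ = (g' ^ i * g ^ i) * (g ^ d * hf * a i) := by rw [ak]; ring
      _ = _ := by rw [gg, one_mul]
  -- The polynomial variable acts as star multiplication by `M` and constants act by right
  -- multiplication; the two commute, so the commutative argument applies with `v = I`.
  let _ : Module (Polynomial C) (Matrix (Fin N) (Fin N) A) := Module.compHom _ (starPoly R F M ι)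
  have sC : ∀ c (Y : Matrix (Fin N) (Fin N) A), (Polynomial.C c : Polynomial C) • Y = rmul Y (ι c) := starPoly_C ι
  have sX : ∀ Y : Matrix (Fin N) (Fin N) A, (Polynomial.X : Polynomial C) • Y = starM R F M Y := starPoly_X ι
  have sP : ∀ i (Y : Matrix (Fin N) (Fin N) A), (Polynomial.X ^ i : Polynomial C) • Y = (starM R F M)^[i] Y :=
    starPoly_X_pow ι
  have sZ : ∀ z (Y : Matrix (Fin N) (Fin N) A), algebraMap ℂ (Polynomial C) z • Y = z • Y := starPoly_algebraMap ι
  have hM : starM R F M 1 = M := h.pair.starM_one h.skew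
  have μq : (orthMu q (2 * n + 1))⁻¹ = q ^ (2 * n) := by rw [orthMu_odd, inv_inv]
  have main := cayleyHamilton_of_recursions (B := Polynomial C) (V := Matrix (Fin N) (Fin N) A) (v := 1) (x := Polynomial.X)
    (h := Polynomial.C hf) (q := q) (n := n)
    (al := altDesc q (orthMu q (2 * n + 1)) R F M) (be := altContr q (orthMu q (2 * n + 1)) R F M)
    (a := fun i => Polynomial.C (a i)) (ε := fun i => Polynomial.C (epsSymm a hf g n i))
    (fun Y hY => h.eq_zero_of_starM_eq_zero (c := ι g') (by rw [← hg, ← map_mul, hg', map_one]) (by rw [← sX, hY])) q0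
    (sq_sub_one_ne_zero hk) hn (fun i hi => one_add_nuVal_ne_zero q0 hk hi)
    (by rw [sX, hM, h.altDesc_one])
    (by rw [← map_pow, hh, mul_smul, sC, sZ, h.altContr_one, hg, rmul_smul, μq])
    (fun j hj => by
      rw [mul_smul, mul_smul, sZ, sC, sX, sX, sZ, hM, ha, cVal, dVal]
      exact h.altDesc_recursion p (by omega) (nuVal_mul q0 (j + 1)) (one_add_nuVal_ne_zero q0 hk (by omega)))
    (fun j hj => by
      rw [← map_pow, hh, sC, hg, sX, mul_smul, mul_smul, mul_smul, sZ, sC, sX, sX, sZ, hM, ha, wVal_mul q0, dVal]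
      exact h.altContr_recursion p (by omega) (nuVal_mul q0 (j + 1)) (one_add_nuVal_ne_zero q0 hk (by omega)))
    (by rw [mul_smul, sZ, sC, ha, h.altDesc_top p h1 (by omega), qNum_div_mu_eta q0 hk hn])
    (by rw [mul_smul, mul_smul, sX, sC, sZ, hM, ha, h.altContr_top p h1 (by omega), qNum_div_eta q0 hk hn])
    (by rw [epsSymm, if_pos (by omega), epsHalf_zero a0, map_one])
    (fun i hi => by rw [eq_epsSymm_add a0 hh hsym hi, map_add, map_mul])
    (by rw [epsSymm, if_neg (by omega), if_neg (by omega), map_zero])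
    (fun m hm => by rw [epsSymm_add hh hm, map_mul, map_pow])
  have e : chPoly (algebraMap ℂ (Polynomial C) q) Polynomial.X (fun i => Polynomial.C (epsSymm a hf g n i)) n •
      (1 : Matrix (Fin N) (Fin N) A) = ∑ i ∈ Finset.range (2 * n + 1), (-q) ^ i •
        rmul ((starM R F M)^[2 * n - i] 1) (ι (epsSymm a hf g n i)) := by
    rw [chPoly, Finset.sum_smul]
    refine Finset.sum_congr rfl fun i _ => ?_
    rw [← map_neg, ← map_pow, mul_smul, sZ, mul_comm, mul_smul, sP, sC]
  rw [e, sC, sX] at main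
  exact main

end

end

/-! ### Naturality in the algebra of entries -/

section

variable {N : ℕ}

section

variable {A A' : Type*} [Ring A] [Algebra ℂ A] [Ring A'] [Algebra ℂ A'] (φ : A →ₐ[ℂ] A')

lemma lift_map {n : ℕ} (X : Op N n ℂ) : (X.lift A).map φ = X.lift A' := by
  ext a b
  exact φ.commutes _

lemma copy_map (F : Op N 2 ℂ) (M : Matrix (Fin N) (Fin N) A) (m i : ℕ) :
    (copy F M m i).map φ = copy F (M.map φ) m i := by
  induction i with
  | zero =>
    ext a b
    simp only [copy, place, Matrix.map_apply, Matrix.of_apply]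
    split_ifs
    · rfl
    · exact map_zero φ
    · exact map_zero φ
  | succ i ih => rw [copy, copy, Matrix.map_mul, Matrix.map_mul, lift_map, lift_map, ih]

lemma copiesProd_map (F : Op N 2 ℂ) (M : Matrix (Fin N) (Fin N) A) (n : ℕ) :
    (copiesProd F M n).map φ = copiesProd F (M.map φ) n := by
  rw [copiesProd, copiesProd, ← AlgHom.mapMatrix_apply, map_list_prod, List.map_map]
  exact congrArg List.prod (List.map_congr_left fun i _ => copy_map φ F M n i)

lemma ch_map (R F : Op N 2 ℂ) (M : Matrix (Fin N) (Fin N) A) {n : ℕ} (X : Op N n ℂ) :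
    φ (ch R F M X) = ch R F (M.map φ) X := by
  rw [ch, ch, ← copiesProd_map, ← lift_map φ, ← Matrix.map_mul]
  simp only [fullTrace, map_sum, map_smul, Matrix.map_apply]

lemma contraction_map (R F : Op N 2 ℂ) (M : Matrix (Fin N) (Fin N) A) (q μ : ℂ) :
    φ (contraction R F M q μ) = contraction R F (M.map φ) q μ := by
  rw [contraction, contraction, map_smul, ch_map]

end

/-! ### The extended quantum matrix algebra -/

section

variable {q μ : ℂ} {R F : Op N 2 ℂ}

lemma isQuantumMatrix_genM : IsQuantumMatrix R F (genM q μ R F) := by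
  set π := RingQuot.mkAlgHom ℂ (ExtRel q μ R F) with hπ
  have e : (R.lift (FreeExt N) * (copy F freeM 2 0 * copy F freeM 2 1)).map π =
      (copy F freeM 2 0 * copy F freeM 2 1 * R.lift (FreeExt N)).map π := by
    ext a b
    exact RingQuot.mkAlgHom_rel ℂ (ExtRel.quantum a b)
  rw [Matrix.map_mul, Matrix.map_mul, Matrix.map_mul, Matrix.map_mul, lift_map, copy_map, copy_map] at e
  exact e

lemma gInv_mul_gElem : gInv q μ R F * gElem q μ R F = 1 := by
  have e := RingQuot.mkAlgHom_rel ℂ (ExtRel.inv_mul (q := q) (μ := μ) (R := R) (F := F))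
  rwa [map_mul, contraction_map, map_one] at e

lemma gElem_mul_gInv : gElem q μ R F * gInv q μ R F = 1 := by
  have e := RingQuot.mkAlgHom_rel ℂ (ExtRel.mul_inv (q := q) (μ := μ) (R := R) (F := F))
  rwa [map_mul, contraction_map, map_one] at e

lemma gInv_mem_charAlg : gInv q μ R F ∈ charAlg q μ R F := Algebra.subset_adjoin (Or.inr rfl)

lemma ch_mem_charAlg {n : ℕ} (hn : 1 ≤ n) {X : Op N n ℂ} (hX : X ∈ braidImage R n) :
    ch R F (genM q μ R F) X ∈ charAlg q μ R F := Algebra.subset_adjoin (Or.inl ⟨n, hn, X, hX, rfl⟩)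

lemma gElem_mem_charAlg : gElem q μ R F ∈ charAlg q μ R F :=
  Subalgebra.smul_mem _ (ch_mem_charAlg (by norm_num) (opK_mem_braidImage q μ R)) _

variable [NeZero N]

lemma aElem_mem_charAlg : ∀ i, aElem q μ R F i ∈ charAlg q μ R F
  | 0 => one_mem _
  | i + 1 => ch_mem_charAlg (by omega) (antisym_mem_braidImage q μ R (i + 1))

omit [NeZero N] in
lemma BMWQuantum.of_genM (hc : IsCompatiblePair R F) (hs : SkewInvertible R) (hB : IsBMWType q μ R) :
    BMWQuantum q μ R F (genM q μ R F) := ⟨hc, hs, hB, isQuantumMatrix_genM⟩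

variable (h : BMWQuantum q μ R F (genM q μ R F))
include h

/-- Characteristic elements commute among themselves; since `g` is one of them up to a scalar, its
inverse commutes with them too, and commutation extends from generators. -/
lemma charAlg_comm : ∀ c ∈ charAlg q μ R F, ∀ d ∈ charAlg q μ R F, c * d = d * c := by
  have key : ∀ {n : ℕ} {X : Op N n ℂ}, X ∈ braidImage R n →
      gInv q μ R F * ch R F (genM q μ R F) X = ch R F (genM q μ R F) X * gInv q μ R F := fun {n X} hX => by
    have e := h.contraction_comm hX
    calc _ = gInv q μ R F * ch R F (genM q μ R F) X * (gElem q μ R F * gInv q μ R F) := by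
          rw [gElem_mul_gInv, mul_one]
      _ = gInv q μ R F * (ch R F (genM q μ R F) X * gElem q μ R F) * gInv q μ R F := by simp only [mul_assoc]
      _ = gInv q μ R F * gElem q μ R F * ch R F (genM q μ R F) X * gInv q μ R F := by
          rw [gElem, ← e]; simp only [mul_assoc]
      _ = _ := by rw [gInv_mul_gElem, one_mul]
  intro c hc d hd
  refine (Algebra.commute_of_mem_adjoin_of_forall_mem_commute hd fun z hz =>
    (Algebra.commute_of_mem_adjoin_of_forall_mem_commute hc fun y hy => ?_).symm).eq
  rcases hy with ⟨n, -, X, hX, rfl⟩ | rfl <;> rcases hz with ⟨m, -, Y, hY, rfl⟩ | rfl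
  · exact h.rel.ch_comm h.pair h.skew hY hX
  · exact key hX
  · exact (key hY).symm
  · exact Commute.refl _

lemma starMul_eq {B B' Z : Matrix (Fin N) (Fin N) (ExtAlg q μ R F)}
    (hZ : IsStarProduct R F (genM q μ R F) (charAlg q μ R F) B B' Z) : starMul q μ R F B B' = Z :=
  h.rel.star_unique h.pair h.skew (charAlg_comm h) (Classical.epsilon_spec ⟨Z, hZ⟩) hZ

lemma starPow_eq (n : ℕ) : starPow q μ R F n ∈ starSpan R F (genM q μ R F) (charAlg q μ R F) ∧
    starPow q μ R F n = (starM R F (genM q μ R F))^[n] 1 := by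
  induction n with
  | zero => exact ⟨AddSubmonoid.subset_closure (Or.inr ⟨1, one_mem _, (rmul_one 1).symm⟩), rfl⟩
  | succ n ih =>
    have e : starPow q μ R F (n + 1) = starM R F (genM q μ R F) (starPow q μ R F n) :=
      starMul_eq h (h.pair.isStarProduct_starM h.skew _ ih.1)
    refine ⟨?_, ?_⟩
    · rw [e]
      exact h.pair.starM_mem h.skew _ ih.1
    · rw [e, ih.2, Function.iterate_succ_apply']

lemma starMul_genM_sub {c : ExtAlg q μ R F} (hc : c ∈ charAlg q μ R F)
    {X : Matrix (Fin N) (Fin N) (ExtAlg q μ R F)} (hX : X ∈ starSpan R F (genM q μ R F) (charAlg q μ R F)) :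
    starMul q μ R F (genM q μ R F - rmul 1 c) X = starM R F (genM q μ R F) X - rmul X c := by
  apply starMul_eq h
  -- The star relation is generated by sums, so the difference is presented as a sum with the scalar
  -- `-c`.
  rw [sub_eq_add_neg, ← rmul_neg, sub_eq_add_neg, ← rmul_neg]
  exact (h.pair.isStarProduct_starM h.skew _ hX).add_left (isStarProduct_scalar _ (neg_mem hc) (charAlg_comm h) hX)

end

end

end QM

end

theorem theorem5p8 {N : ℕ} (ℓ : ℕ) (hℓ : 2 ≤ ℓ) (q : ℂ) (R F : Op N 2 ℂ)
    (hRF : IsCompatiblePair R F)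
    (hRs : StrictSkewInvertible R) (hFs : StrictSkewInvertible F)
    (hR : IsOrthogonalType q (2 * ℓ - 1) R)
    (hq : q ^ (2 * ℓ + 1) ≠ -1) :
    starMul q (orthMu q (2 * ℓ - 1)) R F
      (genM q (orthMu q (2 * ℓ - 1)) R F - rmul 1 (gHalf q (orthMu q (2 * ℓ - 1)) R F ℓ))
      (∑ i ∈ Finset.range (2 * ℓ - 1),
        (-q) ^ i • rmul (starPow q (orthMu q (2 * ℓ - 1)) R F (2 * ℓ - 2 - i))
          (epsElem q (orthMu q (2 * ℓ - 1)) R F ℓ i)) = 0 := by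
  rcases eq_or_ne N 0 with rfl | hN
  -- For `N = 0` there is only one matrix; the other arguments need a basis vector.
  · exact Subsingleton.elim _ _
  have : NeZero N := ⟨hN⟩
  obtain ⟨n, rfl⟩ : ∃ n, ℓ = n + 1 := ⟨ℓ - 1, by omega⟩
  generalize hk : 2 * (n + 1) - 1 = k at *
  obtain rfl : k = 2 * n + 1 := by omega
  rw [show 2 * (n + 1) - 2 = 2 * n by omega]
  have h := BMWQuantum.of_genM hRF hR.skew hR.bmw
  have hS := charAlg_comm h
  -- The characteristic algebra serves as the commutative coefficient ring, with `a`, `g` and `g⁻¹`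
  -- lifted to it.
  let _ : CommRing (charAlg q (orthMu q (2 * n + 1)) R F) :=
    { (inferInstance : Ring (charAlg q (orthMu q (2 * n + 1)) R F)) with
      mul_comm := fun c d => Subtype.ext (hS c c.2 d d.2) }
  let a : ℕ → charAlg q (orthMu q (2 * n + 1)) R F := fun i => ⟨_, aElem_mem_charAlg i⟩
  let g : charAlg q (orthMu q (2 * n + 1)) R F := ⟨_, gElem_mem_charAlg⟩
  let g' : charAlg q (orthMu q (2 * n + 1)) R F := ⟨_, gInv_mem_charAlg⟩
  have q1 : qNum q 1 ≠ 0 := by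
    rw [qNum, pow_one, pow_one, div_self hR.bmw.q_sub_ne]
    exact one_ne_zero
  have main := h.cayleyHamilton (by omega) hR.rank_one.le (fun i h1 h2 => by
      rcases h1.eq_or_lt with rfl | h1
      · exact q1
      · exact hR.qNum_ne i h1 h2) hq (charAlg q (orthMu q (2 * n + 1)) R F).val Subtype.val_injective (a := a)
    (fun i => rfl) (g := g) (g' := g') rfl (Subtype.ext gInv_mul_gElem)
  have hh : gHalf q (orthMu q (2 * n + 1)) R F (n + 1) =
      (charAlg q (orthMu q (2 * n + 1)) R F).val (g' ^ n * a (2 * n + 1)) := rfl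
  have hε : ∀ i ≤ 2 * n, epsElem q (orthMu q (2 * n + 1)) R F (n + 1) i =
      (charAlg q (orthMu q (2 * n + 1)) R F).val (epsSymm a (g' ^ n * a (2 * n + 1)) g n i) := fun i hi => by
    have hs : ∀ j, ∑ m ∈ Finset.range (j + 1), aElem q (orthMu q (2 * n + 1)) R F (j - m) *
        (-gHalf q (orthMu q (2 * n + 1)) R F (n + 1)) ^ m =
        (charAlg q (orthMu q (2 * n + 1)) R F).val (epsHalf a (g' ^ n * a (2 * n + 1)) j) := fun j => by
      rw [epsHalf, map_sum]
      rfl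
    rw [epsElem, epsSymm, Nat.add_sub_cancel]
    split_ifs
    · exact hs i
    · rw [hs, map_mul]
      rfl
  have hsum : (∑ i ∈ Finset.range (2 * n + 1), (-q) ^ i • rmul (starPow q (orthMu q (2 * n + 1)) R F (2 * n - i))
        (epsElem q (orthMu q (2 * n + 1)) R F (n + 1) i)) =
      ∑ i ∈ Finset.range (2 * n + 1), (-q) ^ i • rmul ((starM R F (genM q (orthMu q (2 * n + 1)) R F))^[2 * n - i] 1)
        ((charAlg q (orthMu q (2 * n + 1)) R F).val (epsSymm a (g' ^ n * a (2 * n + 1)) g n i)) :=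
    Finset.sum_congr rfl fun i hi => by
      rw [(starPow_eq h _).2, hε i (by have := Finset.mem_range.1 hi; omega)]
  have hmem : (∑ i ∈ Finset.range (2 * n + 1), (-q) ^ i • rmul (starPow q (orthMu q (2 * n + 1)) R F (2 * n - i))
      (epsElem q (orthMu q (2 * n + 1)) R F (n + 1) i)) ∈
      starSpan R F (genM q (orthMu q (2 * n + 1)) R F) (charAlg q (orthMu q (2 * n + 1)) R F) :=
    sum_mem fun i hi => by
      rw [← rmul_smul, hε i (by have := Finset.mem_range.1 hi; omega)]
      exact rmul_mem_starSpan _ (starPow_eq h _).1 (Subalgebra.smul_mem _ (Subtype.property _) _)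
  rw [starMul_genM_sub h (by rw [hh]; exact (g' ^ n * a (2 * n + 1)).2) hmem, hsum, hh, sub_eq_zero]
  exact main.symm
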